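/- Let $M$ be a smooth manifold (Hausdorff, second countable, of constant finite dimension), $(E,g)$ a smooth real vector bundle over $M$ of positive even rank with a pseudo-Euclidean metric $g$ of arbitrary signature, and $\mathbb{C}\mathrm{l}(E)$ its complex Clifford bundle, with relation $\xi\eta+\eta\xi=2g(\xi,\eta)$. Let $S$ be a spinor bundle of $(E,g)$: a smooth complex vector bundle with a smooth isomorphism of bundles of algebras $\mathbb{C}\mathrm{l}(E)\cong\mathrm{End}\,S$; write $\gamma(\xi)$ for the Clifford action of $\xi\in\Gamma(E)$ on $\Gamma(S)$. Let $(\nabla^E,\nabla^S)$ be a compatible pair of connections: $\nabla^E$ is a connection on $E$ with $\nabla^E g=0$, and $\nabla^S$ is a (complex linear) connection on $S$ with $[\nabla^S_X,\gamma(\xi)]=\gamma(\nabla^E_X\xi)$ for all vector fields $X$ and all $\xi\in\Gamma(E)$. Connections $\nabla^S$ occurring in such pairs are called spinor connections. Let $\mathcal{D}(M,S)\subseteq\mathrm{End}_{\mathbb{C}}(\Gamma(S))$ be the algebra of differential operators on $S$, generated by $\Gamma(\mathrm{End}\,S)$ and the covariant derivatives. Let $\mathcal{D}^+(M,S)$ be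 the subalgebra generated by $\Gamma(\mathbb{C}\mathrm{l}^+(E))$ and the operators $\nabla_X$ for spinor connections $\nabla$, and let $\mathcal{D}^-(M,S)$ be the span of $\Gamma(\mathbb{C}\mathrm{l}^-(E))\,\mathcal{D}^+(M,S)$. Let $[\cdot,\cdot]$ be the graded commutator of $\mathcal{D}(M,S)$ for this parity. Set $\mathcal{D}_k(M,S)=0$ for $k<0$ and, inductively for $k\ge 0$, $$\mathcal{D}_k(M,S)=\{D\in\mathcal{D}(M,S)\;:\;[D,\gamma(\xi)]\in\mathcal{D}_{k-1}(M,S)\ \text{ for all }\xi\in\Gamma(E)\}.$$ Let $\mathcal{O}^{\mathbb{C}}(T^*[2]M\oplus E[1])=\bigoplus_k\mathcal{O}^{\mathbb{C}}_k$, where $\mathcal{O}^{\mathbb{C}}_k=\bigoplus_{2m+l=k}\Gamma(S^mTM\otimes\wedge^lE\otimes\mathbb{C})$ (with $E\cong E^*$ through $g$), be the graded commutative algebra of complex functions, so that functions $f$ on $M$ have degree $0$, sections $\xi$ of $E$ degree $1$ and vector fields $X$ degree $2$. **Theorem.** $\mathcal{D}(M,S)=\mathcal{D}^+(M,S)\oplus\mathcal{D}^-(M,S)$,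 and the $\mathcal{D}_k(M,S)$ form an increasing exhaustive filtration of $\mathcal{D}(M,S)$, with $1\in\mathcal{D}_0$, $\mathcal{D}_k\cdot\mathcal{D}_l\subseteq\mathcal{D}_{k+l}$ and $[\mathcal{D}_k,\mathcal{D}_l]\subseteq\mathcal{D}_{k+l-2}$. So composition and graded commutator induce on $\mathrm{Gr}\,\mathcal{D}(M,S)=\bigoplus_k\mathcal{D}_k/\mathcal{D}_{k-1}$ a product and a bracket of degree $-2$. There is a unique graded Poisson bracket of degree $-2$ on $\mathcal{O}^{\mathbb{C}}(T^*[2]M\oplus E[1])$ such that $$\{X,f\}=X(f),\quad \{h,f\}=0,\quad \{X,\xi\}=\nabla^E_X\xi,\quad \{f,\xi\}=0,\quad \{X,Y\}=[X,Y]+R(X,Y),\quad \{\xi,\eta\}=g(\xi,\eta)$$ for all real functions $f,h\in C^\infty(M)$, vector fields $X,Y$ and $\xi,\eta\in\Gamma(E)$, where the curvature $R(X,Y)$ of $\nabla^E$ is viewed as the section of $\wedge^2E$ with $-\iota_\xi R(X,Y)=\nabla^E_X\nabla^E_Y\xi-\nabla^E_Y\nabla^E_X\xi-\nabla^E_{[X,Y]}\xi$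 for all $\xi\in\Gamma(E)$, $\iota_\xi$ being contraction with $g(\xi,\cdot)$; this is the bracket of Rothstein's symplectic structure defined by $(g,\nabla^E)$. For it there is a unique isomorphism of graded commutative Poisson algebras over $\mathbb{C}$ $$\mathfrak{S}_\nabla:\mathrm{Gr}\,\mathcal{D}(M,S)\longrightarrow\mathcal{O}^{\mathbb{C}}(T^*[2]M\oplus E[1])$$ such that, for all real $f\in C^\infty(M)$, $\xi\in\Gamma(E)$ and vector fields $X$, one has $f\in\mathcal{D}_0$, $\tfrac{1}{\sqrt2}\gamma(\xi)\in\mathcal{D}_1$, $\nabla^S_X\in\mathcal{D}_2$, and $\mathfrak{S}_\nabla$ sends the classes of these operators in degrees $0$, $1$, $2$ to $f$, $\xi$, $X$ respectively. Moreover $\mathfrak{S}_\nabla$ depends only on $\nabla^E$: if $\tilde\nabla^S$ is another connection compatible with the same $\nabla^E$, it gives the same isomorphism. -/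

import Mathlib

open Bundle Manifold Filter Topology
open scoped Manifold ContDiff TensorProduct DirectSum

namespace SpinorSymbol

noncomputable section

/-! ## Graded pieces of a filtered algebra -/

section Graded

variable {A : Type*} [Ring A] [Algebra ℂ A] (F : ℤ → Submodule ℂ A)

/-- `F k / F (k - 1)`. -/
def GrPiece (k : ℤ) : Type _ := F k ⧸ (F (k - 1)).submoduleOf (F k)

instance (k : ℤ) : AddCommGroup (GrPiece F k) :=
  inferInstanceAs (AddCommGroup (F k ⧸ (F (k - 1)).submoduleOf (F k)))

instance (k : ℤ) : Module ℂ (GrPiece F k) :=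
  inferInstanceAs (Module ℂ (F k ⧸ (F (k - 1)).submoduleOf (F k)))

/-- The quotient map `F k → F k / F (k - 1)`. -/
def GrPiece.mk (k : ℤ) : F k →ₗ[ℂ] GrPiece F k := Submodule.mkQ _

theorem GrPiece.mk_surjective (k : ℤ) : Function.Surjective (GrPiece.mk F k) :=
  Submodule.mkQ_surjective _

theorem GrPiece.mk_eq_zero (k : ℤ) (a : F k) (ha : (a : A) ∈ F (k - 1)) : GrPiece.mk F k a = 0 :=
  (Submodule.Quotient.mk_eq_zero _).2 ha

/-- A linear map on `F k` that vanishes on `F (k - 1)` descends to `F k / F (k - 1)`. -/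
def GrPiece.lift {N : Type*} [AddCommGroup N] [Module ℂ N] (k : ℤ) (f : F k →ₗ[ℂ] N)
    (h : ∀ a : F k, (a : A) ∈ F (k - 1) → f a = 0) : GrPiece F k →ₗ[ℂ] N :=
  Submodule.liftQ _ f fun a ha => LinearMap.mem_ker.2 (h a ha)

theorem GrPiece.lift_mk {N : Type*} [AddCommGroup N] [Module ℂ N] (k : ℤ) (f : F k →ₗ[ℂ] N)
    (h : ∀ a : F k, (a : A) ∈ F (k - 1) → f a = 0) (a : F k) :
    GrPiece.lift F k f h (GrPiece.mk F k a) = f a := rfl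

/-- The associated graded space `⨁ₖ F k / F (k - 1)`. -/
def Gr : Type _ := ⨁ k : ℤ, GrPiece F k

instance : AddCommGroup (Gr F) := inferInstanceAs (AddCommGroup (⨁ k : ℤ, GrPiece F k))

instance : Module ℂ (Gr F) := inferInstanceAs (Module ℂ (⨁ k : ℤ, GrPiece F k))

/-- The inclusion of the degree `k` part. -/
def Gr.of (k : ℤ) : GrPiece F k →ₗ[ℂ] Gr F := DirectSum.lof ℂ ℤ (GrPiece F) k

/-- A linear map on `Gr F` given by its restrictions to the homogeneous parts. -/
def Gr.lift {N : Type*} [AddCommGroup N] [Module ℂ N] (f : ∀ k, GrPiece F k →ₗ[ℂ] N) :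
    Gr F →ₗ[ℂ] N :=
  DirectSum.toModule ℂ ℤ N f

theorem Gr.lift_of {N : Type*} [AddCommGroup N] [Module ℂ N] (f : ∀ k, GrPiece F k →ₗ[ℂ] N)
    (k : ℤ) (a : GrPiece F k) : Gr.lift F f (Gr.of F k a) = f k a :=
  DirectSum.toModule_lof ℂ k a

theorem Gr.hom_ext {N : Type*} [AddCommGroup N] [Module ℂ N] {f f' : Gr F →ₗ[ℂ] N}
    (h : ∀ k a, f (Gr.of F k (GrPiece.mk F k a)) = f' (Gr.of F k (GrPiece.mk F k a))) : f = f' :=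
  DirectSum.linearMap_ext ℂ fun k => LinearMap.ext fun x => by
    obtain ⟨a, rfl⟩ := GrPiece.mk_surjective F k x
    exact h k a

/-- The class in `F k / F (k - 1) ⊆ Gr F` of an element of `F k`. -/
def grClass (k : ℤ) : F k →ₗ[ℂ] Gr F := Gr.of F k ∘ₗ GrPiece.mk F k

variable {F}

/-- The bilinear map `F k × F l → Gr F`, `(a, b) ↦` class of `β a b` in degree `k + l + d`. -/
def grPre (β : A →ₗ[ℂ] A →ₗ[ℂ] A) (d : ℤ)
    (h : ∀ k l : ℤ, ∀ a ∈ F k, ∀ b ∈ F l, β a b ∈ F (k + l + d)) (k l : ℤ) :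
    F k →ₗ[ℂ] F l →ₗ[ℂ] Gr F :=
  LinearMap.mk₂ ℂ (fun a b => grClass F (k + l + d) ⟨β a b, h k l a a.2 b b.2⟩)
    (fun a a' b => by rw [← map_add]; congr 1; ext; simp)
    (fun c a b => by rw [← map_smul]; congr 1; ext; simp)
    (fun a b b' => by rw [← map_add]; congr 1; ext; simp)
    (fun c a b => by rw [← map_smul]; congr 1; ext; simp)

theorem grClass_eq_zero {k m : ℤ} (hm : m = k - 1) (a : F k) (ha : (a : A) ∈ F m) :
    grClass F k a = 0 := by
  subst hm
  rw [grClass, LinearMap.comp_apply, GrPiece.mk_eq_zero F k a ha, map_zero]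

/-- The map induced by `grPre` on `Gr F` in the second variable. -/
def grPreTotal (β : A →ₗ[ℂ] A →ₗ[ℂ] A) (d : ℤ)
    (h : ∀ k l : ℤ, ∀ a ∈ F k, ∀ b ∈ F l, β a b ∈ F (k + l + d)) (k : ℤ) :
    F k →ₗ[ℂ] Gr F →ₗ[ℂ] Gr F :=
  (Gr.lift F fun l => GrPiece.lift F l (grPre β d h k l).flip fun b hb => LinearMap.ext fun a =>
    grClass_eq_zero (m := k + (l - 1) + d) (by ring) _ (h k (l - 1) a a.2 b hb)).flip

theorem grPreTotal_apply (β : A →ₗ[ℂ] A →ₗ[ℂ] A) (d : ℤ)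
    (h : ∀ k l : ℤ, ∀ a ∈ F k, ∀ b ∈ F l, β a b ∈ F (k + l + d)) (k l : ℤ) (a : F k) (b : F l) :
    grPreTotal β d h k a (grClass F l b) =
      grClass F (k + l + d) ⟨β a b, h k l a a.2 b b.2⟩ := by
  rw [grPreTotal, LinearMap.flip_apply, grClass, LinearMap.comp_apply, Gr.lift_of,
    GrPiece.lift_mk]
  rfl

/-- A bilinear operation `β` of `A` with `β (F k) (F l) ⊆ F (k + l + d)` induces a bilinear
operation of degree `d` on `Gr F`, namely `[a]ₖ, [b]ₗ ↦ [β a b]ₖ₊ₗ₊d`. -/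
def grMap₂ (β : A →ₗ[ℂ] A →ₗ[ℂ] A) (d : ℤ)
    (h : ∀ k l : ℤ, ∀ a ∈ F k, ∀ b ∈ F l, β a b ∈ F (k + l + d)) :
    Gr F →ₗ[ℂ] Gr F →ₗ[ℂ] Gr F :=
  Gr.lift F fun k => GrPiece.lift F k (grPreTotal β d h k) fun a ha => Gr.hom_ext F fun l b =>
    (grPreTotal_apply β d h k l a b).trans
      (grClass_eq_zero (m := (k - 1) + l + d) (by ring) _ (h (k - 1) l a ha b b.2))

theorem grMap₂_grClass (β : A →ₗ[ℂ] A →ₗ[ℂ] A) (d : ℤ)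
    (h : ∀ k l : ℤ, ∀ a ∈ F k, ∀ b ∈ F l, β a b ∈ F (k + l + d)) (k l : ℤ) (a : F k) (b : F l) :
    grMap₂ β d h (grClass F k a) (grClass F l b) =
      grClass F (k + l + d) ⟨β a b, h k l a a.2 b b.2⟩ := by
  rw [← grPreTotal_apply, grMap₂, grClass, LinearMap.comp_apply, Gr.lift_of, GrPiece.lift_mk]

/-- `F` is an increasing exhaustive filtration of the subalgebra `D` which is compatible with the
product, and for which the bracket `br` lowers the total degree by `2`. -/
structure IsPoissonFiltration (D : Subalgebra ℂ A) (br : A →ₗ[ℂ] A →ₗ[ℂ] A)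
    (F : ℤ → Submodule ℂ A) : Prop where
  mono : Monotone F
  exhaustive : ⨆ k, F k = Subalgebra.toSubmodule D
  one_mem : 1 ∈ F 0
  mul_mem : ∀ k l : ℤ, ∀ a ∈ F k, ∀ b ∈ F l, a * b ∈ F (k + l)
  bracket_mem : ∀ k l : ℤ, ∀ a ∈ F k, ∀ b ∈ F l, br a b ∈ F (k + l - 2)

/-- The product of `Gr F`: `[a]ₖ [b]ₗ = [a b]ₖ₊ₗ`. -/
def IsPoissonFiltration.grMul {D : Subalgebra ℂ A} {br : A →ₗ[ℂ] A →ₗ[ℂ] A}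
    (hF : IsPoissonFiltration D br F) : Gr F →ₗ[ℂ] Gr F →ₗ[ℂ] Gr F :=
  grMap₂ (LinearMap.mul ℂ A) 0 (by simpa using hF.mul_mem)

/-- The bracket of degree `-2` of `Gr F`: `{[a]ₖ, [b]ₗ} = [br a b]ₖ₊ₗ₋₂`. -/
def IsPoissonFiltration.grBracket {D : Subalgebra ℂ A} {br : A →ₗ[ℂ] A →ₗ[ℂ] A}
    (hF : IsPoissonFiltration D br F) : Gr F →ₗ[ℂ] Gr F →ₗ[ℂ] Gr F :=
  grMap₂ br (-2) hF.bracket_mem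

end Graded

/-! ## Parity, graded commutators and commutator filtrations -/

section Parity

variable {A : Type*} [Ring A] [Algebra ℂ A]

open Classical in
/-- A linear map which is the identity on `A₀` and zero on `A₁`. On `A₀ ⊕ A₁` it is the projection
to `A₀`; its values outside `A₀ ⊕ A₁` are irrelevant. -/
def evenPart (A₀ : Subalgebra ℂ A) (A₁ : Submodule ℂ A) : A →ₗ[ℂ] A :=
  if h : ∃ p : A →ₗ[ℂ] A, (∀ a ∈ A₀, p a = a) ∧ (∀ a ∈ A₁, p a = 0) then h.choose else 0

/-- The complementary projection. -/
def oddPart (A₀ : Subalgebra ℂ A) (A₁ : Submodule ℂ A) : A →ₗ[ℂ] A :=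
  LinearMap.id - evenPart A₀ A₁

/-- The graded commutator with respect to the even elements `A₀` and the odd elements `A₁`. With
`a = a₀ + a₁`, `b = b₀ + b₁` it is `a b - b a₀ - (b₀ - b₁) a₁`, which means
`a b - (-1)^(|a| |b|) b a` for homogeneous `a` and `b`. -/
def superCommutator (A₀ : Subalgebra ℂ A) (A₁ : Submodule ℂ A) : A →ₗ[ℂ] A →ₗ[ℂ] A :=
  LinearMap.mk₂ ℂ
    (fun a b => a * b - b * evenPart A₀ A₁ a -
      (evenPart A₀ A₁ b - oddPart A₀ A₁ b) * oddPart A₀ A₁ a)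
    (fun a a' b => by simp only [map_add, mul_add, add_mul]; abel)
    (fun r a b => by simp only [map_smul, mul_smul_comm, smul_mul_assoc, smul_sub])
    (fun a b b' => by simp only [map_add, mul_add, add_mul, sub_mul]; abel)
    (fun r a b => by simp only [map_smul, mul_smul_comm, smul_mul_assoc, smul_sub, sub_mul])

/-- On homogeneous elements `superCommutator` is `a b - (-1)^(|a| |b|) b a`. -/
theorem superCommutator_apply {A₀ : Subalgebra ℂ A} {A₁ : Submodule ℂ A}
    (h : ∃ p : A →ₗ[ℂ] A, (∀ a ∈ A₀, p a = a) ∧ (∀ a ∈ A₁, p a = 0)) (a b : A) :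
    (a ∈ A₀ → superCommutator A₀ A₁ a b = a * b - b * a) ∧
    (a ∈ A₁ → b ∈ A₀ → superCommutator A₀ A₁ a b = a * b - b * a) ∧
    (a ∈ A₁ → b ∈ A₁ → superCommutator A₀ A₁ a b = a * b + b * a) := by
  have h0 : ∀ a ∈ A₀, evenPart A₀ A₁ a = a := by
    rw [evenPart, dif_pos h]; exact h.choose_spec.1
  have h1 : ∀ a ∈ A₁, evenPart A₀ A₁ a = 0 := by
    rw [evenPart, dif_pos h]; exact h.choose_spec.2
  refine ⟨fun ha => ?_, fun ha hb => ?_, fun ha hb => ?_⟩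
  · simp [superCommutator, oddPart, h0 a ha]
  · simp [superCommutator, oddPart, h1 a ha, h0 b hb]
  · simp [superCommutator, oddPart, h1 a ha, h1 b hb]

/-- `commFiltrationAux D br G (k + 1)` is the term of index `k` of the filtration, starting from
zero in index `-1`. -/
def commFiltrationAux (D : Subalgebra ℂ A) (br : A →ₗ[ℂ] A →ₗ[ℂ] A) (G : Set A) :
    ℕ → Submodule ℂ A
  | 0 => ⊥
  | k + 1 => Subalgebra.toSubmodule D ⊓ ⨅ x ∈ G, (commFiltrationAux D br G k).comap (br.flip x)

/-- The filtration `D_k` of `D`: it is zero for `k < 0`, and for `k ≥ 0` it consists of the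
`a ∈ D` with `br a x ∈ D_{k-1}` for all `x ∈ G`. -/
def commFiltration (D : Subalgebra ℂ A) (br : A →ₗ[ℂ] A →ₗ[ℂ] A) (G : Set A) (k : ℤ) :
    Submodule ℂ A :=
  commFiltrationAux D br G (k + 1).toNat

theorem commFiltration_of_neg (D : Subalgebra ℂ A) (br : A →ₗ[ℂ] A →ₗ[ℂ] A) (G : Set A) {k : ℤ}
    (hk : k < 0) : commFiltration D br G k = ⊥ := by
  have : (k + 1).toNat = 0 := by omega
  rw [commFiltration, this, commFiltrationAux]

theorem mem_commFiltration (D : Subalgebra ℂ A) (br : A →ₗ[ℂ] A →ₗ[ℂ] A) (G : Set A) {k : ℤ}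
    (hk : 0 ≤ k) (a : A) :
    a ∈ commFiltration D br G k ↔ a ∈ D ∧ ∀ x ∈ G, br a x ∈ commFiltration D br G (k - 1) := by
  have h1 : (k + 1).toNat = (k - 1 + 1).toNat + 1 := by omega
  rw [commFiltration, h1, commFiltrationAux]
  simp [commFiltration]

end Parity

/-! ## The geometric data -/

section Geometry

variable {n : ℕ} {M : Type*} [TopologicalSpace M] [ChartedSpace (EuclideanSpace ℝ (Fin n)) M]
  [IsManifold (𝓡 n) ∞ M]

/-- Smooth vector fields on `M`. -/
abbrev VField (n : ℕ) (M : Type*) [TopologicalSpace M]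
    [ChartedSpace (EuclideanSpace ℝ (Fin n)) M] [IsManifold (𝓡 n) ∞ M] : Type _ :=
  Cₛ^∞⟮𝓡 n; EuclideanSpace ℝ (Fin n), (TangentSpace (𝓡 n) : M → Type _)⟯

/-- Smooth real functions on `M`. -/
abbrev SFun (n : ℕ) (M : Type*) [TopologicalSpace M]
    [ChartedSpace (EuclideanSpace ℝ (Fin n)) M] : Type _ :=
  C^∞⟮𝓡 n, M; 𝓘(ℝ, ℝ), ℝ⟯

/-- The Lie bracket of two vector fields. -/
def lieBracket (X Y : VField n M) : VField n M where
  toFun := VectorField.mlieBracket (𝓡 n) X Y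
  contMDiff_toFun := by
    have h1 : IsManifold (𝓡 n) (((⊤ : ℕ∞) : ℕ∞ω) + 1) M := by simpa
    have h2 : IsManifold (𝓡 n) (minSmoothness ℝ 2) M :=
      IsManifold.of_le (n := ∞) (by simpa using ENat.LEInfty.out)
    have h3 : IsManifold (𝓡 n) (minSmoothness ℝ 3) M :=
      IsManifold.of_le (n := ∞) (by simpa using ENat.LEInfty.out)
    intro x
    exact ContMDiffAt.mlieBracket_vectorField (m := ⊤) (n := ⊤) (X.contMDiff x) (Y.contMDiff x)
      (by simp)

section Connection

variable {F : Type*} [NormedAddCommGroup F] [NormedSpace ℝ F]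
  {V : M → Type*} [TopologicalSpace (TotalSpace F V)] [∀ x, TopologicalSpace (V x)]
  [∀ x, AddCommGroup (V x)] [∀ x, Module ℝ (V x)]
  [∀ x, IsTopologicalAddGroup (V x)] [∀ x, ContinuousSMul ℝ (V x)]
  [FiberBundle F V] [VectorBundle ℝ F V]

theorem contMDiff_cov (cov : CovariantDerivative (𝓡 n) F V)
    (hc : CovariantDerivative.ContMDiffCovariantDerivative cov ∞) (X : VField n M) (s : ∀ x, V x)
    (hs : ContMDiff (𝓡 n) ((𝓡 n).prod 𝓘(ℝ, F)) ∞ (fun x => TotalSpace.mk' F x (s x))) :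
    ContMDiff (𝓡 n) ((𝓡 n).prod 𝓘(ℝ, F)) ∞
      (fun x => TotalSpace.mk' F x (cov s x (X x))) := by
  have h := hc.contMDiff.contMDiff (σ := s) (by simpa using hs.contMDiffOn)
  rw [contMDiffOn_univ] at h
  exact ContMDiff.clm_bundle_apply h X.contMDiff

variable (n F V) in
/-- A smooth connection on the vector bundle `V`. -/
structure Connection where
  cov : CovariantDerivative (𝓡 n) F V
  smooth : CovariantDerivative.ContMDiffCovariantDerivative cov ∞

/-- The operator `∇_X : Γ(V) → Γ(V)`. -/
def Connection.nabla (D : Connection n F V) (X : VField n M) (s : Cₛ^∞⟮𝓡 n; F, V⟯) :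
    Cₛ^∞⟮𝓡 n; F, V⟯ where
  toFun x := D.cov s x (X x)
  contMDiff_toFun := contMDiff_cov D.cov D.smooth X s s.contMDiff

/-- The curvature `R(X, Y) s = ∇_X ∇_Y s - ∇_Y ∇_X s - ∇_[X, Y] s`. -/
def Connection.curvature (D : Connection n F V) (X Y : VField n M) (s : Cₛ^∞⟮𝓡 n; F, V⟯) :
    Cₛ^∞⟮𝓡 n; F, V⟯ :=
  D.nabla X (D.nabla Y s) - D.nabla Y (D.nabla X s) - D.nabla (lieBracket X Y) s

end Connection

/-! ### Pseudo-Euclidean vector bundles, spinor bundles, compatible connections -/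

section PseudoEuclidean

variable {F : Type*} [NormedAddCommGroup F] [NormedSpace ℝ F]
  {E : M → Type*} [TopologicalSpace (TotalSpace F E)] [∀ x, TopologicalSpace (E x)]
  [∀ x, AddCommGroup (E x)] [∀ x, Module ℝ (E x)]
  [∀ x, IsTopologicalAddGroup (E x)] [∀ x, ContinuousSMul ℝ (E x)]
  [FiberBundle F E] [VectorBundle ℝ F E]

variable (n F E) in
/-- A pseudo-Euclidean metric on the vector bundle `E`: a smooth family of nondegenerate symmetric
bilinear forms, of arbitrary signature. -/
structure PseudoMetric where
  form : ∀ x, LinearMap.BilinForm ℝ (E x)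
  symm : ∀ x v w, form x v w = form x w v
  nondegenerate : ∀ x, (form x).Nondegenerate
  smooth : ∀ ξ η : Cₛ^∞⟮𝓡 n; F, E⟯,
    ContMDiff (𝓡 n) 𝓘(ℝ, ℝ) ∞ (fun x => form x (ξ x) (η x))

/-- The quadratic form `v ↦ g(v, v)` on `E x`. -/
abbrev PseudoMetric.quad (g : PseudoMetric n F E) (x : M) : QuadraticForm ℝ (E x) :=
  LinearMap.BilinMap.toQuadraticMap (g.form x)

/-- The fibre at `x` of the complex Clifford bundle; in it `v w + w v = 2 g(v, w)`. -/
abbrev PseudoMetric.Cl (g : PseudoMetric n F E) (x : M) : Type _ :=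
  ℂ ⊗[ℝ] CliffordAlgebra (g.quad x)

/-- The smooth function `g(ξ, η)`. -/
def PseudoMetric.pair (g : PseudoMetric n F E) (ξ η : Cₛ^∞⟮𝓡 n; F, E⟯) : SFun n M :=
  ⟨fun x => g.form x (ξ x) (η x), g.smooth ξ η⟩

/-- `∇ g = 0`. -/
def PseudoMetric.IsMetricConnection (g : PseudoMetric n F E) (D : Connection n F E) : Prop :=
  ∀ (X : VField n M) (ξ η : Cₛ^∞⟮𝓡 n; F, E⟯) (x : M),
    mvfderiv (𝓡 n) (g.pair ξ η) x (X x) =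
      g.form x (D.nabla X ξ x) (η x) + g.form x (ξ x) (D.nabla X η x)

section Spinor

variable {FS : Type*} [NormedAddCommGroup FS] [NormedSpace ℝ FS]
  {S : M → Type*} [TopologicalSpace (TotalSpace FS S)] [∀ x, TopologicalSpace (S x)]
  [∀ x, AddCommGroup (S x)] [∀ x, Module ℝ (S x)]
  [∀ x, IsTopologicalAddGroup (S x)] [∀ x, ContinuousSMul ℝ (S x)]
  [FiberBundle FS S] [VectorBundle ℝ FS S]
  [∀ x, Module ℂ (S x)] [∀ x, IsScalarTower ℝ ℂ (S x)]

variable (n FS S) in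
/-- The complex structure of the fibres of the real vector bundle `S` is smooth, that is, `S` is a
smooth complex vector bundle. -/
class IsComplexBundle : Prop where
  smooth_I : ∀ s : Cₛ^∞⟮𝓡 n; FS, S⟯,
    ContMDiff (𝓡 n) ((𝓡 n).prod 𝓘(ℝ, FS)) ∞
      (fun x => TotalSpace.mk' FS x (Complex.I • s x))

variable [IsComplexBundle n FS S]

variable (n FS S) in
/-- The complex vector space `Γ(S)` of smooth sections of the complex vector bundle `S`. -/
def SpinorSections : Submodule ℂ (∀ x, S x) where
  carrier := {s | ContMDiff (𝓡 n) ((𝓡 n).prod 𝓘(ℝ, FS)) ∞ (fun x => TotalSpace.mk' FS x (s x))}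
  add_mem' hs ht := hs.add_section ht
  zero_mem' := (0 : Cₛ^∞⟮𝓡 n; FS, S⟯).contMDiff
  smul_mem' c s hs := by
    let σ : Cₛ^∞⟮𝓡 n; FS, S⟯ := ⟨s, hs⟩
    let τ : Cₛ^∞⟮𝓡 n; FS, S⟯ := ⟨_, IsComplexBundle.smooth_I σ⟩
    have h : c • s = (c.re • σ + c.im • τ : Cₛ^∞⟮𝓡 n; FS, S⟯) := by
      funext x
      have h1 : (c.re : ℝ) • s x = (c.re : ℂ) • s x := by
        rw [← algebraMap_smul ℂ c.re (s x)]; rfl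
      have h2 : (c.im : ℝ) • (Complex.I • s x) = (c.im : ℂ) • (Complex.I • s x) := by
        rw [← algebraMap_smul ℂ c.im (Complex.I • s x)]; rfl
      change c • s x = c.re • s x + c.im • (Complex.I • s x)
      rw [h1, h2, smul_smul, ← add_smul, Complex.re_add_im]
    rw [Set.mem_ofPred_eq, h]
    exact ContMDiffSection.contMDiff _

variable (n FS S) in
/-- All complex linear operators on `Γ(S)`. -/
def Op : Type _ := Module.End ℂ (SpinorSections n FS S)

instance : Ring (Op n FS S) := inferInstanceAs (Ring (Module.End ℂ (SpinorSections n FS S)))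

instance : Algebra ℂ (Op n FS S) :=
  inferInstanceAs (Algebra ℂ (Module.End ℂ (SpinorSections n FS S)))

instance : FunLike (Op n FS S) (SpinorSections n FS S) (SpinorSections n FS S) :=
  inferInstanceAs (FunLike (Module.End ℂ (SpinorSections n FS S)) _ _)

instance : LinearMapClass (Op n FS S) ℂ (SpinorSections n FS S) (SpinorSections n FS S) :=
  inferInstanceAs (LinearMapClass (Module.End ℂ (SpinorSections n FS S)) ℂ _ _)

theorem Op.mul_apply (A B : Op n FS S) (s : SpinorSections n FS S) : (A * B) s = A (B s) := rfl

theorem Op.sub_apply (A B : Op n FS S) (s : SpinorSections n FS S) : (A - B) s = A s - B s := rfl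

theorem Op.one_apply (s : SpinorSections n FS S) : (1 : Op n FS S) s = s := rfl

variable (FS S) in
/-- Multiplication by a smooth real function. -/
def mulOp (f : SFun n M) : Op n FS S :=
  show Module.End ℂ (SpinorSections n FS S) from {
    toFun := fun s => ⟨fun x => f x • s.1 x, ContMDiff.smul_section f.contMDiff s.2⟩
    map_add' := fun s t => by ext x; simp
    map_smul' := fun a s => by ext x; exact smul_comm (f x) a (s.1 x) }

variable (n FS S) in
/-- `Γ(End S)`: the operators acting pointwise by complex linear endomorphisms. -/
def endSections : Set (Op n FS S) :=
  {T | ∃ t : ∀ x, Module.End ℂ (S x), ∀ s x, (T s).1 x = t x (s.1 x)}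

variable (n FS S) in
/-- A smooth connection on the complex vector bundle `S`: the covariant derivative is complex
linear. -/
structure ComplexConnection extends Connection n FS S where
  map_smul : ∀ (c : ℂ) (s : SpinorSections n FS S) (x : M) (v : TangentSpace (𝓡 n) x),
    cov (c • s).1 x v = c • cov s.1 x v

/-- The operator `∇_X` on `Γ(S)`. -/
def ComplexConnection.op (D : ComplexConnection n FS S) (X : VField n M) : Op n FS S :=
  show Module.End ℂ (SpinorSections n FS S) from {
    toFun := fun s => ⟨fun x => D.cov s.1 x (X x), contMDiff_cov D.cov D.smooth X s.1 s.2⟩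
    map_add' := fun s t => by
      ext x
      have h := D.cov.isCovariantDerivativeOnUniv.add (x := x)
        ((show ContMDiff _ _ _ _ from s.2).mdifferentiable (by simp) x)
        ((show ContMDiff _ _ _ _ from t.2).mdifferentiable (by simp) x)
      change D.cov (s.1 + t.1) x (X x) = D.cov s.1 x (X x) + D.cov t.1 x (X x)
      rw [h]; rfl
    map_smul' := fun c s => by
      ext x
      exact D.map_smul c s x (X x) }

variable (n FS S) in
/-- The algebra `𝒟(M, S)` of differential operators on `S`, generated by `Γ(End S)` and the
covariant derivatives. -/
def diffOps : Subalgebra ℂ (Op n FS S) :=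
  Algebra.adjoin ℂ (endSections n FS S ∪ {T | ∃ (D : ComplexConnection n FS S) (X : VField n M),
    T = D.op X})

variable (FS S) in
/-- The structure of a spinor bundle on `S`: a smooth isomorphism from the complex Clifford bundle
of `(E, g)` to the bundle of algebras `End S`. -/
structure SpinorStructure (g : PseudoMetric n F E) where
  iso : ∀ x, g.Cl x ≃ₐ[ℂ] Module.End ℂ (S x)
  smooth : ∀ (ξ : Cₛ^∞⟮𝓡 n; F, E⟯) (s : SpinorSections n FS S),
    ContMDiff (𝓡 n) ((𝓡 n).prod 𝓘(ℝ, FS)) ∞ (fun x => TotalSpace.mk' FS x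
      (iso x (1 ⊗ₜ[ℝ] CliffordAlgebra.ι (g.quad x) (ξ x)) (s.1 x)))

namespace SpinorStructure

variable {g : PseudoMetric n F E} (c : SpinorStructure FS S g)

/-- Clifford multiplication `γ(ξ)` by a section `ξ` of `E`. -/
def gamma (ξ : Cₛ^∞⟮𝓡 n; F, E⟯) : Op n FS S :=
  show Module.End ℂ (SpinorSections n FS S) from {
    toFun := fun s => ⟨fun x => c.iso x (1 ⊗ₜ[ℝ] CliffordAlgebra.ι (g.quad x) (ξ x)) (s.1 x),
      c.smooth ξ s⟩
    map_add' := fun s t => by ext x; simp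
    map_smul' := fun a s => by ext x; simp }

/-- `Γ(ℂl⁺(E))` for `i = 0` and `Γ(ℂl⁻(E))` for `i = 1`, as operators on `Γ(S)`. -/
def cliffordSections (i : ZMod 2) : Set (Op n FS S) :=
  {T | ∃ t : ∀ x, g.Cl x,
    (∀ x, t x ∈ (CliffordAlgebra.evenOdd (g.quad x) i).baseChange ℂ) ∧
    ∀ s x, (T s).1 x = c.iso x (t x) (s.1 x)}

/-- `(∇^E, ∇^S)` is a compatible pair of connections: `∇^E` is metric and
`[∇^S_X, γ(ξ)] = γ(∇^E_X ξ)`. -/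
def Compatible (DE : Connection n F E) (DS : ComplexConnection n FS S) : Prop :=
  g.IsMetricConnection DE ∧
    ∀ (X : VField n M) (ξ : Cₛ^∞⟮𝓡 n; F, E⟯),
      DS.op X * c.gamma ξ - c.gamma ξ * DS.op X = c.gamma (DE.nabla X ξ)

/-- `∇^S` is a spinor connection. -/
def IsSpinorConnection (DS : ComplexConnection n FS S) : Prop :=
  ∃ DE : Connection n F E, c.Compatible DE DS

/-- The even operators `𝒟⁺(M, S)`: the algebra generated by `Γ(ℂl⁺(E))` and the operators `∇_X`
for spinor connections `∇`. -/
def evenOps : Subalgebra ℂ (Op n FS S) :=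
  Algebra.adjoin ℂ (c.cliffordSections 0 ∪
    {T | ∃ (D : ComplexConnection n FS S) (X : VField n M), c.IsSpinorConnection D ∧ T = D.op X})

/-- The odd operators `𝒟⁻(M, S) = Γ(ℂl⁻(E)) 𝒟⁺(M, S)`. -/
def oddOps : Submodule ℂ (Op n FS S) :=
  Submodule.span ℂ {T | ∃ A ∈ c.cliffordSections 1, ∃ B ∈ c.evenOps, T = A * B}

/-- The graded commutator of operators on `Γ(S)`. -/
def superComm : Op n FS S →ₗ[ℂ] Op n FS S →ₗ[ℂ] Op n FS S :=
  superCommutator c.evenOps c.oddOps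

/-- The filtration `𝒟_k(M, S)`: it is zero for `k < 0`, and for `k ≥ 0` it consists of the
`A ∈ 𝒟(M, S)` with `[A, γ(ξ)] ∈ 𝒟_{k-1}(M, S)` for all `ξ ∈ Γ(E)`. -/
def filt : ℤ → Submodule ℂ (Op n FS S) :=
  commFiltration (diffOps n FS S) c.superComm (Set.range c.gamma)

/-- The `𝒟_k(M, S)` form an increasing exhaustive filtration of `𝒟(M, S)` with
`𝒟_k 𝒟_l ⊆ 𝒟_{k+l}` and `[𝒟_k, 𝒟_l] ⊆ 𝒟_{k+l-2}`. -/
abbrev IsFiltration : Prop := 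
  IsPoissonFiltration (A := Op n FS S) (diffOps n FS S) c.superComm c.filt

end SpinorStructure

end Spinor

/-! ### Functions on `T^*[2]M ⊕ E[1]` -/

variable (n E) in
/-- The fibre at `x` of the bundle of algebras `S(TM) ⊗ ⋀ E ⊗ ℂ`: the complex polynomial functions
on `T^*_x M` with values in `⋀ E_x ≅ ⋀ E_x^*`, the identification being given by the metric. -/
def FnFiber (x : M) : Type _ :=
  ℂ ⊗[ℝ] (SymmetricAlgebra ℝ (TangentSpace (𝓡 n) x) ⊗[ℝ] ExteriorAlgebra ℝ (E x))

instance (x : M) : Ring (FnFiber n E x) := inferInstanceAs (Ring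
  (ℂ ⊗[ℝ] (SymmetricAlgebra ℝ (TangentSpace (𝓡 n) x) ⊗[ℝ] ExteriorAlgebra ℝ (E x))))

instance (x : M) : Algebra ℂ (FnFiber n E x) := inferInstanceAs (Algebra ℂ
  (ℂ ⊗[ℝ] (SymmetricAlgebra ℝ (TangentSpace (𝓡 n) x) ⊗[ℝ] ExteriorAlgebra ℝ (E x))))

variable (n E) in
/-- The inclusion of the real fibre `S(T_x M) ⊗ ⋀ E_x`. -/
def realι (x : M) :
    SymmetricAlgebra ℝ (TangentSpace (𝓡 n) x) ⊗[ℝ] ExteriorAlgebra ℝ (E x) →+* FnFiber n E x :=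
  (Algebra.TensorProduct.includeRight (R := ℝ) (A := ℂ)).toRingHom

variable (n E) in
/-- A tangent vector, as an element of degree `2` of the fibre. -/
def tangentι (x : M) (v : TangentSpace (𝓡 n) x) : FnFiber n E x :=
  realι n E x (SymmetricAlgebra.ι ℝ _ v ⊗ₜ 1)

variable (n E) in
/-- An element of `⋀ E_x`, as an element of the fibre. -/
def exteriorι (x : M) (r : ExteriorAlgebra ℝ (E x)) : FnFiber n E x := realι n E x (1 ⊗ₜ r)

variable (n E) in
/-- The complex span of `T_x M`, whose elements have degree `2`. -/
def tangentSpan (x : M) : Submodule ℂ (FnFiber n E x) :=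
  Submodule.span ℂ (Set.range (tangentι n E x))

variable (n E) in
/-- The complex span of `E_x`, whose elements have degree `1`. -/
def fiberSpan (x : M) : Submodule ℂ (FnFiber n E x) :=
  Submodule.span ℂ (Set.range fun v : E x => exteriorι n E x (ExteriorAlgebra.ι ℝ v))

variable (n E) in
/-- The degree `k` part `⨁_{2 m + l = k} S^m(T_x M) ⊗ ⋀^l E_x ⊗ ℂ` of the fibre. -/
def FnDegree (k : ℤ) (x : M) : Submodule ℂ (FnFiber n E x) :=
  ⨆ (m : ℕ) (l : ℕ) (_ : 2 * (m : ℤ) + l = k), tangentSpan n E x ^ m * fiberSpan n E x ^ l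

variable (n F E) in
/-- The families `x ↦ F x ∈ S(T_x M) ⊗ ⋀ E_x ⊗ ℂ` that are polynomials in smooth functions on `M`,
vector fields, and sections of `E`. -/
def polyFamilies : Subalgebra ℂ (∀ x, FnFiber n E x) :=
  Algebra.adjoin ℂ
    (Set.range (fun (f : SFun n M) x => algebraMap ℂ (FnFiber n E x) (f x : ℝ)) ∪
     Set.range (fun (X : VField n M) x => tangentι n E x (X x)) ∪
     Set.range (fun (ξ : Cₛ^∞⟮𝓡 n; F, E⟯) x => exteriorι n E x (ExteriorAlgebra.ι ℝ (ξ x))))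

variable (n E) in
/-- The complex span of `1`, `T_x M` and `E_x`; its `N`-th power consists of the polynomials of
length at most `N`. -/
def lengthOne (x : M) : Submodule ℂ (FnFiber n E x) := 1 ⊔ tangentSpan n E x ⊔ fiberSpan n E x

theorem one_le_lengthOne (x : M) : 1 ≤ lengthOne n E x := le_sup_left.trans le_sup_left

variable (n F E) in
/-- The algebra `𝒪^ℂ(T^*[2]M ⊕ E[1])` of complex functions: the smooth sections of bounded
degree of the bundle `S(TM) ⊗ ⋀ E ⊗ ℂ`. Smoothness means that the section is, near each
point, a polynomial in smooth functions, vector fields and sections of `E`. -/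
def Fn : Subalgebra ℂ (∀ x, FnFiber n E x) where
  carrier := {G | (∃ N : ℕ, ∀ x, G x ∈ lengthOne n E x ^ N) ∧
    ∀ x₀, ∃ P ∈ polyFamilies n F E, ∀ᶠ x in 𝓝 x₀, G x = P x}
  add_mem' := by
    rintro G H ⟨⟨N, hN⟩, hG⟩ ⟨⟨N', hN'⟩, hH⟩
    refine ⟨⟨max N N', fun x => ?_⟩, fun x₀ => ?_⟩
    · exact add_mem (pow_le_pow_right₀ (one_le_lengthOne x) (le_max_left _ _) (hN x))
        (pow_le_pow_right₀ (one_le_lengthOne x) (le_max_right _ _) (hN' x))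
    · obtain ⟨P, hP, hGP⟩ := hG x₀
      obtain ⟨Q, hQ, hHQ⟩ := hH x₀
      refine ⟨P + Q, add_mem hP hQ, ?_⟩
      filter_upwards [hGP, hHQ] with x h1 h2
      simp [h1, h2]
  mul_mem' := by
    rintro G H ⟨⟨N, hN⟩, hG⟩ ⟨⟨N', hN'⟩, hH⟩
    refine ⟨⟨N + N', fun x => ?_⟩, fun x₀ => ?_⟩
    · rw [pow_add]
      exact Submodule.mul_mem_mul (hN x) (hN' x)
    · obtain ⟨P, hP, hGP⟩ := hG x₀
      obtain ⟨Q, hQ, hHQ⟩ := hH x₀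
      refine ⟨P * Q, mul_mem hP hQ, ?_⟩
      filter_upwards [hGP, hHQ] with x h1 h2
      simp [h1, h2]
  algebraMap_mem' a := by
    refine ⟨⟨0, fun x => ?_⟩, fun x₀ => ⟨_, Subalgebra.algebraMap_mem _ a, ?_⟩⟩
    · rw [pow_zero, Submodule.mem_one]
      exact ⟨a, rfl⟩
    · exact Eventually.of_forall fun x => rfl

variable (n F E) in
/-- The functions of degree `k`. -/
def FnOfDegree (k : ℤ) : Submodule ℂ (Fn n F E) where
  carrier := {G | ∀ x, G.1 x ∈ FnDegree n E k x}
  add_mem' hG hH x := add_mem (hG x) (hH x)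
  zero_mem' _ := zero_mem _
  smul_mem' a _ hG x := Submodule.smul_mem _ a (hG x)

theorem mem_Fn_of_mem (G : ∀ x, FnFiber n E x) (h : G ∈ polyFamilies n F E)
    (h1 : ∀ x, G x ∈ lengthOne n E x) : G ∈ Fn n F E :=
  ⟨⟨1, fun x => by simpa using h1 x⟩, fun _ => ⟨G, h, Eventually.of_forall fun _ => rfl⟩⟩

variable (F E) in
/-- A function on `M`, as a function of degree `0`. -/
def fnBase (f : SFun n M) : Fn n F E :=
  ⟨fun x => algebraMap ℂ (FnFiber n E x) (f x : ℝ),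
    mem_Fn_of_mem _ (Algebra.subset_adjoin (Or.inl (Or.inl ⟨f, rfl⟩))) fun x =>
      one_le_lengthOne x (by
        rw [Submodule.mem_one]
        exact ⟨_, rfl⟩)⟩

variable (F E) in
/-- A vector field on `M`, as a function of degree `2`. -/
def fnField (X : VField n M) : Fn n F E :=
  ⟨fun x => tangentι n E x (X x),
    mem_Fn_of_mem _ (Algebra.subset_adjoin (Or.inl (Or.inr ⟨X, rfl⟩))) fun x =>
      (le_sup_right.trans le_sup_left : tangentSpan n E x ≤ lengthOne n E x)
        (Submodule.subset_span ⟨X x, rfl⟩)⟩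

/-- A section of `E`, as a function of degree `1`. -/
def fnSection (ξ : Cₛ^∞⟮𝓡 n; F, E⟯) : Fn n F E :=
  ⟨fun x => exteriorι n E x (ExteriorAlgebra.ι ℝ (ξ x)),
    mem_Fn_of_mem _ (Algebra.subset_adjoin (Or.inr ⟨ξ, rfl⟩)) fun x =>
      (le_sup_right : fiberSpan n E x ≤ lengthOne n E x)
        (Submodule.subset_span ⟨ξ x, rfl⟩)⟩

/-- `P` is a graded Poisson bracket of degree `-2` on `𝒪^ℂ(T^*[2]M ⊕ E[1])`. -/
structure IsGradedPoisson (P : Fn n F E →ₗ[ℂ] Fn n F E →ₗ[ℂ] Fn n F E) : Prop where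
  degree : ∀ k l : ℤ, ∀ G ∈ FnOfDegree n F E k, ∀ H ∈ FnOfDegree n F E l,
    P G H ∈ FnOfDegree n F E (k + l - 2)
  skew : ∀ k l : ℤ, ∀ G ∈ FnOfDegree n F E k, ∀ H ∈ FnOfDegree n F E l,
    P G H = -((-1 : ℂ) ^ ((k - 2) * (l - 2)) • P H G)
  leibniz : ∀ k l : ℤ, ∀ G ∈ FnOfDegree n F E k, ∀ H ∈ FnOfDegree n F E l, ∀ K,
    P G (H * K) = P G H * K + (-1 : ℂ) ^ ((k - 2) * l) • (H * P G K)
  jacobi : ∀ k l : ℤ, ∀ G ∈ FnOfDegree n F E k, ∀ H ∈ FnOfDegree n F E l, ∀ K,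
    P G (P H K) = P (P G H) K + (-1 : ℂ) ^ ((k - 2) * (l - 2)) • P H (P G K)

/-- The curvature `R(X, Y)` of a connection on `E`, seen as the section `r` of `⋀² E` with
`-ι_v r = R(X, Y) v`, where `ι_v` is the contraction with `g(v, ·)`. -/
def IsCurvatureBivector (g : PseudoMetric n F E) (DE : Connection n F E) (X Y : VField n M)
    (r : ∀ x, ExteriorAlgebra ℝ (E x)) : Prop :=
  (∀ x, r x ∈ ⋀[ℝ]^2 (E x)) ∧
    ∀ (ξ : Cₛ^∞⟮𝓡 n; F, E⟯) (x : M),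
      -(CliffordAlgebra.contractLeft (Q := (0 : QuadraticForm ℝ (E x)))
          (g.form x (ξ x)) (r x)) = ExteriorAlgebra.ι ℝ (DE.curvature X Y ξ x)

/-- `P` is the Poisson bracket of Rothstein's symplectic structure on `T^*[2]M ⊕ E[1]` defined by
the metric `g` and the metric connection `∇^E`. -/
structure IsRothsteinBracket (g : PseudoMetric n F E) (DE : Connection n F E)
    (P : Fn n F E →ₗ[ℂ] Fn n F E →ₗ[ℂ] Fn n F E) : Prop extends IsGradedPoisson P where
  field_base : ∀ (X : VField n M) (f : SFun n M) (x : M),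
    (P (fnField F E X) (fnBase F E f)).1 x =
      algebraMap ℂ (FnFiber n E x) (mvfderiv (𝓡 n) f x (X x) : ℝ)
  base_base : ∀ f h : SFun n M, P (fnBase F E h) (fnBase F E f) = 0
  field_section : ∀ (X : VField n M) (ξ : Cₛ^∞⟮𝓡 n; F, E⟯),
    P (fnField F E X) (fnSection ξ) = fnSection (DE.nabla X ξ)
  base_section : ∀ (f : SFun n M) (ξ : Cₛ^∞⟮𝓡 n; F, E⟯),
    P (fnBase F E f) (fnSection ξ) = 0
  field_field : ∀ X Y : VField n M, ∃ r : ∀ x, ExteriorAlgebra ℝ (E x),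
    IsCurvatureBivector g DE X Y r ∧
      ∀ x, (P (fnField F E X) (fnField F E Y)).1 x =
        (fnField F E (lieBracket X Y)).1 x + exteriorι n E x (r x)
  section_section : ∀ ξ η : Cₛ^∞⟮𝓡 n; F, E⟯,
    P (fnSection ξ) (fnSection η) = fnBase F E (g.pair ξ η)

/-! ### The isomorphism -/

section Iso

variable {FS : Type*} [NormedAddCommGroup FS] [NormedSpace ℝ FS]
  {S : M → Type*} [TopologicalSpace (TotalSpace FS S)] [∀ x, TopologicalSpace (S x)]
  [∀ x, AddCommGroup (S x)] [∀ x, Module ℝ (S x)]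
  [∀ x, IsTopologicalAddGroup (S x)] [∀ x, ContinuousSMul ℝ (S x)]
  [FiberBundle FS S] [VectorBundle ℝ FS S]
  [∀ x, Module ℂ (S x)] [∀ x, IsScalarTower ℝ ℂ (S x)] [IsComplexBundle n FS S]
  {g : PseudoMetric n F E}

/-- The linear isomorphism `Φ : Gr 𝒟(M, S) → 𝒪^ℂ(T^*[2]M ⊕ E[1])` preserves degrees, products and
brackets, where the bracket of the target is `P`. -/
structure IsPoissonIso (c : SpinorStructure FS S g) (hc : c.IsFiltration)
    (P : Fn n F E →ₗ[ℂ] Fn n F E →ₗ[ℂ] Fn n F E) (Φ : Gr c.filt ≃ₗ[ℂ] Fn n F E) : Prop where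
  degree : ∀ k : ℤ, (LinearMap.range (grClass c.filt k)).map
    (Φ : Gr c.filt →ₗ[ℂ] Fn n F E) = FnOfDegree n F E k
  map_mul : ∀ a b, Φ (hc.grMul a b) = Φ a * Φ b
  map_bracket : ∀ a b, Φ (hc.grBracket a b) = P (Φ a) (Φ b)

/-- The normalization of `Φ`: the class of `f` in degree `0` is sent to `f`, the class of
`γ(ξ) / √2` in degree `1` to `ξ`, and the class of `∇^S_X` in degree `2` to `X`. -/
structure HasSymbols (c : SpinorStructure FS S g) (DS : ComplexConnection n FS S)
    (Φ : Gr c.filt ≃ₗ[ℂ] Fn n F E) : Prop where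
  base : ∀ f : SFun n M, ∃ h : mulOp FS S f ∈ c.filt 0,
    Φ (grClass c.filt 0 ⟨mulOp FS S f, h⟩) = fnBase F E f
  fiber : ∀ ξ : Cₛ^∞⟮𝓡 n; F, E⟯,
    ∃ h : ((1 / Real.sqrt 2 : ℝ) : ℂ) • c.gamma ξ ∈ c.filt 1,
      Φ (grClass c.filt 1 ⟨((1 / Real.sqrt 2 : ℝ) : ℂ) • c.gamma ξ, h⟩) = fnSection ξ
  field : ∀ X : VField n M, ∃ h : DS.op X ∈ c.filt 2,
    Φ (grClass c.filt 2 ⟨DS.op X, h⟩) = fnField F E X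

end Iso

end PseudoEuclidean

end Geometry

end

end SpinorSymbol

open SpinorSymbol

/-! Give functions degree 0, sections of `E` degree 1 and covariant derivatives degree 2. A word of
degree `k` is a sum of products of total degree `k` in the operators `f`, `γ(ξ)/√2`, `∇_X`; write
`W_k` for the space of these. The commutation relations of a compatible pair show that the graded
commutator maps `W_k × W_l` to `W_{k+l-2}`. The Casimir sum `∑ γ(ξ_a) γ(η_a)` is a nonzero constant,
so `1` is a word of degree 2 and `W_{k-2} ⊆ W_k`.

The filtration is defined by iterated commutators, and the main point is that it equals `W_k +
W_{k-1}` (`SymbolData.IsParity.filt_eq`). The tool is an Euler identity: an operator built from the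
commutators of `T` with finitely many functions `f_j` and sections `ξ_a` is multiplication by `k` on
`W_k`, modulo `W_{k-2}` (`SymbolData.degreeOp_sub_mem`). So a word whose commutators all have lower
degree than expected has itself lower degree. On symbols the commutators become derivations and the
Euler identity is exact. Induction on `k` then shows that a word of degree `k` lies in the step `k -
1` of the filtration if and only if the same expression in the graded commutative algebra vanishes
(`SymbolData.IsParity.mem_filt_iff`). Hence the symbol is well defined and injective on the graded
space, and the Euler identity for symbols gives surjectivity (`SymbolData.deg_le_symbols`). The
Poisson laws are the symbols of identities in the associative algebra, and generators determine both
the bracket and the isomorphism.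

Three facts from geometry enter. There are finite global families `f_j`, `X_j`, `ξ_a`, `η_a` that
expand all vector fields and sections; this is an argument of Whitney type (`exists_separates`). An
operator that commutes with functions and whose commutator with `γ(v)` is `γ(δ v)`, with `δ` skew,
is `¼ ∑ γ(δ η_a) γ(ξ_a)` up to a scalar function (`SpinorStructure.exists_cMul_of_derivation`). This
computes the curvature of `∇^S` and the difference of two spinor connections; the scalar has degree
0 and is lost in degree 2, so that `∇^E` alone matters.

Finally, even and odd words meet only in zero. An Euler operator for the order reduces this to
operators of order zero, that is to a fibre. There the map `A ↦ ∑ γ(η_a) A γ(ξ_a)` has the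
eigenvalue `(-1)^k (r - 2k)` on words of length `k` modulo shorter ones (`CliffordFrame.cas_mem`),
and for even rank `r` the values for even `k` and for odd `k` are different. -/

namespace SpinorSymbol

noncomputable section

/-! ## Abstract symbol calculus -/

section AbstractCalculus

/-- The sign `(-1)^k`. -/
def sgn (k : ℤ) : ℂ := (-1 : ℂ) ^ k

theorem sgn_add (k l : ℤ) : sgn (k + l) = sgn k * sgn l := zpow_add₀ (by norm_num) k l

theorem sgn_of_even {k : ℤ} (h : Even k) : sgn k = 1 := h.neg_one_zpow

theorem sgn_of_odd {k : ℤ} (h : Odd k) : sgn k = -1 := h.neg_one_zpow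

@[simp] theorem sgn_zero : sgn 0 = 1 := by simp [sgn]

@[simp] theorem sgn_one : sgn 1 = -1 := by simp [sgn]

@[simp] theorem sgn_two : sgn 2 = 1 := sgn_of_even (by decide)

theorem sgn_mul_self (k : ℤ) : sgn k * sgn k = 1 := by
  rw [← sgn_add]; exact sgn_of_even ⟨k, rfl⟩

theorem sgn_congr {k l : ℤ} (h : Even (k - l)) : sgn k = sgn l := by
  have := sgn_add l (k - l)
  rwa [sgn_of_even h, mul_one, add_sub_cancel] at this

theorem sgn_cases (k : ℤ) : sgn k = 1 ∨ sgn k = -1 := by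
  rcases Int.even_or_odd k with h | h
  · exact Or.inl (sgn_of_even h)
  · exact Or.inr (sgn_of_odd h)

/-- An algebra `A` of operators with generators (complex functions `C`, real functions `R`,
sections `V` of a bundle with metric, vector fields `X`) obeying the commutation relations of a
compatible pair of connections, and an algebra `O` of symbols with derivations which model the
commutators with functions and sections. The finite families `fn`, `vf`, `ξ`, `η` generate. -/
structure SymbolData (A O C R V X ι κ : Type*) [Ring A] [Algebra ℂ A] [Ring O] [Algebra ℂ O]
    [CommRing C] [Algebra ℂ C] [Fintype ι] [Fintype κ] where
  cA : C →ₐ[ℂ] A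
  cO : C →ₐ[ℂ] O
  re : R → C
  sec : V → A
  fld : X → A
  secO : V → O
  fldO : X → O
  metric : V → V → R
  app : X → R → R
  conn : X → V → V
  brk : X → X → X
  smulV : R → V → V
  fn : ι → R
  vf : ι → X
  ξ : κ → V
  η : κ → V
  curvV : X → X → κ → V
  curvC : X → X → C
  ρ : ℂ
  cA_inj : Function.Injective cA
  cO_inj : Function.Injective cO
  c_decomp : ∀ c, ∃ f h, c = re f + Complex.I • re h
  c_sec : ∀ c v, cA c * sec v = sec v * cA c
  sec_sec : ∀ v w, sec v * sec w + sec w * sec v = cA (re (metric v w))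
  fld_c : ∀ Y f, fld Y * cA (re f) = cA (re f) * fld Y + cA (re (app Y f))
  fld_sec : ∀ Y v, fld Y * sec v = sec v * fld Y + sec (conn Y v)
  fld_fld : ∀ Y Z, fld Y * fld Z - fld Z * fld Y = fld (brk Y Z) +
    (cA (curvC Y Z) + (1 / 2 : ℂ) • ∑ a, sec (curvV Y Z a) * sec (ξ a))
  sec_smul : ∀ f v, sec (smulV f v) = cA (re f) * sec v
  fld_expand : ∀ Y, fld Y = ∑ j, cA (re (app Y (fn j))) * fld (vf j)
  sec_expand : ∀ v, sec v = ∑ a, cA (re (metric v (ξ a))) * sec (η a)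
  conn_expand : ∀ Y a, sec (conn Y (ξ a)) =
    ∑ j, cA (re (app Y (fn j))) * sec (conn (vf j) (ξ a))
  casimir : ∑ a, sec (ξ a) * sec (η a) = ρ • 1
  ρ_ne : ρ ≠ 0
  deg : ℤ → Submodule ℂ O
  deg_neg : ∀ k < 0, deg k = ⊥
  deg_zero : ∀ G ∈ deg 0, ∃ c, G = cO c
  cO_mem : ∀ c, cO c ∈ deg 0
  secO_mem : ∀ v, secO v ∈ deg 1
  fldO_mem : ∀ Y, fldO Y ∈ deg 2
  deg_mul : ∀ k l, ∀ G ∈ deg k, ∀ H ∈ deg l, G * H ∈ deg (k + l)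
  indep : iSupIndep deg
  iSup_deg : ⨆ k, deg k = ⊤
  dfn : R → O →ₗ[ℂ] O
  dsec : V → O →ₗ[ℂ] O
  dfn_mem : ∀ f k, ∀ G ∈ deg k, dfn f G ∈ deg (k - 2)
  dsec_mem : ∀ v k, ∀ G ∈ deg k, dsec v G ∈ deg (k - 1)
  dfn_mul : ∀ f G H, dfn f (G * H) = G * dfn f H + dfn f G * H
  dsec_mul : ∀ v l G, ∀ H ∈ deg l, dsec v (G * H) = G * dsec v H + sgn l • (dsec v G * H)
  dfn_c : ∀ f c, dfn f (cO c) = 0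
  dfn_sec : ∀ f v, dfn f (secO v) = 0
  dfn_fld : ∀ f Y, dfn f (fldO Y) = cO (re (app Y f))
  dsec_c : ∀ v c, dsec v (cO c) = 0
  dsec_sec : ∀ v w, dsec v (secO w) = cO (re (metric w v))
  dsec_fld : ∀ v Y, dsec v (fldO Y) = secO (conn Y v)
  -- The subtracted sum removes the part of `dsec (ξ a)` that differentiates vector fields, so the
  -- last sum counts only the factors from sections.
  euler : ∀ k, ∀ G ∈ deg k, (k : ℂ) • G = ∑ j, (2 : ℂ) • (dfn (fn j) G * fldO (vf j)) +
    ∑ a, (dsec (ξ a) G - ∑ j, dfn (fn j) G * secO (conn (vf j) (ξ a))) * secO (η a)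

namespace SymbolData

variable {A O C R V X ι κ : Type*} [Ring A] [Algebra ℂ A] [Ring O] [Algebra ℂ O]
    [CommRing C] [Algebra ℂ C] [Fintype ι] [Fintype κ] (S : SymbolData A O C R V X ι κ)

/-- Multiplication by a real function. -/
abbrev mulA (f : R) : A := S.cA (S.re f)

/-- `S.Sym m k T G`: the operator `T` is a sum of words of degree `k` in the generators with at
most `m` covariant derivatives, and `G` is the same expression in the algebra of symbols. -/
inductive Sym : ℤ → ℤ → A → O → Prop
  | zero (m k : ℤ) : Sym m k 0 0
  | fn (f : R) : Sym 0 0 (S.cA (S.re f)) (S.cO (S.re f))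
  | sec (v : V) : Sym 0 1 (S.sec v) (S.secO v)
  | fld (Y : X) : Sym 1 2 (S.fld Y) (S.fldO Y)
  | add {m k : ℤ} {T T' : A} {G G' : O} : Sym m k T G → Sym m k T' G' → Sym m k (T + T') (G + G')
  | smul {m k : ℤ} {T : A} {G : O} (c : ℂ) : Sym m k T G → Sym m k (c • T) (c • G)
  | mul {m k m' k' : ℤ} {T T' : A} {G G' : O} : Sym m k T G → Sym m' k' T' G' →
      Sym (m + m') (k + k') (T * T') (G * G')
  -- The order is only an upper bound. The degree has no such constructor, because `G` has to stay
  -- homogeneous of degree `k`.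
  | mono {m k : ℤ} {T : A} {G : O} : Sym m k T G → Sym (m + 1) k T G

variable {S}

theorem Sym.mono_le {m m' k : ℤ} {T : A} {G : O} (h : S.Sym m k T G) (hm : m ≤ m') :
    S.Sym m' k T G := by
  obtain ⟨d, rfl⟩ := Int.le.dest hm
  clear hm
  induction d with
  | zero => simpa using h
  | succ d ih => simpa [add_assoc] using ih.mono

theorem Sym.neg {m k : ℤ} {T : A} {G : O} (h : S.Sym m k T G) : S.Sym m k (-T) (-G) := by
  simpa using h.smul (-1)

theorem Sym.sub {m k : ℤ} {T T' : A} {G G' : O} (h : S.Sym m k T G) (h' : S.Sym m k T' G') :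
    S.Sym m k (T - T') (G - G') := by
  simpa [sub_eq_add_neg] using h.add h'.neg

theorem Sym.cast {m k m' k' : ℤ} {T T' : A} {G G' : O} (h : S.Sym m k T G) (hm : m = m')
    (hk : k = k') (hT : T = T') (hG : G = G') : S.Sym m' k' T' G' := by
  subst hm hk hT hG; exact h

theorem Sym.sum {m k : ℤ} {α : Type*} (s : Finset α) {T : α → A} {G : α → O}
    (h : ∀ a ∈ s, S.Sym m k (T a) (G a)) : S.Sym m k (∑ a ∈ s, T a) (∑ a ∈ s, G a) := by
  classical
  induction s using Finset.induction_on with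
  | empty => simpa using Sym.zero m k
  | insert a s ha ih =>
    rw [Finset.sum_insert ha, Finset.sum_insert ha]
    exact (h a (by simp)).add (ih fun b hb => h b (by simp [hb]))

theorem Sym.const (c : C) : S.Sym 0 0 (S.cA c) (S.cO c) := by
  obtain ⟨f, h, rfl⟩ := S.c_decomp c
  simp only [map_add, map_smul]
  exact (Sym.fn f).add ((Sym.fn h).smul _)

theorem Sym.one : S.Sym 0 0 (1 : A) (1 : O) := by
  simpa using Sym.const (S := S) 1

/-- All generators have degree at least 0, so in a nonzero product of degree 0 both factors have
degree 0. Inductions on the degree start here. -/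
theorem Sym.base {m k : ℤ} {T : A} {G : O} (h : S.Sym m k T G) :
    (k < 0 → T = 0 ∧ G = 0) ∧ (k = 0 → ∃ c, T = S.cA c ∧ G = S.cO c) := by
  induction h with
  | zero m k => exact ⟨fun _ => ⟨rfl, rfl⟩, fun _ => ⟨0, by simp, by simp⟩⟩
  | fn f => exact ⟨fun h => absurd h (by norm_num), fun _ => ⟨_, rfl, rfl⟩⟩
  | sec v => exact ⟨fun h => absurd h (by norm_num), fun h => absurd h (by norm_num)⟩
  | fld Y => exact ⟨fun h => absurd h (by norm_num), fun h => absurd h (by norm_num)⟩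
  | add _ _ ih ih' =>
    refine ⟨fun h => by simp [ih.1 h, ih'.1 h], fun h => ?_⟩
    obtain ⟨c, rfl, rfl⟩ := ih.2 h
    obtain ⟨c', rfl, rfl⟩ := ih'.2 h
    exact ⟨c + c', by simp, by simp⟩
  | smul r _ ih =>
    refine ⟨fun h => by simp [ih.1 h], fun h => ?_⟩
    obtain ⟨c, rfl, rfl⟩ := ih.2 h
    exact ⟨r • c, by simp, by simp⟩
  | @mul m k m' k' T T' G G' _ _ ih ih' =>
    rcases lt_or_ge k 0 with hk | hk
    · refine ⟨fun _ => by simp [ih.1 hk], fun _ => ⟨0, by simp [ih.1 hk]⟩⟩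
    rcases lt_or_ge k' 0 with hk' | hk'
    · refine ⟨fun _ => by simp [ih'.1 hk'], fun _ => ⟨0, by simp [ih'.1 hk']⟩⟩
    refine ⟨fun h => absurd h (by omega), fun h => ?_⟩
    obtain ⟨c, rfl, rfl⟩ := ih.2 (by omega)
    obtain ⟨c', rfl, rfl⟩ := ih'.2 (by omega)
    exact ⟨c * c', by simp, by simp⟩
  | mono _ ih => exact ih

theorem Sym.order_neg {m k : ℤ} {T : A} {G : O} (h : S.Sym m k T G) : m < 0 → T = 0 ∧ G = 0 := by
  induction h with
  | zero m k => exact fun _ => ⟨rfl, rfl⟩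
  | fn f => exact fun h => absurd h (by norm_num)
  | sec v => exact fun h => absurd h (by norm_num)
  | fld Y => exact fun h => absurd h (by norm_num)
  | add _ _ ih ih' => exact fun h => by simp [ih h, ih' h]
  | smul r _ ih => exact fun h => by simp [ih h]
  | @mul m k m' k' T T' G G' _ _ ih ih' =>
    intro h
    rcases lt_or_ge m 0 with hk | hk
    · simp [ih hk]
    · simp [ih' (by omega)]
  | mono _ ih => exact fun h => ih (by omega)

theorem Sym.mem_deg {m k : ℤ} {T : A} {G : O} (h : S.Sym m k T G) : G ∈ S.deg k := by
  induction h with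
  | zero m k => exact zero_mem _
  | fn f => exact S.cO_mem _
  | sec v => exact S.secO_mem v
  | fld Y => exact S.fldO_mem Y
  | add _ _ ih ih' => exact add_mem ih ih'
  | smul r _ ih => exact Submodule.smul_mem _ _ ih
  | mul _ _ ih ih' => exact S.deg_mul _ _ _ ih _ ih'
  | mono _ ih => exact ih

/-- Commutation with `f` and `S.dfn f` are both derivations and they correspond on generators, so
they correspond on all words. -/
theorem Sym.comm_fn {m k : ℤ} {T : A} {G : O} (h : S.Sym m k T G) (f : R) :
    S.Sym (m - 1) (k - 2) (T * S.mulA f - S.mulA f * T) (S.dfn f G) := by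
  induction h with
  | zero m k => simpa using Sym.zero (m - 1) (k - 2)
  | fn g =>
    refine (Sym.zero _ _).cast rfl rfl ?_ (S.dfn_c f _).symm
    rw [← map_mul, ← map_mul, mul_comm, sub_self]
  | sec v =>
    refine (Sym.zero _ _).cast rfl rfl ?_ (S.dfn_sec f _).symm
    rw [S.c_sec, sub_self]
  | fld Y =>
    refine (Sym.fn (S.app Y f)).cast rfl rfl ?_ (S.dfn_fld f _).symm
    rw [S.fld_c, add_sub_cancel_left]
  | add _ _ ih ih' =>
    refine (ih.add ih').cast rfl rfl ?_ (by simp)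
    noncomm_ring
  | smul r _ ih =>
    refine (ih.smul r).cast rfl rfl ?_ (by simp)
    simp [smul_sub]
  | @mul m k m' k' T T' G G' h1 h2 ih ih' =>
    refine ((h1.mul ih').cast (by ring) (by ring) rfl rfl).add
      ((ih.mul h2).cast (by ring) (by ring) rfl rfl) |>.cast (k' := k + k' - 2)
        (m' := m + m' - 1) rfl rfl ?_ (S.dfn_mul f _ _).symm
    noncomm_ring
  | mono h1 ih => simpa using ih.mono_le (m' := _) (by omega)

/-- The same comparison for graded derivations. The sign in `S.dsec_mul` comes from carrying `v`,
which stands on the right, across the second factor. -/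
theorem Sym.comm_sec {m k : ℤ} {T : A} {G : O} (h : S.Sym m k T G) (v : V) :
    S.Sym m (k - 1) (T * S.sec v - sgn k • (S.sec v * T)) (S.dsec v G) := by
  induction h with
  | zero m k => simpa using Sym.zero m (k - 1)
  | fn g =>
    refine (Sym.zero _ _).cast rfl rfl ?_ (S.dsec_c v _).symm
    rw [S.c_sec]; simp
  | sec w =>
    refine (Sym.fn (S.metric w v)).cast rfl rfl ?_ (S.dsec_sec v _).symm
    rw [← S.sec_sec]; simp
  | fld Y =>
    refine (Sym.sec (S.conn Y v)).mono.cast rfl rfl ?_ (S.dsec_fld v _).symm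
    rw [S.fld_sec]; simp
  | add _ _ ih ih' =>
    refine (ih.add ih').cast rfl rfl ?_ (by simp)
    simp only [add_mul, mul_add, smul_add]; abel
  | smul r _ ih =>
    refine (ih.smul r).cast rfl rfl ?_ (by simp)
    simp [smul_sub, smul_comm r]
  | @mul m k m' k' T T' G G' h1 h2 ih ih' =>
    refine ((h1.mul ih').cast rfl (by ring) rfl rfl).add
      (((ih.mul h2).smul (sgn k')).cast rfl (by ring) rfl rfl) |>.cast (k' := k + k' - 1)
        (m' := m + m') rfl rfl ?_ (S.dsec_mul v _ _ _ h2.mem_deg).symm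
    rw [sgn_add]
    rcases sgn_cases k with h | h <;> rcases sgn_cases k' with h' | h' <;> simp only [h, h'] <;>
      simp <;> noncomm_ring
  | mono h1 ih => exact ih.mono

/-- The Casimir relation presents `1` as a word of degree 2, so multiplication by `1` raises the
degree by 2 and keeps the operator. The expression `G'` is not the old symbol. -/
theorem Sym.sub_two {m k : ℤ} {T : A} {G : O} (h : S.Sym m (k - 2) T G) :
    ∃ G', S.Sym m k T G' := by
  have h1 : S.Sym 0 2 (1 : A) (S.ρ⁻¹ • ∑ a, S.secO (S.ξ a) * S.secO (S.η a)) := by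
    refine ((Sym.sum Finset.univ fun a _ => (Sym.sec (S.ξ a)).mul (Sym.sec (S.η a))).smul
      S.ρ⁻¹).cast rfl rfl ?_ rfl
    rw [S.casimir, smul_smul, inv_mul_cancel₀ S.ρ_ne, one_smul]
  exact ⟨_, (h.mul h1).cast (by simp) (by ring) (mul_one T) rfl⟩

variable (S) in
/-- The operators which are sums of words of degree `k`. -/
def words (k : ℤ) : Submodule ℂ A where
  carrier := {T | ∃ m G, S.Sym m k T G}
  zero_mem' := ⟨0, 0, Sym.zero _ _⟩
  add_mem' := by
    rintro T T' ⟨m, G, h⟩ ⟨m', G', h'⟩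
    exact ⟨max m m', _, (h.mono_le (le_max_left _ _)).add (h'.mono_le (le_max_right _ _))⟩
  smul_mem' := by
    rintro c T ⟨m, G, h⟩
    exact ⟨m, _, h.smul c⟩

theorem Sym.mem_words {m k : ℤ} {T : A} {G : O} (h : S.Sym m k T G) : T ∈ S.words k := ⟨m, G, h⟩

theorem words_mul {k l : ℤ} {T T' : A} (h : T ∈ S.words k) (h' : T' ∈ S.words l) :
    T * T' ∈ S.words (k + l) := by
  obtain ⟨m, G, h⟩ := h
  obtain ⟨m', G', h'⟩ := h'
  exact ⟨_, _, h.mul h'⟩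

theorem words_sub_two_le (k : ℤ) : S.words (k - 2) ≤ S.words k := by
  rintro T ⟨m, G, h⟩
  exact ⟨m, h.sub_two⟩

theorem words_le {k l : ℤ} (h : k ≤ l) (h' : Even (l - k)) : S.words k ≤ S.words l := by
  obtain ⟨d, hd⟩ := h'
  obtain ⟨e, rfl⟩ : ∃ e : ℕ, d = e := ⟨d.toNat, by omega⟩
  obtain rfl : l = k + 2 * e := by omega
  clear hd h
  induction e with
  | zero => simp
  | succ e ih =>
    refine ih.trans ?_
    convert words_sub_two_le (S := S) (k + 2 * ((e + 1 : ℕ) : ℤ)) using 2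
    push_cast; ring

theorem words_of_neg {k : ℤ} (hk : k < 0) : S.words k = ⊥ := by
  rw [eq_bot_iff]
  rintro T ⟨m, G, h⟩
  exact (h.base.1 hk).1

theorem words_cast {k l : ℤ} {T : A} (h : T ∈ S.words k) (hk : k = l) : T ∈ S.words l := hk ▸ h

theorem sec_mem (v : V) : S.sec v ∈ S.words 1 := (Sym.sec v).mem_words

theorem fld_mem (Y : X) : S.fld Y ∈ S.words 2 := (Sym.fld Y).mem_words

theorem const_mem (c : C) : S.cA c ∈ S.words 0 := (Sym.const c).mem_words

theorem one_mem_words : (1 : A) ∈ S.words 0 := Sym.one.mem_words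

theorem words_comm_fn {k : ℤ} {T : A} (h : T ∈ S.words k) (f : R) :
    T * S.mulA f - S.mulA f * T ∈ S.words (k - 2) := by
  obtain ⟨m, G, h⟩ := h
  exact (h.comm_fn f).mem_words

theorem words_comm_sec {k : ℤ} {T : A} (h : T ∈ S.words k) (v : V) :
    T * S.sec v - sgn k • (S.sec v * T) ∈ S.words (k - 1) := by
  obtain ⟨m, G, h⟩ := h
  exact (h.comm_sec v).mem_words

theorem Sym.comm_fld {m k : ℤ} {T : A} {G : O} (h : S.Sym m k T G) (Y : X) :
    ∃ G', S.Sym m k (T * S.fld Y - S.fld Y * T) G' := by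
  induction h with
  | zero m k => exact ⟨0, by simpa using Sym.zero m k⟩
  | fn g =>
    refine ⟨_, (Sym.fn (S.app Y g)).neg.cast rfl rfl ?_ rfl⟩
    rw [S.fld_c]; abel
  | sec w =>
    refine ⟨_, (Sym.sec (S.conn Y w)).neg.cast rfl rfl ?_ rfl⟩
    rw [S.fld_sec]; abel
  | fld Z =>
    -- The scalar part of the curvature has degree 0; it is rewritten in degree 2 in order to be
    -- added to the other terms.
    obtain ⟨G', hG⟩ := (Sym.sub_two (k := 2) ((Sym.const (S.curvC Z Y)).cast rfl (by norm_num) rfl rfl) :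
      ∃ G', S.Sym 0 2 _ G')
    refine ⟨_, ((Sym.fld (S.brk Z Y)).add (hG.add ((Sym.sum Finset.univ fun a _ =>
      (Sym.sec (S.curvV Z Y a)).mul (Sym.sec (S.ξ a))).smul (1 / 2))).mono).cast rfl rfl ?_ rfl⟩
    rw [S.fld_fld]
  | add _ _ ih ih' =>
    obtain ⟨G, h⟩ := ih
    obtain ⟨G', h'⟩ := ih'
    refine ⟨_, (h.add h').cast rfl rfl ?_ rfl⟩
    noncomm_ring
  | smul r _ ih =>
    obtain ⟨G, h⟩ := ih
    refine ⟨_, (h.smul r).cast rfl rfl ?_ rfl⟩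
    simp [smul_sub]
  | mul h1 h2 ih ih' =>
    obtain ⟨G, h⟩ := ih
    obtain ⟨G', h'⟩ := ih'
    refine ⟨_, ((h1.mul h').add (h.mul h2)).cast rfl rfl ?_ rfl⟩
    noncomm_ring
  | mono _ ih =>
    obtain ⟨G, h⟩ := ih
    exact ⟨G, h.mono⟩

theorem words_comm_fld {k : ℤ} {T : A} (h : T ∈ S.words k) (Y : X) :
    T * S.fld Y - S.fld Y * T ∈ S.words k := by
  obtain ⟨m, G, h⟩ := h
  obtain ⟨G', h⟩ := h.comm_fld Y
  exact h.mem_words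

/-- Induction on the second factor by the graded Leibniz rule. Commutators with `f`, `v`, `Y` lower
the degree by 2, 1, 0, while these generators have degree 0, 1, 2, so the total always drops by 2.
-/
theorem words_comm {k l : ℤ} {T T' : A} (h : T ∈ S.words k) (h' : T' ∈ S.words l) :
    T * T' - sgn (k * l) • (T' * T) ∈ S.words (k + l - 2) := by
  obtain ⟨m, G, h'⟩ := h'
  induction h' with
  | zero m l => simp
  | fn f => simpa using words_comm_fn h f
  | sec v => simpa using words_cast (words_comm_sec h v) (by ring)
  | fld Y =>
    rw [sgn_of_even ⟨k, by ring⟩]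
    simpa using words_comm_fld h Y
  | @add m l T₁ T₂ G₁ G₂ _ _ ih ih' =>
    convert add_mem ih ih' using 1
    simp only [add_mul, mul_add, smul_add]; abel
  | smul r _ ih =>
    convert Submodule.smul_mem _ r ih using 1
    simp [smul_sub, smul_comm r]
  | @mul m l m' l' T₁ T₂ G₁ G₂ h1 h2 ih ih' =>
    have e1 := words_cast (words_mul ih h2.mem_words) (by ring : _ = k + (l + l') - 2)
    have e2 := words_cast (words_mul h1.mem_words ih') (by ring : _ = k + (l + l') - 2)
    convert add_mem e1 (Submodule.smul_mem _ (sgn (k * l)) e2) using 1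
    rw [mul_add, sgn_add]
    rcases sgn_cases (k * l) with h | h <;> rcases sgn_cases (k * l') with h' | h' <;>
      simp only [h, h'] <;> simp <;> noncomm_ring
  | mono _ ih => exact ih

end SymbolData


namespace SymbolData

variable {A O C R V X ι κ : Type*} [Ring A] [Algebra ℂ A] [Ring O] [Algebra ℂ O]
    [CommRing C] [Algebra ℂ C] [Fintype ι] [Fintype κ] {S : SymbolData A O C R V X ι κ}

/-! ### The order operator and the degree operator -/

variable (S) in
/-- The operator `T ↦ ∑ⱼ [T, fⱼ] ∇_{Xⱼ}`, which is multiplication by the order up to terms of lower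
order. -/
def orderOp (T : A) : A := ∑ j, (T * S.mulA (S.fn j) - S.mulA (S.fn j) * T) * S.fld (S.vf j)

/-- The defect from a derivation pairs a commutator with `f_j`, which lowers the order, with a
commutator with `∇`, which does not raise it. -/
theorem orderOp_mul (T T' : A) : S.orderOp (T * T') = T * S.orderOp T' + S.orderOp T * T' +
    ∑ j, (T * S.mulA (S.fn j) - S.mulA (S.fn j) * T) *
      (T' * S.fld (S.vf j) - S.fld (S.vf j) * T') := by
  simp only [orderOp, Finset.mul_sum, Finset.sum_mul, ← Finset.sum_add_distrib]
  refine Finset.sum_congr rfl fun j _ => ?_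
  noncomm_ring

theorem orderOp_add (T T' : A) : S.orderOp (T + T') = S.orderOp T + S.orderOp T' := by
  simp only [orderOp, ← Finset.sum_add_distrib]
  refine Finset.sum_congr rfl fun j _ => ?_
  noncomm_ring

theorem orderOp_smul (c : ℂ) (T : A) : S.orderOp (c • T) = c • S.orderOp T := by
  simp only [orderOp, Finset.smul_sum]
  refine Finset.sum_congr rfl fun j _ => ?_
  simp [smul_sub, sub_mul]

theorem orderOp_sec (v : V) : S.orderOp (S.sec v) = 0 := by
  simp [orderOp, S.c_sec]

theorem orderOp_const (c : C) : S.orderOp (S.cA c) = 0 := by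
  refine Finset.sum_eq_zero fun j _ => ?_
  rw [← map_mul, ← map_mul, mul_comm, sub_self, zero_mul]

theorem orderOp_fld (Y : X) : S.orderOp (S.fld Y) = S.fld Y := by
  conv_rhs => rw [S.fld_expand]
  simp [orderOp, S.fld_c]

/-- On functions and sections `orderOp` vanishes, on covariant derivatives it is the identity, and
it is a derivation modulo lower order. So it multiplies by the order, modulo lower order. -/
theorem Sym.order_euler {m k : ℤ} {T : A} {G : O} (h : S.Sym m k T G) :
    ∃ G', S.Sym (m - 1) k ((m : ℂ) • T - S.orderOp T) G' := by
  induction h with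
  | zero m k => exact ⟨0, by simpa [orderOp] using Sym.zero (m - 1) k⟩
  | fn g => exact ⟨0, by simpa [orderOp_const] using Sym.zero (0 - 1) 0⟩
  | sec w => exact ⟨0, by simpa [orderOp_sec] using Sym.zero (0 - 1) 1⟩
  | fld Z => exact ⟨0, by simpa [orderOp_fld] using Sym.zero (1 - 1) 2⟩
  | add _ _ ih ih' =>
    obtain ⟨G, h⟩ := ih
    obtain ⟨G', h'⟩ := ih'
    refine ⟨_, (h.add h').cast rfl rfl ?_ rfl⟩
    rw [orderOp_add, smul_add]; abel
  | smul r _ ih =>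
    obtain ⟨G, h⟩ := ih
    refine ⟨_, (h.smul r).cast rfl rfl ?_ rfl⟩
    rw [orderOp_smul, smul_sub, smul_comm]
  | @mul m k m' k' T T' _ _ h1 h2 ih ih' =>
    obtain ⟨G, h⟩ := ih
    obtain ⟨G', h'⟩ := ih'
    have h3 : ∀ j, ∃ G, S.Sym (m + m' - 1) (k + k') ((T * S.mulA (S.fn j) - S.mulA (S.fn j) * T) *
      (T' * S.fld (S.vf j) - S.fld (S.vf j) * T')) G := fun j => by
        obtain ⟨G₂, h4⟩ := h2.comm_fld (S.vf j)
        -- The defect has degree two less than the product; `sub_two` restores the common degree `k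
        -- + k'`, so that only the order drops.
        exact (((h1.comm_fn (S.fn j)).mul h4).cast (by ring) (by ring) rfl rfl :
          S.Sym (m + m' - 1) (k + k' - 2) _ _).sub_two
    choose G₃ h3 using h3
    refine ⟨_, (((h1.mul h').cast (m' := m + m' - 1) (by ring) rfl rfl rfl).add ((h.mul h2).cast
      (by ring) rfl rfl rfl) |>.sub (Sym.sum Finset.univ fun j _ => h3 j)).cast rfl rfl ?_ rfl⟩
    rw [orderOp_mul]
    simp only [mul_sub, sub_mul, mul_smul_comm, smul_mul_assoc, Int.cast_add, add_smul]
    abel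
  | @mono m k T _ h1 ih =>
    obtain ⟨G, h⟩ := ih
    refine ⟨_, ((h.mono.cast (by ring) rfl rfl rfl).add h1).cast (by ring) rfl ?_ rfl⟩
    push_cast
    module

/-- Induction on the order. The commutators with the `f_j` have smaller order and both parities, so
they vanish and `orderOp T = 0`. Then `Sym.order_euler` says that a nonzero multiple of `T` has
smaller order, in both parities. -/
theorem Sym.eq_zero_of_even_of_odd
    (hS : ∀ {k l T G G'}, Even k → Odd l → S.Sym 0 k T G → S.Sym 0 l T G' → T = 0)
    (m : ℕ) {k l : ℤ} (hk : Even k) (hl : Odd l) {T : A} {G G' : O} (h : S.Sym m k T G)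
    (h' : S.Sym m l T G') : T = 0 := by
  induction m generalizing k l T G G' with
  | zero => exact hS hk hl (by simpa using h) (by simpa using h')
  | succ m ih =>
    have h0 : S.orderOp T = 0 := by
      refine Finset.sum_eq_zero fun j _ => ?_
      rw [ih (k := k - 2) (l := l - 2) (hk.sub (by decide)) (hl.sub_even (by decide))
        ((h.comm_fn (S.fn j)).cast (by push_cast; ring) rfl rfl rfl)
        ((h'.comm_fn (S.fn j)).cast (by push_cast; ring) rfl rfl rfl), zero_mul]
    obtain ⟨G₁, h1⟩ := h.order_euler
    obtain ⟨G₂, h2⟩ := h'.order_euler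
    rw [h0, sub_zero] at h1 h2
    have := ih hk hl (h1.cast (by push_cast; ring) rfl rfl rfl)
      (h2.cast (by push_cast; ring) rfl rfl rfl)
    refine (smul_eq_zero.1 this).resolve_left ?_
    push_cast
    exact_mod_cast Nat.succ_ne_zero m

theorem words_disjoint
    (hS : ∀ {k l T G G'}, Even k → Odd l → S.Sym 0 k T G → S.Sym 0 l T G' → T = 0)
    {k l : ℤ} (hk : Even k) (hl : Odd l) {T : A} (h : T ∈ S.words k) (h' : T ∈ S.words l) :
    T = 0 := by
  obtain ⟨m, G, h⟩ := h
  obtain ⟨m', G', h'⟩ := h'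
  obtain ⟨N, h1, h2⟩ : ∃ N : ℕ, m ≤ N ∧ m' ≤ N := ⟨(max m m').toNat, by omega, by omega⟩
  exact Sym.eq_zero_of_even_of_odd hS N hk hl (h.mono_le h1) (h'.mono_le h2)

variable (S) in
/-- The correction of the commutator with `ξ a` by the connection. -/
def connTerm (T : A) (a : κ) : A :=
  ∑ j, (T * S.mulA (S.fn j) - S.mulA (S.fn j) * T) * S.sec (S.conn (S.vf j) (S.ξ a))

theorem connTerm_add (T T' : A) (a : κ) :
    S.connTerm (T + T') a = S.connTerm T a + S.connTerm T' a := by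
  simp only [connTerm, ← Finset.sum_add_distrib]
  refine Finset.sum_congr rfl fun j _ => ?_
  noncomm_ring

theorem connTerm_smul (c : ℂ) (T : A) (a : κ) : S.connTerm (c • T) a = c • S.connTerm T a := by
  simp only [connTerm, Finset.smul_sum]
  refine Finset.sum_congr rfl fun j _ => ?_
  simp [smul_sub, sub_mul]

variable (S) in
/-- The error term in the product rule for `connTerm`. -/
def connError (T T' : A) (a : κ) : A := ∑ j, (T * S.mulA (S.fn j) - S.mulA (S.fn j) * T) *
  (T' * (S.sec (S.conn (S.vf j) (S.ξ a)) * S.sec (S.η a)) -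
    (S.sec (S.conn (S.vf j) (S.ξ a)) * S.sec (S.η a)) * T')

theorem connTerm_mul (T T' : A) (a : κ) : S.connTerm (T * T') a * S.sec (S.η a) =
    T * (S.connTerm T' a * S.sec (S.η a)) + (S.connTerm T a * S.sec (S.η a)) * T' +
      S.connError T T' a := by
  simp only [connTerm, connError, Finset.mul_sum, Finset.sum_mul, ← Finset.sum_add_distrib]
  refine Finset.sum_congr rfl fun j _ => ?_
  noncomm_ring

variable (S) in
/-- The covariant contraction of an operator of degree `k` with `ξ a`. -/
def contr (k : ℤ) (T : A) (a : κ) : A :=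
  T * S.sec (S.ξ a) - sgn k • (S.sec (S.ξ a) * T) - S.connTerm T a

variable (S) in
/-- The operator which is multiplication by `k` on operators of degree `k`, up to terms of lower
degree. -/
def degreeOp (k : ℤ) (T : A) : A := (2 : ℂ) • S.orderOp T + ∑ a, S.contr k T a * S.sec (S.η a)

theorem degreeOp_add (k : ℤ) (T T' : A) :
    S.degreeOp k (T + T') = S.degreeOp k T + S.degreeOp k T' := by
  have h : ∀ a, S.contr k (T + T') a * S.sec (S.η a) = S.contr k T a * S.sec (S.η a) +
      S.contr k T' a * S.sec (S.η a) := fun a => by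
    rw [← add_mul]
    congr 1
    simp only [contr, connTerm_add, add_mul, mul_add, smul_add]
    abel
  simp only [degreeOp, orderOp_add, h, Finset.sum_add_distrib, smul_add]
  abel

theorem degreeOp_smul (k : ℤ) (c : ℂ) (T : A) :
    S.degreeOp k (c • T) = c • S.degreeOp k T := by
  have h : ∀ a, S.contr k (c • T) a = c • S.contr k T a := fun a => by
    simp only [contr, smul_mul_assoc, mul_smul_comm, smul_sub, connTerm_smul, smul_comm c]
  simp only [degreeOp, orderOp_smul, h, smul_add, Finset.smul_sum, smul_mul_assoc, smul_comm c]

variable (S) in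
/-- The error term in the product rule for `degreeOp`. -/
def degreeError (k k' : ℤ) (T T' : A) : A :=
  (2 : ℂ) • ∑ j, (T * S.mulA (S.fn j) - S.mulA (S.fn j) * T) *
      (T' * S.fld (S.vf j) - S.fld (S.vf j) * T') +
    ∑ a, (sgn k' • ((T * S.sec (S.ξ a) - sgn k • (S.sec (S.ξ a) * T)) *
      (T' * S.sec (S.η a) - sgn k' • (S.sec (S.η a) * T'))) - S.connError T T' a)

theorem degreeOp_mul (k k' : ℤ) (T T' : A) : S.degreeOp (k + k') (T * T') =
    T * S.degreeOp k' T' + S.degreeOp k T * T' + S.degreeError k k' T T' := by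
  have h : ∀ a, S.contr (k + k') (T * T') a * S.sec (S.η a) =
      T * (S.contr k' T' a * S.sec (S.η a)) + (S.contr k T a * S.sec (S.η a)) * T' +
      (sgn k' • ((T * S.sec (S.ξ a) - sgn k • (S.sec (S.ξ a) * T)) *
      (T' * S.sec (S.η a) - sgn k' • (S.sec (S.η a) * T'))) - S.connError T T' a) := fun a => by
    rw [contr, contr, contr, sub_mul _ (S.connTerm _ a), connTerm_mul, sgn_add]
    rcases sgn_cases k with h | h <;> rcases sgn_cases k' with h' | h' <;>
      simp only [h, h'] <;> simp <;> noncomm_ring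
  simp only [degreeOp, degreeError, h, Finset.sum_add_distrib, orderOp_mul, smul_add]
  simp only [mul_add, add_mul, Finset.mul_sum, Finset.sum_mul, mul_smul_comm, smul_mul_assoc]
  abel

/-- The losses of degree in the two factors are `2 + 0` in the terms with `∇` and in `connError`,
and `1 + 1` in the terms with two contractions. The last line of the proof uses that a product of
two sections has degree 2. -/
theorem degreeError_mem {k k' : ℤ} {T T' : A} (h1 : T ∈ S.words k) (h2 : T' ∈ S.words k') :
    S.degreeError k k' T T' ∈ S.words (k + k' - 2) := by
  have e3 : ∀ j Q, Q ∈ S.words k' → (T * S.mulA (S.fn j) - S.mulA (S.fn j) * T) * Q ∈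
      S.words (k + k' - 2) := fun j Q hQ => words_cast (words_mul (words_comm_fn h1 _) hQ) (by ring)
  refine add_mem (Submodule.smul_mem _ _ (Submodule.sum_mem _ fun j _ =>
    e3 j _ (words_comm_fld h2 _))) (Submodule.sum_mem _ fun a _ => sub_mem
    (Submodule.smul_mem _ _ (words_cast (words_mul (words_comm_sec h1 _) (words_comm_sec h2 _))
    (by ring))) (Submodule.sum_mem _ fun j _ => e3 j _ ?_))
  have := words_comm h2 (words_mul (sec_mem (S.conn (S.vf j) (S.ξ a))) (sec_mem (S.η a)))
  rw [sgn_of_even ⟨k', by ring⟩, one_smul] at this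
  exact words_cast this (by ring)

/-- On generators `degreeOp` is exactly multiplication by 0, 1, 2: `orderOp` counts covariant
derivatives, and `contr` ignores them because `connTerm` cancels `[∇_Y, ξ_a] = ∇_Y ξ_a`. The product
rule holds up to an error two degrees lower. -/
theorem degreeOp_sub_mem {k : ℤ} {T : A} (h : T ∈ S.words k) :
    (k : ℂ) • T - S.degreeOp k T ∈ S.words (k - 2) := by
  obtain ⟨m, G, h⟩ := h
  induction h with
  | zero m k => simp [degreeOp, orderOp, contr, connTerm]
  | fn g =>
    have : S.degreeOp 0 (S.cA (S.re g)) = 0 := by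
      have h : ∀ j, S.cA (S.re g) * S.mulA (S.fn j) - S.mulA (S.fn j) * S.cA (S.re g) = 0 :=
        fun j => by rw [← map_mul, ← map_mul, mul_comm, sub_self]
      simp [degreeOp, orderOp_const, contr, connTerm, S.c_sec, h]
    simp [this]
  | sec w =>
    have : S.degreeOp 1 (S.sec w) = S.sec w := by
      conv_rhs => rw [S.sec_expand]
      simp [degreeOp, orderOp_sec, contr, connTerm, S.c_sec, S.sec_sec]
    simp [this]
  | fld Z =>
    have : S.degreeOp 2 (S.fld Z) = (2 : ℂ) • S.fld Z := by
      simp [degreeOp, orderOp_fld, contr, connTerm, S.fld_sec, S.fld_c, ← S.conn_expand]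
    simp [this]
  | @add m l T₁ T₂ G₁ G₂ _ _ ih ih' =>
    convert add_mem ih ih' using 1
    rw [degreeOp_add, smul_add]; abel
  | smul r _ ih =>
    convert Submodule.smul_mem _ r ih using 1
    rw [degreeOp_smul, smul_sub, smul_comm]
  | @mul m k m' k' T T' _ _ h1 h2 ih ih' =>
    have e1 := words_cast (words_mul ih h2.mem_words) (by ring : _ = k + k' - 2)
    have e2 := words_cast (words_mul h1.mem_words ih') (by ring : _ = k + k' - 2)
    convert sub_mem (add_mem e1 e2) (degreeError_mem h1.mem_words h2.mem_words) using 1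
    rw [degreeOp_mul]
    simp only [mul_sub, sub_mul, mul_smul_comm, smul_mul_assoc, Int.cast_add, add_smul]
    abel
  | mono _ ih => exact ih

end SymbolData


/-! ### The commutator filtration -/

theorem commFiltrationAux_mono {A : Type*} [Ring A] [Algebra ℂ A] (D : Subalgebra ℂ A)
    (br : A →ₗ[ℂ] A →ₗ[ℂ] A) (G : Set A) : Monotone (commFiltrationAux D br G) := by
  refine monotone_nat_of_le_succ fun k => ?_
  induction k with
  | zero => exact bot_le
  | succ k ih =>
    rw [commFiltrationAux, commFiltrationAux]
    exact inf_le_inf_left _ (iInf₂_mono fun x _ => Submodule.comap_mono ih)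

theorem commFiltration_mono {A : Type*} [Ring A] [Algebra ℂ A] (D : Subalgebra ℂ A)
    (br : A →ₗ[ℂ] A →ₗ[ℂ] A) (G : Set A) : Monotone (commFiltration D br G) :=
  fun _ _ h => commFiltrationAux_mono D br G (by omega)

/-- Project along a complement of `p` that contains `q`. This is the projection that
`superCommutator_apply` asks for. -/
theorem exists_proj_of_disjoint {A : Type*} [AddCommGroup A] [Module ℂ A] {p q : Submodule ℂ A}
    (h : Disjoint p q) : ∃ f : A →ₗ[ℂ] A, (∀ a ∈ p, f a = a) ∧ ∀ a ∈ q, f a = 0 := by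
  obtain ⟨r, hr, hc⟩ := h.symm.exists_isCompl
  exact ⟨Submodule.projection p r hc.symm, fun a ha => Submodule.projection_apply_left hc.symm ⟨a, ha⟩,
    fun a ha => (Submodule.projection_apply_eq_zero_iff hc.symm).2 (hr ha)⟩

namespace SymbolData

variable {A O C R V X ι κ : Type*} [Ring A] [Algebra ℂ A] [Ring O] [Algebra ℂ O]
    [CommRing C] [Algebra ℂ C] [Fintype ι] [Fintype κ] {S : SymbolData A O C R V X ι κ}

variable (S) in
/-- The even operators `A₀` are the words of even degree, the odd operators `A₁` are the words of
odd degree, and together they make up `D`. -/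
structure IsParity (D A₀ : Subalgebra ℂ A) (A₁ : Submodule ℂ A) : Prop where
  mem_even : ∀ T, T ∈ A₀ ↔ ∃ k, Even k ∧ T ∈ S.words k
  mem_odd : ∀ T, T ∈ A₁ ↔ ∃ k, Odd k ∧ T ∈ S.words k
  sup_eq : Subalgebra.toSubmodule A₀ ⊔ A₁ = Subalgebra.toSubmodule D
  zero_order : ∀ {k l T G G'}, Even k → Odd l → S.Sym 0 k T G → S.Sym 0 l T G' → T = 0

variable {D A₀ : Subalgebra ℂ A} {A₁ : Submodule ℂ A} (hP : S.IsParity D A₀ A₁)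
  {G : Set A} (hG : ∃ r : ℂ, r ≠ 0 ∧ G = Set.range fun v => r • S.sec v)

include hP

theorem IsParity.disjoint : Disjoint (Subalgebra.toSubmodule A₀) A₁ := by
  rw [Submodule.disjoint_def]
  intro T h0 h1
  obtain ⟨k, hk, h0⟩ := (hP.mem_even T).1 h0
  obtain ⟨l, hl, h1⟩ := (hP.mem_odd T).1 h1
  exact words_disjoint hP.zero_order hk hl h0 h1

theorem IsParity.words_le (k : ℤ) : S.words k ≤ Subalgebra.toSubmodule D := by
  intro T h
  rw [← hP.sup_eq]
  rcases Int.even_or_odd k with hk | hk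
  · exact Submodule.mem_sup_left ((hP.mem_even T).2 ⟨k, hk, h⟩)
  · exact Submodule.mem_sup_right ((hP.mem_odd T).2 ⟨k, hk, h⟩)

theorem IsParity.exists_words {T : A} (h : T ∈ D) (k : ℤ) :
    ∃ d : ℕ, T ∈ S.words (k + d) ⊔ S.words (k + d - 1) := by
  have h' : T ∈ Subalgebra.toSubmodule A₀ ⊔ A₁ := by rw [hP.sup_eq]; exact h
  obtain ⟨T₀, h0, T₁, h1, rfl⟩ := Submodule.mem_sup.1 h'
  obtain ⟨a, ha, h0⟩ := (hP.mem_even _).1 h0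
  obtain ⟨b, hb, h1⟩ := (hP.mem_odd _).1 h1
  -- Any large `d` for which `k + d` is even will do, and one of two consecutive numbers is such.
  obtain ⟨d, hd, hd1, hd2⟩ : ∃ d : ℕ, Even (k + d) ∧ a ≤ k + d ∧ b ≤ k + d - 1 := by
    rcases Int.even_or_odd (k + (|k| + |a| + |b| + 1)) with h | h
    · refine ⟨(|k| + |a| + |b| + 1).toNat, ?_, ?_, ?_⟩
      · rwa [Int.toNat_of_nonneg (by positivity)]
      · have := neg_abs_le k; have := le_abs_self a; have := abs_nonneg b; omega
      · have := neg_abs_le k; have := le_abs_self b; have := abs_nonneg a; omega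
    · refine ⟨(|k| + |a| + |b| + 2).toNat, ?_, ?_, ?_⟩
      · rw [Int.toNat_of_nonneg (by positivity)]
        have := h.add_one
        rwa [show k + (|k| + |a| + |b| + 1) + 1 = k + (|k| + |a| + |b| + 2) by ring] at this
      · have := neg_abs_le k; have := le_abs_self a; have := abs_nonneg b; omega
      · have := neg_abs_le k; have := le_abs_self b; have := abs_nonneg a; omega
  refine ⟨d, add_mem (Submodule.mem_sup_left ?_) (Submodule.mem_sup_right ?_)⟩
  · exact SymbolData.words_le hd1 (hd.sub ha) h0
  · refine SymbolData.words_le hd2 ?_ h1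
    rw [show k + d - 1 - b = k + d - (b + 1) by ring]
    exact hd.sub hb.add_one

theorem IsParity.induction {p : A → Prop} (hw : ∀ k, ∀ T ∈ S.words k, p T)
    (hadd : ∀ T T', p T → p T' → p (T + T')) {T : A} (h : T ∈ D) : p T := by
  obtain ⟨d, hd⟩ := hP.exists_words h 0
  obtain ⟨T₀, h0, T₁, h1, rfl⟩ := Submodule.mem_sup.1 hd
  exact hadd _ _ (hw _ _ h0) (hw _ _ h1)

theorem IsParity.bracket {k l : ℤ} {T T' : A} (h : T ∈ S.words k) (h' : T' ∈ S.words l) :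
    superCommutator A₀ A₁ T T' = T * T' - sgn (k * l) • (T' * T) := by
  obtain ⟨h1, h2, h3⟩ := superCommutator_apply (exists_proj_of_disjoint hP.disjoint) T T'
  rcases Int.even_or_odd k with hk | hk
  · rw [h1 ((hP.mem_even T).2 ⟨k, hk, h⟩), sgn_of_even (hk.mul_right l), one_smul]
  · have hT := (hP.mem_odd T).2 ⟨k, hk, h⟩
    rcases Int.even_or_odd l with hl | hl
    · rw [h2 hT ((hP.mem_even T').2 ⟨l, hl, h'⟩), sgn_of_even (hl.mul_left k), one_smul]
    · rw [h3 hT ((hP.mem_odd T').2 ⟨l, hl, h'⟩), sgn_of_odd (hk.mul hl), neg_one_smul,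
        sub_neg_eq_add]

theorem IsParity.bracket_mem {k l : ℤ} {T T' : A} (h : T ∈ S.words k) (h' : T' ∈ S.words l) :
    superCommutator A₀ A₁ T T' ∈ S.words (k + l - 2) := by
  rw [hP.bracket h h']; exact words_comm h h'

theorem IsParity.bracket_sec {k : ℤ} {T : A} (h : T ∈ S.words k) (v : V) :
    superCommutator A₀ A₁ T (S.sec v) = T * S.sec v - sgn k • (S.sec v * T) := by
  simpa using hP.bracket h (sec_mem v)

omit hP in
theorem mulA_comm_sec (f : R) (v : V) : S.mulA f * S.sec v = S.sec v * S.mulA f := S.c_sec _ v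

/-- Jacobi identity for `T`, `f`, `v`, where `f` and `v` commute. -/
theorem IsParity.bracket_comm_fn {T : A} (h : T ∈ D) (f : R) (v : V) :
    superCommutator A₀ A₁ (T * S.mulA f - S.mulA f * T) (S.sec v) =
      superCommutator A₀ A₁ T (S.sec v) * S.mulA f -
        S.mulA f * superCommutator A₀ A₁ T (S.sec v) := by
  refine hP.induction (p := fun T => superCommutator A₀ A₁ (T * S.mulA f - S.mulA f * T)
    (S.sec v) = superCommutator A₀ A₁ T (S.sec v) * S.mulA f -
      S.mulA f * superCommutator A₀ A₁ T (S.sec v)) (fun k T h => ?_) (fun T T' h h' => ?_) h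
  · rw [hP.bracket_sec h, hP.bracket_sec (words_comm_fn h f), sgn_congr (l := k) (by simp)]
    have h2 := mulA_comm_sec (S := S) f v
    simp only [sub_mul, mul_sub, smul_sub, smul_mul_assoc, mul_smul_comm, mul_assoc, h2]
    simp only [← mul_assoc, h2]
    abel
  · have : (T + T') * S.mulA f - S.mulA f * (T + T') =
      (T * S.mulA f - S.mulA f * T) + (T' * S.mulA f - S.mulA f * T') := by noncomm_ring
    rw [this, map_add, LinearMap.add_apply, h, h', map_add, LinearMap.add_apply]
    noncomm_ring

/-- This Leibniz rule expresses `[T, f] v` by brackets with sections, which are the only brackets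
that the definition of the filtration controls. -/
theorem IsParity.bracket_smul_sec {T : A} (h : T ∈ D) (f : R) (v : V) :
    superCommutator A₀ A₁ T (S.sec (S.smulV f v)) =
      S.mulA f * superCommutator A₀ A₁ T (S.sec v) +
        (T * S.mulA f - S.mulA f * T) * S.sec v := by
  refine hP.induction (p := fun T => superCommutator A₀ A₁ T (S.sec (S.smulV f v)) =
      S.mulA f * superCommutator A₀ A₁ T (S.sec v) +
        (T * S.mulA f - S.mulA f * T) * S.sec v) (fun k T h => ?_) (fun T T' h h' => ?_) h
  · rw [hP.bracket_sec h, hP.bracket_sec h, S.sec_smul]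
    simp only [mul_sub, sub_mul, mul_smul_comm, mul_assoc]
    abel
  · simp only [map_add, LinearMap.add_apply, h, h']
    noncomm_ring

theorem IsParity.bracket_mul_sec {T : A} (h : T ∈ D) (v w : V) :
    superCommutator A₀ A₁ (T * S.sec v) (S.sec w) = T * S.mulA (S.metric v w) -
      superCommutator A₀ A₁ T (S.sec w) * S.sec v := by
  refine hP.induction (p := fun T => superCommutator A₀ A₁ (T * S.sec v) (S.sec w) =
    T * S.mulA (S.metric v w) - superCommutator A₀ A₁ T (S.sec w) * S.sec v)
      (fun k T h => ?_) (fun T T' h h' => ?_) h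
  · rw [hP.bracket_sec h, hP.bracket_sec (words_mul h (SymbolData.sec_mem v)), mulA,
      ← S.sec_sec, sgn_add]
    simp only [sgn_one, mul_neg, mul_one, neg_smul, mul_add, sub_mul, smul_mul_assoc, mul_assoc]
    abel
  · simp only [add_mul, map_add, LinearMap.add_apply, h, h']
    abel

theorem IsParity.mulA_mem (f : R) : S.mulA f ∈ D := hP.words_le 0 (SymbolData.const_mem _)

-- By the Casimir relation `ρ T = ∑ (T ξ_a) η_a`.
omit hP in
theorem eq_zero_of_mul_sec {T : A} (h : ∀ v, T * S.sec v = 0) : T = 0 := by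
  have : T * (S.ρ • (1 : A)) = 0 := by
    rw [← S.casimir, Finset.mul_sum]
    exact Finset.sum_eq_zero fun a _ => by rw [← mul_assoc, h, zero_mul]
  rw [mul_smul_comm, mul_one] at this
  exact (smul_eq_zero.1 this).resolve_left S.ρ_ne

include hG

theorem IsParity.mem_filt {k : ℤ} (hk : 0 ≤ k) (T : A) :
    T ∈ commFiltration D (superCommutator A₀ A₁) G k ↔ T ∈ D ∧ ∀ v,
      superCommutator A₀ A₁ T (S.sec v) ∈ commFiltration D (superCommutator A₀ A₁) G (k - 1) := by
  obtain ⟨r, hr, rfl⟩ := hG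
  rw [mem_commFiltration _ _ _ hk, Set.forall_mem_range]
  refine and_congr_right fun _ => forall_congr' fun v => ?_
  rw [map_smul]
  exact Submodule.smul_mem_iff _ hr

theorem IsParity.words_le_filt (k : ℤ) :
    S.words k ≤ commFiltration D (superCommutator A₀ A₁) G k := by
  obtain ⟨N, hN⟩ : ∃ N : ℕ, k < N := ⟨k.toNat + 1, by omega⟩
  induction N generalizing k with
  | zero => rw [words_of_neg (by simpa using hN)]; exact bot_le
  | succ N ih =>
    rcases lt_or_ge k 0 with hk | hk
    · rw [words_of_neg hk]; exact bot_le
    intro T hT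
    refine (hP.mem_filt hG hk T).2 ⟨hP.words_le k hT, fun v => ih _ (by push_cast at hN; omega) ?_⟩
    exact words_cast (hP.bracket_mem hT (SymbolData.sec_mem v)) (by ring)

theorem IsParity.filt_le {k : ℤ} {T : A}
    (h : T ∈ commFiltration D (superCommutator A₀ A₁) G k) : T ∈ D := by
  rcases lt_or_ge k 0 with hk | hk
  · rw [commFiltration_of_neg _ _ _ hk] at h
    rw [(Submodule.mem_bot ℂ).1 h]; exact zero_mem D
  · exact ((hP.mem_filt hG hk T).1 h).1

/-- All brackets of `T` with sections vanish, also the one with `f v`, and the Leibniz rule leaves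
`[T, f] v = 0`. -/
theorem IsParity.filt_zero_comm_fn {T : A}
    (h : T ∈ commFiltration D (superCommutator A₀ A₁) G 0) (f : R) :
    T * S.mulA f - S.mulA f * T = 0 := by
  obtain ⟨hD, h⟩ := (hP.mem_filt hG le_rfl T).1 h
  replace h : ∀ v, superCommutator A₀ A₁ T (S.sec v) = 0 := fun v => by
    have := h v
    rwa [commFiltration_of_neg _ _ _ (by norm_num), Submodule.mem_bot] at this
  refine eq_zero_of_mul_sec (S := S) fun v => ?_
  have := hP.bracket_smul_sec hD f v
  rwa [h, h, mul_zero, zero_add, eq_comm] at this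

/-- Put `B = [T, f]`. Then `[B, w] = [[T, w], f] = 0` because `[T, w]` lies in step 0. Also `B v =
[T, f v] - f [T, v]` lies in step 0, so `0 = [B v, w] = B g(v, w)`. Expanding `v` in the `η_a` gives
`B v = 0`, hence `B = 0`. -/
theorem IsParity.filt_one_comm_fn {T : A}
    (h : T ∈ commFiltration D (superCommutator A₀ A₁) G 1) (f : R) :
    T * S.mulA f - S.mulA f * T = 0 := by
  obtain ⟨hD, h⟩ := (hP.mem_filt hG zero_le_one T).1 h
  have hB : T * S.mulA f - S.mulA f * T ∈ D :=
    sub_mem (mul_mem hD (hP.mulA_mem f)) (mul_mem (hP.mulA_mem f) hD)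
  set B := T * S.mulA f - S.mulA f * T with hBdef
  have h1 : ∀ v, superCommutator A₀ A₁ B (S.sec v) = 0 := fun v => by
    rw [hBdef, hP.bracket_comm_fn hD]
    exact hP.filt_zero_comm_fn hG (h v) f
  have h2 : ∀ v, B * S.sec v ∈ commFiltration D (superCommutator A₀ A₁) G 0 := fun v => by
    have h3 := hP.bracket_smul_sec hD f v
    have h4 : S.mulA f * superCommutator A₀ A₁ T (S.sec v) ∈
        commFiltration D (superCommutator A₀ A₁) G 0 := by
      have h5 := h v
      obtain ⟨h6, h7⟩ := (hP.mem_filt hG le_rfl _).1 h5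
      refine (hP.mem_filt hG le_rfl _).2 ⟨mul_mem (hP.mulA_mem f) h6, fun w => ?_⟩
      have h8 := h7 w
      rw [commFiltration_of_neg _ _ _ (by norm_num), Submodule.mem_bot] at h8 ⊢
      have h9 : superCommutator A₀ A₁ (S.mulA f * superCommutator A₀ A₁ T (S.sec v)) (S.sec w) =
        S.mulA f * superCommutator A₀ A₁ (superCommutator A₀ A₁ T (S.sec v)) (S.sec w) := by
        refine hP.induction (p := fun Q => superCommutator A₀ A₁ (S.mulA f * Q) (S.sec w) =
          S.mulA f * superCommutator A₀ A₁ Q (S.sec w)) (fun k Q h => ?_) (fun Q Q' h h' => ?_) h6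
        · rw [hP.bracket_sec h, hP.bracket_sec (words_cast (words_mul (const_mem _) h)
            (zero_add k)), mul_sub, mul_smul_comm, ← mul_assoc, ← mul_assoc, ← mul_assoc,
            mulA_comm_sec]
        · simp only [mul_add, map_add, LinearMap.add_apply, h, h']
      rw [h9, h8, mul_zero]
    rw [eq_sub_of_add_eq' h3.symm]
    have h5 := h (S.smulV f v)
    exact sub_mem h5 h4
  refine eq_zero_of_mul_sec (S := S) fun v => ?_
  have h3 : ∀ w, B * S.mulA (S.metric v w) = 0 := fun w => by
    have h4 := ((hP.mem_filt hG le_rfl _).1 (h2 v)).2 w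
    rwa [commFiltration_of_neg _ _ _ (by norm_num), Submodule.mem_bot, hP.bracket_mul_sec hB,
      h1, zero_mul, sub_zero] at h4
  rw [S.sec_expand, Finset.mul_sum]
  exact Finset.sum_eq_zero fun a _ => by rw [← mul_assoc, h3, zero_mul]

/-- Induction by `[[T, f], v] = [[T, v], f]`. For `k < 2` the target is zero and this identity gives
nothing, so those cases rest on `IsParity.filt_one_comm_fn`. -/
theorem IsParity.filt_comm_fn {k : ℤ} {T : A}
    (h : T ∈ commFiltration D (superCommutator A₀ A₁) G k) (f : R) :
    T * S.mulA f - S.mulA f * T ∈ commFiltration D (superCommutator A₀ A₁) G (k - 2) := by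
  obtain ⟨N, hN⟩ : ∃ N : ℕ, k < N := ⟨k.toNat + 1, by omega⟩
  induction N generalizing k T with
  | zero =>
    rw [commFiltration_of_neg _ _ _ (by simpa using hN), Submodule.mem_bot] at h
    simp [h]
  | succ N ih =>
    rcases lt_or_ge k 2 with hk | hk
    · rw [(_ : T * S.mulA f - S.mulA f * T = 0)]
      · exact zero_mem _
      exact hP.filt_one_comm_fn hG (commFiltration_mono _ _ _ (by omega) h) f
    obtain ⟨hD, h⟩ := (hP.mem_filt hG (by omega) T).1 h
    refine (hP.mem_filt hG (by omega) _).2 ⟨sub_mem (mul_mem hD (hP.mulA_mem f))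
      (mul_mem (hP.mulA_mem f) hD), fun v => ?_⟩
    rw [hP.bracket_comm_fn hD]
    convert ih (h v) (by push_cast at hN; omega) using 1
    congr 1; ring

/-- By induction the commutators of `T` with functions and sections are words of degree `k - 4` and
`k - 3`, two below the expected degrees. Then `degreeOp k T` has degree `k - 2`, and so has `k T` by
the Euler identity. -/
theorem IsParity.mem_words_sub_two {k : ℤ} {T : A} (h : T ∈ S.words k)
    (h' : T ∈ commFiltration D (superCommutator A₀ A₁) G (k - 1)) : T ∈ S.words (k - 2) := by
  obtain ⟨N, hN⟩ : ∃ N : ℕ, k < N := ⟨k.toNat + 1, by omega⟩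
  induction N generalizing k T with
  | zero =>
    rw [words_of_neg (by simpa using hN), Submodule.mem_bot] at h
    simp [h]
  | succ N ih =>
    rcases lt_or_ge k 1 with hk | hk
    · rw [commFiltration_of_neg _ _ _ (by omega), Submodule.mem_bot] at h'
      simp [h']
    have h1 : ∀ f, T * S.mulA f - S.mulA f * T ∈ S.words (k - 4) := fun f => by
      refine words_cast (ih (words_comm_fn h f) ?_ (by push_cast at hN; omega)) (by ring)
      convert hP.filt_comm_fn hG h' f using 1
      congr 1; ring
    have h2 : ∀ v, T * S.sec v - sgn k • (S.sec v * T) ∈ S.words (k - 3) := fun v => by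
      refine words_cast (ih (words_comm_sec h v) ?_ (by push_cast at hN; omega)) (by ring)
      rw [← hP.bracket_sec h]
      exact ((hP.mem_filt hG (by omega) _).1 h').2 v
    have h3 : S.degreeOp k T ∈ S.words (k - 2) := by
      refine add_mem (Submodule.smul_mem _ _ (Submodule.sum_mem _ fun j _ =>
        words_cast (words_mul (h1 _) (fld_mem _)) (by ring))) (Submodule.sum_mem _ fun a _ => ?_)
      refine words_cast (words_mul (k := k - 3) (sub_mem (h2 _) (Submodule.sum_mem _ fun j _ =>
        words_cast (words_mul (h1 _) (SymbolData.sec_mem _)) (by ring))) (SymbolData.sec_mem _)) (by ring)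
    have h4 := add_mem (degreeOp_sub_mem h) h3
    rw [sub_add_cancel] at h4
    refine (Submodule.smul_mem_iff _ ?_).1 h4
    exact_mod_cast (by omega : k ≠ 0)

/-- An element of the filtration step lies in `words (k + d) ⊔ words (k + d - 1)` for some `d`, and
`d` can be lowered one at a time. The summand of degree `k + d` lies in step `k + d - 1`, as the
difference of two elements of that step, so `mem_words_sub_two` brings it down by 2. -/
theorem IsParity.filt_eq (k : ℤ) :
    commFiltration D (superCommutator A₀ A₁) G k = S.words k ⊔ S.words (k - 1) := by
  refine le_antisymm (fun T h => ?_) (sup_le (hP.words_le_filt hG k)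
    ((hP.words_le_filt hG _).trans (commFiltration_mono _ _ _ (by omega))))
  obtain ⟨d, hd⟩ := hP.exists_words (hP.filt_le hG h) k
  induction d with
  | zero => simpa using hd
  | succ d ih =>
    refine ih ?_
    obtain ⟨T₀, h0, T₁, h1, rfl⟩ := Submodule.mem_sup.1 hd
    have h2 := hP.words_le_filt hG _ h1
    have h3 : T₀ ∈ commFiltration D (superCommutator A₀ A₁) G (k + ((d + 1 : ℕ) : ℤ) - 1) := by
      have := sub_mem (commFiltration_mono D (superCommutator A₀ A₁) G
        (show k ≤ k + ((d + 1 : ℕ) : ℤ) - 1 by push_cast; omega) h) h2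
      rwa [add_sub_cancel_right] at this
    have h4 := hP.mem_words_sub_two hG h0 h3
    exact add_mem (Submodule.mem_sup_right (words_cast h4 (by push_cast; ring)))
      (Submodule.mem_sup_left (words_cast h1 (by push_cast; ring)))

end SymbolData


/-! ### The symbol map -/

namespace SymbolData

variable {A O C R V X ι κ : Type*} [Ring A] [Algebra ℂ A] [Ring O] [Algebra ℂ O]
    [CommRing C] [Algebra ℂ C] [Fintype ι] [Fintype κ] {S : SymbolData A O C R V X ι κ}

variable (S) in
/-- `F` is the filtration by degree of words, and the elements of degree `k` with vanishing symbol
are those of `F (k - 1)`. -/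
structure IsSymbolic (br : A →ₗ[ℂ] A →ₗ[ℂ] A) (F : ℤ → Submodule ℂ A) : Prop where
  mono : Monotone F
  eq_sup : ∀ k, F k = S.words k ⊔ S.words (k - 1)
  mem_iff : ∀ {m k T G}, S.Sym m k T G → (T ∈ F (k - 1) ↔ G = 0)
  bracket : ∀ {k l T T'}, T ∈ S.words k → T' ∈ S.words l →
    br T T' = T * T' - sgn (k * l) • (T' * T)

section Parity

variable {D A₀ : Subalgebra ℂ A} {A₁ : Submodule ℂ A} (hP : S.IsParity D A₀ A₁)
  {W : Set A} (hW : ∃ r : ℂ, r ≠ 0 ∧ W = Set.range fun v => r • S.sec v)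
include hP hW

/-- Induction on `k`. In degree 0 both `T` and `G` come from the same function. For `k > 0` the
membership is a condition on the commutators with sections, whose symbols are the `dsec v G`. If
they vanish because `T` lies in step `k - 1`, so do the `dfn f G`, by `filt_comm_fn`, and the Euler
identity gives `k G = 0`. -/
theorem IsParity.mem_filt_iff {m k : ℤ} {T : A} {G : O} (h : S.Sym m k T G) :
    T ∈ commFiltration D (superCommutator A₀ A₁) W (k - 1) ↔ G = 0 := by
  obtain ⟨N, hN⟩ : ∃ N : ℕ, k < N := ⟨k.toNat + 1, by omega⟩
  induction N generalizing m k T G with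
  | zero =>
    obtain ⟨rfl, rfl⟩ := h.base.1 (by simpa using hN)
    simp
  | succ N ih =>
    push_cast at hN
    rcases lt_trichotomy k 0 with hk | rfl | hk
    · obtain ⟨rfl, rfl⟩ := h.base.1 hk
      simp
    · obtain ⟨c, rfl, rfl⟩ := h.base.2 rfl
      rw [commFiltration_of_neg _ _ _ (by norm_num), Submodule.mem_bot,
        map_eq_zero_iff _ S.cA_inj, map_eq_zero_iff _ S.cO_inj]
    have h1 : ∀ v, superCommutator A₀ A₁ T (S.sec v) ∈
        commFiltration D (superCommutator A₀ A₁) W (k - 1 - 1) ↔ S.dsec v G = 0 := fun v => by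
      rw [hP.bracket_sec h.mem_words]
      exact ih (h.comm_sec v) (by omega)
    constructor
    · intro hT
      have h2 : ∀ v, S.dsec v G = 0 := fun v =>
        (h1 v).1 (((hP.mem_filt hW (by omega) T).1 hT).2 v)
      have h3 : ∀ f, S.dfn f G = 0 := fun f => by
        refine (ih (h.comm_fn f) (by omega)).1 ?_
        rw [show k - 2 - 1 = k - 1 - 2 by ring]
        exact hP.filt_comm_fn hW hT f
      have h4 := S.euler k G h.mem_deg
      simp only [h2, h3, zero_mul, smul_zero, Finset.sum_const_zero, sub_zero, add_zero] at h4
      refine (smul_eq_zero.1 h4).resolve_left ?_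
      exact_mod_cast hk.ne'
    · rintro rfl
      exact (hP.mem_filt hW (by omega) T).2 ⟨hP.words_le k h.mem_words,
        fun v => (h1 v).2 (map_zero _)⟩

theorem IsParity.isSymbolic :
    S.IsSymbolic (superCommutator A₀ A₁) (commFiltration D (superCommutator A₀ A₁) W) where
  mono := commFiltration_mono _ _ _
  eq_sup := hP.filt_eq hW
  mem_iff := hP.mem_filt_iff hW
  bracket := hP.bracket

theorem IsParity.isPoissonFiltration :
    IsPoissonFiltration D (superCommutator A₀ A₁) (commFiltration D (superCommutator A₀ A₁) W) where
  mono := commFiltration_mono _ _ _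
  exhaustive := by
    refine le_antisymm (iSup_le fun k T h => hP.filt_le hW h) fun T h => ?_
    obtain ⟨d, hd⟩ := hP.exists_words h 0
    rw [← hP.filt_eq hW] at hd
    exact Submodule.mem_iSup_of_mem _ hd
  one_mem := hP.words_le_filt hW 0 one_mem_words
  mul_mem k l T hT T' hT' := by
    rw [hP.filt_eq hW] at hT hT' ⊢
    obtain ⟨a, ha, b, hb, rfl⟩ := Submodule.mem_sup.1 hT
    obtain ⟨a', ha', b', hb', rfl⟩ := Submodule.mem_sup.1 hT'
    rw [add_mul, mul_add, mul_add]
    -- The product of the two lower summands has degree `k + l - 2` and is absorbed in degree `k +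
    -- l`.
    refine add_mem (add_mem (Submodule.mem_sup_left (words_mul ha ha')) (Submodule.mem_sup_right
      (words_cast (words_mul ha hb') (by ring)))) (add_mem (Submodule.mem_sup_right
      (words_cast (words_mul hb ha') (by ring))) (Submodule.mem_sup_left
      (words_sub_two_le _ (words_cast (words_mul hb hb') (by ring)))))
  bracket_mem k l T hT T' hT' := by
    rw [hP.filt_eq hW] at hT hT' ⊢
    obtain ⟨a, ha, b, hb, rfl⟩ := Submodule.mem_sup.1 hT
    obtain ⟨a', ha', b', hb', rfl⟩ := Submodule.mem_sup.1 hT'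
    simp only [map_add, LinearMap.add_apply]
    refine add_mem (add_mem (Submodule.mem_sup_left (hP.bracket_mem ha ha'))
      (Submodule.mem_sup_right (words_cast (hP.bracket_mem hb ha') (by ring))))
      (add_mem (Submodule.mem_sup_right (words_cast (hP.bracket_mem ha hb') (by ring)))
      (Submodule.mem_sup_left (words_sub_two_le _ (words_cast (hP.bracket_mem hb hb') (by ring)))))

end Parity

variable (S) in
/-- The symbols of words of degree `k`. -/
def symbols (k : ℤ) : Submodule ℂ O where
  carrier := {G | ∃ m T, S.Sym m k T G}
  zero_mem' := ⟨0, 0, Sym.zero _ _⟩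
  add_mem' := by
    rintro T T' ⟨m, G, h⟩ ⟨m', G', h'⟩
    exact ⟨max m m', _, (h.mono_le (le_max_left _ _)).add (h'.mono_le (le_max_right _ _))⟩
  smul_mem' := by
    rintro c T ⟨m, G, h⟩
    exact ⟨m, _, h.smul c⟩

theorem symbols_mul {k l : ℤ} {G G' : O} (h : G ∈ S.symbols k) (h' : G' ∈ S.symbols l) :
    G * G' ∈ S.symbols (k + l) := by
  obtain ⟨m, T, h⟩ := h
  obtain ⟨m', T', h'⟩ := h'
  exact ⟨_, _, h.mul h'⟩

/-- Surjectivity of the symbol map. The Euler identity writes `k G` through generators with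
coefficients that are derivatives of `G`, hence of lower degree and polynomial by induction. -/
theorem deg_le_symbols (k : ℤ) : S.deg k ≤ S.symbols k := by
  obtain ⟨N, hN⟩ : ∃ N : ℕ, k < N := ⟨k.toNat + 1, by omega⟩
  induction N generalizing k with
  | zero => rw [S.deg_neg k (by simpa using hN)]; exact bot_le
  | succ N ih =>
    push_cast at hN
    intro G hG
    rcases lt_trichotomy k 0 with hk | rfl | hk
    · rw [S.deg_neg k hk] at hG
      rw [(Submodule.mem_bot ℂ).1 hG]
      exact zero_mem _
    · obtain ⟨c, rfl⟩ := S.deg_zero G hG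
      exact ⟨_, _, Sym.const c⟩
    have hc : ∀ {l} {H : O}, H ∈ S.symbols l → l = k → H ∈ S.symbols k := fun h hl => hl ▸ h
    have h1 : ∀ f, S.dfn f G ∈ S.symbols (k - 2) := fun f =>
      ih _ (by omega) (S.dfn_mem f k G hG)
    refine (Submodule.smul_mem_iff (s := (k : ℂ)) _ (by exact_mod_cast hk.ne')).1 ?_
    rw [S.euler k G hG]
    refine add_mem (Submodule.sum_mem _ fun j _ => Submodule.smul_mem _ _ (hc (symbols_mul (h1 _)
      ⟨_, _, Sym.fld _⟩) (by ring))) (Submodule.sum_mem _ fun a _ => hc (symbols_mul (k := k - 1)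
      (sub_mem (ih _ (by omega) (S.dsec_mem _ _ _ hG)) (Submodule.sum_mem _ fun j _ => ?_))
      ⟨_, _, Sym.sec _⟩) (by ring))
    rw [show k - 1 = k - 2 + 1 by ring]
    exact symbols_mul (h1 _) ⟨_, _, Sym.sec _⟩

theorem exists_sym {k : ℤ} {G : O} (h : G ∈ S.deg k) : ∃ m T, S.Sym m k T G := deg_le_symbols k h

namespace IsSymbolic

variable {br : A →ₗ[ℂ] A →ₗ[ℂ] A} {F : ℤ → Submodule ℂ A} (hS : S.IsSymbolic br F)
include hS

theorem unique {m m' k : ℤ} {T T' : A} {G G' : O} (h : S.Sym m k T G) (h' : S.Sym m' k T' G')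
    (hT : T - T' ∈ F (k - 1)) : G = G' := by
  have := (h.mono_le (le_max_left m m')).sub (h'.mono_le (le_max_right m m'))
  exact sub_eq_zero.1 ((hS.mem_iff this).1 hT)

theorem eq_of_sym {m m' k : ℤ} {T : A} {G G' : O} (h : S.Sym m k T G) (h' : S.Sym m' k T G') :
    G = G' := hS.unique h h' (by rw [sub_self]; exact zero_mem _)

theorem mem {m k : ℤ} {T : A} {G : O} (h : S.Sym m k T G) : T ∈ F k := by
  rw [hS.eq_sup]; exact Submodule.mem_sup_left h.mem_words

theorem exists_rep {k : ℤ} {T : A} (h : T ∈ F k) : ∃ G m T', S.Sym m k T' G ∧ T - T' ∈ F (k - 1) := by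
  rw [hS.eq_sup] at h
  obtain ⟨a, ⟨m, G, ha⟩, b, hb, rfl⟩ := Submodule.mem_sup.1 h
  refine ⟨G, m, a, ha, ?_⟩
  rw [add_sub_cancel_left, hS.eq_sup]
  exact Submodule.mem_sup_left hb

/-- The symbol map on operators of degree `k`. -/
def symbol (k : ℤ) : F k →ₗ[ℂ] S.deg k where
  toFun T := ⟨(hS.exists_rep T.2).choose, by
    obtain ⟨m, T', h, _⟩ := (hS.exists_rep T.2).choose_spec
    exact h.mem_deg⟩
  map_add' T T' := by
    ext
    obtain ⟨m, U, h, hU⟩ := (hS.exists_rep T.2).choose_spec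
    obtain ⟨m', U', h', hU'⟩ := (hS.exists_rep T'.2).choose_spec
    obtain ⟨m'', U'', h'', hU''⟩ := (hS.exists_rep (T + T').2).choose_spec
    refine hS.unique h'' ((h.mono_le (le_max_left m m')).add (h'.mono_le (le_max_right m m'))) ?_
    convert sub_mem (add_mem hU hU') hU'' using 1
    push_cast
    abel
  map_smul' c T := by
    ext
    obtain ⟨m, U, h, hU⟩ := (hS.exists_rep T.2).choose_spec
    obtain ⟨m'', U'', h'', hU''⟩ := (hS.exists_rep (c • T).2).choose_spec
    refine hS.unique h'' (h.smul c) ?_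
    convert sub_mem (Submodule.smul_mem _ c hU) hU'' using 1
    push_cast
    rw [smul_sub]
    abel

theorem symbol_eq {k m : ℤ} {T T' : A} {G : O} (hT : T ∈ F k) (h : S.Sym m k T' G)
    (h' : T - T' ∈ F (k - 1)) : (hS.symbol k ⟨T, hT⟩ : O) = G := by
  obtain ⟨m', U, h1, hU⟩ := (hS.exists_rep hT).choose_spec
  refine hS.unique h1 h ?_
  convert sub_mem h' hU using 1
  abel

theorem symbol_eq_zero_iff {k : ℤ} (T : F k) : hS.symbol k T = 0 ↔ (T : A) ∈ F (k - 1) := by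
  obtain ⟨T, hT⟩ := T
  obtain ⟨G, m, T', h, h'⟩ := hS.exists_rep hT
  rw [Subtype.ext_iff, hS.symbol_eq hT h h', Submodule.coe_zero, ← hS.mem_iff h]
  exact ⟨fun h1 => by simpa using add_mem h' h1, fun h1 => by simpa using sub_mem h1 h'⟩

/-- The symbol map on `F k / F (k - 1)`. -/
def grSymbol (k : ℤ) : GrPiece F k →ₗ[ℂ] S.deg k :=
  GrPiece.lift F k (hS.symbol k) fun T => (hS.symbol_eq_zero_iff T).2

theorem grSymbol_injective (k : ℤ) : Function.Injective (hS.grSymbol k) := by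
  refine (injective_iff_map_eq_zero _).2 fun x hx => ?_
  obtain ⟨T, rfl⟩ := GrPiece.mk_surjective F k x
  exact GrPiece.mk_eq_zero F k T ((hS.symbol_eq_zero_iff T).1 hx)

theorem grSymbol_surjective (k : ℤ) : Function.Surjective (hS.grSymbol k) := by
  rintro ⟨G, hG⟩
  obtain ⟨m, T, h⟩ := exists_sym hG
  refine ⟨GrPiece.mk F k ⟨T, hS.mem h⟩, Subtype.ext ?_⟩
  exact hS.symbol_eq (hS.mem h) h (by rw [sub_self]; exact zero_mem _)

/-- The linear isomorphism of the associated graded space with the symbols. -/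
def symbolEquiv : Gr F ≃ₗ[ℂ] O :=
  (LinearEquiv.ofBijective (DirectSum.lmap hS.grSymbol)
    ⟨(DirectSum.lmap_injective _).2 hS.grSymbol_injective,
      (DirectSum.lmap_surjective _).2 hS.grSymbol_surjective⟩ : (⨁ k, GrPiece F k) ≃ₗ[ℂ] _).trans
  (LinearEquiv.ofBijective (DirectSum.coeLinearMap S.deg)
    (DirectSum.isInternal_submodule_of_iSupIndep_of_iSup_eq_top S.indep S.iSup_deg))

theorem symbolEquiv_grClass (k : ℤ) (T : F k) :
    hS.symbolEquiv (grClass F k T) = hS.symbol k T := by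
  change DirectSum.coeLinearMap S.deg (DirectSum.lmap hS.grSymbol
    (DirectSum.lof ℂ ℤ (GrPiece F) k (GrPiece.mk F k T))) = _
  rw [DirectSum.lmap_lof, DirectSum.coeLinearMap_lof]
  rfl

theorem symbolEquiv_sym {m k : ℤ} {T : A} {G : O} (h : S.Sym m k T G) (hT : T ∈ F k) :
    hS.symbolEquiv (grClass F k ⟨T, hT⟩) = G := by
  rw [symbolEquiv_grClass]
  exact hS.symbol_eq hT h (by rw [sub_self]; exact zero_mem _)

theorem symbolEquiv_sym' {m k l : ℤ} {T : A} {G : O} (h : S.Sym m k T G) (hk : k = l)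
    (hT : T ∈ F l) : hS.symbolEquiv (grClass F l ⟨T, hT⟩) = G := by
  subst hk; exact hS.symbolEquiv_sym h hT

theorem exists_grClass (k : ℤ) (T : F k) :
    ∃ (m : ℤ) (T' : A) (G : O) (h : S.Sym m k T' G), grClass F k T = grClass F k ⟨T', hS.mem h⟩ := by
  obtain ⟨T, hT⟩ := T
  obtain ⟨G, m, T', h, h'⟩ := hS.exists_rep hT
  refine ⟨m, T', G, h, sub_eq_zero.1 ?_⟩
  rw [← map_sub]
  exact grClass_eq_zero rfl _ h'

theorem map_symbolEquiv (k : ℤ) : (LinearMap.range (grClass F k)).map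
    (hS.symbolEquiv : Gr F →ₗ[ℂ] O) = S.deg k := by
  ext G
  constructor
  · rintro ⟨_, ⟨T, rfl⟩, rfl⟩
    rw [LinearEquiv.coe_coe, symbolEquiv_grClass]
    exact Subtype.prop _
  · intro h
    obtain ⟨m, T, h⟩ := exists_sym h
    exact ⟨_, ⟨⟨T, hS.mem h⟩, rfl⟩, hS.symbolEquiv_sym h _⟩

/-- Two bilinear maps on `Gr F` agree if they agree on classes of words. -/
theorem gr_ext₂ {N : Type*} [AddCommGroup N] [Module ℂ N] {β β' : Gr F →ₗ[ℂ] Gr F →ₗ[ℂ] N}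
    (h : ∀ {m k T G m' k' T' G'} (h : S.Sym m k T G) (h' : S.Sym m' k' T' G'),
      β (grClass F k ⟨T, hS.mem h⟩) (grClass F k' ⟨T', hS.mem h'⟩) =
        β' (grClass F k ⟨T, hS.mem h⟩) (grClass F k' ⟨T', hS.mem h'⟩)) : β = β' := by
  refine Gr.hom_ext F fun k a => Gr.hom_ext F fun l b => ?_
  obtain ⟨m, T, G, h1, e1⟩ := hS.exists_grClass k a
  obtain ⟨m', T', G', h2, e2⟩ := hS.exists_grClass l b
  change β (grClass F k a) (grClass F l b) = β' (grClass F k a) (grClass F l b)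
  rw [e1, e2]
  exact h h1 h2

variable {D : Subalgebra ℂ A} (hF : IsPoissonFiltration D br F)

theorem symbolEquiv_mul (a b : Gr F) :
    hS.symbolEquiv (hF.grMul a b) = hS.symbolEquiv a * hS.symbolEquiv b := by
  have : hF.grMul.compr₂ (hS.symbolEquiv : Gr F →ₗ[ℂ] O) =
      (LinearMap.mul ℂ O).compl₁₂ (hS.symbolEquiv : Gr F →ₗ[ℂ] O)
        (hS.symbolEquiv : Gr F →ₗ[ℂ] O) := by
    refine hS.gr_ext₂ fun {m k T G m' k' T' G'} h h' => ?_
    simp only [LinearMap.compr₂_apply, LinearMap.compl₁₂_apply, LinearEquiv.coe_coe,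
      LinearMap.mul_apply', hS.symbolEquiv_sym h, hS.symbolEquiv_sym h']
    rw [IsPoissonFiltration.grMul, grMap₂_grClass]
    exact hS.symbolEquiv_sym' (h.mul h') (by ring) _
  exact LinearMap.congr_fun₂ this a b

/-- The bracket of symbols which corresponds to the bracket of `Gr F`. -/
def poisson : O →ₗ[ℂ] O →ₗ[ℂ] O :=
  (hF.grBracket.compl₁₂ (hS.symbolEquiv.symm : O →ₗ[ℂ] Gr F)
    (hS.symbolEquiv.symm : O →ₗ[ℂ] Gr F)).compr₂ (hS.symbolEquiv : Gr F →ₗ[ℂ] O)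

theorem symbolEquiv_bracket (a b : Gr F) : hS.symbolEquiv (hF.grBracket a b) =
    hS.poisson hF (hS.symbolEquiv a) (hS.symbolEquiv b) := by
  simp [poisson]

/-- The transported bracket is computed by the graded commutator of any representing words. All
later statements on `poisson` compare two symbols of one operator. -/
theorem poisson_sym {m k m' l : ℤ} {T T' : A} {G H : O} (h : S.Sym m k T G)
    (h' : S.Sym m' l T' H) : ∃ m'', S.Sym m'' (k + l - 2) (T * T' - sgn (k * l) • (T' * T))
      (hS.poisson hF G H) := by
  obtain ⟨m'', K, hK⟩ := words_comm h.mem_words h'.mem_words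
  refine ⟨m'', ?_⟩
  rw [← hS.symbolEquiv_sym h (hS.mem h), ← hS.symbolEquiv_sym h' (hS.mem h'),
    ← hS.symbolEquiv_bracket, IsPoissonFiltration.grBracket, grMap₂_grClass]
  rw [hS.symbolEquiv_sym' (l := k + l + -2) (hK.cast rfl rfl
    (hS.bracket h.mem_words h'.mem_words).symm rfl) (by ring)]
  exact hK

end IsSymbolic

end SymbolData


/-! ### The Poisson bracket of symbols -/

/-- Graded Poisson brackets of degree `-2` with respect to a grading of an algebra. -/
structure IsPoisson {O : Type*} [Ring O] [Algebra ℂ O] (deg : ℤ → Submodule ℂ O)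
    (P : O →ₗ[ℂ] O →ₗ[ℂ] O) : Prop where
  degree : ∀ k l : ℤ, ∀ G ∈ deg k, ∀ H ∈ deg l, P G H ∈ deg (k + l - 2)
  skew : ∀ k l : ℤ, ∀ G ∈ deg k, ∀ H ∈ deg l, P G H = -((-1 : ℂ) ^ ((k - 2) * (l - 2)) • P H G)
  leibniz : ∀ k l : ℤ, ∀ G ∈ deg k, ∀ H ∈ deg l, ∀ K,
    P G (H * K) = P G H * K + (-1 : ℂ) ^ ((k - 2) * l) • (H * P G K)
  jacobi : ∀ k l : ℤ, ∀ G ∈ deg k, ∀ H ∈ deg l, ∀ K,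
    P G (P H K) = P (P G H) K + (-1 : ℂ) ^ ((k - 2) * (l - 2)) • P H (P G K)

theorem sgn_sub_two_mul (k l : ℤ) : (-1 : ℂ) ^ ((k - 2) * l) = sgn (k * l) :=
  sgn_congr ⟨-l, by ring⟩

theorem sgn_sub_two_mul_sub_two (k l : ℤ) : (-1 : ℂ) ^ ((k - 2) * (l - 2)) = sgn (k * l) :=
  sgn_congr ⟨-l - k + 2, by ring⟩

theorem grClass_congr {A : Type*} [Ring A] [Algebra ℂ A] {F : ℤ → Submodule ℂ A} {k l : ℤ}
    {T T' : A} (hk : k = l) (hT : T = T') (h : T ∈ F k) (h' : T' ∈ F l) :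
    grClass F k ⟨T, h⟩ = grClass F l ⟨T', h'⟩ := by
  subst hk hT; rfl

namespace SymbolData

variable {A O C R V X ι κ : Type*} [Ring A] [Algebra ℂ A] [Ring O] [Algebra ℂ O]
    [CommRing C] [Algebra ℂ C] [Fintype ι] [Fintype κ] {S : SymbolData A O C R V X ι κ}

/-- A property of symbols that is additive holds for all if it holds for symbols of words. -/
theorem symbol_induction {p : O → Prop} (h : ∀ {m k T G}, S.Sym m k T G → p G)
    (hadd : ∀ G H, p G → p H → p (G + H)) (G : O) : p G := by
  have hG : G ∈ ⨆ k, S.deg k := by rw [S.iSup_deg]; trivial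
  refine Submodule.iSup_induction (motive := p) _ hG (fun k H hH => ?_) (h (Sym.zero 0 0)) hadd
  obtain ⟨m, T, h'⟩ := exists_sym hH
  exact h h'

namespace IsSymbolic

variable {br : A →ₗ[ℂ] A →ₗ[ℂ] A} {F : ℤ → Submodule ℂ A} (hS : S.IsSymbolic br F)
  {D : Subalgebra ℂ A} (hF : IsPoissonFiltration D br F)
include hS

theorem eq_of_sym' {m m' k k' : ℤ} {T T' : A} {G G' : O} (h : S.Sym m k T G)
    (h' : S.Sym m' k' T' G') (hk : k = k') (hT : T = T') : G = G' := by
  subst hk hT; exact hS.eq_of_sym h h'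

/-- Each law is the symbol of an identity in the associative algebra, transferred by `eq_of_sym'`.
The shifts by 2 in the exponents of the signs do not change parity. -/
theorem isPoisson : IsPoisson S.deg (hS.poisson hF) where
  degree k l G hG H hH := by
    obtain ⟨m, T, h⟩ := exists_sym hG
    obtain ⟨m', T', h'⟩ := exists_sym hH
    obtain ⟨_, h2⟩ := hS.poisson_sym hF h h'
    exact h2.mem_deg
  skew k l G hG H hH := by
    obtain ⟨m, T, h⟩ := exists_sym hG
    obtain ⟨m', T', h'⟩ := exists_sym hH
    obtain ⟨_, h2⟩ := hS.poisson_sym hF h h'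
    obtain ⟨_, h3⟩ := hS.poisson_sym hF h' h
    refine hS.eq_of_sym' h2 (h3.smul _).neg (by ring) ?_
    rw [sgn_sub_two_mul_sub_two, smul_sub, smul_smul, mul_comm l k, sgn_mul_self]
    simp
  leibniz k l G hG H hH K := by
    obtain ⟨m, T, h⟩ := exists_sym hG
    obtain ⟨m', T', h'⟩ := exists_sym hH
    refine symbol_induction (S := S) (p := fun K => hS.poisson hF G (H * K) =
      hS.poisson hF G H * K + (-1 : ℂ) ^ ((k - 2) * l) • (H * hS.poisson hF G K))
      (fun {m'' j T'' K} h'' => ?_) (fun K K' h h' => ?_) K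
    · obtain ⟨_, h1⟩ := hS.poisson_sym hF h (h'.mul h'')
      obtain ⟨a, h2⟩ := hS.poisson_sym hF h h'
      obtain ⟨b, h3⟩ := hS.poisson_sym hF h h''
      have e2 := h2.mul h''
      have e3 := (h'.mul h3).smul ((-1 : ℂ) ^ ((k - 2) * l))
      refine hS.eq_of_sym' h1 (((e2.mono_le (le_max_left _ _)).cast rfl (by ring) rfl rfl).add
        (e3.mono_le (le_max_right _ _))) (by ring) ?_
      rw [sgn_sub_two_mul, mul_add, sgn_add]
      rcases sgn_cases (k * l) with h | h <;> rcases sgn_cases (k * j) with h' | h' <;>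
        simp only [h, h'] <;> simp <;> noncomm_ring
    · simp only [mul_add, map_add, h, h', smul_add]
      abel
  jacobi k l G hG H hH K := by
    obtain ⟨m, T, h⟩ := exists_sym hG
    obtain ⟨m', T', h'⟩ := exists_sym hH
    refine symbol_induction (S := S) (p := fun K => hS.poisson hF G (hS.poisson hF H K) =
      hS.poisson hF (hS.poisson hF G H) K + (-1 : ℂ) ^ ((k - 2) * (l - 2)) •
        hS.poisson hF H (hS.poisson hF G K))
      (fun {m'' j T'' K} h'' => ?_) (fun K K' h h' => ?_) K
    · obtain ⟨_, h1⟩ := hS.poisson_sym hF h h'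
      obtain ⟨_, h2⟩ := hS.poisson_sym hF h' h''
      obtain ⟨_, h3⟩ := hS.poisson_sym hF h h''
      obtain ⟨_, e1⟩ := hS.poisson_sym hF h h2
      obtain ⟨_, e2⟩ := hS.poisson_sym hF h1 h''
      obtain ⟨_, e3⟩ := hS.poisson_sym hF h' h3
      have e3 := e3.smul ((-1 : ℂ) ^ ((k - 2) * (l - 2)))
      refine hS.eq_of_sym' e1 (((e2.mono_le (le_max_left _ _)).cast rfl (by ring) rfl rfl).add
        (e3.mono_le (le_max_right _ _))) (by ring) ?_
      rw [sgn_sub_two_mul_sub_two, sgn_congr (k := k * (l + j - 2)) (l := k * l + k * j)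
        ⟨-k, by ring⟩, sgn_congr (k := (k + l - 2) * j) (l := k * j + l * j) ⟨-j, by ring⟩,
        sgn_congr (k := l * (k + j - 2)) (l := k * l + l * j) ⟨-l, by ring⟩, sgn_add, sgn_add,
        sgn_add]
      rcases sgn_cases (k * l) with h | h <;> rcases sgn_cases (k * j) with h' | h' <;>
        rcases sgn_cases (l * j) with h'' | h'' <;>
        simp only [h, h', h''] <;> simp <;> noncomm_ring
    · simp only [map_add, h, h', smul_add]
      abel

theorem poisson_fld_fn (Y : X) (f : R) :
    hS.poisson hF (S.fldO Y) (S.cO (S.re f)) = S.cO (S.re (S.app Y f)) := by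
  obtain ⟨_, h⟩ := hS.poisson_sym hF (Sym.fld Y) (Sym.fn f)
  refine hS.eq_of_sym' h (Sym.fn _) (by norm_num) ?_
  simp [S.fld_c]

theorem poisson_fn_fn (f h : R) : hS.poisson hF (S.cO (S.re h)) (S.cO (S.re f)) = 0 := by
  obtain ⟨_, h1⟩ := hS.poisson_sym hF (Sym.fn h) (Sym.fn f)
  exact (h1.base.1 (by norm_num)).2

theorem poisson_fld_sec (Y : X) (v : V) :
    hS.poisson hF (S.fldO Y) (S.secO v) = S.secO (S.conn Y v) := by
  obtain ⟨_, h⟩ := hS.poisson_sym hF (Sym.fld Y) (Sym.sec v)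
  refine hS.eq_of_sym' h (Sym.sec _) (by norm_num) ?_
  simp [S.fld_sec]

theorem poisson_fn_sec (f : R) (v : V) : hS.poisson hF (S.cO (S.re f)) (S.secO v) = 0 := by
  obtain ⟨_, h⟩ := hS.poisson_sym hF (Sym.fn f) (Sym.sec v)
  exact (h.base.1 (by norm_num)).2

theorem poisson_sec_sec (v w : V) :
    hS.poisson hF (S.secO v) (S.secO w) = S.cO (S.re (S.metric v w)) := by
  obtain ⟨_, h⟩ := hS.poisson_sym hF (Sym.sec v) (Sym.sec w)
  refine hS.eq_of_sym' h (Sym.fn _) (by norm_num) ?_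
  simp [← S.sec_sec]

/-- The scalar part `curvC` of the curvature has degree 0 and vanishes in the quotient in degree 2,
so only the quadratic part survives. -/
theorem poisson_fld_fld (Y Z : X) : hS.poisson hF (S.fldO Y) (S.fldO Z) = S.fldO (S.brk Y Z) +
    (1 / 2 : ℂ) • ∑ a, S.secO (S.curvV Y Z a) * S.secO (S.ξ a) := by
  obtain ⟨_, h⟩ := hS.poisson_sym hF (Sym.fld Y) (Sym.fld Z)
  have h1 := ((Sym.sum (S := S) Finset.univ fun a _ => (Sym.sec (S.curvV Y Z a)).mul
    (Sym.sec (S.ξ a))).smul (1 / 2 : ℂ)).mono.cast (m' := 1) (k' := 2) (by norm_num)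
      (by norm_num) rfl rfl
  refine hS.unique (h.cast rfl (by norm_num) rfl rfl) ((Sym.fld (S.brk Y Z)).add h1) ?_
  have h2 : S.cA (S.curvC Y Z) ∈ F (2 - 1) := hS.mono (by norm_num) (hS.mem (Sym.const _))
  convert h2 using 1
  have h3 := S.fld_fld Y Z
  rw [sgn_of_even (by decide), one_smul, h3]
  abel

end IsSymbolic

/-- Two graded Poisson brackets that agree on generators are equal. -/
theorem isPoisson_unique {P P' : O →ₗ[ℂ] O →ₗ[ℂ] O} (hP : IsPoisson S.deg P)
    (hP' : IsPoisson S.deg P')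
    (h1 : ∀ f h, P (S.cO (S.re f)) (S.cO (S.re h)) = P' (S.cO (S.re f)) (S.cO (S.re h)))
    (h2 : ∀ f v, P (S.cO (S.re f)) (S.secO v) = P' (S.cO (S.re f)) (S.secO v))
    (h3 : ∀ v w, P (S.secO v) (S.secO w) = P' (S.secO v) (S.secO w))
    (h4 : ∀ Y f, P (S.fldO Y) (S.cO (S.re f)) = P' (S.fldO Y) (S.cO (S.re f)))
    (h5 : ∀ Y v, P (S.fldO Y) (S.secO v) = P' (S.fldO Y) (S.secO v))
    (h6 : ∀ Y Z, P (S.fldO Y) (S.fldO Z) = P' (S.fldO Y) (S.fldO Z)) : P = P' := by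
  have swap : ∀ {m k T G m' l T' H}, S.Sym m k T G → S.Sym m' l T' H → P G H = P' G H →
      P H G = P' H G := fun h h' e => by
    rw [hP.skew _ _ _ h'.mem_deg _ h.mem_deg, hP'.skew _ _ _ h'.mem_deg _ h.mem_deg, e]
  -- The Leibniz rule carries agreement in the second argument from generators to all words. Skew
  -- symmetry then exchanges the arguments.
  have key : ∀ {k G}, G ∈ S.deg k → (∀ f, P G (S.cO (S.re f)) = P' G (S.cO (S.re f))) →
      (∀ v, P G (S.secO v) = P' G (S.secO v)) → (∀ Y, P G (S.fldO Y) = P' G (S.fldO Y)) →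
      ∀ {m l T H}, S.Sym m l T H → P G H = P' G H := by
    intro k G hG e1 e2 e3 m l T H h
    induction h with
    | zero => simp
    | fn f => exact e1 f
    | sec v => exact e2 v
    | fld Y => exact e3 Y
    | add _ _ ih ih' => rw [map_add, map_add, ih, ih']
    | smul c _ ih => rw [map_smul, map_smul, ih]
    | mul a b ih ih' =>
      rw [hP.leibniz _ _ _ hG _ a.mem_deg, hP'.leibniz _ _ _ hG _ a.mem_deg, ih, ih']
    | mono _ ih => exact ih
  have g1 : ∀ f {m l T H}, S.Sym m l T H → P (S.cO (S.re f)) H = P' (S.cO (S.re f)) H :=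
    fun f => key (S.cO_mem _) (h1 f) (h2 f) fun Y => swap (Sym.fld Y) (Sym.fn f) (h4 Y f)
  have g2 : ∀ v {m l T H}, S.Sym m l T H → P (S.secO v) H = P' (S.secO v) H :=
    fun v => key (S.secO_mem _) (fun f => swap (Sym.fn f) (Sym.sec v) (h2 f v)) (h3 v)
      fun Y => swap (Sym.fld Y) (Sym.sec v) (h5 Y v)
  have g3 : ∀ Y {m l T H}, S.Sym m l T H → P (S.fldO Y) H = P' (S.fldO Y) H :=
    fun Y => key (S.fldO_mem _) (h4 Y) (h5 Y) (h6 Y)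
  refine LinearMap.ext fun G => LinearMap.ext fun H => ?_
  refine symbol_induction (S := S) (p := fun G => P G H = P' G H) (fun {m k T G} h => ?_)
    (fun G G' h h' => by rw [map_add, map_add, LinearMap.add_apply, LinearMap.add_apply, h, h']) G
  refine symbol_induction (S := S) (p := fun H => P G H = P' G H) (fun {m' l T' H} h' => ?_)
    (fun G G' h h' => by rw [map_add, map_add, h, h']) H
  exact key h.mem_deg (fun f => swap (Sym.fn f) h (g1 f h)) (fun f => swap (Sym.sec f) h (g2 f h))
    (fun f => swap (Sym.fld f) h (g3 f h)) h'

/-- The symbol map is determined by its values on generators. -/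
theorem IsSymbolic.symbolEquiv_unique {br : A →ₗ[ℂ] A →ₗ[ℂ] A} {F : ℤ → Submodule ℂ A}
    (hS : S.IsSymbolic br F) {D : Subalgebra ℂ A} (hF : IsPoissonFiltration D br F)
    {Φ : Gr F ≃ₗ[ℂ] O} (hmul : ∀ a b, Φ (hF.grMul a b) = Φ a * Φ b)
    (h1 : ∀ f h, Φ (grClass F 0 ⟨S.cA (S.re f), h⟩) = S.cO (S.re f))
    (h2 : ∀ v h, Φ (grClass F 1 ⟨S.sec v, h⟩) = S.secO v)
    (h3 : ∀ Y h, Φ (grClass F 2 ⟨S.fld Y, h⟩) = S.fldO Y) : Φ = hS.symbolEquiv := by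
  have key : ∀ {m k T G}, S.Sym m k T G → ∀ h, Φ (grClass F k ⟨T, h⟩) = G := by
    intro m k T G h
    induction h with
    | zero m k =>
      intro h
      rw [show (⟨0, h⟩ : F k) = 0 from rfl, map_zero, map_zero]
    | fn f => exact h1 f
    | sec v => exact h2 v
    | fld Y => exact h3 Y
    | @add m k T T' G G' a b ih ih' =>
      intro h
      rw [show (⟨T + T', h⟩ : F k) = ⟨T, hS.mem a⟩ + ⟨T', hS.mem b⟩ from rfl, map_add, map_add,
        ih, ih']
    | @smul m k T G c a ih =>
      intro h
      rw [show (⟨c • T, h⟩ : F k) = c • ⟨T, hS.mem a⟩ from rfl, map_smul, map_smul, ih]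
    | @mul m k m' k' T T' G G' a b ih ih' =>
      intro h
      rw [← ih (hS.mem a), ← ih' (hS.mem b), ← hmul, IsPoissonFiltration.grMul, grMap₂_grClass]
      exact congrArg Φ (grClass_congr (add_zero _).symm rfl _ _)
    | mono _ ih => exact ih
  refine LinearEquiv.toLinearMap_injective (Gr.hom_ext F fun k a => ?_)
  obtain ⟨m, T, G, h, e⟩ := hS.exists_grClass k a
  change Φ (grClass F k a) = hS.symbolEquiv (grClass F k a)
  rw [e, key h, hS.symbolEquiv_sym h]

end SymbolData

end AbstractCalculus


/-! ## Smooth covectors and finite generation of sections -/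

section Generation

variable {n : ℕ} {M : Type*} [TopologicalSpace M] [ChartedSpace (EuclideanSpace ℝ (Fin n)) M]
  {F : Type*} [NormedAddCommGroup F] [NormedSpace ℝ F]
  {V : M → Type*} [TopologicalSpace (TotalSpace F V)] [∀ x, TopologicalSpace (V x)]
  [∀ x, AddCommGroup (V x)] [∀ x, Module ℝ (V x)]
  [FiberBundle F V] [VectorBundle ℝ F V]

variable (n F V) in
/-- A smooth family of linear forms on the fibres of a vector bundle. -/
structure SmoothCovector where
  toFun : ∀ x, V x →ₗ[ℝ] ℝ
  smooth : ∀ s : Cₛ^∞⟮𝓡 n; F, V⟯, ContMDiff (𝓡 n) 𝓘(ℝ, ℝ) ∞ (fun x => toFun x (s x))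

theorem exists_cutoff [T2Space M] [SecondCountableTopology M] [IsManifold (𝓡 n) ∞ M]
    {s t : Set M} (hs : IsClosed s) (ht : IsOpen t) (hst : s ⊆ t) :
    ∃ χ : SFun n M, (∀ x ∈ s, ∀ᶠ y in 𝓝 x, χ y = 1) ∧ tsupport χ ⊆ t := by
  have := Manifold.locallyCompact_of_finiteDimensional (M := M) (𝓡 n)
  obtain ⟨u, hu, hsu, hut⟩ := normal_exists_closure_subset hs ht hst
  obtain ⟨χ, h1, h2, -⟩ := exists_contMDiffMap_one_nhds_of_subset_interior (𝓡 n) (n := ⊤) hs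
    (t := u) (by rwa [hu.interior_eq])
  refine ⟨χ, fun x hx => ?_, (closure_mono fun x hx => ?_).trans hut⟩
  · exact (eventually_nhdsSet_iff_forall.1 h1) x hx
  · by_contra hxu
    exact hx (h2 x hxu)

theorem exists_cutoff_at [T2Space M] [SecondCountableTopology M] [IsManifold (𝓡 n) ∞ M]
    {x₀ : M} {t : Set M} (ht : t ∈ 𝓝 x₀) :
    ∃ χ : SFun n M, (∀ᶠ y in 𝓝 x₀, χ y = 1) ∧ tsupport χ ⊆ t := by
  obtain ⟨u, hut, hu, hx⟩ := mem_nhds_iff.1 ht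
  obtain ⟨χ, h1, h2⟩ := exists_cutoff (n := n) (isClosed_singleton (x := x₀)) hu
    (Set.singleton_subset_iff.2 hx)
  exact ⟨χ, h1 x₀ rfl, h2.trans hut⟩

variable
  [ContMDiffVectorBundle ∞ F V (𝓡 n)] [FiniteDimensional ℝ F]

omit [FiniteDimensional ℝ F]
  [ContMDiffVectorBundle ∞ F V (𝓡 n)] in
theorem contMDiffVectorBundle_one [ContMDiffVectorBundle ∞ F V (𝓡 n)] :
    ContMDiffVectorBundle 1 F V (𝓡 n) :=
  ContMDiffVectorBundle.of_le (n := ∞) (by simp)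

/-- Near each point there is a local frame given by global sections and global covectors. -/
theorem exists_local_frame [T2Space M] [SecondCountableTopology M] [IsManifold (𝓡 n) ∞ M]
    (x₀ : M) : ∃ (θ : Fin (Module.finrank ℝ F) → SmoothCovector n F V)
      (ξ : Fin (Module.finrank ℝ F) → Cₛ^∞⟮𝓡 n; F, V⟯), ∀ᶠ x in 𝓝 x₀,
        (∀ v : V x, v = ∑ i, (θ i).toFun x v • ξ i x) ∧
          ∀ i j, (θ i).toFun x (ξ j x) = if i = j then 1 else 0 := by
  have := contMDiffVectorBundle_one (n := n) (F := F) (V := V)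
  let e := trivializationAt F V x₀
  let b := Module.finBasis ℝ F
  have he : e.baseSet ∈ 𝓝 x₀ := e.open_baseSet.mem_nhds (mem_baseSet_trivializationAt F V x₀)
  obtain ⟨χ, h1, h2⟩ := exists_cutoff_at (n := n) he
  -- The local frame and its coframe become global after multiplication by a cutoff that is 1 near
  -- `x₀`.
  refine ⟨fun i => ⟨fun x => χ x • e.localFrameCoeff (𝓡 n) b i x, fun s => ?_⟩,
    fun i => ⟨fun x => χ x • e.localFrame b i x, ?_⟩, ?_⟩
  · refine contMDiff_of_tsupport fun x hx => ?_
    have hx' : x ∈ e.baseSet := by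
      refine h2 (closure_mono (fun y hy => ?_) hx)
      intro h
      simp [h] at hy
    exact (χ.contMDiff x).smul (contMDiffAt_localFrameCoeff b hx' (s.contMDiff x) i)
  · exact ContMDiffOn.smul_section_of_tsupport χ.contMDiff.contMDiffOn e.open_baseSet h2
      (e.contMDiffOn_localFrame_baseSet ∞ b i)
  · filter_upwards [h1, he] with x hx hxe
    refine ⟨fun v => ?_, fun i j => ?_⟩
    · obtain ⟨s, rfl⟩ : ∃ s : ∀ y, V y, s x = v := by
        classical exact ⟨Function.update 0 x v, Function.update_self ..⟩
      simpa [hx] using! e.eq_sum_localFrameCoeff_smul (I := 𝓡 n) (b := b) (s := s) hxe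
    · have := e.localFrameCoeff_apply_of_mem_baseSet (I := 𝓡 n) b hxe (e.localFrame b j) i
      change χ x • (e.localFrameCoeff (𝓡 n) b i x) (χ x • e.localFrame b j x) = _
      rw [hx, one_smul, one_smul, this, e.localFrame_apply_of_mem_baseSet b hxe]
      simp [Finsupp.single_apply, eq_comm]

/-- The images of the fibres over a manifold of dimension `n` of a bundle of rank `r` under finitely
many covectors have dimension at most `n + r`. -/
theorem dimH_covectors_le [T2Space M] [SecondCountableTopology M] [IsManifold (𝓡 n) ∞ M] {N : ℕ}
    (θ : Fin N → SmoothCovector n F V) :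
    dimH (⋃ x : M, Set.range fun (v : V x) (i : Fin N) => (θ i).toFun x v) ≤
      ((n + Module.finrank ℝ F : ℕ) : ENNReal) := by
  set r := Module.finrank ℝ F
  have key : ∀ x₀ : M, ∃ U ∈ 𝓝 x₀,
      dimH (⋃ x ∈ U, Set.range fun (v : V x) (i : Fin N) => (θ i).toFun x v) ≤ (n + r : ℕ) := by
    intro x₀
    obtain ⟨θ', ξ, hθ⟩ := exists_local_frame (n := n) (F := F) (V := V) x₀
    let ψ := extChartAt (𝓡 n) x₀
    obtain ⟨ε, hε, hB⟩ := Metric.mem_nhds_iff.1 (extChartAt_target_mem_nhds (I := 𝓡 n) x₀)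
    -- Base coordinates and frame coefficients parametrize the fibres near `x₀` by a part of a space
    -- of dimension `n + r`; a `C¹` map does not raise Hausdorff dimension.
    let G : EuclideanSpace ℝ (Fin n) × (Fin r → ℝ) → (Fin N → ℝ) := fun p i =>
      ∑ j, p.2 j * (θ i).toFun (ψ.symm p.1) (ξ j (ψ.symm p.1))
    have hG : ContDiffOn ℝ 1 G (Metric.ball (ψ x₀) ε ×ˢ Set.univ) := by
      refine contDiffOn_pi.2 fun i => ContDiffOn.sum fun j _ => ContDiffOn.mul (by fun_prop) ?_
      have h1 : ContDiffOn ℝ 1 (fun y => (θ i).toFun (ψ.symm y) (ξ j (ψ.symm y)))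
          (Metric.ball (ψ x₀) ε) := by
        rw [← contMDiffOn_iff_contDiffOn]
        have h2 := ((θ i).smooth (ξ j)).of_le (m := 1) (by simp)
        exact h2.comp_contMDiffOn (((contMDiffOn_extChartAt_symm (n := ∞) x₀).of_le (by simp)).mono hB)
      exact h1.comp contDiffOn_fst fun p hp => hp.1
    refine ⟨_, inter_mem hθ (inter_mem (extChartAt_source_mem_nhds (I := 𝓡 n) x₀)
      ((continuousAt_extChartAt (I := 𝓡 n) x₀).preimage_mem_nhds (Metric.ball_mem_nhds _ hε))), ?_⟩
    refine (dimH_mono (t := G '' (Metric.ball (ψ x₀) ε ×ˢ Set.univ)) ?_).trans ?_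
    · refine Set.iUnion₂_subset fun x hx => ?_
      rintro _ ⟨v, rfl⟩
      refine ⟨(ψ x, fun j => (θ' j).toFun x v), ⟨hx.2.2, trivial⟩, funext fun i => ?_⟩
      have h3 : ψ.symm (ψ x) = x := ψ.left_inv hx.2.1
      have h4 : ∀ y, y = x → ∀ j, (θ i).toFun y (ξ j y) = (θ i).toFun x (ξ j x) := by
        rintro y rfl j; rfl
      conv_rhs => rw [hx.1.1 v]
      simp [G, h4 _ h3]
      rfl
    · refine (hG.dimH_image_le ((convex_ball _ _).prod convex_univ) subset_rfl).trans ?_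
      refine (dimH_mono (Set.subset_univ _)).trans ?_
      rw [Real.dimH_univ_eq_finrank]
      simp
  choose U hU hU' using key
  -- The dimension of a countable union is the supremum of the dimensions.
  obtain ⟨s, hs, hs'⟩ := TopologicalSpace.countable_cover_nhds hU
  refine (dimH_mono (t := ⋃ x₀ ∈ s, ⋃ x ∈ U x₀,
    Set.range fun (v : V x) (i : Fin N) => (θ i).toFun x v) ?_).trans ?_
  · refine Set.iUnion_subset fun x => ?_
    obtain ⟨x₀, hx₀, hx⟩ := Set.mem_iUnion₂.1 (hs'.symm ▸ Set.mem_univ x : x ∈ ⋃ x ∈ s, U x)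
    exact fun y hy => Set.mem_iUnion₂.2 ⟨x₀, hx₀, Set.mem_iUnion₂.2 ⟨x, hx, hy⟩⟩
  · rw [dimH_bUnion hs]
    exact iSup₂_le fun x _ => hU' x

end Generation


/-! ### Finitely many global objects that separate all fibres, by a projection argument of Whitney
type -/

section Generation

variable {n : ℕ} {M : Type*} [TopologicalSpace M] [ChartedSpace (EuclideanSpace ℝ (Fin n)) M]
  [T2Space M] [SecondCountableTopology M] [IsManifold (𝓡 n) ∞ M]
  {F : Type*} [NormedAddCommGroup F] [NormedSpace ℝ F]
  {V : M → Type*} [TopologicalSpace (TotalSpace F V)] [∀ x, TopologicalSpace (V x)]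
  [∀ x, AddCommGroup (V x)] [∀ x, Module ℝ (V x)]
  [FiberBundle F V] [VectorBundle ℝ F V]
  [ContMDiffVectorBundle ∞ F V (𝓡 n)] [FiniteDimensional ℝ F]
  {𝒯 : Type*} [AddCommGroup 𝒯] [Module ℝ 𝒯]

/-- The covectors `d (t i) x` separate the points of the fibres over `K`. -/
def Separates {V : M → Type*} [∀ x, AddCommGroup (V x)] [∀ x, Module ℝ (V x)] {ι : Type*}
    (d : 𝒯 → ∀ x, V x →ₗ[ℝ] ℝ) (t : ι → 𝒯) (K : Set M) : Prop :=
  ∀ x ∈ K, ∀ v : V x, (∀ i, d (t i) x v = 0) → v = 0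

variable (d : 𝒯 →ₗ[ℝ] ∀ x, V x →ₗ[ℝ] ℝ)
  (hd : ∀ (t : 𝒯) (s : Cₛ^∞⟮𝓡 n; F, V⟯), ContMDiff (𝓡 n) 𝓘(ℝ, ℝ) ∞ (fun x => d t x (s x)))
include hd

/-- If there are more than `n + r` separating covectors, one of them can be spared after a linear
change. -/
theorem Separates.reduce {N : ℕ} (hN : n + Module.finrank ℝ F < N + 1) {t : Fin (N + 1) → 𝒯}
    {K : Set M} (ht : Separates d t K) : ∃ t' : Fin N → 𝒯, Separates d t' K := by
  let θ : Fin (N + 1) → SmoothCovector n F V := fun i => ⟨d (t i), hd (t i)⟩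
  have h1 : dimH (insert 0 (⋃ x : M, Set.range fun (v : V x) (i : Fin (N + 1)) =>
      (θ i).toFun x v)) < Module.finrank ℝ (Fin (N + 1) → ℝ) := by
    rw [Set.insert_eq, dimH_union, dimH_singleton, max_lt_iff]
    refine ⟨by simp, (dimH_covectors_le θ).trans_lt ?_⟩
    rw [Module.finrank_fin_fun]
    exact_mod_cast hN
  -- The image of the total space has too small a dimension to be everything, so it misses some `l ≠
  -- 0`. Project along `l`: a vector killed by the new covectors has its image on the line through
  -- `l`, and a nonzero such image could be rescaled to `l` itself.
  obtain ⟨l, hl⟩ := (dense_compl_of_dimH_lt_finrank h1).nonempty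
  rw [Set.mem_compl_iff, Set.mem_insert_iff, not_or] at hl
  obtain ⟨p, hp⟩ := Function.ne_iff.1 hl.1
  refine ⟨fun i => t (p.succAbove i) - (l (p.succAbove i) / l p) • t p, fun x hx v hv => ?_⟩
  have h2 : ∀ i, d (t i) x v = (l i / l p) * d (t p) x v := fun i => by
    rcases Fin.eq_self_or_eq_succAbove p i with rfl | ⟨j, rfl⟩
    · rw [div_self hp, one_mul]
    · have := hv j
      simpa [sub_eq_zero] using! this
  by_cases h0 : d (t p) x v = 0
  · exact ht x hx v fun i => by rw [h2, h0, mul_zero]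
  · refine (hl.2 (Set.mem_iUnion.2 ⟨x, (l p / d (t p) x v) • v, funext fun i => ?_⟩)).elim
    change d (t i) x ((l p / d (t p) x v) • v) = l i
    have hp' : l p ≠ 0 := hp
    rw [map_smul, smul_eq_mul, h2 i]
    field_simp

/-- Pad with zeros and remove superfluous covectors one by one. That the final number does not
depend on `K` is what allows gluing over infinitely many compact sets. -/
theorem Separates.exists_fin {ι : Type*} [Fintype ι] {t : ι → 𝒯} {K : Set M}
    (ht : Separates d t K) : ∃ t' : Fin (n + Module.finrank ℝ F) → 𝒯, Separates d t' K := by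
  obtain ⟨N, hN, t', ht'⟩ : ∃ N, n + Module.finrank ℝ F ≤ N ∧
      ∃ t' : Fin N → 𝒯, Separates d t' K := by
    refine ⟨Fintype.card ι + (n + Module.finrank ℝ F), by omega,
      Fin.append (t ∘ (Fintype.equivFin ι).symm) 0, fun x hx v hv => ht x hx v fun i => ?_⟩
    simpa using hv (Fin.castAdd _ (Fintype.equivFin ι i))
  obtain ⟨k, rfl⟩ := Nat.exists_eq_add_of_le hN
  clear hN ht t
  induction k with
  | zero => exact ⟨t', ht'⟩
  | succ k ih =>
    obtain ⟨t'', h⟩ := Separates.reduce d hd (Nat.lt_succ_of_le (Nat.le_add_right _ _)) ht'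
    exact ih t'' h

theorem exists_separates_of_isCompact (hloc : ∀ x₀ : M, ∃ (ι : Type) (_ : Fintype ι) (t : ι → 𝒯),
    ∃ U ∈ 𝓝 x₀, Separates d t U) {K : Set M} (hK : IsCompact K) :
    ∃ t : Fin (n + Module.finrank ℝ F) → 𝒯, Separates d t K := by
  suffices ∃ (ι : Type) (_ : Fintype ι) (t : ι → 𝒯), Separates d t K by
    obtain ⟨ι, _, t, ht⟩ := this
    exact ht.exists_fin d hd
  refine hK.induction_on (p := fun K => ∃ (ι : Type) (_ : Fintype ι) (t : ι → 𝒯),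
    Separates d t K) ⟨Empty, inferInstance, Empty.elim, by simp [Separates]⟩ ?_ ?_ ?_
  · rintro s s' hs ⟨ι, h, t, ht⟩
    exact ⟨ι, h, t, fun x hx => ht x (hs hx)⟩
  · rintro s s' ⟨ι, h, t, ht⟩ ⟨ι', h', t', ht'⟩
    refine ⟨ι ⊕ ι', inferInstance, Sum.elim t t', fun x hx v hv => ?_⟩
    rcases hx with hx | hx
    · exact ht x hx v fun i => hv (Sum.inl i)
    · exact ht' x hx v fun i => hv (Sum.inr i)
  · intro x _
    obtain ⟨ι, h, t, U, hU, ht⟩ := hloc x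
    exact ⟨U, mem_nhdsWithin_of_mem_nhds hU, ι, h, t, ht⟩

/-- Finitely many global objects separate the points of all fibres. -/
theorem exists_separates (hloc : ∀ x₀ : M, ∃ (ι : Type) (_ : Fintype ι) (t : ι → 𝒯),
    ∃ U ∈ 𝓝 x₀, Separates d t U)
    (hglue : ∀ (χ : ℕ → SFun n M) (t : ℕ → 𝒯), LocallyFinite (fun i => Function.support (χ i)) →
      ∃ t' : 𝒯, ∀ i x, (∀ᶠ y in 𝓝 x, χ i y = 1 ∧ ∀ j ≠ i, χ j y = 0) → d t' x = d (t i) x) :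
    ∃ t : Fin 3 × Fin (n + Module.finrank ℝ F) → 𝒯, Separates d t Set.univ := by
  have := Manifold.locallyCompact_of_finiteDimensional (M := M) (𝓡 n)
  let K := (CompactExhaustion.choice M).shiftr
  have hK : ∀ {i j}, i < j → K i ⊆ interior (K j) := fun h =>
    (K.subset_interior_succ _).trans (interior_mono (K.subset h))
  choose t ht using fun i => exists_separates_of_isCompact d hd hloc (K.isCompact i)
  -- `O i` is an open neighbourhood of the shell `K (i + 1) \ interior (K i)`. It meets `O j` only
  -- for `|i - j| ≤ 2`, so three colours suffice. The index `i - 1` is truncated at 0, where the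
  -- shifted exhaustion is empty.
  let O : ℕ → Set M := fun i => interior (K (i + 2)) \ K (i - 1)
  have hO : ∀ i, IsOpen (O i) := fun i => isOpen_interior.sdiff (K.isCompact _).isClosed
  have hOd : ∀ i j, i + 3 ≤ j → Disjoint (O i) (O j) := fun i j h =>
    Set.disjoint_left.2 fun x hx hx' => hx'.2 (K.subset (by omega) (interior_subset hx.1))
  have hA : ∀ i, K (i + 1) \ interior (K i) ⊆ O i := fun i x hx => by
    refine ⟨hK (by omega) hx.1, fun h => ?_⟩
    rcases i with _ | i
    · exact (h : x ∈ (∅ : Set M))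
    · exact hx.2 (hK (by omega) h)
  choose χ hχ hχ' using fun i => exists_cutoff (n := n)
    ((K.isCompact (i + 1)).isClosed.sdiff (isOpen_interior (s := K i))) (hO i) (hA i)
  have hχ0 : ∀ i x, x ∉ O i → χ i x = 0 := fun i x hx => by
    by_contra h
    exact hx (hχ' i (subset_tsupport _ h))
  have hfin : ∀ c : Fin 3, LocallyFinite
      fun k => Function.support (χ (3 * k + c)) := fun c x => by
    refine ⟨interior (K (K.find x + 1)), isOpen_interior.mem_nhds (hK (by omega) (K.mem_find x)), ?_⟩
    refine (Set.finite_lt_nat (K.find x + 3)).subset fun k ⟨y, hy, hy'⟩ => ?_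
    by_contra hk
    refine hy (hχ0 _ _ fun h => h.2 (K.subset ?_ (interior_subset hy')))
    simp only [Set.mem_ofPred_eq] at hk
    omega
  -- For each colour and each position in the lists, the objects on the shells of that colour are
  -- glued into one. The supports are disjoint, so on its own shell every piece is seen unchanged.
  choose T hT using fun (p : Fin 3 × Fin (n + Module.finrank ℝ F)) =>
    hglue (fun k => χ (3 * k + p.1)) (fun k => t (3 * k + p.1 + 1) p.2) (hfin p.1)
  refine ⟨T, fun x _ v hv => ?_⟩
  obtain ⟨i, hi⟩ : ∃ i, x ∈ K (i + 1) \ interior (K i) := by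
    refine ⟨(CompactExhaustion.choice M).find x, ?_⟩
    have h := (CompactExhaustion.choice M).mem_sdiff_shiftr_find x
    exact ⟨h.1, fun h' => h.2 (interior_subset h')⟩
  refine ht (i + 1) x hi.1 v fun a => ?_
  have h3 : 3 * (i / 3) + i % 3 = i := Nat.div_add_mod i 3
  have h1 := hT (⟨i % 3, Nat.mod_lt _ (by norm_num)⟩, a) (i / 3) x ?_
  · simp only [h3] at h1
    rw [← h1]
    exact hv _
  · simp only [h3]
    filter_upwards [hχ i x hi, (hO i).mem_nhds (hA i hi)] with y hy hy'
    refine ⟨hy, fun j hj => hχ0 _ _ fun h => ?_⟩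
    rcases lt_or_gt_of_ne hj with hj | hj
    · exact (hOd _ _ (by omega)).le_bot ⟨h, hy'⟩
    · exact (hOd _ _ (by omega)).le_bot ⟨hy', h⟩

end Generation


/-! ### Dual sections of separating covectors -/

theorem finsum_smul_eq {α : Type*} [AddCommGroup α] [Module ℝ α] (c : ℕ → ℝ) (a : ℕ → α) (i : ℕ)
    (h : c i = 1) (h' : ∀ j ≠ i, c j = 0) : ∑ᶠ j, c j • a j = a i := by
  rw [finsum_eq_single _ i fun j hj => by rw [h' j hj, zero_smul], h, one_smul]

section Generation

variable {n : ℕ} {M : Type*} [TopologicalSpace M] [ChartedSpace (EuclideanSpace ℝ (Fin n)) M]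

theorem contMDiffAt_finset_sum {α : Type*} (s : Finset α) {f : α → M → ℝ} {x₀ : M}
    (h : ∀ i ∈ s, ContMDiffAt (𝓡 n) 𝓘(ℝ, ℝ) ∞ (f i) x₀) :
    ContMDiffAt (𝓡 n) 𝓘(ℝ, ℝ) ∞ (fun x => ∑ i ∈ s, f i x) x₀ := by
  classical
  induction s using Finset.induction_on with
  | empty => simpa using contMDiffAt_const
  | insert a s ha ih =>
    simp only [Finset.sum_insert ha]
    exact (h a (by simp)).add (ih fun i hi => h i (by simp [hi]))

theorem contMDiffAt_finset_prod {α : Type*} (s : Finset α) {f : α → M → ℝ} {x₀ : M}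
    (h : ∀ i ∈ s, ContMDiffAt (𝓡 n) 𝓘(ℝ, ℝ) ∞ (f i) x₀) :
    ContMDiffAt (𝓡 n) 𝓘(ℝ, ℝ) ∞ (fun x => ∏ i ∈ s, f i x) x₀ := by
  classical
  induction s using Finset.induction_on with
  | empty => simpa using contMDiffAt_const
  | insert a s ha ih =>
    simp only [Finset.prod_insert ha]
    exact (h a (by simp)).mul (ih fun i hi => h i (by simp [hi]))

theorem contMDiffAt_det {r : ℕ} {A : M → Matrix (Fin r) (Fin r) ℝ} {x₀ : M}
    (h : ∀ i j, ContMDiffAt (𝓡 n) 𝓘(ℝ, ℝ) ∞ (fun x => A x i j) x₀) :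
    ContMDiffAt (𝓡 n) 𝓘(ℝ, ℝ) ∞ (fun x => (A x).det) x₀ := by
  simp only [Matrix.det_apply']
  exact contMDiffAt_finset_sum _ fun σ _ => contMDiffAt_const.mul
    (contMDiffAt_finset_prod _ fun i _ => h _ _)

theorem contMDiffAt_matrix_inv {r : ℕ} {A : M → Matrix (Fin r) (Fin r) ℝ} {x₀ : M}
    (h : ∀ i j, ContMDiffAt (𝓡 n) 𝓘(ℝ, ℝ) ∞ (fun x => A x i j) x₀) (h0 : (A x₀).det ≠ 0)
    (i j : Fin r) : ContMDiffAt (𝓡 n) 𝓘(ℝ, ℝ) ∞ (fun x => (A x)⁻¹ i j) x₀ := by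
  simp only [Matrix.inv_def, Matrix.smul_apply, Ring.inverse_eq_inv', smul_eq_mul,
    Matrix.adjugate_apply]
  have h1 : ContMDiffAt (𝓡 n) 𝓘(ℝ, ℝ) ∞ (fun x => ((A x).det)⁻¹) x₀ :=
    (contDiffAt_inv ℝ h0).contMDiffAt.comp x₀ (contMDiffAt_det h)
  refine h1.mul (contMDiffAt_det fun k l => ?_)
  by_cases hk : k = j
  · subst hk
    simpa using contMDiffAt_const
  · simpa [Matrix.updateRow_ne hk] using h k l

variable [T2Space M] [SecondCountableTopology M] [IsManifold (𝓡 n) ∞ M]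
  {F : Type*} [NormedAddCommGroup F] [NormedSpace ℝ F]
  {V : M → Type*} [TopologicalSpace (TotalSpace F V)] [∀ x, TopologicalSpace (V x)]
  [∀ x, AddCommGroup (V x)] [∀ x, Module ℝ (V x)]
  [FiberBundle F V] [VectorBundle ℝ F V]
  [ContMDiffVectorBundle ∞ F V (𝓡 n)] [FiniteDimensional ℝ F]

omit [ContMDiffVectorBundle ∞ F V (𝓡 n)] [T2Space M] [SecondCountableTopology M]
  [IsManifold (𝓡 n) ∞ M] [ChartedSpace (EuclideanSpace ℝ (Fin n)) M] in
theorem finiteDimensional_fiber (F : Type*) [NormedAddCommGroup F] [NormedSpace ℝ F]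
    {V : M → Type*} [TopologicalSpace (TotalSpace F V)] [∀ x, TopologicalSpace (V x)]
    [∀ x, AddCommGroup (V x)] [∀ x, Module ℝ (V x)] [FiberBundle F V] [VectorBundle ℝ F V]
    [FiniteDimensional ℝ F] (x : M) : FiniteDimensional ℝ (V x) :=
  ((trivializationAt F V x).linearEquivAt ℝ x
    (mem_baseSet_trivializationAt F V x)).symm.finiteDimensional

omit [ContMDiffVectorBundle ∞ F V (𝓡 n)] [T2Space M] [SecondCountableTopology M]
  [IsManifold (𝓡 n) ∞ M] [ChartedSpace (EuclideanSpace ℝ (Fin n)) M] in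
theorem finrank_fiber (F : Type*) [NormedAddCommGroup F] [NormedSpace ℝ F]
    {V : M → Type*} [TopologicalSpace (TotalSpace F V)] [∀ x, TopologicalSpace (V x)]
    [∀ x, AddCommGroup (V x)] [∀ x, Module ℝ (V x)] [FiberBundle F V] [VectorBundle ℝ F V]
    (x : M) : Module.finrank ℝ (V x) = Module.finrank ℝ F :=
  ((trivializationAt F V x).linearEquivAt ℝ x (mem_baseSet_trivializationAt F V x)).finrank_eq

/-- Separating covectors have dual sections. -/
theorem exists_dual_sections {ι : Type*} [Fintype ι] (θ : ι → SmoothCovector n F V)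
    (hθ : ∀ x (v : V x), (∀ i, (θ i).toFun x v = 0) → v = 0) :
    ∃ Z : ι → Cₛ^∞⟮𝓡 n; F, V⟯, ∀ x (v : V x), v = ∑ i, (θ i).toFun x v • Z i x := by
  -- The Gram form `∑ θ_i ⊗ θ_i` is positive definite because the `θ_i` separate. The section `Z i`
  -- is the vector that represents `θ_i` with respect to it.
  obtain ⟨B, hB⟩ : ∃ B : ∀ x, V x →ₗ[ℝ] Module.Dual ℝ (V x),
      ∀ x v w, B x v w = ∑ i, (θ i).toFun x v * (θ i).toFun x w :=
    ⟨fun x => ∑ i, ((θ i).toFun x).smulRight ((θ i).toFun x), fun x v w => by simp⟩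
  have hBinj : ∀ x, Function.Injective (B x) := fun x => by
    refine (injective_iff_map_eq_zero _).2 fun v hv => hθ x v fun i => ?_
    have h1 : ∑ i, (θ i).toFun x v * (θ i).toFun x v = 0 := by rw [← hB, hv]; rfl
    exact mul_self_eq_zero.1 ((Finset.sum_eq_zero_iff_of_nonneg fun i _ => mul_self_nonneg _).1 h1 i
      (Finset.mem_univ i))
  have hBsurj : ∀ x, Function.Surjective (B x) := fun x => by
    have := finiteDimensional_fiber F (V := V) x
    exact (LinearMap.injective_iff_surjective_of_finrank_eq_finrank
      (Subspace.dual_finrank_eq).symm).1 (hBinj x)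
  choose Z hZ using fun (i : ι) x => hBsurj x ((θ i).toFun x)
  have hv : ∀ x (v : V x), v = ∑ i, (θ i).toFun x v • Z i x := fun x v => by
    refine hBinj x (LinearMap.ext fun w => ?_)
    rw [hB, map_sum, LinearMap.sum_apply]
    exact Finset.sum_congr rfl fun i _ => by rw [map_smul, hZ]; rfl
  refine ⟨fun i => ⟨Z i, fun x₀ => ?_⟩, hv⟩
  obtain ⟨θ', ξ, h0⟩ := exists_local_frame (n := n) (F := F) (V := V) x₀
  -- Smoothness of `Z i` is checked in a local frame, where `Z i` is the inverse Gram matrix applied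
  -- to the coefficients of `θ_i`.
  let A : M → Matrix (Fin (Module.finrank ℝ F)) (Fin (Module.finrank ℝ F)) ℝ :=
    fun x => Matrix.of fun j k => B x (ξ j x) (ξ k x)
  have hA : ∀ j k, ContMDiff (𝓡 n) 𝓘(ℝ, ℝ) ∞ (fun x => A x j k) := fun j k x => by
    simp only [A, Matrix.of_apply, hB]
    exact contMDiffAt_finset_sum _ fun i _ => ((θ i).smooth _ x).mul ((θ i).smooth _ x)
  have hdet : ∀ᶠ x in 𝓝 x₀, (A x).det ≠ 0 := by
    filter_upwards [h0] with x hx h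
    obtain ⟨c, hc, hc'⟩ := Matrix.exists_mulVec_eq_zero_iff.2 h
    refine hc (funext fun j => ?_)
    have h1 : B x (∑ j, c j • ξ j x) = 0 := by
      refine LinearMap.ext fun w => ?_
      rw [hx.1 w, map_sum]
      refine Finset.sum_eq_zero fun k _ => ?_
      have := congrFun hc' k
      simp only [Matrix.mulVec, dotProduct, A, Matrix.of_apply, Pi.zero_apply] at this
      rw [map_smul, map_sum, LinearMap.sum_apply, smul_eq_mul]
      refine mul_eq_zero_of_right _ (Eq.trans (Finset.sum_congr rfl fun j _ => ?_) this)
      rw [map_smul, LinearMap.smul_apply, smul_eq_mul, mul_comm, hB, hB]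
      simp only [mul_comm]
    have h2 := hBinj x (h1.trans (map_zero _).symm)
    have h3 := congrArg ((θ' j).toFun x) h2
    simpa [hx.2] using h3
  have hloc : ∀ᶠ x in 𝓝 x₀, Z i x =
      ∑ j, (∑ k, (A x)⁻¹ j k * (θ i).toFun x (ξ k x)) • ξ j x := by
    filter_upwards [h0, hdet] with x hx hd
    refine hBinj x (LinearMap.ext fun w => ?_)
    have h1 : (A x).mulVec ((A x)⁻¹.mulVec fun k => (θ i).toFun x (ξ k x)) =
        fun k => (θ i).toFun x (ξ k x) := by
      rw [Matrix.mulVec_mulVec, Matrix.mul_nonsing_inv _ (isUnit_iff_ne_zero.2 hd),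
        Matrix.one_mulVec]
    rw [hZ, hx.1 w, map_sum, map_sum]
    refine Finset.sum_congr rfl fun k _ => ?_
    rw [map_smul, map_smul]
    congr 1
    have h2 := (congrFun h1 k).symm
    simp only [Matrix.mulVec, dotProduct, A, Matrix.of_apply] at h2
    rw [h2, map_sum, LinearMap.sum_apply]
    refine Finset.sum_congr rfl fun j _ => ?_
    rw [map_smul, LinearMap.smul_apply, smul_eq_mul, mul_comm, hB, hB]
    simp only [mul_comm]
    rfl
  have h1 : ContMDiffAt (𝓡 n) ((𝓡 n).prod 𝓘(ℝ, F)) ∞ (fun x => TotalSpace.mk' F x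
      (∑ j, (∑ k, (A x)⁻¹ j k * (θ i).toFun x (ξ k x)) • ξ j x)) x₀ :=
    ContMDiffAt.sum_section fun j _ => ContMDiffAt.smul_section
      (contMDiffAt_finset_sum _ fun k _ => (contMDiffAt_matrix_inv (fun j k => hA j k x₀)
        hdet.self_of_nhds j k).mul ((θ i).smooth _ x₀)) ((ξ j).contMDiff x₀)
  refine h1.congr_of_eventuallyEq ?_
  filter_upwards [hloc] with x hx
  rw [hx]

/-! ### Vector fields and sections of a pseudo-Euclidean bundle -/

/-- The derivative of a function along a vector field. -/
def VField.app (X : VField n M) (f : SFun n M) : SFun n M where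
  val x := mvfderiv (𝓡 n) f x (X x)
  property := by
    have h1 : ContMDiff (𝓡 n) (𝓘(ℝ, ℝ)).tangent ∞
        (tangentMap (𝓡 n) 𝓘(ℝ, ℝ) f ∘ fun x => TotalSpace.mk' (EuclideanSpace ℝ (Fin n)) x (X x)) :=
      (f.contMDiff.contMDiff_tangentMap (m := ∞) (by simp)).comp X.contMDiff
    exact (contMDiff_snd_tangentBundle_modelSpace ℝ 𝓘(ℝ, ℝ)).comp h1

omit [T2Space M] [SecondCountableTopology M] [IsManifold (𝓡 n) ∞ M] in
theorem SFun.mdifferentiableAt (f : SFun n M) (x : M) : MDifferentiableAt (𝓡 n) 𝓘(ℝ, ℝ) f x :=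
  f.contMDiff.mdifferentiable (by simp) x

omit [T2Space M] [SecondCountableTopology M] [IsManifold (𝓡 n) ∞ M] in
theorem mvfderiv_congr {f h : M → ℝ} {x : M} (e : f =ᶠ[𝓝 x] h) :
    mvfderiv (𝓡 n) f x = mvfderiv (𝓡 n) h x := by
  simp only [mvfderiv]
  rw [e.mfderiv_eq, e.self_of_nhds]

omit [T2Space M] [SecondCountableTopology M] [IsManifold (𝓡 n) ∞ M] in
theorem mvfderiv_eq_of_hasMFDerivAt {f : M → ℝ} {x : M} {L : TangentSpace (𝓡 n) x →L[ℝ] ℝ}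
    (h : HasMFDerivAt (𝓡 n) 𝓘(ℝ, ℝ) f x L) : mvfderiv (𝓡 n) f x = L := by
  simp only [mvfderiv]
  rw [h.mfderiv]
  rfl

variable (n M) in
/-- The differential of functions. -/
def differential : SFun n M →ₗ[ℝ] ∀ x : M, TangentSpace (𝓡 n) x →ₗ[ℝ] ℝ where
  toFun f x := (mvfderiv (𝓡 n) f x).toLinearMap
  map_add' f h := by
    funext x
    have := mvfderiv_add (f.mdifferentiableAt x) (h.mdifferentiableAt x)
    exact congrArg ContinuousLinearMap.toLinearMap this
  map_smul' c f := by
    funext x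
    have := mvfderiv_smul (mdifferentiableAt_const (c := c)) (f.mdifferentiableAt x)
    rw [mvfderiv_const] at this
    ext v
    simpa using! congrArg (fun L => L v) this

variable (n M) in
/-- There are finitely many functions whose differentials span the cotangent spaces. -/
theorem exists_functions : ∃ (ι : Type) (_ : Fintype ι) (f : ι → SFun n M) (X : ι → VField n M),
    ∀ x (v : TangentSpace (𝓡 n) x), v = ∑ i, mvfderiv (𝓡 n) (f i) x v • X i x := by
  have h1 : ∀ x₀ : M, ∃ (ι : Type) (_ : Fintype ι) (t : ι → SFun n M), ∃ U ∈ 𝓝 x₀,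
      Separates (differential n M) t U := by
    intro x₀
    obtain ⟨χ, h1, h2⟩ := exists_cutoff_at (n := n) (chart_source_mem_nhds
      (EuclideanSpace ℝ (Fin n)) x₀)
    let ψ := extChartAt (𝓡 n) x₀
    have hs : ∀ i, ContMDiff (𝓡 n) 𝓘(ℝ, ℝ) ∞ (fun x => χ x * ψ x i) := fun i =>
      contMDiff_of_tsupport fun x hx => by
        have hx' : x ∈ (chartAt (EuclideanSpace ℝ (Fin n)) x₀).source :=
          h2 (closure_mono (Function.support_mul_subset_left _ _) hx)
        exact (χ.contMDiff x).mul ((EuclideanSpace.proj (𝕜 := ℝ) i).contMDiff.contMDiffAt.comp x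
          (contMDiffAt_extChartAt' hx'))
    refine ⟨Fin n, inferInstance, fun i => ⟨_, hs i⟩, _, inter_mem
      (eventually_eventually_nhds.2 h1) (extChartAt_source_mem_nhds (I := 𝓡 n) x₀),
      fun x hx v hv => ?_⟩
    obtain ⟨hx, hx'⟩ := hx
    -- Near `x` the cutoff is 1, so the functions have the differentials of the chart coordinates,
    -- and the differential of the chart is injective.
    have h3 : mfderiv (𝓡 n) 𝓘(ℝ, EuclideanSpace ℝ (Fin n)) ψ x v = 0 := by
      refine PiLp.ext (p := 2) (α := fun _ : Fin n => ℝ) fun i => ?_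
      have h4 : HasMFDerivAt (𝓡 n) 𝓘(ℝ, ℝ) (fun x => ψ x i) x
          ((EuclideanSpace.proj (𝕜 := ℝ) i).comp
            (mfderiv (𝓡 n) 𝓘(ℝ, EuclideanSpace ℝ (Fin n)) ψ x)) :=
        (EuclideanSpace.proj (𝕜 := ℝ) i).hasMFDerivAt.comp x
          (mdifferentiableAt_extChartAt (by simpa using hx')).hasMFDerivAt
      have h5 : (fun x => χ x * ψ x i) =ᶠ[𝓝 x] fun x => ψ x i := by
        filter_upwards [hx] with y hy
        rw [hy, one_mul]
      have h6 := hv i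
      change mvfderiv (𝓡 n) (fun x => χ x * ψ x i) x v = 0 at h6
      rw [mvfderiv_congr h5, mvfderiv_eq_of_hasMFDerivAt h4] at h6
      exact h6
    have h4 := (isInvertible_mfderiv_extChartAt (I := 𝓡 n) hx').injective
    exact h4 (h3.trans (map_zero _).symm)
  have h2 : ∀ (χ : ℕ → SFun n M) (t : ℕ → SFun n M),
      LocallyFinite (fun i => Function.support (χ i)) → ∃ t' : SFun n M, ∀ i x,
        (∀ᶠ y in 𝓝 x, χ i y = 1 ∧ ∀ j ≠ i, χ j y = 0) →
          differential n M t' x = differential n M (t i) x := by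
    intro χ t hχ
    refine ⟨⟨fun x => ∑ᶠ i, χ i x • t i x, contMDiff_finsum
      (fun i => (χ i).contMDiff.smul (t i).contMDiff)
      (hχ.subset fun i x hx h => hx (by simp [show χ i x = 0 from h]))⟩, fun i x h => ?_⟩
    -- A differential depends on the germ of the function, so here the gluing condition is needed on
    -- a neighbourhood and not only at `x`.
    refine congrArg ContinuousLinearMap.toLinearMap (mvfderiv_congr ?_)
    filter_upwards [h] with y hy
    exact finsum_smul_eq (fun i => χ i y) (fun i => t i y) i hy.1 hy.2
  have hd : ∀ (f : SFun n M) (X : VField n M),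
      ContMDiff (𝓡 n) 𝓘(ℝ, ℝ) ∞ fun x => differential n M f x (X x) :=
    fun f X => (VField.app X f).contMDiff
  obtain ⟨f, hf⟩ := exists_separates (F := EuclideanSpace ℝ (Fin n)) (differential n M) hd h1 h2
  obtain ⟨Z, hZ⟩ := exists_dual_sections (F := EuclideanSpace ℝ (Fin n))
    (fun i => ⟨differential n M (f i), hd (f i)⟩) (fun x v hv => hf x trivial v hv)
  exact ⟨_, inferInstance, f, Z, hZ⟩

end Generation

section

variable {n : ℕ} {M : Type*} [TopologicalSpace M] [ChartedSpace (EuclideanSpace ℝ (Fin n)) M]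
  [IsManifold (𝓡 n) ∞ M] [T2Space M] [SecondCountableTopology M]
  {F : Type*} [NormedAddCommGroup F] [NormedSpace ℝ F]
  {E : M → Type*} [TopologicalSpace (TotalSpace F E)] [∀ x, TopologicalSpace (E x)]
  [∀ x, AddCommGroup (E x)] [∀ x, Module ℝ (E x)]
  [FiberBundle F E] [VectorBundle ℝ F E] [ContMDiffVectorBundle ∞ F E (𝓡 n)]
  [FiniteDimensional ℝ F]

/-- A pseudo-Euclidean bundle has finitely many sections which generate it. -/
theorem PseudoMetric.exists_generators (g : PseudoMetric n F E) :
    ∃ (κ : Type) (_ : Fintype κ) (ξ η : κ → Cₛ^∞⟮𝓡 n; F, E⟯),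
      ∀ x (v : E x), v = ∑ a, g.form x v (ξ a x) • η a x := by
  let d : Cₛ^∞⟮𝓡 n; F, E⟯ →ₗ[ℝ] ∀ x, E x →ₗ[ℝ] ℝ :=
    { toFun := fun ξ x => g.form x (ξ x)
      map_add' := fun ξ η => by ext; simp
      map_smul' := fun c ξ => by ext; simp }
  have h1 : ∀ x₀ : M, ∃ (ι : Type) (_ : Fintype ι) (t : ι → Cₛ^∞⟮𝓡 n; F, E⟯), ∃ U ∈ 𝓝 x₀,
      Separates d t U := by
    intro x₀
    obtain ⟨θ, ξ, h⟩ := exists_local_frame (n := n) (F := F) (V := E) x₀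
    refine ⟨_, inferInstance, ξ, _, h, fun x hx v hv => (g.nondegenerate x).2 v fun w => ?_⟩
    rw [hx.1 w, map_sum, LinearMap.sum_apply]
    exact Finset.sum_eq_zero fun i _ => by
      rw [map_smul, LinearMap.smul_apply, show g.form x (ξ i x) v = 0 from hv i, smul_zero]
  have h2 : ∀ (χ : ℕ → SFun n M) (t : ℕ → Cₛ^∞⟮𝓡 n; F, E⟯),
      LocallyFinite (fun i => Function.support (χ i)) → ∃ t', ∀ i x,
        (∀ᶠ y in 𝓝 x, χ i y = 1 ∧ ∀ j ≠ i, χ j y = 0) → d t' x = d (t i) x := by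
    intro χ t hχ
    refine ⟨⟨fun x => ∑ᶠ i, χ i x • t i x, ContMDiff.finsum_section_of_locallyFinite
      (hχ.subset fun i x hx h => hx (by simp [show χ i x = 0 from h]))
      fun i => ContMDiff.smul_section (χ i).contMDiff (t i).contMDiff⟩, fun i x h => ?_⟩
    obtain ⟨h1, h2⟩ := h.self_of_nhds
    exact congrArg (g.form x) (finsum_smul_eq (fun i => χ i x) (fun i => t i x) i h1 h2)
  obtain ⟨ξ, hξ⟩ := exists_separates d (fun ξ η => g.smooth ξ η) h1 h2
  obtain ⟨Z, hZ⟩ := exists_dual_sections (fun i => ⟨d (ξ i), fun η => g.smooth (ξ i) η⟩)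
    (fun x v hv => hξ x trivial v hv)
  refine ⟨_, inferInstance, ξ, Z, fun x v => (hZ x v).trans (Finset.sum_congr rfl fun i _ => ?_)⟩
  rw [g.symm]
  rfl

end


/-! ### Derivations of symmetric and exterior algebras -/

section FibreAlgebra

variable {T W : Type*} [AddCommGroup T] [Module ℝ T] [AddCommGroup W] [Module ℝ W]

/-- The algebra map `s ↦ s + ε ∂_μ s` from the symmetric algebra to its dual numbers. -/
def symDual (μ : T →ₗ[ℝ] ℝ) : SymmetricAlgebra ℝ T →ₐ[ℝ]
    TrivSqZeroExt (SymmetricAlgebra ℝ T) (SymmetricAlgebra ℝ T) :=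
  SymmetricAlgebra.lift
    ((TrivSqZeroExt.inlAlgHom ℝ (SymmetricAlgebra ℝ T) (SymmetricAlgebra ℝ T)).toLinearMap ∘ₗ
        SymmetricAlgebra.ι ℝ T +
      (TrivSqZeroExt.inrHom (SymmetricAlgebra ℝ T) (SymmetricAlgebra ℝ T)).restrictScalars ℝ ∘ₗ
        Algebra.linearMap ℝ (SymmetricAlgebra ℝ T) ∘ₗ μ)

theorem fst_symDual (μ : T →ₗ[ℝ] ℝ) (s : SymmetricAlgebra ℝ T) : (symDual μ s).fst = s := by
  have : (TrivSqZeroExt.fstHom ℝ (SymmetricAlgebra ℝ T) (SymmetricAlgebra ℝ T)).comp (symDual μ) =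
      AlgHom.id ℝ _ := by
    apply SymmetricAlgebra.algHom_ext
    ext v
    simp [symDual, SymmetricAlgebra.lift_ι_apply]
  exact AlgHom.congr_fun this s

/-- The derivation of the symmetric algebra which extends a linear form. -/
def symDeriv (μ : T →ₗ[ℝ] ℝ) : SymmetricAlgebra ℝ T →ₗ[ℝ] SymmetricAlgebra ℝ T :=
  (TrivSqZeroExt.sndHom (SymmetricAlgebra ℝ T) (SymmetricAlgebra ℝ T)).restrictScalars ℝ ∘ₗ
    (symDual μ).toLinearMap

theorem symDeriv_ι (μ : T →ₗ[ℝ] ℝ) (v : T) :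
    symDeriv μ (SymmetricAlgebra.ι ℝ T v) = algebraMap ℝ _ (μ v) := by
  simp [symDeriv, symDual, SymmetricAlgebra.lift_ι_apply, Algebra.algebraMap_eq_smul_one]

theorem symDeriv_mul (μ : T →ₗ[ℝ] ℝ) (s t : SymmetricAlgebra ℝ T) :
    symDeriv μ (s * t) = s * symDeriv μ t + symDeriv μ s * t := by
  simp [symDeriv, fst_symDual, mul_comm]

theorem symDeriv_one (μ : T →ₗ[ℝ] ℝ) : symDeriv μ 1 = 0 := by
  simp [symDeriv]

/-- Contraction from the right mirrors commutators in which the section stands on the right: passing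
the second factor produces its parity. -/
theorem contractRight_mul (μ : W →ₗ[ℝ] ℝ) (a b : ExteriorAlgebra ℝ W) :
    CliffordAlgebra.contractRight (Q := (0 : QuadraticForm ℝ W)) (a * b) μ =
      a * CliffordAlgebra.contractRight b μ +
        CliffordAlgebra.contractRight a μ * CliffordAlgebra.involute b := by
  induction b using CliffordAlgebra.right_induction generalizing a with
  | algebraMap r =>
    rw [CliffordAlgebra.contractRight_mul_algebraMap, CliffordAlgebra.contractRight_algebraMap,
      AlgHom.commutes, mul_zero, zero_add]
  | add b b' h h' => rw [mul_add, map_add, LinearMap.add_apply, h, h', map_add, map_add,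
      LinearMap.add_apply, mul_add, mul_add]; abel
  | mul_ι m b h =>
    rw [← mul_assoc, CliffordAlgebra.contractRight_mul_ι, CliffordAlgebra.contractRight_mul_ι, h,
      map_mul, CliffordAlgebra.involute_ι]
    simp only [mul_sub, mul_neg, add_mul, mul_smul_comm, mul_assoc]
    abel

theorem mul_ι_eq (b : ExteriorAlgebra ℝ W) (w : W) :
    b * ExteriorAlgebra.ι ℝ w = ExteriorAlgebra.ι ℝ w * CliffordAlgebra.involute b := by
  induction b using CliffordAlgebra.right_induction with
  | algebraMap r => rw [AlgHom.commutes, Algebra.commutes]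
  | add b b' h h' => rw [add_mul, h, h', map_add, mul_add]
  | mul_ι m b h =>
    have h1 := ExteriorAlgebra.ι_add_mul_swap (R := ℝ) m w
    have h2 : ExteriorAlgebra.ι ℝ m * ExteriorAlgebra.ι ℝ w =
      - (ExteriorAlgebra.ι ℝ w * ExteriorAlgebra.ι ℝ m) := eq_neg_of_add_eq_zero_left h1
    rw [map_mul, CliffordAlgebra.involute_ι, ← mul_assoc, ← h, mul_neg, mul_assoc]
    change b * (ExteriorAlgebra.ι ℝ m * ExteriorAlgebra.ι ℝ w) = _
    rw [h2, mul_neg, ← mul_assoc]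

end FibreAlgebra

/-! ### The fibre of the algebra of functions and its elementary operators -/

section Fibre

variable {n : ℕ} {M : Type*} [TopologicalSpace M] [ChartedSpace (EuclideanSpace ℝ (Fin n)) M]
  {E : M → Type*} [∀ x, AddCommGroup (E x)] [∀ x, Module ℝ (E x)] {x : M}

/-- The element `z ⊗ s ⊗ a` of the fibre. -/
def fnPure (z : ℂ) (s : SymmetricAlgebra ℝ (TangentSpace (𝓡 n) x)) (a : ExteriorAlgebra ℝ (E x)) :
    FnFiber n E x := z ⊗ₜ[ℝ] (s ⊗ₜ[ℝ] a)

theorem fnPure_mul (z z' : ℂ) (s s' : SymmetricAlgebra ℝ (TangentSpace (𝓡 n) x))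
    (a a' : ExteriorAlgebra ℝ (E x)) :
    fnPure z s a * fnPure z' s' a' = fnPure (z * z') (s * s') (a * a') := by
  refine (Algebra.TensorProduct.tmul_mul_tmul z z' _ _).trans ?_
  rw [Algebra.TensorProduct.tmul_mul_tmul]; rfl

theorem FnFiber.induction {p : FnFiber n E x → Prop} (h0 : p 0)
    (h : ∀ z s a, p (fnPure z s a)) (hadd : ∀ G H, p G → p H → p (G + H)) (G) : p G := by
  refine TensorProduct.induction_on (motive := p) G h0 (fun z t => ?_) hadd
  change p (show FnFiber n E x from z ⊗ₜ[ℝ] t)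
  induction t using TensorProduct.induction_on with
  | zero => rw [TensorProduct.tmul_zero]; exact h0
  | tmul s a => exact h z s a
  | add t t' ht ht' => rw [TensorProduct.tmul_add]; exact hadd _ _ ht ht'

theorem algebraMap_eq_fnPure (z : ℂ) : algebraMap ℂ (FnFiber n E x) z = fnPure z 1 1 := rfl

theorem tangentι_eq_fnPure (v : TangentSpace (𝓡 n) x) :
    tangentι n E x v = fnPure 1 (SymmetricAlgebra.ι ℝ _ v) 1 := rfl

theorem exteriorι_eq_fnPure (r : ExteriorAlgebra ℝ (E x)) : exteriorι n E x r = fnPure 1 1 r := rfl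

theorem smul_fnPure (w z : ℂ) (s : SymmetricAlgebra ℝ (TangentSpace (𝓡 n) x))
    (a : ExteriorAlgebra ℝ (E x)) : w • fnPure z s a = fnPure (w * z) s a := by
  rw [Algebra.smul_def, algebraMap_eq_fnPure, fnPure_mul, one_mul, one_mul]

theorem fnPure_add_left (z : ℂ) (s s' : SymmetricAlgebra ℝ (TangentSpace (𝓡 n) x))
    (a : ExteriorAlgebra ℝ (E x)) : fnPure z (s + s') a = fnPure z s a + fnPure z s' a := by
  rw [fnPure, TensorProduct.add_tmul, TensorProduct.tmul_add]; rfl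

theorem fnPure_add_right (z : ℂ) (s : SymmetricAlgebra ℝ (TangentSpace (𝓡 n) x))
    (a a' : ExteriorAlgebra ℝ (E x)) : fnPure z s (a + a') = fnPure z s a + fnPure z s a' := by
  rw [fnPure, TensorProduct.tmul_add, TensorProduct.tmul_add]; rfl

/-- The linear operator of the fibre which acts on the tensor factors by `φ` and `ψ`. -/
def fnMap (φ : SymmetricAlgebra ℝ (TangentSpace (𝓡 n) x) →ₗ[ℝ]
      SymmetricAlgebra ℝ (TangentSpace (𝓡 n) x))
    (ψ : ExteriorAlgebra ℝ (E x) →ₗ[ℝ] ExteriorAlgebra ℝ (E x)) :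
    FnFiber n E x →ₗ[ℂ] FnFiber n E x :=
  show ℂ ⊗[ℝ] (SymmetricAlgebra ℝ (TangentSpace (𝓡 n) x) ⊗[ℝ] ExteriorAlgebra ℝ (E x)) →ₗ[ℂ]
      ℂ ⊗[ℝ] (SymmetricAlgebra ℝ (TangentSpace (𝓡 n) x) ⊗[ℝ] ExteriorAlgebra ℝ (E x)) from
    LinearMap.baseChange ℂ (TensorProduct.map φ ψ)

theorem fnMap_pure (φ : SymmetricAlgebra ℝ (TangentSpace (𝓡 n) x) →ₗ[ℝ]
      SymmetricAlgebra ℝ (TangentSpace (𝓡 n) x))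
    (ψ : ExteriorAlgebra ℝ (E x) →ₗ[ℝ] ExteriorAlgebra ℝ (E x)) (z s a) :
    fnMap φ ψ (fnPure z s a) = fnPure z (φ s) (ψ a) := rfl

/-- The derivative along the tangent directions given by a covector. -/
def fibreD (μ : TangentSpace (𝓡 n) x →ₗ[ℝ] ℝ) : FnFiber n E x →ₗ[ℂ] FnFiber n E x :=
  fnMap (symDeriv μ) LinearMap.id

/-- The contraction from the right with a covector on `E x`. -/
def fibreC (μ : E x →ₗ[ℝ] ℝ) : FnFiber n E x →ₗ[ℂ] FnFiber n E x :=
  fnMap LinearMap.id (CliffordAlgebra.contractRight.flip μ)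

/-- The parity involution. -/
def fibreInv : FnFiber n E x →ₗ[ℂ] FnFiber n E x :=
  fnMap LinearMap.id CliffordAlgebra.involute.toLinearMap

theorem fibre_bilin_ext {L L' : FnFiber n E x →ₗ[ℂ] FnFiber n E x →ₗ[ℂ] FnFiber n E x}
    (h : ∀ z s a z' s' a', L (fnPure z s a) (fnPure z' s' a') =
      L' (fnPure z s a) (fnPure z' s' a')) (G H) : L G H = L' G H := by
  induction G using FnFiber.induction with
  | h0 => simp
  | hadd G G' h h' => rw [map_add, map_add, LinearMap.add_apply, h, h', LinearMap.add_apply]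
  | h z s a =>
    induction H using FnFiber.induction with
    | h0 => simp
    | hadd G G' h h' => rw [map_add, map_add, h, h']
    | h z' s' a' => exact h _ _ _ _ _ _

theorem fibreInv_mul (G H : FnFiber n E x) : fibreInv (G * H) = fibreInv G * fibreInv H := by
  refine fibre_bilin_ext (L := (LinearMap.mul ℂ _).compr₂ fibreInv)
    (L' := (LinearMap.mul ℂ _).compl₁₂ fibreInv fibreInv) (fun z s a z' s' a' => ?_) G H
  simp [fnPure_mul, fibreInv, fnMap_pure]

theorem fibreD_mul (μ : TangentSpace (𝓡 n) x →ₗ[ℝ] ℝ) (G H : FnFiber n E x) :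
    fibreD μ (G * H) = G * fibreD μ H + fibreD μ G * H := by
  refine fibre_bilin_ext (L := (LinearMap.mul ℂ _).compr₂ (fibreD μ))
    (L' := (LinearMap.mul ℂ _).compl₂ (fibreD μ) + (LinearMap.mul ℂ _).comp (fibreD μ))
    (fun z s a z' s' a' => ?_) G H
  simp [fnPure_mul, fibreD, fnMap_pure, symDeriv_mul, fnPure_add_left]

theorem fibreC_mul (μ : E x →ₗ[ℝ] ℝ) (G H : FnFiber n E x) :
    fibreC μ (G * H) = G * fibreC μ H + fibreC μ G * fibreInv H := by
  refine fibre_bilin_ext (L := (LinearMap.mul ℂ _).compr₂ (fibreC μ))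
    (L' := (LinearMap.mul ℂ _).compl₂ (fibreC μ) +
      (LinearMap.mul ℂ _).compl₁₂ (fibreC μ) fibreInv)
    (fun z s a z' s' a' => ?_) G H
  simp [fnPure_mul, fibreC, fibreInv, fnMap_pure, contractRight_mul, fnPure_add_right]

theorem fibre_mul_ι (G : FnFiber n E x) (w : E x) :
    G * exteriorι n E x (ExteriorAlgebra.ι ℝ w) =
      exteriorι n E x (ExteriorAlgebra.ι ℝ w) * fibreInv G := by
  induction G using FnFiber.induction with
  | h0 => simp
  | hadd G G' h h' => rw [add_mul, h, h', map_add, mul_add]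
  | h z s a =>
    simp [exteriorι_eq_fnPure, fibreInv, fnMap_pure, fnPure_mul, mul_ι_eq]

theorem fibre_mul_tangentι (G : FnFiber n E x) (v : TangentSpace (𝓡 n) x) :
    G * tangentι n E x v = tangentι n E x v * G := by
  induction G using FnFiber.induction with
  | h0 => simp
  | hadd G G' h h' => rw [add_mul, h, h', mul_add]
  | h z s a => simp [tangentι_eq_fnPure, fnPure_mul, mul_comm]

theorem fnPure_zero_left (z : ℂ) (a : ExteriorAlgebra ℝ (E x)) : fnPure z 0 a = (0 : FnFiber n E x) := by
  simpa using fnPure_add_left (n := n) z 0 0 a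

theorem fnPure_zero_right (z : ℂ) (s : SymmetricAlgebra ℝ (TangentSpace (𝓡 n) x)) :
    fnPure z s 0 = (0 : FnFiber n E x) := by
  simpa using fnPure_add_right (E := E) z s 0 0

theorem fnPure_algebraMap_left (z : ℂ) (r : ℝ) (a : ExteriorAlgebra ℝ (E x)) :
    (fnPure z (algebraMap ℝ _ r) a : FnFiber n E x) = fnPure (r * z) 1 a := by
  rw [Algebra.algebraMap_eq_smul_one, fnPure, ← TensorProduct.smul_tmul', ← TensorProduct.smul_tmul,
    Algebra.smul_def]; rfl

theorem fnPure_algebraMap_right (z : ℂ) (r : ℝ) (s : SymmetricAlgebra ℝ (TangentSpace (𝓡 n) x)) :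
    (fnPure z s (algebraMap ℝ _ r) : FnFiber n E x) = fnPure (r * z) s 1 := by
  rw [Algebra.algebraMap_eq_smul_one, fnPure, TensorProduct.tmul_smul, ← TensorProduct.smul_tmul,
    Algebra.smul_def]; rfl

theorem fibreD_algebraMap (μ : TangentSpace (𝓡 n) x →ₗ[ℝ] ℝ) (z : ℂ) :
    fibreD μ (algebraMap ℂ (FnFiber n E x) z) = 0 := by
  rw [algebraMap_eq_fnPure, fibreD, fnMap_pure, symDeriv_one, fnPure_zero_left]

theorem fibreD_tangentι (μ : TangentSpace (𝓡 n) x →ₗ[ℝ] ℝ) (v : TangentSpace (𝓡 n) x) :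
    fibreD μ (tangentι n E x v) = algebraMap ℂ _ (μ v : ℂ) := by
  rw [tangentι_eq_fnPure, fibreD, fnMap_pure, symDeriv_ι, fnPure_algebraMap_left, mul_one]; rfl

theorem fibreD_exteriorι (μ : TangentSpace (𝓡 n) x →ₗ[ℝ] ℝ) (r : ExteriorAlgebra ℝ (E x)) :
    fibreD μ (exteriorι n E x r) = 0 := by
  rw [exteriorι_eq_fnPure, fibreD, fnMap_pure, symDeriv_one, fnPure_zero_left]

theorem fibreC_algebraMap (μ : E x →ₗ[ℝ] ℝ) (z : ℂ) :
    fibreC μ (algebraMap ℂ (FnFiber n E x) z) = 0 := by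
  rw [algebraMap_eq_fnPure, fibreC, fnMap_pure, LinearMap.flip_apply,
    CliffordAlgebra.contractRight_one, fnPure_zero_right]

theorem fibreC_tangentι (μ : E x →ₗ[ℝ] ℝ) (v : TangentSpace (𝓡 n) x) :
    fibreC μ (tangentι n E x v) = 0 := by
  rw [tangentι_eq_fnPure, fibreC, fnMap_pure, LinearMap.flip_apply,
    CliffordAlgebra.contractRight_one, fnPure_zero_right]

theorem fibreC_exteriorι (μ : E x →ₗ[ℝ] ℝ) (w : E x) :
    fibreC μ (exteriorι n E x (ExteriorAlgebra.ι ℝ w)) = algebraMap ℂ (FnFiber n E x) (μ w : ℂ) := by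
  rw [exteriorι_eq_fnPure, fibreC, fnMap_pure, LinearMap.flip_apply]
  refine (congrArg _ (CliffordAlgebra.contractRight_ι (Q := 0) μ w)).trans ?_
  rw [fnPure_algebraMap_right, mul_one]; rfl

theorem fibreInv_algebraMap (z : ℂ) :
    fibreInv (algebraMap ℂ (FnFiber n E x) z) = algebraMap ℂ _ z := by
  rw [algebraMap_eq_fnPure, fibreInv, fnMap_pure, AlgHom.toLinearMap_apply,
    map_one CliffordAlgebra.involute]; rfl

theorem fibreInv_tangentι (v : TangentSpace (𝓡 n) x) :
    fibreInv (tangentι n E x v) = tangentι n E x v := by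
  rw [tangentι_eq_fnPure, fibreInv, fnMap_pure, AlgHom.toLinearMap_apply,
    map_one CliffordAlgebra.involute]; rfl

theorem fibreInv_exteriorι (w : E x) : fibreInv (exteriorι n E x (ExteriorAlgebra.ι ℝ w)) =
    -exteriorι n E x (ExteriorAlgebra.ι ℝ w) := by
  rw [exteriorι_eq_fnPure, fibreInv, fnMap_pure, AlgHom.toLinearMap_apply]
  refine (congrArg _ (CliffordAlgebra.involute_ι (Q := 0) w)).trans ?_
  rw [eq_neg_iff_add_eq_zero]
  refine (fnPure_add_right _ _ _ _).symm.trans ?_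
  rw [LinearMap.id_apply]
  refine (congrArg _ (neg_add_cancel (ExteriorAlgebra.ι ℝ w))).trans (fnPure_zero_right _ _)

variable (n E x) in
/-- The projection of the fibre to its part of degree `0`. -/
def augmentation : FnFiber n E x →ₐ[ℂ] ℂ :=
  show ℂ ⊗[ℝ] (SymmetricAlgebra ℝ (TangentSpace (𝓡 n) x) ⊗[ℝ] ExteriorAlgebra ℝ (E x)) →ₐ[ℂ] ℂ from
    Algebra.TensorProduct.lift (AlgHom.id ℂ ℂ) ((Algebra.ofId ℝ ℂ).comp
      (Algebra.TensorProduct.lift SymmetricAlgebra.algebraMapInv ExteriorAlgebra.algebraMapInv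
        fun _ _ => Commute.all _ _)) fun _ _ => Commute.all _ _

theorem augmentation_algebraMap (z : ℂ) :
    augmentation n E x (algebraMap ℂ (FnFiber n E x) z) = z := AlgHom.commutes _ z

theorem augmentation_pure (z : ℂ) (s : SymmetricAlgebra ℝ (TangentSpace (𝓡 n) x))
    (a : ExteriorAlgebra ℝ (E x)) : augmentation n E x (fnPure z s a) =
      z * ((SymmetricAlgebra.algebraMapInv s * ExteriorAlgebra.algebraMapInv a : ℝ) : ℂ) := rfl

theorem augmentation_tangentι (v : TangentSpace (𝓡 n) x) :
    augmentation n E x (tangentι n E x v) = 0 := by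
  rw [tangentι_eq_fnPure, augmentation_pure, SymmetricAlgebra.algebraMapInv_ι]; simp

theorem augmentation_exteriorι (w : E x) :
    augmentation n E x (exteriorι n E x (ExteriorAlgebra.ι ℝ w)) = 0 := by
  rw [exteriorι_eq_fnPure, augmentation_pure]; simp [ExteriorAlgebra.algebraMapInv]

end Fibre


/-! ### The grading of the fibre and its Euler operator -/

section FibreDegree

variable {n : ℕ} {M : Type*} [TopologicalSpace M] [ChartedSpace (EuclideanSpace ℝ (Fin n)) M]
  {E : M → Type*} [∀ x, AddCommGroup (E x)] [∀ x, Module ℝ (E x)] {x : M}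

theorem tangentSpan_le {p : Submodule ℂ (FnFiber n E x)} :
    tangentSpan n E x ≤ p ↔ ∀ v, tangentι n E x v ∈ p := by
  rw [tangentSpan, Submodule.span_le, Set.range_subset_iff]; rfl

theorem fiberSpan_le {p : Submodule ℂ (FnFiber n E x)} :
    fiberSpan n E x ≤ p ↔ ∀ w, exteriorι n E x (ExteriorAlgebra.ι ℝ w) ∈ p := by
  rw [fiberSpan, Submodule.span_le, Set.range_subset_iff]; rfl

theorem mem_tangentSpan (v : TangentSpace (𝓡 n) x) : tangentι n E x v ∈ tangentSpan n E x :=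
  Submodule.subset_span ⟨v, rfl⟩

theorem mem_fiberSpan (w : E x) :
    exteriorι n E x (ExteriorAlgebra.ι ℝ w) ∈ fiberSpan n E x :=
  Submodule.subset_span ⟨w, rfl⟩

theorem pow_le_of_graded {A : Type*} [Ring A] [Algebra ℂ A] {𝒢 : ℤ → Submodule ℂ A}
    (h1 : 1 ∈ 𝒢 0) (hmul : ∀ k l, ∀ G ∈ 𝒢 k, ∀ H ∈ 𝒢 l, G * H ∈ 𝒢 (k + l)) {p : Submodule ℂ A}
    {k : ℤ} (hp : p ≤ 𝒢 k) (m : ℕ) : p ^ m ≤ 𝒢 (m * k) := by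
  induction m with
  | zero => simpa [Submodule.one_le] using h1
  | succ m ih =>
    rw [pow_succ, Submodule.mul_le]
    intro G hG H hH
    have := hmul _ _ G (ih hG) H (hp hH)
    rwa [Nat.cast_succ, add_mul, one_mul]

/-- An induction principle: a property of homogeneous elements, encoded as a multiplicative family
`𝒢`, has to be checked on generators only. -/
theorem FnDegree_le {𝒢 : ℤ → Submodule ℂ (FnFiber n E x)} (h1 : 1 ∈ 𝒢 0)
    (hmul : ∀ k l, ∀ G ∈ 𝒢 k, ∀ H ∈ 𝒢 l, G * H ∈ 𝒢 (k + l)) (hT : ∀ v, tangentι n E x v ∈ 𝒢 2)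
    (hE : ∀ w, exteriorι n E x (ExteriorAlgebra.ι ℝ w) ∈ 𝒢 1) (k : ℤ) :
    FnDegree n E k x ≤ 𝒢 k := by
  refine iSup_le fun m => iSup_le fun l => iSup_le fun h => Submodule.mul_le.2 fun G hG H hH => ?_
  have := hmul _ _ G (pow_le_of_graded h1 hmul (tangentSpan_le.2 hT) m hG) H
    (pow_le_of_graded h1 hmul (fiberSpan_le.2 hE) l hH)
  rwa [mul_one, mul_comm, h] at this

theorem commute_spans : Commute (tangentSpan n E x) (fiberSpan n E x) := by
  have h : ∀ G ∈ tangentSpan n E x, ∀ H : FnFiber n E x, H * G = G * H := by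
    intro G hG H
    induction hG using Submodule.span_induction with
    | mem G hG => obtain ⟨v, rfl⟩ := hG; exact fibre_mul_tangentι H v
    | zero => simp
    | add G G' _ _ h h' => rw [mul_add, h, h', add_mul]
    | smul z G _ h => rw [mul_smul_comm, h, smul_mul_assoc]
  refine le_antisymm (Submodule.mul_le.2 fun G hG H hH => ?_)
    (Submodule.mul_le.2 fun H hH G hG => ?_)
  · rw [← h G hG]; exact Submodule.mul_mem_mul hH hG
  · rw [h G hG]; exact Submodule.mul_mem_mul hG hH

theorem FnDegree_mul {k l : ℤ} {G H : FnFiber n E x} (hG : G ∈ FnDegree n E k x)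
    (hH : H ∈ FnDegree n E l x) : G * H ∈ FnDegree n E (k + l) x := by
  refine (?_ : FnDegree n E k x * FnDegree n E l x ≤ _) (Submodule.mul_mem_mul hG hH)
  simp only [FnDegree, Submodule.iSup_mul, Submodule.mul_iSup]
  refine iSup_le fun m => iSup_le fun p => iSup_le fun h => iSup_le fun m' => iSup_le fun p' =>
    iSup_le fun h' => ?_
  refine le_trans (le_of_eq ?_) (le_iSup_of_le (m' + m) (le_iSup_of_le (p' + p)
    (le_iSup_of_le (by push_cast; linarith) le_rfl)))
  rw [pow_add, pow_add, mul_assoc, ← mul_assoc (fiberSpan n E x ^ p'),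
    ← (commute_spans.pow_pow m p').eq]
  simp only [mul_assoc]

theorem one_mem_FnDegree : (1 : FnFiber n E x) ∈ FnDegree n E 0 x :=
  Submodule.mem_iSup_of_mem 0 (Submodule.mem_iSup_of_mem 0 (Submodule.mem_iSup_of_mem (by simp)
    (by simpa using Submodule.one_le.1 (le_refl (1 : Submodule ℂ (FnFiber n E x))))))

theorem tangentι_mem_FnDegree (v : TangentSpace (𝓡 n) x) :
    tangentι n E x v ∈ FnDegree n E 2 x :=
  Submodule.mem_iSup_of_mem 1 (Submodule.mem_iSup_of_mem 0 (Submodule.mem_iSup_of_mem (by simp)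
    (by simpa using mem_tangentSpan v)))

theorem exteriorι_mem_FnDegree (w : E x) :
    exteriorι n E x (ExteriorAlgebra.ι ℝ w) ∈ FnDegree n E 1 x :=
  Submodule.mem_iSup_of_mem 0 (Submodule.mem_iSup_of_mem 1 (Submodule.mem_iSup_of_mem (by simp)
    (by simpa using mem_fiberSpan w)))

theorem algebraMap_mem_FnDegree (z : ℂ) :
    algebraMap ℂ (FnFiber n E x) z ∈ FnDegree n E 0 x := by
  rw [Algebra.algebraMap_eq_smul_one]
  exact Submodule.smul_mem _ _ one_mem_FnDegree

theorem FnDegree_neg {k : ℤ} (hk : k < 0) : FnDegree n E k x = ⊥ := by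
  refine eq_bot_iff.2 (iSup_le fun m => iSup_le fun l => iSup_le fun h => ?_)
  omega

theorem FnDegree_zero {G : FnFiber n E x} (hG : G ∈ FnDegree n E 0 x) :
    G = algebraMap ℂ _ (augmentation n E x G) := by
  have h : FnDegree n E 0 x ≤ 1 := by
    refine iSup_le fun m => iSup_le fun l => iSup_le fun h => ?_
    have hm : m = 0 := by omega
    have hl : l = 0 := by omega
    simp [hm, hl]
  obtain ⟨z, rfl⟩ := Submodule.mem_one.1 (h hG)
  rw [augmentation_algebraMap]

theorem fibreInv_fibreInv (G : FnFiber n E x) : fibreInv (fibreInv G) = G := by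
  induction G using FnFiber.induction with
  | h0 => simp
  | hadd G G' h h' => rw [map_add, map_add, h, h']
  | h z s a => simp [fibreInv, fnMap_pure]

theorem fibreInv_eq {k : ℤ} {G : FnFiber n E x} (hG : G ∈ FnDegree n E k x) :
    fibreInv G = sgn k • G := by
  have := FnDegree_le (𝒢 := fun k => LinearMap.eqLocus (fibreInv : FnFiber n E x →ₗ[ℂ] _)
    (sgn k • LinearMap.id)) ?_ ?_ ?_ ?_ k hG
  · simpa using this
  · have := fibreInv_algebraMap (n := n) (E := E) (x := x) 1
    simpa using this
  · intro k l G hG H hH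
    have h1 : fibreInv G = sgn k • G := hG
    have h2 : fibreInv H = sgn l • H := hH
    change fibreInv (G * H) = sgn (k + l) • (G * H)
    rw [fibreInv_mul, h1, h2, smul_mul_smul_comm, sgn_add]
  · intro v
    simpa using fibreInv_tangentι v
  · intro v
    simpa using fibreInv_exteriorι v

theorem fibreD_mem (μ : TangentSpace (𝓡 n) x →ₗ[ℝ] ℝ) {k : ℤ} {G : FnFiber n E x}
    (hG : G ∈ FnDegree n E k x) : fibreD μ G ∈ FnDegree n E (k - 2) x := by
  have := FnDegree_le (𝒢 := fun k => FnDegree n E k x ⊓ (FnDegree n E (k - 2) x).comap (fibreD μ))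
    ?_ ?_ ?_ ?_ k hG
  · exact this.2
  · refine ⟨one_mem_FnDegree, ?_⟩
    have := fibreD_algebraMap (E := E) μ 1
    rw [map_one] at this
    refine Submodule.mem_comap.2 ?_
    rw [this]; exact zero_mem _
  · rintro k l G ⟨h1, h2⟩ H ⟨h3, h4⟩
    refine ⟨FnDegree_mul h1 h3, ?_⟩
    refine Submodule.mem_comap.2 ?_
    rw [fibreD_mul]
    refine add_mem ?_ ?_
    · convert FnDegree_mul h1 h4 using 2; ring
    · convert FnDegree_mul h2 h3 using 2; ring
  · refine fun v => ⟨tangentι_mem_FnDegree v, ?_⟩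
    refine Submodule.mem_comap.2 ?_
    rw [fibreD_tangentι]
    exact algebraMap_mem_FnDegree _
  · refine fun v => ⟨exteriorι_mem_FnDegree v, ?_⟩
    refine Submodule.mem_comap.2 ?_
    rw [fibreD_exteriorι]
    exact zero_mem _

theorem fibreC_mem (μ : E x →ₗ[ℝ] ℝ) {k : ℤ} {G : FnFiber n E x}
    (hG : G ∈ FnDegree n E k x) : fibreC μ G ∈ FnDegree n E (k - 1) x := by
  have := FnDegree_le (𝒢 := fun k => FnDegree n E k x ⊓ (FnDegree n E (k - 1) x).comap (fibreC μ))
    ?_ ?_ ?_ ?_ k hG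
  · exact this.2
  · refine ⟨one_mem_FnDegree, ?_⟩
    have := fibreC_algebraMap (n := n) μ 1
    rw [map_one] at this
    refine Submodule.mem_comap.2 ?_
    rw [this]; exact zero_mem _
  · rintro k l G ⟨h1, h2⟩ H ⟨h3, h4⟩
    refine ⟨FnDegree_mul h1 h3, ?_⟩
    refine Submodule.mem_comap.2 ?_
    rw [fibreC_mul, fibreInv_eq h3, mul_smul_comm]
    refine add_mem ?_ (Submodule.smul_mem _ _ ?_)
    · convert FnDegree_mul h1 h4 using 2; ring
    · convert FnDegree_mul h2 h3 using 2; ring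
  · refine fun v => ⟨tangentι_mem_FnDegree v, ?_⟩
    refine Submodule.mem_comap.2 ?_
    rw [fibreC_tangentι]
    exact zero_mem _
  · refine fun v => ⟨exteriorι_mem_FnDegree v, ?_⟩
    refine Submodule.mem_comap.2 ?_
    rw [fibreC_exteriorι]
    exact algebraMap_mem_FnDegree _

/-- The Euler operator of the fibre: `k` in degree `k`. -/
def fibreEuler {ι κ : Type*} [Fintype ι] [Fintype κ] (μ : ι → TangentSpace (𝓡 n) x →ₗ[ℝ] ℝ)
    (v : ι → TangentSpace (𝓡 n) x) (ν : κ → E x →ₗ[ℝ] ℝ) (w : κ → E x) :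
    FnFiber n E x →ₗ[ℂ] FnFiber n E x :=
  ∑ j, (2 : ℂ) • LinearMap.mulRight ℂ (tangentι n E x (v j)) ∘ₗ fibreD (μ j) +
    ∑ a, LinearMap.mulRight ℂ (exteriorι n E x (ExteriorAlgebra.ι ℝ (w a))) ∘ₗ fibreC (ν a)

section

variable {ι κ : Type*} [Fintype ι] [Fintype κ] (μ : ι → TangentSpace (𝓡 n) x →ₗ[ℝ] ℝ)
    (v : ι → TangentSpace (𝓡 n) x) (ν : κ → E x →ₗ[ℝ] ℝ) (w : κ → E x)

theorem fibreEuler_apply (G : FnFiber n E x) : fibreEuler μ v ν w G =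
    ∑ j, (2 : ℂ) • (fibreD (μ j) G * tangentι n E x (v j)) +
      ∑ a, fibreC (ν a) G * exteriorι n E x (ExteriorAlgebra.ι ℝ (w a)) := by
  simp [fibreEuler, LinearMap.sum_apply]

/-- The contraction is only a graded derivation, but moving the section past `H` applies the parity
involution a second time and the signs cancel. -/
theorem fibreEuler_mul (G H : FnFiber n E x) : fibreEuler μ v ν w (G * H) =
    G * fibreEuler μ v ν w H + fibreEuler μ v ν w G * H := by
  simp only [fibreEuler_apply, fibreD_mul, fibreC_mul, mul_add, add_mul, Finset.mul_sum,
    Finset.sum_mul, smul_add, Finset.sum_add_distrib, mul_smul_comm, smul_mul_assoc, mul_assoc]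
  simp only [fibre_mul_tangentι H, fibre_mul_ι (fibreInv H), fibreInv_fibreInv]
  abel

variable {μ v ν w}

theorem tangentι_sum (c : ι → ℝ) : tangentι n E x (∑ j, c j • v j) =
    ∑ j, (c j : ℂ) • tangentι n E x (v j) := by
  have h : ∀ (r : ℝ) u, tangentι n E x (r • u) = (r : ℂ) • tangentι n E x u := by
    intro r u
    rw [tangentι_eq_fnPure, tangentι_eq_fnPure, smul_fnPure, mul_one, map_smul, fnPure, fnPure,
      ← TensorProduct.smul_tmul', ← TensorProduct.smul_tmul, Algebra.smul_def, mul_one]; rfl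
  have h0 : ∀ u u', tangentι n E x (u + u') = tangentι n E x u + tangentι n E x u' := by
    intro u u'
    rw [tangentι_eq_fnPure, map_add, fnPure_add_left]; rfl
  have := map_sum (AddMonoidHom.mk' (tangentι n E x) h0) (fun j => c j • v j) Finset.univ
  refine this.trans (Finset.sum_congr rfl fun j _ => h _ _)

theorem exteriorι_smul (r : ℝ) (a : ExteriorAlgebra ℝ (E x)) :
    exteriorι n E x (r • a) = (r : ℂ) • exteriorι n E x a := by
  rw [exteriorι_eq_fnPure, exteriorι_eq_fnPure, smul_fnPure, mul_one, fnPure, fnPure,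
    TensorProduct.tmul_smul, ← TensorProduct.smul_tmul, Algebra.smul_def, mul_one]; rfl

theorem exteriorι_sum {α : Type*} (s : Finset α) (a : α → ExteriorAlgebra ℝ (E x)) :
    exteriorι n E x (∑ i ∈ s, a i) = ∑ i ∈ s, exteriorι n E x (a i) :=
  map_sum (AddMonoidHom.mk' (exteriorι n E x) fun b b' => by
    rw [exteriorι_eq_fnPure, fnPure_add_right]; rfl) a s

theorem fibreEuler_eq (hv : ∀ u, u = ∑ j, μ j u • v j) (hw : ∀ u, u = ∑ a, ν a u • w a)
    {k : ℤ} {G : FnFiber n E x} (hG : G ∈ FnDegree n E k x) :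
    fibreEuler μ v ν w G = (k : ℂ) • G := by
  have := FnDegree_le (𝒢 := fun k => LinearMap.eqLocus (fibreEuler μ v ν w)
    ((k : ℂ) • LinearMap.id)) ?_ ?_ ?_ ?_ k hG
  · simpa using this
  · have h1 := fun μ => fibreD_algebraMap (n := n) (E := E) (x := x) μ 1
    have h2 := fun μ => fibreC_algebraMap (n := n) (x := x) (E := E) μ 1
    simp only [map_one] at h1 h2
    simp [fibreEuler_apply, h1, h2]
  · intro k l G hG H hH
    have h1 : fibreEuler μ v ν w G = (k : ℂ) • G := hG
    have h2 : fibreEuler μ v ν w H = (l : ℂ) • H := hH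
    change fibreEuler μ v ν w (G * H) = ((k + l : ℤ) : ℂ) • (G * H)
    rw [fibreEuler_mul, h1, h2, mul_smul_comm, smul_mul_assoc, Int.cast_add, add_smul, add_comm]
  · intro u
    rw [LinearMap.mem_eqLocus, LinearMap.smul_apply, LinearMap.id_apply, fibreEuler_apply]
    simp only [fibreD_tangentι, fibreC_tangentι, zero_mul, Finset.sum_const_zero, add_zero,
      ← Algebra.smul_def]
    rw [← Finset.smul_sum, ← tangentι_sum, ← hv]; simp
  · intro u
    rw [LinearMap.mem_eqLocus, LinearMap.smul_apply, LinearMap.id_apply, fibreEuler_apply]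
    simp only [fibreD_exteriorι, fibreC_exteriorι, zero_mul, smul_zero, Finset.sum_const_zero,
      zero_add, ← Algebra.smul_def, ← exteriorι_smul, ← exteriorι_sum, ← map_smul, ← map_sum]
    rw [← hw]; simp

end

theorem lengthOne_le {p : Submodule ℂ (FnFiber n E x)} : lengthOne n E x ≤ p ↔
    1 ∈ p ∧ (∀ v, tangentι n E x v ∈ p) ∧
      ∀ w, exteriorι n E x (ExteriorAlgebra.ι ℝ w) ∈ p := by
  rw [lengthOne, sup_le_iff, sup_le_iff, Submodule.one_le, tangentSpan_le, fiberSpan_le, and_assoc]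

/-- Letters have degree at most 2. A bound on the length that is uniform in `x` thus gives a finite
set of degrees common to all fibres. -/
theorem lengthOne_pow_le (N : ℕ) : lengthOne n E x ^ N ≤
    ⨆ k ∈ Finset.range (2 * N + 1), FnDegree n E (k : ℤ) x := by
  induction N with
  | zero => 
    rw [pow_zero, Submodule.one_le]
    exact Submodule.mem_iSup_of_mem 0 (Submodule.mem_iSup_of_mem (by simp)
      (by simpa using one_mem_FnDegree))
  | succ N ih =>
    have h1 : lengthOne n E x ≤ ⨆ k ∈ Finset.range 3, FnDegree n E (k : ℤ) x :=
      lengthOne_le.2 ⟨Submodule.mem_iSup_of_mem 0 (Submodule.mem_iSup_of_mem (by simp)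
          (by simpa using one_mem_FnDegree)),
        fun v => Submodule.mem_iSup_of_mem 2 (Submodule.mem_iSup_of_mem (by simp)
          (by simpa using tangentι_mem_FnDegree v)),
        fun v => Submodule.mem_iSup_of_mem 1 (Submodule.mem_iSup_of_mem (by simp)
          (by simpa using exteriorι_mem_FnDegree v))⟩
    rw [pow_succ]
    refine (mul_le_mul' ih h1).trans ?_
    simp only [Submodule.iSup_mul, Submodule.mul_iSup]
    refine iSup_le fun k => iSup_le fun hk => iSup_le fun l => iSup_le fun hl => ?_
    rw [Finset.mem_range] at hk hl
    refine le_iSup_of_le (l + k) (le_iSup_of_le (Finset.mem_range.2 (by omega)) ?_)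
    rw [Nat.cast_add]
    exact Submodule.mul_le.2 fun G hG H hH => FnDegree_mul hG hH

theorem lengthOne_pow_map (L I : FnFiber n E x →ₗ[ℂ] FnFiber n E x)
    (h : ∀ G H, L (G * H) = G * L H + L G * I H) (h1 : L 1 = 0)
    (hI : lengthOne n E x ≤ (lengthOne n E x).comap I)
    (hL : lengthOne n E x ≤ (lengthOne n E x).comap L) (N : ℕ) :
    lengthOne n E x ^ N ≤ (lengthOne n E x ^ N).comap L := by
  induction N with
  | zero => 
    rw [pow_zero, Submodule.one_le, Submodule.mem_comap, h1]; exact zero_mem _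
  | succ N ih =>
    rw [pow_succ, Submodule.mul_le]
    intro G hG H hH
    refine Submodule.mem_comap.2 ?_
    rw [h]
    exact add_mem (Submodule.mul_mem_mul hG (hL hH)) (Submodule.mul_mem_mul (ih hG) (hI hH))

/-- Split off the component of `a` in `p i`. The rest is an eigenvector for `e i` and a sum of
eigenvectors for other eigenvalues, hence zero. -/
theorem eigenspace_le_of_iSup {A ι : Type*} [AddCommGroup A] [Module ℂ A] (f : Module.End ℂ A)
    (e : ι → ℂ) (he : Function.Injective e) (p : ι → Submodule ℂ A)
    (hp : ∀ i, ∀ a ∈ p i, f a = e i • a) {a : A} (ha : a ∈ ⨆ i, p i) (i : ι) (h : f a = e i • a) :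
    a ∈ p i := by
  have hind := (f.eigenspaces_iSupIndep).comp he
  have hle : ∀ j, p j ≤ f.eigenspace (e j) := fun j a ha => Module.End.mem_eigenspace_iff.2 (hp j a ha)
  have h2 : ⨆ j, p j ≤ p i ⊔ ⨆ (j) (_ : j ≠ i), p j := by
    refine iSup_le fun j => ?_
    by_cases hj : j = i
    · subst hj; exact le_sup_left
    · exact le_sup_of_le_right (le_iSup₂_of_le j hj le_rfl)
  obtain ⟨b, hb, d, hd, rfl⟩ := Submodule.mem_sup.1 (h2 ha)
  have h3 : d ∈ f.eigenspace (e i) := by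
    rw [Module.End.mem_eigenspace_iff]
    rw [map_add, smul_add, hp i b hb] at h
    exact add_left_cancel h
  have h4 : d ∈ ⨆ (j) (_ : j ≠ i), f.eigenspace (e j) :=
    iSup₂_mono (fun j _ => hle j) hd
  have := (Submodule.disjoint_def.1 (hind i)) d h3 h4
  rwa [this, add_zero]

end FibreDegree


set_option linter.unusedSectionVars false

/-! ### The algebra of functions: scalars, derivations, decomposition by degree -/

section Functions

variable {n : ℕ} {M : Type*} [TopologicalSpace M] [ChartedSpace (EuclideanSpace ℝ (Fin n)) M]
  [IsManifold (𝓡 n) ∞ M]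
  {F : Type*} [NormedAddCommGroup F] [NormedSpace ℝ F]
  {E : M → Type*} [TopologicalSpace (TotalSpace F E)] [∀ x, TopologicalSpace (E x)]
  [∀ x, AddCommGroup (E x)] [∀ x, Module ℝ (E x)]
  [∀ x, IsTopologicalAddGroup (E x)] [∀ x, ContinuousSMul ℝ (E x)]
  [FiberBundle F E] [VectorBundle ℝ F E]

variable (n M) in
/-- Smooth complex functions on `M`. -/
def CFun : Subalgebra ℂ (M → ℂ) where
  carrier := {c | ContMDiff (𝓡 n) 𝓘(ℝ, ℝ) ∞ (fun x => (c x).re) ∧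
    ContMDiff (𝓡 n) 𝓘(ℝ, ℝ) ∞ (fun x => (c x).im)}
  add_mem' h h' := ⟨h.1.add h'.1, h.2.add h'.2⟩
  mul_mem' {c d} h h' := by
    refine ⟨?_, ?_⟩
    · exact ((h.1.mul h'.1).sub (h.2.mul h'.2)).congr fun x => Complex.mul_re _ _
    · exact ((h.1.mul h'.2).add (h.2.mul h'.1)).congr fun x => Complex.mul_im _ _
  algebraMap_mem' z := ⟨contMDiff_const (c := z.re), contMDiff_const (c := z.im)⟩

/-- A smooth real function as a complex function. -/
def CFun.ofReal (f : SFun n M) : CFun n M :=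
  ⟨fun x => (f x : ℂ), by simpa using f.contMDiff, by simpa using contMDiff_const⟩

theorem CFun.exists_ofReal (c : CFun n M) :
    ∃ f h : SFun n M, c = CFun.ofReal f + Complex.I • CFun.ofReal h := by
  refine ⟨⟨fun x => (c.1 x).re, c.2.1⟩, ⟨fun x => (c.1 x).im, c.2.2⟩, Subtype.ext (funext fun x => ?_)⟩
  change c.1 x = ((c.1 x).re : ℂ) + Complex.I * ((c.1 x).im : ℂ)
  rw [mul_comm, Complex.re_add_im]

theorem polyFamilies_induction {p : (∀ x, FnFiber n E x) → Prop}
    (hf : ∀ f : SFun n M, p fun x => algebraMap ℂ (FnFiber n E x) (f x : ℝ))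
    (hX : ∀ X : VField n M, p fun x => tangentι n E x (X x))
    (hξ : ∀ ξ : Cₛ^∞⟮𝓡 n; F, E⟯, p fun x => exteriorι n E x (ExteriorAlgebra.ι ℝ (ξ x)))
    (hc : ∀ z : ℂ, p fun x => algebraMap ℂ (FnFiber n E x) z)
    (hadd : ∀ P ∈ polyFamilies n F E, ∀ Q ∈ polyFamilies n F E, p P → p Q → p (P + Q))
    (hmul : ∀ P ∈ polyFamilies n F E, ∀ Q ∈ polyFamilies n F E, p P → p Q → p (P * Q))
    {P : ∀ x, FnFiber n E x} (hP : P ∈ polyFamilies n F E) : p P := by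
  refine Algebra.adjoin_induction (p := fun P _ => p P) ?_ hc
    (fun P Q h1 h2 h3 h4 => hadd P h1 Q h2 h3 h4) (fun P Q h1 h2 h3 h4 => hmul P h1 Q h2 h3 h4) hP
  rintro _ ((⟨f, rfl⟩ | ⟨X, rfl⟩) | ⟨ξ, rfl⟩)
  · exact hf f
  · exact hX X
  · exact hξ ξ

theorem smooth_augmentation {P : ∀ x, FnFiber n E x} (hP : P ∈ polyFamilies n F E) :
    (fun x => augmentation n E x (P x)) ∈ CFun n M := by
  refine polyFamilies_induction (F := F) (p := fun P => (fun x => augmentation n E x (P x)) ∈ CFun n M)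
    (fun f => ?_) (fun X => ?_) (fun ξ => ?_) (fun z => ?_) (fun P _ Q _ h h' => ?_)
    (fun P _ Q _ h h' => ?_) hP
  · simp only [augmentation_algebraMap]; exact (CFun.ofReal f).2
  · simp only [augmentation_tangentι]; exact zero_mem _
  · simp only [augmentation_exteriorι]; exact zero_mem _
  · simp only [augmentation_algebraMap]; exact (CFun n M).algebraMap_mem z
  · simp only [Pi.add_apply, map_add]; exact add_mem h h'
  · simp only [Pi.mul_apply, map_mul]; exact mul_mem h h'

theorem CFun.mem_of_contMDiffAt {c : M → ℂ}
    (h : ∀ x₀, ContMDiffAt (𝓡 n) 𝓘(ℝ, ℝ) ∞ (fun x => (c x).re) x₀ ∧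
      ContMDiffAt (𝓡 n) 𝓘(ℝ, ℝ) ∞ (fun x => (c x).im) x₀) : c ∈ CFun n M :=
  ⟨fun x₀ => (h x₀).1, fun x₀ => (h x₀).2⟩

theorem CFun.mem_of_eventuallyEq {c : M → ℂ}
    (h : ∀ x₀, ∃ d ∈ CFun n M, c =ᶠ[𝓝 x₀] d) : c ∈ CFun n M := by
  refine ⟨fun x₀ => ?_, fun x₀ => ?_⟩
  · obtain ⟨d, hd, e⟩ := h x₀
    exact (hd.1 x₀).congr_of_eventuallyEq (e.mono fun x hx => congrArg Complex.re hx)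
  · obtain ⟨d, hd, e⟩ := h x₀
    exact (hd.2 x₀).congr_of_eventuallyEq (e.mono fun x hx => congrArg Complex.im hx)

theorem exists_cfun_of_degree_zero {G : Fn n F E} (hG : G ∈ FnOfDegree n F E 0) :
    ∃ c : CFun n M, ∀ x, G.1 x = algebraMap ℂ _ (c.1 x) := by
  refine ⟨⟨fun x => augmentation n E x (G.1 x), CFun.mem_of_eventuallyEq fun x₀ => ?_⟩,
    fun x => FnDegree_zero (hG x)⟩
  obtain ⟨P, hP, e⟩ := G.2.2 x₀
  exact ⟨_, smooth_augmentation hP, e.mono fun x hx => congrArg (augmentation n E x) hx⟩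

variable (F E) in
/-- A complex function on `M`, as a function of degree `0`. -/
def fnScalar : CFun n M →ₐ[ℂ] Fn n F E where
  toFun c := ⟨fun x => algebraMap ℂ (FnFiber n E x) (c.1 x), by
    obtain ⟨f, h, rfl⟩ := CFun.exists_ofReal c
    have := (fnBase F E f + Complex.I • fnBase F E h).2
    convert this using 1
    funext x
    change algebraMap ℂ _ ((f x : ℂ) + Complex.I * (h x : ℂ)) =
      algebraMap ℂ (FnFiber n E x) (f x : ℂ) + Complex.I • algebraMap ℂ (FnFiber n E x) (h x : ℂ)
    rw [map_add, map_mul, ← Algebra.smul_def]⟩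
  map_one' := Subtype.ext (funext fun x => map_one _)
  map_mul' c d := Subtype.ext (funext fun x => map_mul _ _ _)
  map_zero' := Subtype.ext (funext fun x => map_zero _)
  map_add' c d := Subtype.ext (funext fun x => map_add _ _ _)
  commutes' z := Subtype.ext (funext fun x => rfl)

theorem fnScalar_apply (c : CFun n M) (x : M) :
    (fnScalar F E c).1 x = algebraMap ℂ (FnFiber n E x) (c.1 x) := rfl

theorem fnScalar_injective : Function.Injective (fnScalar (n := n) F E) := by
  intro c d h
  refine Subtype.ext (funext fun x => ?_)
  have := congrArg (fun G : Fn n F E => augmentation n E x (G.1 x)) h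
  simpa [fnScalar_apply, augmentation_algebraMap] using this

/-- A fibrewise operator on functions. -/
def fnLift (L : ∀ x, FnFiber n E x →ₗ[ℂ] FnFiber n E x)
    (hL : ∀ x N, lengthOne n E x ^ N ≤ (lengthOne n E x ^ N).comap (L x))
    (hP : ∀ P ∈ polyFamilies n F E, (fun x => L x (P x)) ∈ polyFamilies n F E) :
    Fn n F E →ₗ[ℂ] Fn n F E where
  toFun G := ⟨fun x => L x (G.1 x), by
    obtain ⟨⟨N, hN⟩, hG⟩ := G.2
    refine ⟨⟨N, fun x => hL x N (hN x)⟩, fun x₀ => ?_⟩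
    obtain ⟨P, hP', e⟩ := hG x₀
    exact ⟨_, hP P hP', e.mono fun x hx => congrArg (L x) hx⟩⟩
  map_add' G H := Subtype.ext (funext fun x => map_add (L x) _ _)
  map_smul' z G := Subtype.ext (funext fun x => map_smul (L x) z _)

theorem polyFamilies_scalar (f : SFun n M) :
    (fun x => algebraMap ℂ (FnFiber n E x) (f x : ℝ)) ∈ polyFamilies n F E :=
  Algebra.subset_adjoin (Or.inl (Or.inl ⟨f, rfl⟩))

theorem polyFamilies_tangent (X : VField n M) :
    (fun x => tangentι n E x (X x)) ∈ polyFamilies n F E :=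
  Algebra.subset_adjoin (Or.inl (Or.inr ⟨X, rfl⟩))

theorem polyFamilies_exterior (ξ : Cₛ^∞⟮𝓡 n; F, E⟯) :
    (fun x => exteriorι n E x (ExteriorAlgebra.ι ℝ (ξ x))) ∈ polyFamilies n F E :=
  Algebra.subset_adjoin (Or.inr ⟨ξ, rfl⟩)

theorem polyFamilies_inv {P : ∀ x, FnFiber n E x} (hP : P ∈ polyFamilies n F E) :
    (fun x => fibreInv (P x)) ∈ polyFamilies n F E := by
  refine polyFamilies_induction (F := F) (p := fun P => (fun x => fibreInv (P x)) ∈ polyFamilies n F E)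
    (fun f => ?_) (fun X => ?_) (fun ξ => ?_) (fun z => ?_) (fun P _ Q _ h h' => ?_)
    (fun P _ Q _ h h' => ?_) hP
  · simp only [fibreInv_algebraMap]; exact polyFamilies_scalar f
  · simp only [fibreInv_tangentι]; exact polyFamilies_tangent X
  · simp only [fibreInv_exteriorι]; exact neg_mem (polyFamilies_exterior ξ)
  · simp only [fibreInv_algebraMap]; exact (polyFamilies n F E).algebraMap_mem z
  · simp only [Pi.add_apply, map_add]; exact add_mem h h'
  · simp only [Pi.mul_apply, fibreInv_mul]; exact mul_mem h h'

theorem one_mem_lengthOne (x : M) : (1 : FnFiber n E x) ∈ lengthOne n E x :=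
  (lengthOne_le.1 le_rfl).1

theorem algebraMap_mem_lengthOne (x : M) (z : ℂ) :
    algebraMap ℂ (FnFiber n E x) z ∈ lengthOne n E x := by
  rw [Algebra.algebraMap_eq_smul_one]
  exact Submodule.smul_mem _ _ (one_mem_lengthOne x)

theorem tangentι_mem_lengthOne (x : M) (v) : tangentι n E x v ∈ lengthOne n E x :=
  (lengthOne_le.1 le_rfl).2.1 v

theorem exteriorι_mem_lengthOne (x : M) (w : E x) :
    exteriorι n E x (ExteriorAlgebra.ι ℝ w) ∈ lengthOne n E x :=
  (lengthOne_le.1 le_rfl).2.2 w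

theorem fibreD_one {x : M} (μ : TangentSpace (𝓡 n) x →ₗ[ℝ] ℝ) :
    fibreD μ (1 : FnFiber n E x) = 0 := by
  simpa using fibreD_algebraMap (E := E) μ 1

theorem fibreC_one {x : M} (μ : E x →ₗ[ℝ] ℝ) :
    fibreC μ (1 : FnFiber n E x) = 0 := by
  simpa using fibreC_algebraMap (n := n) (E := E) μ 1

variable (F E) in
/-- The derivation of functions on `T^*[2]M ⊕ E[1]` along the fibre direction `df`. -/
def fnD (f : SFun n M) : Fn n F E →ₗ[ℂ] Fn n F E :=
  fnLift (fun x => fibreD (mvfderiv (𝓡 n) f x).toLinearMap)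
    (fun x N => lengthOne_pow_map _ LinearMap.id (fun G H => fibreD_mul _ G H) (fibreD_one _) le_rfl
      (lengthOne_le.2 ⟨by
          refine Submodule.mem_comap.2 ?_
          rw [fibreD_one]; exact zero_mem _, fun v => by
          refine Submodule.mem_comap.2 ?_
          rw [fibreD_tangentι]; exact algebraMap_mem_lengthOne x _, fun w => by
          refine Submodule.mem_comap.2 ?_
          rw [fibreD_exteriorι]; exact zero_mem _⟩) N)
    fun P hP => by
      refine polyFamilies_induction (F := F) (p := fun P => (fun x =>
          fibreD (mvfderiv (𝓡 n) f x).toLinearMap (P x)) ∈ polyFamilies n F E)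
        (fun h => ?_) (fun X => ?_) (fun ξ => ?_) (fun z => ?_) (fun P _ Q _ h h' => ?_)
        (fun P hP Q hQ h h' => ?_) hP
      · simp only [fibreD_algebraMap]; exact zero_mem _
      · simp only [fibreD_tangentι]; exact polyFamilies_scalar (X.app f)
      · simp only [fibreD_exteriorι]; exact zero_mem _
      · simp only [fibreD_algebraMap]; exact zero_mem _
      · simp only [Pi.add_apply, map_add]; exact add_mem h h'
      · simp only [Pi.mul_apply, fibreD_mul]; exact add_mem (mul_mem hP h') (mul_mem h hQ)

/-- The contraction of functions on `T^*[2]M ⊕ E[1]` with `g(ξ, ·)`. -/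
def fnC (g : PseudoMetric n F E) (v : Cₛ^∞⟮𝓡 n; F, E⟯) : Fn n F E →ₗ[ℂ] Fn n F E :=
  fnLift (fun x => fibreC (g.form x (v x)))
    (fun x N => lengthOne_pow_map _ fibreInv (fun G H => fibreC_mul _ G H) (fibreC_one _)
      (lengthOne_le.2 ⟨by
          refine Submodule.mem_comap.2 ?_
          have := fibreInv_algebraMap (n := n) (E := E) (x := x) 1
          rw [map_one] at this
          rw [this]; exact one_mem_lengthOne x, fun v => by
          refine Submodule.mem_comap.2 ?_
          rw [fibreInv_tangentι]; exact tangentι_mem_lengthOne x _, fun w => by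
          refine Submodule.mem_comap.2 ?_
          rw [fibreInv_exteriorι]; exact neg_mem (exteriorι_mem_lengthOne x w)⟩)
      (lengthOne_le.2 ⟨by
          refine Submodule.mem_comap.2 ?_
          rw [fibreC_one]; exact zero_mem _, fun v => by
          refine Submodule.mem_comap.2 ?_
          rw [fibreC_tangentι]; exact zero_mem _, fun w => by
          refine Submodule.mem_comap.2 ?_
          rw [fibreC_exteriorι]; exact algebraMap_mem_lengthOne x _⟩) N)
    fun P hP => by
      refine polyFamilies_induction (F := F) (p := fun P => (fun x =>
          fibreC (g.form x (v x)) (P x)) ∈ polyFamilies n F E)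
        (fun h => ?_) (fun X => ?_) (fun ξ => ?_) (fun z => ?_) (fun P _ Q _ h h' => ?_)
        (fun P hP Q hQ h h' => ?_) hP
      · simp only [fibreC_algebraMap]; exact zero_mem _
      · simp only [fibreC_tangentι]; exact zero_mem _
      · simp only [fibreC_exteriorι]; exact polyFamilies_scalar (g.pair v ξ)
      · simp only [fibreC_algebraMap]; exact zero_mem _
      · simp only [Pi.add_apply, map_add]; exact add_mem h h'
      · simp only [Pi.mul_apply, fibreC_mul]
        exact add_mem (mul_mem hP h') (mul_mem h (polyFamilies_inv hQ))

variable {ι κ : Type*} [Fintype ι] [Fintype κ]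

-- The factors are pairwise coprime, so the kernel of the product is the sum of the kernels. It
-- serves to split a function into homogeneous parts that are again smooth.
open Polynomial in
theorem ker_aeval_prod_eq_iSup {A : Type*} [AddCommGroup A] [Module ℂ A] (T : Module.End ℂ A)
    (m : ℕ) : LinearMap.ker (aeval T (∏ k ∈ Finset.range m, (X - C (k : ℂ)))) =
      ⨆ k ∈ Finset.range m, T.eigenspace (k : ℂ) := by
  induction m with
  | zero => simp [Module.End.one_eq_id]
  | succ m ih =>
    have hc : IsCoprime (∏ k ∈ Finset.range m, (X - C (k : ℂ))) (X - C (m : ℂ)) := by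
      refine IsCoprime.prod_left fun k hk => ?_
      refine pairwise_coprime_X_sub_C (s := fun k : ℕ => (k : ℂ)) Nat.cast_injective ?_
      exact (Finset.mem_range.1 hk).ne
    rw [Finset.prod_range_succ, ← sup_ker_aeval_eq_ker_aeval_mul_of_coprime T hc, ih,
      Finset.range_add_one, Finset.iSup_insert, sup_comm, Module.End.eigenspace_def, map_sub,
      aeval_X, aeval_C, Algebra.algebraMap_eq_smul_one]

/-- The Euler operator of the algebra of functions. -/
def fnEuler (g : PseudoMetric n F E) (f : ι → SFun n M) (X : ι → VField n M)
    (ξ η : κ → Cₛ^∞⟮𝓡 n; F, E⟯) : Fn n F E →ₗ[ℂ] Fn n F E :=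
  ∑ j, (2 : ℂ) • LinearMap.mulRight ℂ (fnField F E (X j)) ∘ₗ fnD F E (f j) +
    ∑ a, LinearMap.mulRight ℂ (fnSection (η a)) ∘ₗ fnC g (ξ a)

theorem Fn.coe_sum {α : Type*} (s : Finset α) (G : α → Fn n F E) (x : M) :
    (∑ i ∈ s, G i).1 x = ∑ i ∈ s, (G i).1 x := by
  classical
  induction s using Finset.induction_on with
  | empty => rfl
  | insert a s ha ih => rw [Finset.sum_insert ha, Finset.sum_insert ha, ← ih]; rfl

variable {g : PseudoMetric n F E} {f : ι → SFun n M} {X : ι → VField n M}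
    {ξ η : κ → Cₛ^∞⟮𝓡 n; F, E⟯}

theorem fnEuler_apply (G : Fn n F E) : fnEuler g f X ξ η G =
    ∑ j, (2 : ℂ) • (fnD F E (f j) G * fnField F E (X j)) + ∑ a, fnC g (ξ a) G * fnSection (η a) := by
  simp [fnEuler, LinearMap.sum_apply]

theorem fnEuler_apply_apply (G : Fn n F E) (x : M) : (fnEuler g f X ξ η G).1 x =
    fibreEuler (fun j => (mvfderiv (𝓡 n) (f j) x).toLinearMap) (fun j => X j x)
      (fun a => g.form x (ξ a x)) (fun a => η a x) (G.1 x) := by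
  rw [fnEuler_apply, fibreEuler_apply]
  change (∑ j, (2 : ℂ) • (fnD F E (f j) G * fnField F E (X j)) : Fn n F E).1 x +
    (∑ a, fnC g (ξ a) G * fnSection (η a) : Fn n F E).1 x = _
  rw [Fn.coe_sum, Fn.coe_sum]
  rfl

section

variable (hX : ∀ (x : M) (v : TangentSpace (𝓡 n) x), v = ∑ j, mvfderiv (𝓡 n) (f j) x v • X j x)
  (hξ : ∀ (x : M) (v : E x), v = ∑ a, g.form x v (ξ a x) • η a x)
include hX hξ

/-- In each fibre the value of a function is a sum of homogeneous elements, and degrees are distinct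
eigenvalues of the Euler operator. -/
theorem fnEuler_eq_iff (G : Fn n F E) (k : ℤ) :
    fnEuler g f X ξ η G = (k : ℂ) • G ↔ G ∈ FnOfDegree n F E k := by
  have hξ' : ∀ (x : M) (v : E x), v = ∑ a, g.form x (ξ a x) v • η a x := fun x v => by
    simpa only [g.symm x v] using hξ x v
  constructor
  · intro h x
    obtain ⟨N, hN⟩ := G.2.1
    refine eigenspace_le_of_iSup (fibreEuler (fun j => (mvfderiv (𝓡 n) (f j) x).toLinearMap)
      (fun j => X j x) (fun a => g.form x (ξ a x)) (fun a => η a x)) (fun k : ℤ => (k : ℂ))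
      Int.cast_injective (fun k => FnDegree n E k x)
      (fun k G hG => fibreEuler_eq (hX x) (hξ' x) hG) ?_ k ?_
    · have : ⨆ k ∈ Finset.range (2 * N + 1), FnDegree n E (k : ℤ) x ≤
          ⨆ k : ℤ, FnDegree n E k x :=
        iSup₂_le fun k _ => le_iSup (fun k : ℤ => FnDegree n E k x) (k : ℤ)
      exact this (lengthOne_pow_le N (hN x))
    · rw [← fnEuler_apply_apply, h]; rfl
  · intro h
    refine Subtype.ext (funext fun x => ?_)
    rw [fnEuler_apply_apply, fibreEuler_eq (hX x) (hξ' x) (h x)]; rfl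

theorem FnOfDegree_indep : iSupIndep (FnOfDegree n F E) := by
  have := (Module.End.eigenspaces_iSupIndep (fnEuler g f X ξ η)).comp
    (f := fun k : ℤ => (k : ℂ)) Int.cast_injective
  refine this.mono fun k G hG => ?_
  rw [Function.comp_apply, Module.End.mem_eigenspace_iff]
  exact (fnEuler_eq_iff hX hξ G k).2 hG

/-- If `G` has length at most `N`, the product of the `T - k` with `k ≤ 2 N` kills it in every
fibre, hence globally. The Euler operator `T` acts on smooth functions, so the resulting
eigencomponents are smooth without further argument. -/
theorem FnOfDegree_iSup : ⨆ k, FnOfDegree n F E k = ⊤ := by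
  have hξ' : ∀ (x : M) (v : E x), v = ∑ a, g.form x (ξ a x) v • η a x := fun x v => by
    simpa only [g.symm x v] using hξ x v
  refine eq_top_iff.2 fun G _ => ?_
  obtain ⟨N, hN⟩ := G.2.1
  set T : Module.End ℂ (Fn n F E) := fnEuler g f X ξ η with hT
  have h1 : G ∈ ⨆ k ∈ Finset.range (2 * N + 1), T.eigenspace (k : ℂ) := by
    rw [← ker_aeval_prod_eq_iSup]
    rw [LinearMap.mem_ker]
    refine Subtype.ext (funext fun x => ?_)
    let Tx : Module.End ℂ (FnFiber n E x) :=
      fibreEuler (fun j => (mvfderiv (𝓡 n) (f j) x).toLinearMap) (fun j => X j x)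
        (fun a => g.form x (ξ a x)) (fun a => η a x)
    -- Evaluation at `x` intertwines the global and the fibrewise Euler operator, and so their
    -- polynomials.
    have h2 : ∀ (p : Polynomial ℂ) (H : Fn n F E),
        (Polynomial.aeval T p H).1 x = Polynomial.aeval Tx p (H.1 x) := by
      intro p
      induction p using Polynomial.induction_on' with
      | add p q hp hq =>
        intro H
        rw [map_add, map_add, LinearMap.add_apply, LinearMap.add_apply, ← hp, ← hq]; rfl
      | monomial m z =>
        intro H
        rw [Polynomial.aeval_monomial, Polynomial.aeval_monomial, Module.End.mul_apply,
          Module.End.mul_apply, Module.algebraMap_end_apply, Module.algebraMap_end_apply]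
        change z • ((T ^ m) H).1 x = _
        congr 1
        induction m generalizing H with
        | zero => rfl
        | succ m ih =>
          rw [pow_succ, pow_succ, Module.End.mul_apply, Module.End.mul_apply, ih,
            hT, fnEuler_apply_apply]
    rw [h2]
    have h3 : ⨆ k ∈ Finset.range (2 * N + 1), FnDegree n E (k : ℤ) x ≤
        ⨆ k ∈ Finset.range (2 * N + 1), Tx.eigenspace (k : ℂ) :=
      iSup₂_mono fun k _ H hH => Module.End.mem_eigenspace_iff.2 (fibreEuler_eq (hX x) (hξ' x) hH)
    have h4 := h3 (lengthOne_pow_le N (hN x))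
    rw [← ker_aeval_prod_eq_iSup, LinearMap.mem_ker] at h4
    exact h4
  have h2 : ⨆ k ∈ Finset.range (2 * N + 1), T.eigenspace (k : ℂ) ≤ ⨆ k, FnOfDegree n F E k := by
    refine iSup₂_le fun k _ => le_iSup_of_le (k : ℤ) fun H hH => ?_
    refine (fnEuler_eq_iff hX hξ H k).1 ?_
    simpa using Module.End.mem_eigenspace_iff.1 hH
  exact h2 h1

end

end Functions


set_option linter.unusedSectionVars false

/-! ### Vector fields as derivations -/

section LieDerivatives

variable {n : ℕ} {M : Type*} [TopologicalSpace M] [ChartedSpace (EuclideanSpace ℝ (Fin n)) M]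
  [IsManifold (𝓡 n) ∞ M]

theorem VField.app_add (X : VField n M) (f h : SFun n M) :
    X.app (f + h) = X.app f + X.app h := by
  ext x
  have := mvfderiv_add (I := 𝓡 n) (f.mdifferentiableAt x) (h.mdifferentiableAt x)
  change mvfderiv (𝓡 n) (⇑f + ⇑h) x (X x) = _
  rw [this]; rfl

section

variable {F : Type*} [NormedAddCommGroup F] [NormedSpace ℝ F]
  {V : M → Type*} [TopologicalSpace (TotalSpace F V)] [∀ x, TopologicalSpace (V x)]
  [∀ x, AddCommGroup (V x)] [∀ x, Module ℝ (V x)] [FiberBundle F V] [VectorBundle ℝ F V]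

/-- The product of a function and a section. -/
def fsmul (f : SFun n M) (s : Cₛ^∞⟮𝓡 n; F, V⟯) : Cₛ^∞⟮𝓡 n; F, V⟯ :=
  ⟨fun x => f x • s x, ContMDiff.smul_section f.contMDiff s.contMDiff⟩

theorem fsmul_apply (f : SFun n M) (s : Cₛ^∞⟮𝓡 n; F, V⟯) (x : M) : fsmul f s x = f x • s x := rfl

theorem section_mdifferentiableAt (s : Cₛ^∞⟮𝓡 n; F, V⟯) (x : M) :
    MDifferentiableAt (𝓡 n) ((𝓡 n).prod 𝓘(ℝ, F)) (fun x => TotalSpace.mk' F x (s x)) x :=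
  s.contMDiff.mdifferentiable (by simp) x

theorem section_sum_apply {α : Type*} (t : Finset α) (s : α → Cₛ^∞⟮𝓡 n; F, V⟯) (x : M) :
    (∑ i ∈ t, s i) x = ∑ i ∈ t, s i x := by
  classical
  induction t using Finset.induction_on with
  | empty => rfl
  | insert a t ha ih => rw [Finset.sum_insert ha, Finset.sum_insert ha, ← ih]; rfl

variable [∀ x, IsTopologicalAddGroup (V x)] [∀ x, ContinuousSMul ℝ (V x)]

theorem Connection.nabla_add (D : Connection n F V) (X : VField n M) (s t : Cₛ^∞⟮𝓡 n; F, V⟯) :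
    D.nabla X (s + t) = D.nabla X s + D.nabla X t := by
  ext x
  have := D.cov.isCovariantDerivativeOnUniv.add (x := x) (section_mdifferentiableAt s x)
    (section_mdifferentiableAt t x)
  exact congrArg (fun L => L (X x)) this

theorem Connection.cov_fsmul (D : Connection n F V) (f : SFun n M) (s : Cₛ^∞⟮𝓡 n; F, V⟯) (x : M)
    (v : TangentSpace (𝓡 n) x) :
    D.cov (fsmul f s) x v = f x • D.cov s x v + mvfderiv (𝓡 n) f x v • s x := by
  have := D.cov.isCovariantDerivativeOnUniv.leibniz (x := x) (section_mdifferentiableAt s x)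
    (f.mdifferentiableAt x)
  exact congrArg (fun L => L v) this

theorem Connection.nabla_fsmul (D : Connection n F V) (X : VField n M) (f : SFun n M)
    (s : Cₛ^∞⟮𝓡 n; F, V⟯) :
    D.nabla X (fsmul f s) = fsmul f (D.nabla X s) + fsmul (X.app f) s := by
  ext x
  exact D.cov_fsmul f s x (X x)

end

theorem lieBracket_fsmul (X : VField n M) (f : SFun n M) (Z : VField n M) :
    lieBracket X (fsmul f Z) = fsmul (X.app f) Z + fsmul f (lieBracket X Z) := by
  ext x
  exact VectorField.mlieBracket_smul_right (V := X) (W := Z) (f.mdifferentiableAt x)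
    (section_mdifferentiableAt Z x)

theorem lieBracket_add (X Y Z : VField n M) :
    lieBracket X (Y + Z) = lieBracket X Y + lieBracket X Z := by
  ext x
  exact VectorField.mlieBracket_add_right (V := X) (section_mdifferentiableAt Y x)
    (section_mdifferentiableAt Z x)

theorem lieBracket_leibniz (X Y Z : VField n M) :
    lieBracket X (lieBracket Y Z) = lieBracket (lieBracket X Y) Z + lieBracket Y (lieBracket X Z) := by
  have h2 : IsManifold (𝓡 n) (minSmoothness ℝ 3) M :=
    IsManifold.of_le (n := ∞) (by simpa using ENat.LEInfty.out)
  have h : ∀ (U : VField n M) (x : M), ContMDiffAt (𝓡 n) ((𝓡 n).prod 𝓘(ℝ, EuclideanSpace ℝ (Fin n)))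
      (minSmoothness ℝ 2) (fun x => TotalSpace.mk' (EuclideanSpace ℝ (Fin n)) x (U x)) x :=
    fun U x => (U.contMDiff x).of_le (by simpa using ENat.LEInfty.out)
  ext x
  exact VectorField.leibniz_identity_mlieBracket_apply (h X x) (h Y x) (h Z x)

/-- Apply the Jacobi identity to `X`, `Y`, `f Z` and compare the coefficients of `Z` at a point
where `Z` is nonzero. If all vector fields vanish at the point, both sides are zero there. -/
theorem lieBracket_app (X Y : VField n M) (f : SFun n M) :
    (lieBracket X Y).app f = X.app (Y.app f) - Y.app (X.app f) := by
  ext x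
  by_cases h : ∃ Z : VField n M, Z x ≠ 0
  · obtain ⟨Z, hZ⟩ := h
    have h1 := lieBracket_leibniz X Y (fsmul f Z)
    have e := lieBracket_leibniz X Y Z
    simp only [lieBracket_fsmul, lieBracket_add] at h1
    have h2 := congrArg (fun W : VField n M => W x) h1
    have e2 := congrArg (fun W : VField n M => W x) e
    simp only [ContMDiffSection.coe_add, Pi.add_apply, fsmul_apply] at h2 e2
    rw [e2] at h2
    change _ = X.app (Y.app f) x - Y.app (X.app f) x
    have h3 : ((lieBracket X Y).app f x - (X.app (Y.app f) x - Y.app (X.app f) x)) • Z x = 0 := by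
      rw [← neg_eq_zero, ← sub_eq_zero.2 h2]
      module
    exact sub_eq_zero.1 ((smul_eq_zero.1 h3).resolve_right hZ)
  · push Not at h
    change mvfderiv (𝓡 n) f x (lieBracket X Y x) =
      mvfderiv (𝓡 n) (Y.app f) x (X x) - mvfderiv (𝓡 n) (X.app f) x (Y x)
    rw [h, h, h, map_zero, map_zero, map_zero, sub_zero]

end LieDerivatives

/-! ### Curvature of a metric connection as a bivector -/

section Curvature

variable {n : ℕ} {M : Type*} [TopologicalSpace M] [ChartedSpace (EuclideanSpace ℝ (Fin n)) M]
  [IsManifold (𝓡 n) ∞ M]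
  {F : Type*} [NormedAddCommGroup F] [NormedSpace ℝ F]
  {E : M → Type*} [TopologicalSpace (TotalSpace F E)] [∀ x, TopologicalSpace (E x)]
  [∀ x, AddCommGroup (E x)] [∀ x, Module ℝ (E x)]
  [∀ x, IsTopologicalAddGroup (E x)] [∀ x, ContinuousSMul ℝ (E x)]
  [FiberBundle F E] [VectorBundle ℝ F E]

theorem Connection.curvature_add (D : Connection n F E) (X Y : VField n M)
    (s t : Cₛ^∞⟮𝓡 n; F, E⟯) : D.curvature X Y (s + t) = D.curvature X Y s + D.curvature X Y t := by
  simp only [Connection.curvature, Connection.nabla_add]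
  abel

theorem Connection.curvature_fsmul (D : Connection n F E) (X Y : VField n M) (f : SFun n M)
    (s : Cₛ^∞⟮𝓡 n; F, E⟯) : D.curvature X Y (fsmul f s) = fsmul f (D.curvature X Y s) := by
  simp only [Connection.curvature, Connection.nabla_add, Connection.nabla_fsmul, lieBracket_app]
  ext x
  simp only [ContMDiffSection.coe_add, ContMDiffSection.coe_sub, Pi.add_apply, Pi.sub_apply,
    fsmul_apply, smul_sub]
  have : (X.app (Y.app f) - Y.app (X.app f)) x = X.app (Y.app f) x - Y.app (X.app f) x := rfl
  rw [this]
  module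

theorem Connection.curvature_sum (D : Connection n F E) (X Y : VField n M) {α : Type*}
    (t : Finset α) (s : α → Cₛ^∞⟮𝓡 n; F, E⟯) :
    D.curvature X Y (∑ i ∈ t, s i) = ∑ i ∈ t, D.curvature X Y (s i) := by
  exact map_sum (AddMonoidHom.mk' (D.curvature X Y) (D.curvature_add X Y)) s t

variable {g : PseudoMetric n F E} {D : Connection n F E}

theorem PseudoMetric.pair_apply (ξ η : Cₛ^∞⟮𝓡 n; F, E⟯) (x : M) :
    g.pair ξ η x = g.form x (ξ x) (η x) := rfl

theorem PseudoMetric.IsMetricConnection.app_pair (h : g.IsMetricConnection D) (X : VField n M)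
    (ξ η : Cₛ^∞⟮𝓡 n; F, E⟯) :
    X.app (g.pair ξ η) = g.pair (D.nabla X ξ) η + g.pair ξ (D.nabla X η) := by
  ext x
  exact h X ξ η x

/-- Expand `[X, Y] g(ξ, η) = X Y g(ξ, η) - Y X g(ξ, η)` by the metric property; the mixed terms
cancel. -/
theorem PseudoMetric.IsMetricConnection.curvature_skew (h : g.IsMetricConnection D)
    (X Y : VField n M) (ξ η : Cₛ^∞⟮𝓡 n; F, E⟯) :
    g.pair (D.curvature X Y ξ) η + g.pair ξ (D.curvature X Y η) = 0 := by
  have h1 := lieBracket_app X Y (g.pair ξ η)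
  simp only [h.app_pair, VField.app_add] at h1
  ext x
  have h2 := congrArg (fun f : SFun n M => f x) h1
  change _ + _ = ((_ + _) + (_ + _)) - ((_ + _) + (_ + _) : ℝ) at h2
  change g.form x (D.curvature X Y ξ x) (η x) + g.form x (ξ x) (D.curvature X Y η x) = 0
  simp only [PseudoMetric.pair_apply] at h2
  simp only [Connection.curvature, ContMDiffSection.coe_sub, Pi.sub_apply, map_sub,
    LinearMap.sub_apply]
  linear_combination -h2

variable {κ : Type*} [Fintype κ] {ξ η : κ → Cₛ^∞⟮𝓡 n; F, E⟯}
  (hξ : ∀ (x : M) (v : E x), v = ∑ a, g.form x v (ξ a x) • η a x)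
include hξ

theorem expand_section (s : Cₛ^∞⟮𝓡 n; F, E⟯) : s = ∑ a, fsmul (g.pair s (ξ a)) (η a) := by
  ext x
  rw [section_sum_apply]
  exact hξ x (s x)

/-- Pair with an arbitrary `w`, expand `w` and use that the metric is nondegenerate. So the families
`ξ` and `η` may be exchanged. -/
theorem expand_dual (x : M) (v : E x) : v = ∑ a, g.form x v (η a x) • ξ a x := by
  refine sub_eq_zero.1 ((g.nondegenerate x).2 _ fun w => ?_)
  have h := congrArg (g.form x v) (hξ x w)
  rw [map_sub, map_sum, g.symm x w v, h, map_sum, sub_eq_zero]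
  refine Finset.sum_congr rfl fun a _ => ?_
  rw [map_smul, map_smul, smul_eq_mul, smul_eq_mul, mul_comm]

theorem curvature_expand (X Y : VField n M) (s : Cₛ^∞⟮𝓡 n; F, E⟯) (x : M) :
    D.curvature X Y s x = ∑ a, g.form x (s x) (ξ a x) • D.curvature X Y (η a) x := by
  conv_lhs => rw [expand_section hξ s, D.curvature_sum, section_sum_apply]
  simp only [D.curvature_fsmul]
  rfl

omit hξ in
theorem contractLeft_ι_mul_ι {W : Type*} [AddCommGroup W] [Module ℝ W] (μ : W →ₗ[ℝ] ℝ) (u w : W) :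
    CliffordAlgebra.contractLeft (Q := (0 : QuadraticForm ℝ W)) μ
      (ExteriorAlgebra.ι ℝ u * ExteriorAlgebra.ι ℝ w) =
    μ u • ExteriorAlgebra.ι ℝ w - μ w • ExteriorAlgebra.ι ℝ u := by
  refine (CliffordAlgebra.contractLeft_ι_mul (Q := 0) μ u _).trans ?_
  congr 1
  refine (congrArg _ (CliffordAlgebra.contractLeft_ι (Q := 0) μ w)).trans ?_
  rw [Algebra.smul_def, Algebra.commutes]

/-- Contraction with `s` gives two sums. By skewness of the curvature and by the two expansions,
each of them is `-½ R(X, Y) s`. -/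
theorem isCurvatureBivector_sum (h : g.IsMetricConnection D) (X Y : VField n M) :
    IsCurvatureBivector g D X Y fun x => (1 / 2 : ℝ) • ∑ a,
      ExteriorAlgebra.ι ℝ (D.curvature X Y (η a) x) * ExteriorAlgebra.ι ℝ (ξ a x) := by
  refine ⟨fun x => ?_, fun s x => ?_⟩
  · refine Submodule.smul_mem _ _ (Submodule.sum_mem _ fun a _ => ?_)
    change _ ∈ LinearMap.range (ExteriorAlgebra.ι ℝ) ^ 2
    rw [pow_two]
    exact Submodule.mul_mem_mul ⟨_, rfl⟩ ⟨_, rfl⟩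
  · have h1 : ∀ a, g.form x (s x) (D.curvature X Y (η a) x) =
        -g.form x (D.curvature X Y s x) (η a x) := fun a => by
      have := congrArg (fun f : SFun n M => f x) (h.curvature_skew X Y s (η a))
      exact (eq_neg_of_add_eq_zero_right this)
    simp only [map_smul, map_sum, contractLeft_ι_mul_ι, h1, Finset.sum_sub_distrib, neg_smul,
      Finset.sum_neg_distrib]
    simp only [← map_smul, ← map_sum]
    rw [← curvature_expand hξ, ← expand_dual hξ]
    rw [← map_neg, ← map_sub, ← map_smul, ← map_neg]
    exact congrArg _ (by module)

-- Euler identity in degree 2: `∑ w_a ∧ ι_{μ_a} r = 2 r`, so a bivector is recovered from its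
-- contractions.
omit hξ in
theorem bivector_unique {W : Type*} [AddCommGroup W] [Module ℝ W] {μ : κ → W →ₗ[ℝ] ℝ} {w : κ → W}
    (hw : ∀ u, u = ∑ a, μ a u • w a) {r : ExteriorAlgebra ℝ W} (hr : r ∈ ⋀[ℝ]^2 W)
    (h : ∀ a, CliffordAlgebra.contractLeft (Q := (0 : QuadraticForm ℝ W)) (μ a) r = 0) : r = 0 := by
  have h1 : ∀ r ∈ ⋀[ℝ]^2 W, ∑ a, ExteriorAlgebra.ι ℝ (w a) *
      CliffordAlgebra.contractLeft (Q := (0 : QuadraticForm ℝ W)) (μ a) r = (2 : ℝ) • r := by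
    intro r hr
    change _ ∈ LinearMap.range (ExteriorAlgebra.ι ℝ) ^ 2 at hr
    rw [pow_two] at hr
    induction hr using Submodule.mul_induction_on' with
    | mem_mul_mem a ha b hb =>
      obtain ⟨u, rfl⟩ := ha
      obtain ⟨v, rfl⟩ := hb
      have h2 : ∀ u v, ExteriorAlgebra.ι ℝ (u : W) * ExteriorAlgebra.ι ℝ (v : W) =
          ∑ a, μ a u • (ExteriorAlgebra.ι ℝ (w a) * ExteriorAlgebra.ι ℝ v) := fun u v => by
        conv_lhs => rw [hw u]
        rw [map_sum, Finset.sum_mul]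
        simp
      simp only [contractLeft_ι_mul_ι, mul_sub, Finset.sum_sub_distrib, mul_smul_comm, ← h2]
      have h3 := ExteriorAlgebra.ι_add_mul_swap (R := ℝ) u v
      rw [eq_neg_of_add_eq_zero_right h3, two_smul, sub_neg_eq_add]
    | add x _ y _ hx hy => simp only [map_add, mul_add, Finset.sum_add_distrib, hx, hy, smul_add]
  have h2 := h1 r hr
  simp only [h, mul_zero, Finset.sum_const_zero] at h2
  exact (smul_eq_zero.1 h2.symm).resolve_left two_ne_zero

end Curvature


/-! ### Parity in a Clifford algebra of even rank, through a Casimir operator -/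

section CliffordFrame

/-- A system of generators of a Clifford algebra mapping to `B`, with dual finite families `ξ`, `η`
of vectors. -/
structure CliffordFrame (W B κ : Type*) [Ring B] [Algebra ℂ B] [Fintype κ] where
  form : W → W → ℝ
  γ : W → B
  ξ : κ → W
  η : κ → W
  r : ℂ
  symm : ∀ v w, form v w = form w v
  rel : ∀ v w, γ v * γ w = (2 * form v w : ℂ) • (1 : B) - γ w * γ v
  expand : ∀ v, γ v = ∑ a, (form v (ξ a) : ℂ) • γ (η a)
  expand_dual : ∀ v, γ v = ∑ a, (form v (η a) : ℂ) • γ (ξ a)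
  casimir : ∑ a, γ (η a) * γ (ξ a) = r • 1
  r_ne : r ≠ 0

namespace CliffordFrame

variable {W B κ : Type*} [Ring B] [Algebra ℂ B] [Fintype κ] (f : CliffordFrame W B κ)

/-- The span of the generators. -/
def gen : Submodule ℂ B := Submodule.span ℂ (Set.range f.γ)

/-- The filtration by the length of words, shifted by one. -/
def low : ℕ → Submodule ℂ B
  | 0 => ⊥
  | k + 1 => f.gen ^ k

/-- The filtration by the length of words, shifted by two. -/
def low' : ℕ → Submodule ℂ B
  | 0 => ⊥
  | k + 1 => f.low k

variable {f}

theorem γ_mem (v : W) : f.γ v ∈ f.gen := Submodule.subset_span ⟨v, rfl⟩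

theorem γ_mul_mem {k : ℕ} {A : B} (v : W) (h : A ∈ f.gen ^ k) : f.γ v * A ∈ f.gen ^ (k + 1) := by
  rw [pow_succ']; exact Submodule.mul_mem_mul (γ_mem v) h

theorem γ_mul_low {k : ℕ} {A : B} (v : W) (h : A ∈ f.low k) : f.γ v * A ∈ f.gen ^ k := by
  cases k with
  | zero => rw [(Submodule.mem_bot ℂ).1 h, mul_zero]; exact zero_mem _
  | succ k => exact γ_mul_mem v h

theorem γ_mul_low' {k : ℕ} {A : B} (v : W) (h : A ∈ f.low' k) : f.γ v * A ∈ f.low k := by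
  cases k with
  | zero => rw [(Submodule.mem_bot ℂ).1 h, mul_zero]; exact zero_mem _
  | succ k => exact γ_mul_low v h

theorem induction {p : ℕ → B → Prop} (hz : ∀ k, p k 0) (h0 : ∀ z : ℂ, p 0 (z • 1))
    (hmul : ∀ k v, ∀ A ∈ f.gen ^ k, p k A → p (k + 1) (f.γ v * A))
    (hadd : ∀ k A A', p k A → p k A' → p k (A + A'))
    (hsmul : ∀ k (z : ℂ) A, p k A → p k (z • A)) {k : ℕ} {A : B} (h : A ∈ f.gen ^ k) : p k A := by
  induction k generalizing A with
  | zero =>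
    obtain ⟨z, rfl⟩ := Submodule.mem_one.1 (by simpa using h)
    rw [Algebra.algebraMap_eq_smul_one]
    exact h0 z
  | succ k ih =>
    rw [pow_succ'] at h
    induction h using Submodule.mul_induction_on' with
    | mem_mul_mem a ha b hb =>
      induction ha using Submodule.span_induction with
      | mem a ha => obtain ⟨v, rfl⟩ := ha; exact hmul k v b hb (ih hb)
      | zero => rw [zero_mul]; exact hz _
      | add a a' _ _ h h' => rw [add_mul]; exact hadd _ _ _ h h'
      | smul z a _ h => rw [smul_mul_assoc]; exact hsmul _ _ _ h
    | add x _ y _ hx hy => exact hadd _ _ _ hx hy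

/-- The graded commutator with a generator lowers the length. -/
theorem comm_mem (v : W) {k : ℕ} {A : B} (h : A ∈ f.gen ^ k) :
    f.γ v * A - (-1 : ℂ) ^ k • (A * f.γ v) ∈ f.low k := by
  refine induction (f := f) (p := fun k A => f.γ v * A - (-1 : ℂ) ^ k • (A * f.γ v) ∈ f.low k) ?_ ?_
    ?_ ?_ ?_ h
  · intro k; simp
  · intro z; simp
  · intro k w A hA h
    have e : f.γ v * (f.γ w * A) - (-1 : ℂ) ^ (k + 1) • (f.γ w * A * f.γ v) =
        (2 * f.form v w : ℂ) • A - f.γ w * (f.γ v * A - (-1 : ℂ) ^ k • (A * f.γ v)) := by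
      rw [← mul_assoc, f.rel v w, sub_mul, smul_mul_assoc, one_mul, mul_sub, mul_smul_comm, pow_succ,
        mul_neg, mul_one, neg_smul]
      simp only [mul_assoc]
      abel
    rw [e]
    exact sub_mem (Submodule.smul_mem _ _ hA) (γ_mul_low w h)
  · intro k A A' h h'
    have := add_mem h h'
    convert this using 1
    rw [mul_add, add_mul, smul_add]; abel
  · intro k z A h
    have := Submodule.smul_mem _ z h
    convert this using 1
    rw [mul_smul_comm, smul_mul_assoc, smul_sub, smul_comm]

/-- `∑ γ(η_a) [γ(ξ_a), A] = 2 k A` for words of length `k`, up to shorter words. -/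
theorem euler_mem {k : ℕ} {A : B} (h : A ∈ f.gen ^ k) :
    ∑ a, f.γ (f.η a) * (f.γ (f.ξ a) * A - (-1 : ℂ) ^ k • (A * f.γ (f.ξ a))) - (2 * k : ℂ) • A ∈
      f.low' k := by
  refine induction (f := f) (p := fun k A => ∑ a, f.γ (f.η a) * (f.γ (f.ξ a) * A -
    (-1 : ℂ) ^ k • (A * f.γ (f.ξ a))) - (2 * k : ℂ) • A ∈ f.low' k) ?_ ?_ ?_ ?_ ?_ h
  · intro k; simp
  · intro z; simp
  · intro k w A hA h
    have e : ∀ v, f.γ v * (f.γ w * A) - (-1 : ℂ) ^ (k + 1) • (f.γ w * A * f.γ v) =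
        (2 * f.form w v : ℂ) • A - f.γ w * (f.γ v * A - (-1 : ℂ) ^ k • (A * f.γ v)) := by
      intro v
      rw [← mul_assoc, f.rel v w, sub_mul, smul_mul_assoc, one_mul, mul_sub, mul_smul_comm, pow_succ,
        mul_neg, mul_one, neg_smul, f.symm w v]
      simp only [mul_assoc]
      abel
    have e1 : ∑ a, f.γ (f.η a) * ((2 * f.form w (f.ξ a) : ℂ) • A) = (2 : ℂ) • (f.γ w * A) := by
      conv_rhs => rw [f.expand w]
      rw [Finset.sum_mul, Finset.smul_sum]
      refine Finset.sum_congr rfl fun a _ => ?_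
      rw [mul_smul_comm, smul_mul_assoc, smul_smul]
    -- Interchanging `γ(w)` with `γ(η_a)` leaves twice the commutator of `w` with `A`, which is
    -- shorter by one letter and so negligible here.
    have e2 : ∑ a, f.γ (f.η a) * (f.γ w * (f.γ (f.ξ a) * A - (-1 : ℂ) ^ k • (A * f.γ (f.ξ a)))) =
        (2 : ℂ) • (f.γ w * A - (-1 : ℂ) ^ k • (A * f.γ w)) -
        f.γ w * ∑ a, f.γ (f.η a) * (f.γ (f.ξ a) * A - (-1 : ℂ) ^ k • (A * f.γ (f.ξ a))) := by
      have hX : f.γ w * A - (-1 : ℂ) ^ k • (A * f.γ w) = ∑ a, (f.form w (f.η a) : ℂ) •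
          (f.γ (f.ξ a) * A - (-1 : ℂ) ^ k • (A * f.γ (f.ξ a))) := by
        conv_lhs => rw [f.expand_dual w]
        simp only [Finset.sum_mul, Finset.mul_sum, Finset.smul_sum, ← Finset.sum_sub_distrib,
          smul_mul_assoc, mul_smul_comm, smul_sub, smul_comm ((-1 : ℂ) ^ k)]
      rw [hX, Finset.smul_sum, Finset.mul_sum, ← Finset.sum_sub_distrib]
      refine Finset.sum_congr rfl fun a _ => ?_
      rw [← mul_assoc, f.rel (f.η a) w, f.symm (f.η a) w, sub_mul, smul_mul_assoc, one_mul,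
        mul_assoc, smul_smul]
    simp only [e, mul_sub (f.γ _) ((2 * f.form w _ : ℂ) • A), Finset.sum_sub_distrib, e1, e2]
    have h1 := γ_mul_low' w h
    have h2 := Submodule.smul_mem _ (2 : ℂ) (comm_mem w hA)
    have := sub_mem h1 h2
    change _ ∈ f.low k
    convert this using 1
    rw [mul_sub, mul_smul_comm, Nat.cast_succ]
    module
  · intro k A A' h h'
    have := add_mem h h'
    convert this using 1
    simp only [mul_add, add_mul, smul_add, mul_sub, Finset.sum_add_distrib, Finset.sum_sub_distrib]
    abel
  · intro k z A h
    have := Submodule.smul_mem _ z h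
    convert this using 1
    rw [smul_sub, Finset.smul_sum, smul_comm]
    congr 1
    refine Finset.sum_congr rfl fun a _ => ?_
    rw [mul_smul_comm, smul_mul_assoc, smul_comm, ← smul_sub, mul_smul_comm]

variable (f) in
/-- The operator `A ↦ ∑ γ(η_a) A γ(ξ_a)`. -/
def cas : B →ₗ[ℂ] B :=
  ∑ a, LinearMap.mulLeft ℂ (f.γ (f.η a)) ∘ₗ LinearMap.mulRight ℂ (f.γ (f.ξ a))

theorem cas_apply (A : B) : f.cas A = ∑ a, f.γ (f.η a) * (A * f.γ (f.ξ a)) := by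
  simp [cas, LinearMap.sum_apply]

/-- Since `∑ γ(η_a) γ(ξ_a) = r`, the Euler sum is `r A - (-1)^k cas A`, and it equals `2 k A` up to
words shorter by two. -/
theorem cas_mem {k : ℕ} {A : B} (h : A ∈ f.gen ^ k) :
    f.cas A - ((-1 : ℂ) ^ k * (f.r - 2 * k)) • A ∈ f.low' k := by
  have := Submodule.smul_mem _ (-(-1 : ℂ) ^ k) (euler_mem h)
  convert this using 1
  simp only [mul_sub, Finset.sum_sub_distrib, mul_smul_comm, ← mul_assoc]
  rw [← Finset.sum_mul, f.casimir, ← Finset.smul_sum, cas_apply]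
  simp only [smul_mul_assoc, one_mul, smul_sub, smul_smul, ← mul_assoc, neg_mul, neg_smul]
  have : (-1 : ℂ) ^ k * (-1 : ℂ) ^ k = 1 := by rw [← mul_pow]; simp
  rw [this]
  module

theorem gen_pow_le (k : ℕ) : f.gen ^ k ≤ f.gen ^ (k + 2) := by
  intro A hA
  have h1 : (1 : B) ∈ f.gen ^ 2 := by
    have h2 : ∑ a, f.γ (f.η a) * f.γ (f.ξ a) ∈ f.gen ^ 2 := Submodule.sum_mem _ fun a _ => by
      rw [pow_two]; exact Submodule.mul_mem_mul (γ_mem _) (γ_mem _)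
    rw [f.casimir] at h2
    have := Submodule.smul_mem _ f.r⁻¹ h2
    rwa [smul_smul, inv_mul_cancel₀ f.r_ne, one_smul] at this
  have := Submodule.mul_mem_mul hA h1
  rwa [mul_one, ← pow_add] at this

/-- The dimension can grow strictly at most `finrank ℂ V` times, and after the first repetition `h`
keeps the chain constant. -/
theorem stabilizes {V : Type*} [AddCommGroup V] [Module ℂ V] [FiniteDimensional ℂ V]
    (p : ℕ → Submodule ℂ V) (hp : Monotone p) (h : ∀ j, p j = p (j + 1) → p (j + 1) = p (j + 2))
    (j : ℕ) : p j ≤ p (Module.finrank ℂ V) := by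
  obtain ⟨i, hi, e⟩ : ∃ i ≤ Module.finrank ℂ V, p i = p (i + 1) := by
    by_contra! hc
    have : ∀ i ≤ Module.finrank ℂ V + 1, i ≤ Module.finrank ℂ (p i) := by
      intro i
      induction i with
      | zero => simp
      | succ i ih =>
        intro hi
        have h1 := ih (by omega)
        have h2 : Module.finrank ℂ (p i) < Module.finrank ℂ (p (i + 1)) :=
          Submodule.finrank_lt_finrank_of_lt (lt_of_le_of_ne (hp (Nat.le_succ i)) (hc i (by omega)))
        omega
    have h1 := this _ le_rfl
    have h2 := Submodule.finrank_le (p (Module.finrank ℂ V + 1))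
    omega
  have e' : ∀ l, p (i + l) = p (i + l + 1) := by
    intro l
    induction l with
    | zero => exact e
    | succ l ih => exact h _ ih
  have e2 : ∀ l, p (i + l) = p i := by
    intro l
    induction l with
    | zero => rfl
    | succ l ih => rw [← ih]; exact (e' l).symm
  refine (hp (Nat.le_add_left j i)).trans ?_
  rw [e2]
  exact hp hi

theorem gen_pow_mono {k l : ℕ} (h : k ≤ l) (h2 : Even (l - k)) : f.gen ^ k ≤ f.gen ^ l := by
  obtain ⟨m, hm⟩ := h2
  obtain rfl : l = k + 2 * m := by omega
  clear h hm
  induction m with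
  | zero => exact le_rfl
  | succ m ih => exact ih.trans (gen_pow_le _)

/-- Consecutive powers of equal parity differ by the factor `gen ^ 2`, so one equality implies all
later ones. Only a bound `D` on the dimension is needed, and it can be chosen for all fibres at
once. -/
theorem gen_pow_le_max [FiniteDimensional ℂ B] {D : ℕ} (hD : Module.finrank ℂ B ≤ D) (i j : ℕ) :
    f.gen ^ (2 * j + i) ≤ f.gen ^ (2 * D + i) := by
  refine (stabilizes (fun j => f.gen ^ (2 * j + i)) (monotone_nat_of_le_succ fun j => ?_)
    (fun j hj => ?_) j).trans (gen_pow_mono (by omega) ⟨D - Module.finrank ℂ B, by omega⟩)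
  · exact gen_pow_mono (by omega) ⟨1, by omega⟩
  · have h1 : ∀ j, f.gen ^ (2 * (j + 1) + i) = f.gen ^ 2 * f.gen ^ (2 * j + i) := fun j => by
      rw [← pow_add]; congr 1; ring
    change f.gen ^ (2 * (j + 1) + i) = f.gen ^ (2 * ((j + 1) + 1) + i)
    rw [h1, h1 (j + 1), ← show f.gen ^ (2 * j + i) = f.gen ^ (2 * (j + 1) + i) from hj]

theorem cas_pow_mem {k : ℕ} {A : B} (h : A ∈ f.gen ^ k) : f.cas A ∈ f.gen ^ k := by
  have h1 : f.low' k ≤ f.gen ^ k := by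
    match k with
    | 0 => exact bot_le
    | 1 => exact bot_le
    | k + 2 => exact gen_pow_le k
  have := add_mem (h1 (cas_mem h)) (Submodule.smul_mem _ ((-1 : ℂ) ^ k * (f.r - 2 * k)) h)
  rwa [sub_add_cancel] at this

open Polynomial

theorem aeval_cas_mem (P : ℂ[X]) {k : ℕ} {A : B} (h : A ∈ f.gen ^ k) :
    aeval f.cas P A ∈ f.gen ^ k := by
  induction P using Polynomial.induction_on' with
  | add p q hp hq => rw [map_add]; exact add_mem hp hq
  | monomial m z =>
    rw [aeval_monomial, Module.End.mul_apply, Module.algebraMap_end_apply]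
    refine Submodule.smul_mem _ _ ?_
    induction m with
    | zero => exact h
    | succ m ih => rw [pow_succ', Module.End.mul_apply]; exact cas_pow_mem ih

/-- A polynomial in the operator `cas` which kills the words of length at most `2 m + i` and the
parity of `i`. -/
def killPoly (r : ℂ) (i m : ℕ) : ℂ[X] :=
  ∏ j ∈ Finset.range (m + 1), (X - C ((-1) ^ i * (r - 2 * (2 * j + i))))

/-- Each factor subtracts the eigenvalue for the current length and so shortens words by two
letters; after `m + 1` factors nothing is left. -/
theorem aeval_killPoly {i m : ℕ} (hi : i < 2) {A : B} (h : A ∈ f.gen ^ (2 * m + i)) :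
    aeval f.cas (killPoly f.r i m) A = 0 := by
  have h0 : ∀ m : ℕ, ∀ A ∈ f.gen ^ (2 * m + i), aeval f.cas
      (X - C ((-1) ^ i * (f.r - 2 * (2 * m + i)))) A ∈ f.low' (2 * m + i) := by
    intro m A h
    have := cas_mem h
    simp only [map_sub, aeval_X, aeval_C, LinearMap.sub_apply, Module.algebraMap_end_apply]
    convert this using 3
    rw [pow_add, pow_mul]; simp
  induction m generalizing A with
  | zero =>
    have h1 := h0 0 A h
    have h2 : f.low' (2 * 0 + i) = ⊥ := by interval_cases i <;> rfl
    rw [h2, Submodule.mem_bot] at h1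
    simpa [killPoly] using h1
  | succ m ih =>
    rw [killPoly, Finset.prod_range_succ, map_mul, Module.End.mul_apply]
    refine ih ?_
    have h1 := h0 (m + 1) A h
    rwa [show 2 * (m + 1) + i = 2 * m + i + 2 by ring] at h1

/-- A common root would mean `r - 4 j = -(r - 4 l - 2)`, that is `r = 2 j + 2 l + 1`. This is where
the even rank enters. -/
theorem isCoprime_killPoly {r : ℕ} (hr : Even r) (m m' : ℕ) :
    IsCoprime (killPoly r 0 m) (killPoly r 1 m') := by
  refine IsCoprime.prod_left fun j _ => IsCoprime.prod_right fun l _ => ?_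
  refine isCoprime_X_sub_C_of_isUnit_sub (sub_ne_zero.2 fun h => ?_).isUnit
  have h1 : ((r : ℤ) - 2 * (2 * j) : ℂ) = -((r : ℤ) - 2 * (2 * l + 1)) := by
    push_cast
    linear_combination h
  have h2 : (r : ℤ) - 2 * (2 * j) = -((r : ℤ) - 2 * (2 * l + 1)) := by exact_mod_cast h1
  obtain ⟨q, rfl⟩ := hr
  omega

/-- Two coprime polynomials in `cas` kill `A`, hence so does `1`. -/
theorem eq_zero_of_mem_pow {r : ℕ} (hr : Even r) (hf : f.r = r) {m m' : ℕ} {A : B}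
    (h : A ∈ f.gen ^ (2 * m)) (h' : A ∈ f.gen ^ (2 * m' + 1)) : A = 0 := by
  obtain ⟨u, w, e⟩ := isCoprime_killPoly hr m m'
  have h1 := aeval_killPoly (f := f) (i := 0) (by norm_num) h
  have h2 := aeval_killPoly (f := f) (by norm_num) h'
  rw [hf] at h1 h2
  have := congrArg (fun P => aeval f.cas P A) e
  simpa [Module.End.mul_apply, h1, h2] using this.symm

/-- Bézout gives projections to the two parities as polynomials in `cas`. They depend on `r` and `m`
only, so the same polynomials work in every fibre and can be applied to a global operator. -/
theorem exists_split {r : ℕ} (hr : Even r) (m : ℕ) : ∃ P₀ P₁ : ℂ[X], P₀ + P₁ = 1 ∧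
    ∀ (W B κ : Type _) [Ring B] [Algebra ℂ B] [Fintype κ] (f : CliffordFrame W B κ), f.r = r →
      ∀ A ∈ f.gen ^ (2 * m) ⊔ f.gen ^ (2 * m + 1),
        aeval f.cas P₀ A ∈ f.gen ^ (2 * m) ∧ aeval f.cas P₁ A ∈ f.gen ^ (2 * m + 1) := by
  obtain ⟨u, w, e⟩ := isCoprime_killPoly hr m m
  refine ⟨w * killPoly r 1 m, u * killPoly r 0 m, by rw [add_comm, e], ?_⟩
  intro W B κ _ _ _ f hf A hA
  obtain ⟨a, ha, b, hb, rfl⟩ := Submodule.mem_sup.1 hA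
  have h1 := aeval_killPoly (f := f) (i := 0) (by norm_num) ha
  have h2 := aeval_killPoly (f := f) (by norm_num) hb
  rw [hf] at h1 h2
  constructor
  · rw [map_add, map_mul, Module.End.mul_apply, Module.End.mul_apply, h2, map_zero, add_zero]
    exact aeval_cas_mem _ (aeval_cas_mem _ ha)
  · rw [map_add, map_mul, Module.End.mul_apply, Module.End.mul_apply, h1, map_zero, zero_add]
    exact aeval_cas_mem _ (aeval_cas_mem _ hb)

theorem pow_sup_pow_eq_top [FiniteDimensional ℂ B] (hf : Algebra.adjoin ℂ (Set.range f.γ) = ⊤)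
    {D : ℕ} (hD : Module.finrank ℂ B ≤ D) : f.gen ^ (2 * D) ⊔ f.gen ^ (2 * D + 1) = ⊤ := by
  have h1 : (1 : B) ∈ f.gen ^ (2 * D) ⊔ f.gen ^ (2 * D + 1) :=
    Submodule.mem_sup_left (gen_pow_mono (Nat.zero_le _) ⟨D, by omega⟩
      (by simpa using Submodule.one_le.1 (le_refl (1 : Submodule ℂ B))))
  have h2 : ∀ b : B, ∀ A ∈ f.gen ^ (2 * D) ⊔ f.gen ^ (2 * D + 1),
      b * A ∈ f.gen ^ (2 * D) ⊔ f.gen ^ (2 * D + 1) := by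
    intro b
    have hb : b ∈ Algebra.adjoin ℂ (Set.range f.γ) := hf ▸ Algebra.mem_top
    induction hb using Algebra.adjoin_induction with
    | mem b hb =>
      obtain ⟨v, rfl⟩ := hb
      intro A hA
      obtain ⟨a, ha, b, hb, rfl⟩ := Submodule.mem_sup.1 hA
      rw [mul_add]
      exact add_mem (Submodule.mem_sup_right (γ_mul_mem v ha)) (Submodule.mem_sup_left
        (gen_pow_le_max hD 0 (D + 1) (γ_mul_mem v hb)))
    | algebraMap z =>
      intro A hA
      rw [← Algebra.smul_def]
      exact Submodule.smul_mem _ _ hA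
    | add b b' _ _ h h' => intro A hA; rw [add_mul]; exact add_mem (h A hA) (h' A hA)
    | mul b b' _ _ h h' => intro A hA; rw [mul_assoc]; exact h _ (h' A hA)
  exact eq_top_iff.2 fun b _ => by simpa using h2 b 1 h1

end CliffordFrame

end CliffordFrame


set_option linter.unusedSectionVars false

/-! ### Operators that act pointwise on spinors -/

section SpinorOperators

variable {n : ℕ} {M : Type*} [TopologicalSpace M] [ChartedSpace (EuclideanSpace ℝ (Fin n)) M]
  [IsManifold (𝓡 n) ∞ M]
  {FS : Type*} [NormedAddCommGroup FS] [NormedSpace ℝ FS]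
  {S : M → Type*} [TopologicalSpace (TotalSpace FS S)] [∀ x, TopologicalSpace (S x)]
  [∀ x, AddCommGroup (S x)] [∀ x, Module ℝ (S x)]
  [∀ x, IsTopologicalAddGroup (S x)] [∀ x, ContinuousSMul ℝ (S x)]
  [FiberBundle FS S] [VectorBundle ℝ FS S]
  [∀ x, Module ℂ (S x)] [∀ x, IsScalarTower ℝ ℂ (S x)] [IsComplexBundle n FS S]

/-- A section of `S`, as a smooth section of a real vector bundle. -/
def toSection (s : SpinorSections n FS S) : Cₛ^∞⟮𝓡 n; FS, S⟯ := ⟨s.1, s.2⟩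

/-- A smooth section of the real vector bundle `S`, as an element of `Γ(S)`. -/
def ofSection (s : Cₛ^∞⟮𝓡 n; FS, S⟯) : SpinorSections n FS S := ⟨s, s.contMDiff⟩

theorem coe_smul_fibre (r : ℝ) (x : M) (v : S x) : (r : ℂ) • v = r • v := by
  rw [← algebraMap_smul ℂ r v]; rfl

/-- `T` acts pointwise by the endomorphisms `t`. -/
def ActsBy (T : Op n FS S) (t : ∀ x, Module.End ℂ (S x)) : Prop :=
  ∀ s x, (T s).1 x = t x (s.1 x)

namespace ActsBy

variable {T T' : Op n FS S} {t t' : ∀ x, Module.End ℂ (S x)}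

theorem mul (h : ActsBy T t) (h' : ActsBy T' t') : ActsBy (T * T') (fun x => t x * t' x) :=
  fun s x => by rw [Op.mul_apply, h, h']; rfl

theorem add (h : ActsBy T t) (h' : ActsBy T' t') : ActsBy (T + T') (fun x => t x + t' x) :=
  fun s x => congrArg₂ (· + ·) (h s x) (h' s x)

theorem sub (h : ActsBy T t) (h' : ActsBy T' t') : ActsBy (T - T') (fun x => t x - t' x) :=
  fun s x => congrArg₂ (· - ·) (h s x) (h' s x)

theorem smul (z : ℂ) (h : ActsBy T t) : ActsBy (z • T) (fun x => z • t x) :=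
  fun s x => congrArg (z • ·) (h s x)

theorem zero : ActsBy (0 : Op n FS S) (fun _ => 0) := fun _ _ => rfl

theorem one : ActsBy (1 : Op n FS S) (fun _ => 1) := fun _ _ => rfl

theorem sum {α : Type*} (u : Finset α) {T : α → Op n FS S} {t : α → ∀ x, Module.End ℂ (S x)}
    (h : ∀ i ∈ u, ActsBy (T i) (t i)) : ActsBy (∑ i ∈ u, T i) (fun x => ∑ i ∈ u, t i x) := by
  classical
  induction u using Finset.induction_on with
  | empty => simpa using zero
  | insert a u ha ih =>
    simp only [Finset.sum_insert ha]
    exact (h a (by simp)).add (ih fun i hi => h i (by simp [hi]))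

theorem ext (h : ActsBy T t) (h' : ActsBy T' t) : T = T' :=
  LinearMap.ext fun s => Subtype.ext (funext fun x => (h s x).trans (h' s x).symm)

end ActsBy

section

variable [T2Space M] [SecondCountableTopology M] [ContMDiffVectorBundle ∞ FS S (𝓡 n)]
  [FiniteDimensional ℝ FS]

variable (n FS) in
theorem exists_section_through (x : M) (v : S x) : ∃ s : SpinorSections n FS S, s.1 x = v := by
  obtain ⟨θ, e, h⟩ := exists_local_frame (n := n) (F := FS) (V := S) x
  refine ⟨ofSection (∑ i, ((θ i).toFun x v) • e i), ?_⟩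
  have := h.self_of_nhds.1 v
  change (∑ i, ((θ i).toFun x v) • e i : Cₛ^∞⟮𝓡 n; FS, S⟯) x = v
  rw [section_sum_apply]
  exact this.symm

theorem ActsBy.unique {T : Op n FS S} {t t' : ∀ x, Module.End ℂ (S x)} (h : ActsBy T t)
    (h' : ActsBy T t') : t = t' := by
  funext x
  ext v
  obtain ⟨s, rfl⟩ := exists_section_through n FS x v
  rw [← h, ← h']

theorem mulOp_apply (f : SFun n M) (s : SpinorSections n FS S) (x : M) :
    (mulOp FS S f s).1 x = f x • s.1 x := rfl

/-- Operators which commute with functions are local. -/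
theorem apply_eq_zero_of_comm {T : Op n FS S} (h : ∀ f, T * mulOp FS S f = mulOp FS S f * T)
    {s : SpinorSections n FS S} {x : M} (hs : s.1 x = 0) : (T s).1 x = 0 := by
  obtain ⟨θ, e, he⟩ := exists_local_frame (n := n) (F := FS) (V := S) x
  obtain ⟨χ, h1, h2⟩ := exists_cutoff_at (n := n) he
  let c : Fin (Module.finrank ℝ FS) → SFun n M := fun i => ⟨_, (θ i).smooth (toSection s)⟩
  -- The cutoff is supported where the frame is valid, so this expansion holds on all of `M`.
  have e1 : mulOp FS S χ s = ∑ i, mulOp FS S (c i) (mulOp FS S χ (ofSection (e i))) := by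
    refine Subtype.ext (funext fun y => ?_)
    rw [mulOp_apply]
    have hsum : (∑ i, mulOp FS S (c i) (mulOp FS S χ (ofSection (e i))) :
        SpinorSections n FS S).1 y = ∑ i, c i y • χ y • e i y := by
      rw [AddSubmonoidClass.coe_finsetSum, Finset.sum_apply]; rfl
    rw [hsum]
    by_cases hy : χ y = 0
    · simp [hy]
    · have := (h2 (subset_tsupport _ hy)).1 (s.1 y)
      conv_lhs => rw [this, Finset.smul_sum]
      exact Finset.sum_congr rfl fun i _ => smul_comm _ _ _
  have h3 : ∀ (f : SFun n M) (s : SpinorSections n FS S), T (mulOp FS S f s) = mulOp FS S f (T s) :=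
    fun f s => congrArg (fun A : Op n FS S => A s) (h f)
  have e2 := congrArg (fun s => (T s).1 x) e1
  have h4 : (T (∑ i, mulOp FS S (c i) (mulOp FS S χ (ofSection (e i))))).1 x =
      ∑ i, c i x • (T (mulOp FS S χ (ofSection (e i)))).1 x := by
    rw [map_sum, AddSubmonoidClass.coe_finsetSum, Finset.sum_apply]
    simp only [h3 (c _)]; rfl
  simp only [h3 χ, h4] at e2
  rw [mulOp_apply, h1.self_of_nhds, one_smul] at e2
  rw [e2]
  refine Finset.sum_eq_zero fun i _ => ?_
  have : c i x = 0 := by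
    change (θ i).toFun x (s.1 x) = 0
    rw [hs, map_zero]
  rw [this, zero_smul]

/-- By linearity and locality `(T s)(x)` depends on `s(x)` only, and every vector of the fibre is
the value of a section. -/
theorem exists_actsBy_of_comm {T : Op n FS S} (h : ∀ f, T * mulOp FS S f = mulOp FS S f * T) :
    ∃ t, ActsBy T t := by
  choose σ hσ using fun x (v : S x) => exists_section_through n FS x v
  have key : ∀ (s s' : SpinorSections n FS S) (x : M), s.1 x = s'.1 x → (T s).1 x = (T s').1 x := by
    intro s s' x hs
    have := apply_eq_zero_of_comm h (s := s - s') (x := x) (sub_eq_zero.2 hs)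
    rw [map_sub] at this
    exact sub_eq_zero.1 this
  refine ⟨fun x => LinearMap.mk (AddHom.mk (fun v => (T (σ x v)).1 x) fun v w => ?_)
    fun z v => ?_, fun s x => ?_⟩
  · rw [key (σ x (v + w)) (σ x v + σ x w) x
      (by rw [hσ]; exact (congrArg₂ (· + ·) (hσ x v) (hσ x w)).symm), map_add]; rfl
  · change (T (σ x (z • v))).1 x = z • (T (σ x v)).1 x
    rw [key (σ x (z • v)) (z • σ x v) x (by rw [hσ]; exact (congrArg (z • ·) (hσ x v)).symm),
      map_smul]; rfl
  · exact key _ _ x (hσ x _).symm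

theorem ActsBy.comm_mulOp {T : Op n FS S} {t : ∀ x, Module.End ℂ (S x)} (h : ActsBy T t)
    (f : SFun n M) : T * mulOp FS S f = mulOp FS S f * T := by
  refine LinearMap.ext fun s => Subtype.ext (funext fun x => ?_)
  change (T (mulOp FS S f s)).1 x = (mulOp FS S f (T s)).1 x
  rw [h, mulOp_apply, mulOp_apply, h, ← coe_smul_fibre, ← coe_smul_fibre, map_smul]

/-- The complex linear form `θ(v) - i θ(i v)`. -/
def complexify (θ : SmoothCovector n FS S) (s : SpinorSections n FS S) : CFun n M :=
  ⟨fun x => ⟨θ.toFun x (s.1 x), -θ.toFun x (Complex.I • s.1 x)⟩,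
    θ.smooth (toSection s), (θ.smooth ⟨_, IsComplexBundle.smooth_I (toSection s)⟩).neg⟩

theorem complexify_smul (θ : SmoothCovector n FS S) {s s' : SpinorSections n FS S} {x : M} {z : ℂ}
    (h : s'.1 x = z • s.1 x) : (complexify θ s').1 x = z * (complexify θ s).1 x := by
  have hz : ∀ (z : ℂ) (v : S x), θ.toFun x (z • v) =
      z.re * θ.toFun x v + z.im * θ.toFun x (Complex.I • v) := by
    intro z v
    conv_lhs => rw [← Complex.re_add_im z, add_smul, mul_smul, coe_smul_fibre, coe_smul_fibre,
      map_add, map_smul, map_smul]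
    rfl
  apply Complex.ext
  · change θ.toFun x (s'.1 x) = _
    rw [h, hz, Complex.mul_re]
    change _ = z.re * θ.toFun x (s.1 x) - z.im * -θ.toFun x (Complex.I • s.1 x)
    ring
  · change -θ.toFun x (Complex.I • s'.1 x) = _
    rw [h, smul_comm, hz, Complex.mul_im, smul_smul, Complex.I_mul_I, neg_one_smul, map_neg]
    change _ = z.re * -θ.toFun x (Complex.I • s.1 x) + z.im * θ.toFun x (s.1 x)
    ring

/-- Operators which act pointwise by scalars are given by smooth functions. -/
theorem ActsBy.scalar_smooth [∀ x, Nontrivial (S x)] {T : Op n FS S}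
    {c : M → ℂ} (h : ActsBy T fun x => c x • 1) : c ∈ CFun n M := by
  refine CFun.mem_of_contMDiffAt fun x₀ => ?_
  obtain ⟨θ, e, he⟩ := exists_local_frame (n := n) (F := FS) (V := S) x₀
  have hd : 0 < Module.finrank ℝ FS := by
    have := finiteDimensional_fiber FS (V := S) x₀
    rw [← finrank_fiber FS (V := S) x₀]
    exact Module.finrank_pos
  let i : Fin (Module.finrank ℝ FS) := ⟨0, hd⟩
  -- The complex coordinate `a` has real part 1 at `x₀`, and `T` multiplies it by `c`. So `c = b /
  -- a` near `x₀`.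
  let a := complexify (θ i) (ofSection (e i))
  let b := complexify (θ i) (T (ofSection (e i)))
  have hab : ∀ x, b.1 x = c x * a.1 x := fun x => complexify_smul _ (h _ x)
  have ha : a.1 x₀ ≠ 0 := fun h0 => by
    have h1 : (a.1 x₀).re = 1 := (he.self_of_nhds.2 i i).trans (if_pos rfl)
    rw [h0] at h1
    simp at h1
  have hcont : ContinuousAt (fun x => Complex.normSq (a.1 x)) x₀ := by
    simp only [Complex.normSq_apply]
    exact ((a.2.1.continuous.mul a.2.1.continuous).add
      (a.2.2.continuous.mul a.2.2.continuous)).continuousAt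
  have hne : ∀ᶠ x in 𝓝 x₀, Complex.normSq (a.1 x) ≠ 0 :=
    hcont.eventually_ne (by simpa using ha)
  have hinv : ContMDiffAt (𝓡 n) 𝓘(ℝ, ℝ) ∞ (fun x => (Complex.normSq (a.1 x))⁻¹) x₀ := by
    have h1 : ContMDiff (𝓡 n) 𝓘(ℝ, ℝ) ∞ (fun x => Complex.normSq (a.1 x)) :=
      (((a.2.1.mul a.2.1).add (a.2.2.mul a.2.2))).congr fun x => Complex.normSq_apply _
    exact (contDiffAt_inv ℝ (by simpa using ha)).contMDiffAt.comp x₀ (h1 x₀)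
  have hc : ∀ᶠ x in 𝓝 x₀, c x = b.1 x / a.1 x := hne.mono fun x hx => by
    rw [hab, mul_div_cancel_right₀]
    simpa using hx
  constructor
  · refine ContMDiffAt.congr_of_eventuallyEq (f := fun x => ((b.1 x).re * (a.1 x).re +
      (b.1 x).im * (a.1 x).im) * (Complex.normSq (a.1 x))⁻¹) ?_ (hc.mono fun x hx => ?_)
    · exact (((b.2.1.mul a.2.1).add (b.2.2.mul a.2.2)) x₀).mul hinv
    · change (c x).re = _
      rw [hx, Complex.div_re]; ring
  · refine ContMDiffAt.congr_of_eventuallyEq (f := fun x => ((b.1 x).im * (a.1 x).re -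
      (b.1 x).re * (a.1 x).im) * (Complex.normSq (a.1 x))⁻¹) ?_ (hc.mono fun x hx => ?_)
    · exact (((b.2.2.mul a.2.1).sub (b.2.1.mul a.2.2)) x₀).mul hinv
    · change (c x).im = _
      rw [hx, Complex.div_im]; ring

end

variable (FS S) in
/-- Multiplication by a smooth complex function. -/
def cMul : CFun n M →ₐ[ℂ] Op n FS S where
  toFun c := show Module.End ℂ (SpinorSections n FS S) from
    { toFun := fun s => ⟨fun x => c.1 x • s.1 x, by
        have h : (fun x => c.1 x • s.1 x) =
            (mulOp FS S ⟨_, c.2.1⟩ s + Complex.I • mulOp FS S ⟨_, c.2.2⟩ s).1 := by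
          funext x
          change c.1 x • s.1 x = (c.1 x).re • s.1 x + Complex.I • ((c.1 x).im • s.1 x)
          rw [← coe_smul_fibre, ← coe_smul_fibre, smul_smul, ← add_smul, mul_comm,
            Complex.re_add_im]
        rw [h]
        exact Subtype.property _⟩
      map_add' := fun _ _ => Subtype.ext (funext fun _ => smul_add _ _ _)
      map_smul' := fun _ _ => Subtype.ext (funext fun _ => smul_comm _ _ _) }
  map_one' := LinearMap.ext fun s => Subtype.ext (funext fun x => one_smul _ _)
  map_mul' c d := LinearMap.ext fun s => Subtype.ext (funext fun x => mul_smul _ _ _)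
  map_zero' := LinearMap.ext fun s => Subtype.ext (funext fun x => zero_smul _ _)
  map_add' c d := LinearMap.ext fun s => Subtype.ext (funext fun x => add_smul _ _ _)
  commutes' z := LinearMap.ext fun _ => Subtype.ext (funext fun _ => rfl)

theorem cMul_actsBy (c : CFun n M) : ActsBy (cMul FS S c) fun x => c.1 x • 1 := fun _ _ => rfl

theorem cMul_ofReal (f : SFun n M) : cMul FS S (CFun.ofReal f) = mulOp FS S f :=
  LinearMap.ext fun s => Subtype.ext (funext fun x => coe_smul_fibre _ _ _)

section

variable [T2Space M] [SecondCountableTopology M] [ContMDiffVectorBundle ∞ FS S (𝓡 n)]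
  [FiniteDimensional ℝ FS]

theorem cMul_injective [∀ x, Nontrivial (S x)] : Function.Injective (cMul (n := n) FS S) := by
  intro c d h
  refine Subtype.ext (funext fun x => ?_)
  have h1 := (cMul_actsBy (FS := FS) (S := S) c).unique (h ▸ cMul_actsBy d)
  obtain ⟨v, hv⟩ := exists_ne (0 : S x)
  have h2 := congrArg (fun t => t x v) h1
  exact smul_left_injective ℂ hv h2

theorem ActsBy.exists_cMul [∀ x, Nontrivial (S x)] {T : Op n FS S}
    {c : M → ℂ} (h : ActsBy T fun x => c x • 1) : ∃ c, T = cMul FS S c :=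
  ⟨⟨c, h.scalar_smooth⟩, h.ext (cMul_actsBy _)⟩

end

end SpinorOperators


set_option linter.unusedSectionVars false

/-! ### The Clifford frame of a fibre of the spinor bundle -/

section SpinorFrame

variable {n : ℕ} {M : Type*} [TopologicalSpace M] [ChartedSpace (EuclideanSpace ℝ (Fin n)) M]
  [IsManifold (𝓡 n) ∞ M]
  {F : Type*} [NormedAddCommGroup F] [NormedSpace ℝ F]
  {E : M → Type*} [TopologicalSpace (TotalSpace F E)] [∀ x, TopologicalSpace (E x)]
  [∀ x, AddCommGroup (E x)] [∀ x, Module ℝ (E x)]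
  [∀ x, IsTopologicalAddGroup (E x)] [∀ x, ContinuousSMul ℝ (E x)]
  [FiberBundle F E] [VectorBundle ℝ F E]
  {g : PseudoMetric n F E}
  {FS : Type*} [NormedAddCommGroup FS] [NormedSpace ℝ FS]
  {S : M → Type*} [TopologicalSpace (TotalSpace FS S)] [∀ x, TopologicalSpace (S x)]
  [∀ x, AddCommGroup (S x)] [∀ x, Module ℝ (S x)]
  [∀ x, IsTopologicalAddGroup (S x)] [∀ x, ContinuousSMul ℝ (S x)]
  [FiberBundle FS S] [VectorBundle ℝ FS S]
  [∀ x, Module ℂ (S x)] [∀ x, IsScalarTower ℝ ℂ (S x)] [IsComplexBundle n FS S]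

namespace SpinorStructure

variable (c : SpinorStructure FS S g)

/-- Clifford multiplication in the fibre at `x`. -/
def gammaAt (x : M) (v : E x) : Module.End ℂ (S x) :=
  c.iso x (1 ⊗ₜ[ℝ] CliffordAlgebra.ι (g.quad x) v)

theorem gamma_actsBy (ξ : Cₛ^∞⟮𝓡 n; F, E⟯) : ActsBy (c.gamma ξ) fun x => c.gammaAt x (ξ x) :=
  fun _ _ => rfl

theorem gammaAt_add (x : M) (v w : E x) : c.gammaAt x (v + w) = c.gammaAt x v + c.gammaAt x w := by
  rw [gammaAt, map_add, TensorProduct.tmul_add, map_add]; rfl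

theorem gammaAt_smul (x : M) (r : ℝ) (v : E x) :
    c.gammaAt x (r • v) = (r : ℂ) • c.gammaAt x v := by
  have h : (1 : ℂ) ⊗ₜ[ℝ] (r • CliffordAlgebra.ι (g.quad x) v) =
      (r : ℂ) • ((1 : ℂ) ⊗ₜ[ℝ] CliffordAlgebra.ι (g.quad x) v : g.Cl x) := by
    rw [TensorProduct.tmul_smul, TensorProduct.smul_tmul', TensorProduct.smul_tmul',
      Complex.real_smul, smul_eq_mul]
  rw [gammaAt, map_smul, h, map_smul]
  rfl

theorem gammaAt_sum (x : M) {α : Type*} (s : Finset α) (v : α → E x) :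
    c.gammaAt x (∑ a ∈ s, v a) = ∑ a ∈ s, c.gammaAt x (v a) :=
  map_sum (AddMonoidHom.mk' (c.gammaAt x) (c.gammaAt_add x)) v s

theorem gammaAt_rel (x : M) (v w : E x) : c.gammaAt x v * c.gammaAt x w =
    (2 * g.form x v w : ℂ) • (1 : Module.End ℂ (S x)) - c.gammaAt x w * c.gammaAt x v := by
  rw [eq_sub_iff_add_eq, gammaAt, gammaAt, ← map_mul, ← map_mul, ← map_add,
    Algebra.TensorProduct.tmul_mul_tmul, Algebra.TensorProduct.tmul_mul_tmul,
    ← TensorProduct.tmul_add, CliffordAlgebra.ι_mul_ι_add_swap,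
    LinearMap.BilinMap.polar_toQuadraticMap, g.symm x w v, Algebra.algebraMap_eq_smul_one,
    TensorProduct.tmul_smul, TensorProduct.smul_tmul', mul_one]
  have h1 : ((g.form x v w + g.form x v w) • (1 : ℂ)) ⊗ₜ[ℝ] (1 : CliffordAlgebra (g.quad x)) =
      (2 * g.form x v w : ℂ) • (1 : g.Cl x) := by
    rw [Algebra.TensorProduct.one_def, TensorProduct.smul_tmul']
    congr 1
    rw [Complex.real_smul]; push_cast; rw [smul_eq_mul]; ring
  rw [h1, map_smul, map_one]

include c in
theorem nontrivial_fiber (x : M) : Nontrivial (S x) := by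
  have h2 : Invertible (2 : ℝ) := invertibleOfNonzero two_ne_zero
  have h3 : Nontrivial (g.Cl x) := inferInstance
  by_contra h
  rw [not_nontrivial_iff_subsingleton] at h
  have h1 : (1 : Module.End ℂ (S x)) = 0 := LinearMap.ext fun v => Subsingleton.elim _ _
  have : (1 : g.Cl x) = 0 := (c.iso x).injective (by rw [map_one, map_zero, h1])
  exact one_ne_zero this

theorem adjoin_gammaAt (x : M) : Algebra.adjoin ℂ (Set.range (c.gammaAt x)) = ⊤ := by
  refine eq_top_iff.2 fun A _ => ?_
  obtain ⟨b, rfl⟩ := (c.iso x).surjective A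
  induction b using TensorProduct.induction_on with
  | zero => rw [map_zero]; exact zero_mem _
  | add b b' h h' => rw [map_add]; exact add_mem (h trivial) (h' trivial)
  | tmul z a =>
    have h1 : z ⊗ₜ[ℝ] a = z • ((1 : ℂ) ⊗ₜ[ℝ] a : g.Cl x) := by
      rw [TensorProduct.smul_tmul', smul_eq_mul, mul_one]
    rw [h1, map_smul]
    refine Subalgebra.smul_mem _ ?_ _
    clear h1
    induction a using CliffordAlgebra.induction with
    | algebraMap r =>
      have : (1 : ℂ) ⊗ₜ[ℝ] algebraMap ℝ (CliffordAlgebra (g.quad x)) r =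
          algebraMap ℂ (g.Cl x) r := by
        rw [Algebra.algebraMap_eq_smul_one, TensorProduct.tmul_smul, TensorProduct.smul_tmul',
          Complex.real_smul, mul_one]; rfl
      rw [this, AlgEquiv.commutes]
      exact Subalgebra.algebraMap_mem _ _
    | ι v => exact Algebra.subset_adjoin ⟨v, rfl⟩
    | add a b h h' => rw [TensorProduct.tmul_add, map_add]; exact add_mem (h trivial) (h' trivial)
    | mul a b h h' =>
      have : (1 : ℂ) ⊗ₜ[ℝ] (a * b) = ((1 : ℂ) ⊗ₜ[ℝ] a : g.Cl x) * ((1 : ℂ) ⊗ₜ[ℝ] b) := by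
        rw [Algebra.TensorProduct.tmul_mul_tmul, one_mul]
      rw [this, map_mul]
      exact mul_mem (h trivial) (h' trivial)

/-- Endomorphisms which commute with Clifford multiplication are scalars. -/
theorem exists_scalar_of_comm {x : M} {t : Module.End ℂ (S x)}
    (h : ∀ v, t * c.gammaAt x v = c.gammaAt x v * t) : ∃ z : ℂ, t = z • 1 := by
  have h1 : t ∈ Set.center (Module.End ℂ (S x)) := by
    rw [Semigroup.mem_center_iff]
    intro b
    have hb : b ∈ Algebra.adjoin ℂ (Set.range (c.gammaAt x)) := by
      rw [adjoin_gammaAt]; trivial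
    induction hb using Algebra.adjoin_induction with
    | mem b hb => obtain ⟨v, rfl⟩ := hb; exact (h v).symm
    | algebraMap z => exact Algebra.commutes z t
    | add a b _ _ h h' => rw [add_mul, mul_add, h, h']
    | mul a b _ _ h h' => rw [mul_assoc, h', ← mul_assoc, h, mul_assoc]
  obtain ⟨z, hz, e⟩ := Module.End.mem_center_iff.1 h1
  exact ⟨z, by rw [e]; rfl⟩

section Frame

variable {κ : Type*} [Fintype κ] {ξ η : κ → Cₛ^∞⟮𝓡 n; F, E⟯}
  (hξ : ∀ (x : M) (v : E x), v = ∑ a, g.form x v (ξ a x) • η a x)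
include hξ

omit c

/-- Both sides are the trace of the identity of the fibre, written as `∑ g(·, ξ_a) η_a`. -/
theorem sum_form_generators [FiniteDimensional ℝ F] (x : M) :
    ∑ a, g.form x (η a x) (ξ a x) = Module.finrank ℝ F := by
  have h1 : (LinearMap.id : E x →ₗ[ℝ] E x) =
      ∑ a, ((g.form x).flip (ξ a x)).smulRight (η a x) := by
    ext v
    simpa [LinearMap.sum_apply] using hξ x v
  have := finiteDimensional_fiber F (V := E) x
  have h2 := congrArg (LinearMap.trace ℝ (E x)) h1
  rw [LinearMap.trace_id, map_sum, finrank_fiber F (V := E) x] at h2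
  simp only [LinearMap.trace_smulRight] at h2
  exact h2.symm

theorem expand_gammaAt (c : SpinorStructure FS S g) (x : M) (v : E x) :
    c.gammaAt x v = ∑ a, (g.form x v (ξ a x) : ℂ) • c.gammaAt x (η a x) := by
  conv_lhs => rw [hξ x v, gammaAt_sum]
  exact Finset.sum_congr rfl fun a _ => c.gammaAt_smul x _ _

theorem expand_dual_gammaAt (c : SpinorStructure FS S g) (x : M) (v : E x) :
    c.gammaAt x v = ∑ a, (g.form x v (η a x) : ℂ) • c.gammaAt x (ξ a x) := by
  conv_lhs => rw [expand_dual hξ x v, gammaAt_sum]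
  exact Finset.sum_congr rfl fun a _ => c.gammaAt_smul x _ _

/-- Expand `ξ_a` in the `η_b`. The coefficients `g(ξ_a, ξ_b)` are symmetric, so twice the sum only
involves the anticommutators `2 g(η_a, η_b)`, and it reduces to `2 ∑ g(η_a, ξ_a)`. -/
theorem gammaAt_casimir [FiniteDimensional ℝ F] (c : SpinorStructure FS S g) (x : M) :
    ∑ a, c.gammaAt x (η a x) * c.gammaAt x (ξ a x) = (Module.finrank ℝ F : ℂ) • 1 := by
  have h1 : ∑ a, c.gammaAt x (η a x) * c.gammaAt x (ξ a x) = ∑ a, ∑ b,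
      (g.form x (ξ a x) (ξ b x) : ℂ) • (c.gammaAt x (η a x) * c.gammaAt x (η b x)) := by
    refine Finset.sum_congr rfl fun a _ => ?_
    conv_lhs => rw [expand_gammaAt hξ c x (ξ a x), Finset.mul_sum]
    simp only [mul_smul_comm]
  have h2 : ∑ a, c.gammaAt x (η a x) * c.gammaAt x (ξ a x) = ∑ a, ∑ b,
      (g.form x (ξ a x) (ξ b x) : ℂ) • (c.gammaAt x (η b x) * c.gammaAt x (η a x)) := by
    rw [h1, Finset.sum_comm]
    simp only [fun a b => g.symm x (ξ a x) (ξ b x)]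
  have h3 : (2 : ℂ) • ∑ a, c.gammaAt x (η a x) * c.gammaAt x (ξ a x) =
      (2 : ℂ) • (Module.finrank ℝ F : ℂ) • 1 := by
    rw [two_smul]
    conv_lhs => arg 1; rw [h1]
    conv_lhs => arg 2; rw [h2]
    have h5 : (Module.finrank ℝ F : ℂ) = ∑ a, (g.form x (η a x) (ξ a x) : ℂ) := by
      exact_mod_cast congrArg (fun r : ℝ => (r : ℂ)) (sum_form_generators hξ x).symm
    rw [h5, ← Finset.sum_add_distrib, Finset.sum_smul, Finset.smul_sum]
    refine Finset.sum_congr rfl fun a _ => ?_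
    have h4 : g.form x (η a x) (ξ a x) = ∑ b, g.form x (ξ a x) (ξ b x) * g.form x (η a x) (η b x) := by
      conv_lhs => rw [hξ x (ξ a x)]
      rw [map_sum]
      simp only [map_smul, smul_eq_mul]
    rw [h4, ← Finset.sum_add_distrib]
    push_cast
    rw [Finset.sum_smul, Finset.smul_sum]
    refine Finset.sum_congr rfl fun b _ => ?_
    rw [← smul_add, c.gammaAt_rel x (η a x), sub_add_cancel]
    module
  exact smul_right_injective _ (two_ne_zero (α := ℂ)) h3

/-- The Clifford frame of the fibre at `x`. -/
def frameAt [FiniteDimensional ℝ F] (hpos : 0 < Module.finrank ℝ F) (c : SpinorStructure FS S g)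
    (x : M) : CliffordFrame (E x) (Module.End ℂ (S x)) κ where
  form v w := g.form x v w
  γ := c.gammaAt x
  ξ a := ξ a x
  η a := η a x
  r := Module.finrank ℝ F
  symm := g.symm x
  rel := c.gammaAt_rel x
  expand := expand_gammaAt hξ c x
  expand_dual := expand_dual_gammaAt hξ c x
  casimir := gammaAt_casimir hξ c x
  r_ne := by exact_mod_cast hpos.ne'

variable [FiniteDimensional ℝ F] (hpos : 0 < Module.finrank ℝ F) (c : SpinorStructure FS S g)

/-- Elements of parity `i` are sums of words of all lengths of that parity, but these lengths
stabilize at `2 D + i`. So one exponent serves for all fibres. -/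
theorem iso_mem_pow {x : M} {i : ZMod 2} {D : ℕ} [FiniteDimensional ℂ (Module.End ℂ (S x))]
    (hD : Module.finrank ℂ (Module.End ℂ (S x)) ≤ D) {a : g.Cl x}
    (ha : a ∈ (CliffordAlgebra.evenOdd (g.quad x) i).baseChange ℂ) :
    c.iso x a ∈ (frameAt hξ hpos c x).gen ^ (2 * D + i.val) := by
  rw [Submodule.baseChange_eq_span] at ha
  induction ha using Submodule.span_induction with
  | zero => rw [map_zero]; exact zero_mem _
  | add a b _ _ h h' => rw [map_add]; exact add_mem h h'
  | smul z a _ h => rw [map_smul]; exact Submodule.smul_mem _ _ h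
  | mem a ha =>
    obtain ⟨b, hb, rfl⟩ := ha
    let φ : CliffordAlgebra (g.quad x) →ₗ[ℝ] g.Cl x := TensorProduct.mk ℝ ℂ _ 1
    let N : Submodule ℝ (g.Cl x) := (((frameAt hξ hpos c x).gen ^ (2 * D + i.val)).comap
      (c.iso x).toLinearMap).restrictScalars ℝ
    have h1 : CliffordAlgebra.evenOdd (g.quad x) i ≤ N.comap φ := by
      refine iSup_le fun ⟨j, hj⟩ => ?_
      have h2 : ∀ b ∈ LinearMap.range (CliffordAlgebra.ι (g.quad x)) ^ j,
          c.iso x (1 ⊗ₜ[ℝ] b) ∈ (frameAt hξ hpos c x).gen ^ j := by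
        intro b hb
        clear hj
        induction j generalizing b with
        | zero =>
          obtain ⟨r, rfl⟩ := Submodule.mem_one.1 (by simpa using hb)
          have : (1 : ℂ) ⊗ₜ[ℝ] algebraMap ℝ (CliffordAlgebra (g.quad x)) r =
              algebraMap ℂ (g.Cl x) r := by
            rw [Algebra.algebraMap_eq_smul_one, TensorProduct.tmul_smul, TensorProduct.smul_tmul',
              Complex.real_smul, mul_one]; rfl
          rw [this, AlgEquiv.commutes, pow_zero]
          exact Submodule.mem_one.2 ⟨_, rfl⟩
        | succ j ih =>
          rw [pow_succ'] at hb
          induction hb using Submodule.mul_induction_on' with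
          | mem_mul_mem a ha b hb =>
            obtain ⟨v, rfl⟩ := ha
            have : (1 : ℂ) ⊗ₜ[ℝ] (CliffordAlgebra.ι (g.quad x) v * b) =
                ((1 : ℂ) ⊗ₜ[ℝ] CliffordAlgebra.ι (g.quad x) v : g.Cl x) * ((1 : ℂ) ⊗ₜ[ℝ] b) := by
              rw [Algebra.TensorProduct.tmul_mul_tmul, one_mul]
            rw [this, map_mul]
            exact CliffordFrame.γ_mul_mem (f := frameAt hξ hpos c x) v (ih b hb)
          | add a _ b _ h h' => rw [TensorProduct.tmul_add, map_add]; exact add_mem h h'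
      intro b hb
      obtain ⟨q, hq⟩ : ∃ q, j = 2 * q + i.val := by
        refine ⟨j / 2, ?_⟩
        rw [← hj, ZMod.val_natCast]; omega
      have h3 := h2 b hb
      rw [hq] at h3
      exact CliffordFrame.gen_pow_le_max hD _ _ h3
    exact h1 hb

theorem iso_symm_mem {x : M} {k : ℕ} {A : Module.End ℂ (S x)}
    (h : A ∈ (frameAt hξ hpos c x).gen ^ k) :
    (c.iso x).symm A ∈ (CliffordAlgebra.evenOdd (g.quad x) (k : ZMod 2)).baseChange ℂ := by
  refine CliffordFrame.induction (p := fun k A => (c.iso x).symm A ∈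
    (CliffordAlgebra.evenOdd (g.quad x) (k : ZMod 2)).baseChange ℂ) ?_ ?_ ?_ ?_ ?_ h
  · intro k; rw [map_zero]; exact zero_mem _
  · intro z
    rw [map_smul, map_one]
    refine Submodule.smul_mem _ _ (Submodule.tmul_mem_baseChange_of_mem _ ?_)
    simpa using Submodule.one_le.1 (CliffordAlgebra.one_le_evenOdd_zero (g.quad x))
  · intro k v A _ hA
    have h1 : (c.iso x).symm (c.gammaAt x v) = 1 ⊗ₜ[ℝ] CliffordAlgebra.ι (g.quad x) v :=
      (c.iso x).symm_apply_apply _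
    change (c.iso x).symm (c.gammaAt x v * A) ∈ _
    rw [map_mul, h1, Nat.cast_succ]
    change (c.iso x).symm A ∈ _ at hA
    generalize (c.iso x).symm A = b at hA ⊢
    rw [Submodule.baseChange_eq_span] at hA
    induction hA using Submodule.span_induction with
    | zero => rw [mul_zero]; exact zero_mem _
    | add a b _ _ h h' => rw [mul_add]; exact add_mem h h'
    | smul z a _ h => rw [mul_smul_comm]; exact Submodule.smul_mem _ _ h
    | mem a ha =>
      obtain ⟨b, hb, rfl⟩ := ha
      have h2 : ((1 : ℂ) ⊗ₜ[ℝ] CliffordAlgebra.ι (g.quad x) v : g.Cl x) * ((1 : ℂ) ⊗ₜ[ℝ] b) =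
          1 ⊗ₜ[ℝ] (CliffordAlgebra.ι (g.quad x) v * b) := by
        rw [Algebra.TensorProduct.tmul_mul_tmul, one_mul]
      change ((1 : ℂ) ⊗ₜ[ℝ] CliffordAlgebra.ι (g.quad x) v : g.Cl x) * ((1 : ℂ) ⊗ₜ[ℝ] b) ∈ _
      rw [h2, add_comm]
      exact Submodule.tmul_mem_baseChange_of_mem _ (CliffordAlgebra.evenOdd_mul_le _ _ _
        (Submodule.mul_mem_mul (CliffordAlgebra.ι_mem_evenOdd_one _ v) hb))
  · intro k A A' h h'; rw [map_add]; exact add_mem h h'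
  · intro k z A h; rw [map_smul]; exact Submodule.smul_mem _ _ h

end Frame

end SpinorStructure

end SpinorFrame


set_option linter.unusedSectionVars false

/-! ### Commutation relations of a compatible pair of connections -/

section SpinorRelations

variable {n : ℕ} {M : Type*} [TopologicalSpace M] [ChartedSpace (EuclideanSpace ℝ (Fin n)) M]
  [IsManifold (𝓡 n) ∞ M]
  {F : Type*} [NormedAddCommGroup F] [NormedSpace ℝ F]
  {E : M → Type*} [TopologicalSpace (TotalSpace F E)] [∀ x, TopologicalSpace (E x)]
  [∀ x, AddCommGroup (E x)] [∀ x, Module ℝ (E x)]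
  [∀ x, IsTopologicalAddGroup (E x)] [∀ x, ContinuousSMul ℝ (E x)]
  [FiberBundle F E] [VectorBundle ℝ F E]
  {g : PseudoMetric n F E}
  {FS : Type*} [NormedAddCommGroup FS] [NormedSpace ℝ FS]
  {S : M → Type*} [TopologicalSpace (TotalSpace FS S)] [∀ x, TopologicalSpace (S x)]
  [∀ x, AddCommGroup (S x)] [∀ x, Module ℝ (S x)]
  [∀ x, IsTopologicalAddGroup (S x)] [∀ x, ContinuousSMul ℝ (S x)]
  [FiberBundle FS S] [VectorBundle ℝ FS S]
  [∀ x, Module ℂ (S x)] [∀ x, IsScalarTower ℝ ℂ (S x)] [IsComplexBundle n FS S]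

theorem Op.sum_apply {α : Type*} (u : Finset α) (T : α → Op n FS S) (s : SpinorSections n FS S)
    (x : M) : ((∑ i ∈ u, T i) s).1 x = ∑ i ∈ u, (T i s).1 x := by
  classical
  induction u using Finset.induction_on with
  | empty => rfl
  | insert a u ha ih => rw [Finset.sum_insert ha, Finset.sum_insert ha, ← ih]; rfl

theorem mulOp_actsBy (f : SFun n M) : ActsBy (mulOp FS S f) fun x => (f x : ℂ) • 1 :=
  fun _ _ => (coe_smul_fibre _ _ _).symm

theorem mulOp_sub (f h : SFun n M) : mulOp FS S (f - h) = mulOp FS S f - mulOp FS S h :=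
  LinearMap.ext fun _ => Subtype.ext (funext fun _ => sub_smul _ _ _)

theorem mulOp_neg (f : SFun n M) : mulOp FS S (-f) = -mulOp FS S f :=
  LinearMap.ext fun _ => Subtype.ext (funext fun _ => neg_smul _ _)

namespace ComplexConnection

theorem op_mulOp (D : ComplexConnection n FS S) (Y : VField n M) (f : SFun n M) :
    D.op Y * mulOp FS S f - mulOp FS S f * D.op Y = mulOp FS S (Y.app f) := by
  rw [sub_eq_iff_eq_add, add_comm]
  exact LinearMap.ext fun s => Subtype.ext (funext fun x => D.cov_fsmul f (toSection s) x (Y x))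

theorem op_expand (D : ComplexConnection n FS S) {ι : Type*} [Fintype ι] {f : ι → SFun n M}
    {X : ι → VField n M}
    (hX : ∀ x (v : TangentSpace (𝓡 n) x), v = ∑ i, mvfderiv (𝓡 n) (f i) x v • X i x)
    (Y : VField n M) : D.op Y = ∑ j, mulOp FS S (Y.app (f j)) * D.op (X j) := by
  refine LinearMap.ext fun s => Subtype.ext (funext fun x => ?_)
  refine Eq.trans ?_ (Op.sum_apply _ _ s x).symm
  change D.cov s.1 x (Y x) = _
  conv_lhs => rw [hX x (Y x), map_sum]
  exact Finset.sum_congr rfl fun j _ => _root_.map_smul _ _ _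

end ComplexConnection

theorem Connection.nabla_expand (D : Connection n F E) {ι : Type*} [Fintype ι] {f : ι → SFun n M}
    {X : ι → VField n M}
    (hX : ∀ x (v : TangentSpace (𝓡 n) x), v = ∑ i, mvfderiv (𝓡 n) (f i) x v • X i x)
    (Y : VField n M) (s : Cₛ^∞⟮𝓡 n; F, E⟯) :
    D.nabla Y s = ∑ j, fsmul (Y.app (f j)) (D.nabla (X j) s) := by
  ext x
  rw [section_sum_apply]
  change D.cov s x (Y x) = _
  conv_lhs => rw [hX x (Y x), map_sum]
  exact Finset.sum_congr rfl fun j _ => map_smul _ _ _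

/-- The Jacobi identity, arranged so that known commutators with `f` can be inserted. It is used
with `f` a function and with `f` a Clifford multiplication. -/
theorem commutator_identity {A : Type*} [Ring A] (X Y Z f : A) :
    (X * Y - Y * X - Z) * f - f * (X * Y - Y * X - Z) =
      X * (Y * f - f * Y) - (Y * f - f * Y) * X - (Y * (X * f - f * X) - (X * f - f * X) * Y) -
        (Z * f - f * Z) := by
  noncomm_ring

namespace SpinorStructure

variable (c : SpinorStructure FS S g)

theorem gamma_fsmul (f : SFun n M) (v : Cₛ^∞⟮𝓡 n; F, E⟯) :
    c.gamma (fsmul f v) = mulOp FS S f * c.gamma v := by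
  refine LinearMap.ext fun s => Subtype.ext (funext fun x => ?_)
  change c.gammaAt x (f x • v x) (s.1 x) = f x • c.gammaAt x (v x) (s.1 x)
  rw [gammaAt_smul, ← coe_smul_fibre]; rfl

/-- `gamma` as an additive map. -/
def gammaHom : Cₛ^∞⟮𝓡 n; F, E⟯ →+ Op n FS S :=
  AddMonoidHom.mk' c.gamma fun v w =>
    LinearMap.ext fun s => Subtype.ext (funext fun x => by
      change c.gammaAt x (v x + w x) (s.1 x) = c.gammaAt x (v x) (s.1 x) + c.gammaAt x (w x) (s.1 x)
      rw [gammaAt_add]; rfl)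

theorem gamma_sub (v w : Cₛ^∞⟮𝓡 n; F, E⟯) : c.gamma (v - w) = c.gamma v - c.gamma w :=
  map_sub c.gammaHom v w

theorem gamma_zero : c.gamma 0 = 0 := map_zero c.gammaHom

theorem gamma_sum {α : Type*} (u : Finset α) (v : α → Cₛ^∞⟮𝓡 n; F, E⟯) :
    c.gamma (∑ a ∈ u, v a) = ∑ a ∈ u, c.gamma (v a) := map_sum c.gammaHom v u

theorem gamma_rel (v w : Cₛ^∞⟮𝓡 n; F, E⟯) :
    c.gamma v * c.gamma w + c.gamma w * c.gamma v = (2 : ℂ) • mulOp FS S (g.pair v w) := by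
  refine ActsBy.ext (((c.gamma_actsBy v).mul (c.gamma_actsBy w)).add
    ((c.gamma_actsBy w).mul (c.gamma_actsBy v))) ?_
  have : (fun x => c.gammaAt x (v x) * c.gammaAt x (w x) + c.gammaAt x (w x) * c.gammaAt x (v x)) =
      fun x => (2 : ℂ) • ((g.pair v w x : ℂ) • (1 : Module.End ℂ (S x))) := funext fun x => by
    rw [gammaAt_rel, sub_add_cancel, mul_smul]; rfl
  rw [this]
  exact (mulOp_actsBy _).smul 2

theorem mulOp_comm_gamma (f : SFun n M) (v : Cₛ^∞⟮𝓡 n; F, E⟯) :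
    c.gamma v * mulOp FS S f = mulOp FS S f * c.gamma v :=
  LinearMap.ext fun s => Subtype.ext (funext fun x => by
    change c.gammaAt x (v x) (f x • s.1 x) = f x • c.gammaAt x (v x) (s.1 x)
    rw [← coe_smul_fibre, ← coe_smul_fibre, map_smul])

theorem cMul_comm_gamma (z : CFun n M) (v : Cₛ^∞⟮𝓡 n; F, E⟯) :
    cMul FS S z * c.gamma v = c.gamma v * cMul FS S z :=
  LinearMap.ext fun _ => Subtype.ext (funext fun x => (map_smul (c.gammaAt x (v x)) _ _).symm)

section Frame

variable {κ : Type*} [Fintype κ] {ξ η : κ → Cₛ^∞⟮𝓡 n; F, E⟯}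
  (hξ : ∀ (x : M) (v : E x), v = ∑ a, g.form x v (ξ a x) • η a x)
include hξ

theorem gamma_expand (v : Cₛ^∞⟮𝓡 n; F, E⟯) :
    c.gamma v = ∑ a, mulOp FS S (g.pair v (ξ a)) * c.gamma (η a) := by
  conv_lhs => rw [expand_section hξ v, gamma_sum]
  simp only [gamma_fsmul]

theorem gamma_casimir [FiniteDimensional ℝ F] :
    ∑ a, c.gamma (ξ a) * c.gamma (η a) = (Module.finrank ℝ F : ℂ) • 1 := by
  refine ActsBy.ext (ActsBy.sum _ fun a _ => (c.gamma_actsBy (ξ a)).mul (c.gamma_actsBy (η a))) ?_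
  simp only [gammaAt_casimir (expand_dual hξ) c]
  exact ActsBy.one.smul _

omit c in
theorem exists_section_eq (x : M) (v : E x) : ∃ s : Cₛ^∞⟮𝓡 n; F, E⟯, s x = v := by
  refine ⟨∑ a, g.form x v (ξ a x) • η a, ?_⟩
  rw [section_sum_apply]
  exact (hξ x v).symm

omit c in
theorem tensorial_expand {δ : Cₛ^∞⟮𝓡 n; F, E⟯ → Cₛ^∞⟮𝓡 n; F, E⟯}
    (hadd : ∀ v w, δ (v + w) = δ v + δ w) (hsmul : ∀ f v, δ (fsmul f v) = fsmul f (δ v))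
    (v : Cₛ^∞⟮𝓡 n; F, E⟯) : δ v = ∑ a, fsmul (g.pair v (ξ a)) (δ (η a)) := by
  conv_lhs => rw [expand_section hξ v]
  refine (map_sum (AddMonoidHom.mk' δ hadd) _ _).trans ?_
  exact Finset.sum_congr rfl fun a _ => hsmul _ _

variable [T2Space M] [SecondCountableTopology M] [ContMDiffVectorBundle ∞ FS S (𝓡 n)]
  [FiniteDimensional ℝ FS]

/-- Commuting with functions makes `T` pointwise. In each fibre `T` is central in the endomorphism
algebra, which Clifford multiplication generates, so it is a scalar, and the scalars vary smoothly.
-/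
theorem exists_cMul_of_comm {T : Op n FS S} (hf : ∀ f, T * mulOp FS S f = mulOp FS S f * T)
    (hT : ∀ v, T * c.gamma v = c.gamma v * T) : ∃ z, T = cMul FS S z := by
  obtain ⟨t, ht⟩ := exists_actsBy_of_comm hf
  have := c.nontrivial_fiber
  have h1 : ∀ x, ∃ z : ℂ, t x = z • 1 := fun x => by
    refine c.exists_scalar_of_comm fun v => ?_
    obtain ⟨s, rfl⟩ := exists_section_eq hξ x v
    have h2 := (c.gamma_actsBy s).mul ht
    rw [← hT] at h2
    exact congrFun ((ht.mul (c.gamma_actsBy s)).unique h2) x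
  choose z hz using h1
  have : t = fun x => z x • 1 := funext hz
  subst this
  exact ht.exists_cMul

/-- The quadratic expression has the same commutators with Clifford multiplication as `T`: each of
its terms contributes twice two sums, and either sum expands `γ(δ v)`, which explains the factor ¼.
The difference from `T` is then scalar. -/
theorem exists_cMul_of_derivation {T : Op n FS S} {δ : Cₛ^∞⟮𝓡 n; F, E⟯ → Cₛ^∞⟮𝓡 n; F, E⟯}
    (hf : ∀ f, T * mulOp FS S f = mulOp FS S f * T)
    (hT : ∀ v, T * c.gamma v - c.gamma v * T = c.gamma (δ v))
    (hadd : ∀ v w, δ (v + w) = δ v + δ w) (hsmul : ∀ f v, δ (fsmul f v) = fsmul f (δ v))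
    (hskew : ∀ v w, g.pair (δ v) w + g.pair v (δ w) = 0) :
    ∃ z, T = cMul FS S z + (1 / 4 : ℂ) • ∑ a, c.gamma (δ (η a)) * c.gamma (ξ a) := by
  set B : Op n FS S := (1 / 4 : ℂ) • ∑ a, c.gamma (δ (η a)) * c.gamma (ξ a) with hB
  have h1 : ∀ a v, c.gamma (δ (η a)) * c.gamma (ξ a) * c.gamma v -
      c.gamma v * (c.gamma (δ (η a)) * c.gamma (ξ a)) =
      (2 : ℂ) • (mulOp FS S (g.pair v (ξ a)) * c.gamma (δ (η a)) +
        mulOp FS S (g.pair (δ v) (η a)) * c.gamma (ξ a)) := fun a v => by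
    have e1 : c.gamma (δ (η a)) * c.gamma (ξ a) * c.gamma v -
        c.gamma v * (c.gamma (δ (η a)) * c.gamma (ξ a)) =
        c.gamma (δ (η a)) * (c.gamma v * c.gamma (ξ a) + c.gamma (ξ a) * c.gamma v) -
        (c.gamma v * c.gamma (δ (η a)) + c.gamma (δ (η a)) * c.gamma v) * c.gamma (ξ a) := by
      noncomm_ring
    rw [e1, gamma_rel, gamma_rel, eq_neg_of_add_eq_zero_left (hskew v (η a)), mulOp_neg,
      mul_smul_comm, mulOp_comm_gamma, smul_mul_assoc, ← smul_sub, neg_mul, sub_eq_add_neg]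
  have h2 : ∀ v, B * c.gamma v - c.gamma v * B = c.gamma (δ v) := fun v => by
    have e1 : c.gamma (δ v) = ∑ a, mulOp FS S (g.pair v (ξ a)) * c.gamma (δ (η a)) := by
      conv_lhs => rw [tensorial_expand hξ hadd hsmul v, gamma_sum]
      simp only [gamma_fsmul]
    have e2 := c.gamma_expand (expand_dual hξ) (δ v)
    rw [hB, smul_mul_assoc, mul_smul_comm, ← smul_sub, Finset.sum_mul, Finset.mul_sum,
      ← Finset.sum_sub_distrib]
    simp only [h1]
    rw [← Finset.smul_sum, Finset.sum_add_distrib, ← e1, ← e2, ← two_smul ℂ (c.gamma (δ v)),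
      smul_smul, smul_smul]
    norm_num
  have hBf : ∀ f, B * mulOp FS S f = mulOp FS S f * B := fun f => by
    have h3 : ActsBy B fun x => (1 / 4 : ℂ) • ∑ a, c.gammaAt x (δ (η a) x) * c.gammaAt x (ξ a x) :=
      (ActsBy.sum _ fun a _ => (c.gamma_actsBy _).mul (c.gamma_actsBy _)).smul _
    exact h3.comm_mulOp f
  obtain ⟨z, hz⟩ := exists_cMul_of_comm c hξ (T := T - B)
    (fun f => by rw [sub_mul, mul_sub, hf, hBf])
    (fun v => by
      rw [sub_mul, mul_sub, ← sub_eq_zero]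
      have := (hT v).trans (h2 v).symm
      rw [← sub_eq_zero] at this
      rw [← this]; abel)
  exact ⟨z, sub_eq_iff_eq_add.1 hz⟩

/-- The curvature operator of `∇^S` commutes with functions because `[X, Y] = X Y - Y X` on them,
and it acts on Clifford multiplication by the curvature of `∇^E`, which is skew. -/
theorem exists_cMul_curvature {DE : Connection n F E} {DS : ComplexConnection n FS S}
    (hD : c.Compatible DE DS) (X Y : VField n M) :
    ∃ z, DS.op X * DS.op Y - DS.op Y * DS.op X = DS.op (lieBracket X Y) + (cMul FS S z +
      (1 / 4 : ℂ) • ∑ a, c.gamma (DE.curvature X Y (η a)) * c.gamma (ξ a)) := by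
  obtain ⟨z, hz⟩ := exists_cMul_of_derivation c hξ
    (T := DS.op X * DS.op Y - DS.op Y * DS.op X - DS.op (lieBracket X Y))
    (δ := DE.curvature X Y) (fun f => by
      rw [← sub_eq_zero, commutator_identity]
      simp only [ComplexConnection.op_mulOp]
      rw [← mulOp_sub, lieBracket_app, sub_self]) (fun v => by
      rw [commutator_identity]
      simp only [hD.2]
      rw [← gamma_sub, ← gamma_sub]; rfl) (DE.curvature_add X Y) (DE.curvature_fsmul X Y)
    (hD.1.curvature_skew X Y)
  exact ⟨z, by rw [← hz]; abel⟩

/-- The difference of two metric connections is tensorial and skew. If they coincide, only the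
scalar function remains, which is the source of the independence of `∇^S`. -/
theorem exists_cMul_sub {DE DE' : Connection n F E} {DS DS' : ComplexConnection n FS S}
    (hD : c.Compatible DE DS) (hD' : c.Compatible DE' DS') (X : VField n M) :
    ∃ z, DS'.op X = DS.op X + (cMul FS S z + (1 / 4 : ℂ) •
      ∑ a, c.gamma (DE'.nabla X (η a) - DE.nabla X (η a)) * c.gamma (ξ a)) := by
  obtain ⟨z, hz⟩ := exists_cMul_of_derivation c hξ (T := DS'.op X - DS.op X)
    (δ := fun v => DE'.nabla X v - DE.nabla X v) (fun f => by
      have h1 := DS.op_mulOp X f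
      rw [← DS'.op_mulOp X f] at h1
      rw [sub_mul, mul_sub, ← sub_eq_zero, ← sub_eq_zero.2 h1.symm]; abel) (fun v => by
      rw [gamma_sub, ← hD.2, ← hD'.2]; noncomm_ring)
    (fun v w => by simp only [Connection.nabla_add]; abel)
    (fun f v => by
      simp only [Connection.nabla_fsmul]
      ext x
      change (f x • DE'.nabla X v x + X.app f x • v x) - (f x • DE.nabla X v x + X.app f x • v x) =
        f x • (DE'.nabla X v x - DE.nabla X v x)
      module)
    (fun v w => by
      have h1 := hD.1.app_pair X v w
      rw [hD'.1.app_pair X v w] at h1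
      ext x
      have h2 := congrArg (fun f : SFun n M => f x) h1
      change g.form x (DE'.nabla X v x) (w x) + g.form x (v x) (DE'.nabla X w x) =
        g.form x (DE.nabla X v x) (w x) + g.form x (v x) (DE.nabla X w x) at h2
      change g.form x (DE'.nabla X v x - DE.nabla X v x) (w x) +
        g.form x (v x) (DE'.nabla X w x - DE.nabla X w x) = 0
      simp only [map_sub, LinearMap.sub_apply]
      linear_combination h2)
  exact ⟨z, by rw [← hz]; abel⟩

end Frame

end SpinorStructure

end SpinorRelations


set_option linter.unusedSectionVars false

/-! ### The geometric instance of the abstract symbol calculus -/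

section SpinorSymbolData

variable {n : ℕ} {M : Type*} [TopologicalSpace M] [ChartedSpace (EuclideanSpace ℝ (Fin n)) M]
  [IsManifold (𝓡 n) ∞ M]
  {F : Type*} [NormedAddCommGroup F] [NormedSpace ℝ F]
  {E : M → Type*} [TopologicalSpace (TotalSpace F E)] [∀ x, TopologicalSpace (E x)]
  [∀ x, AddCommGroup (E x)] [∀ x, Module ℝ (E x)]
  [∀ x, IsTopologicalAddGroup (E x)] [∀ x, ContinuousSMul ℝ (E x)]
  [FiberBundle F E] [VectorBundle ℝ F E]
  {g : PseudoMetric n F E}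

/-- `fnSection` as an additive map. -/
def fnSectionHom : Cₛ^∞⟮𝓡 n; F, E⟯ →+ Fn n F E :=
  AddMonoidHom.mk' fnSection fun v w => Subtype.ext (funext fun x => by
    change exteriorι n E x (ExteriorAlgebra.ι ℝ (v x + w x)) =
      exteriorι n E x (ExteriorAlgebra.ι ℝ (v x)) + exteriorι n E x (ExteriorAlgebra.ι ℝ (w x))
    rw [map_add, exteriorι_eq_fnPure, fnPure_add_right]; rfl)

theorem fnSection_fsmul (f : SFun n M) (v : Cₛ^∞⟮𝓡 n; F, E⟯) :
    fnSection (fsmul f v) = fnBase F E f * fnSection v := by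
  refine Subtype.ext (funext fun x => ?_)
  change exteriorι n E x (ExteriorAlgebra.ι ℝ (f x • v x)) = _
  rw [map_smul, exteriorι_smul]
  exact Algebra.smul_def _ _

theorem fnSection_nabla (D : Connection n F E) {ι : Type*} [Fintype ι] {f : ι → SFun n M}
    {X : ι → VField n M}
    (hX : ∀ x (v : TangentSpace (𝓡 n) x), v = ∑ i, mvfderiv (𝓡 n) (f i) x v • X i x)
    (Y : VField n M) (s : Cₛ^∞⟮𝓡 n; F, E⟯) :
    fnSection (D.nabla Y s) = ∑ j, fnBase F E (Y.app (f j)) * fnSection (D.nabla (X j) s) := by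
  conv_lhs => rw [D.nabla_expand hX Y s]
  refine (map_sum fnSectionHom _ _).trans (Finset.sum_congr rfl fun j _ => ?_)
  exact fnSection_fsmul _ _

theorem fnD_mul (f : SFun n M) (G H : Fn n F E) :
    fnD F E f (G * H) = G * fnD F E f H + fnD F E f G * H :=
  Subtype.ext (funext fun x => fibreD_mul _ (G.1 x) (H.1 x))

theorem fnD_fnScalar (f : SFun n M) (z : CFun n M) : fnD F E f (fnScalar F E z) = 0 :=
  Subtype.ext (funext fun _ => fibreD_algebraMap _ _)

theorem fnD_fnSection (f : SFun n M) (v : Cₛ^∞⟮𝓡 n; F, E⟯) : fnD F E f (fnSection v) = 0 :=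
  Subtype.ext (funext fun _ => fibreD_exteriorι _ _)

theorem fnD_fnField (f : SFun n M) (Y : VField n M) :
    fnD F E f (fnField F E Y) = fnBase F E (Y.app f) :=
  Subtype.ext (funext fun _ => fibreD_tangentι _ _)

theorem fnD_mem (f : SFun n M) {k : ℤ} {G : Fn n F E} (hG : G ∈ FnOfDegree n F E k) :
    fnD F E f G ∈ FnOfDegree n F E (k - 2) := fun x => fibreD_mem _ (hG x)

theorem FnOfDegree_mul {k l : ℤ} {G H : Fn n F E} (hG : G ∈ FnOfDegree n F E k)
    (hH : H ∈ FnOfDegree n F E l) : G * H ∈ FnOfDegree n F E (k + l) :=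
  fun x => FnDegree_mul (hG x) (hH x)

theorem fnSection_mem (v : Cₛ^∞⟮𝓡 n; F, E⟯) : fnSection v ∈ FnOfDegree n F E 1 :=
  fun _ => exteriorι_mem_FnDegree _

theorem fnC_mul (v : Cₛ^∞⟮𝓡 n; F, E⟯) (G : Fn n F E) {l : ℤ} {H : Fn n F E}
    (hH : H ∈ FnOfDegree n F E l) :
    fnC g v (G * H) = G * fnC g v H + sgn l • (fnC g v G * H) :=
  Subtype.ext (funext fun x => by
    refine (fibreC_mul _ (G.1 x) (H.1 x)).trans ?_
    rw [fibreInv_eq (hH x), mul_smul_comm]; rfl)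

theorem mul_fnSection (v : Cₛ^∞⟮𝓡 n; F, E⟯) {l : ℤ} {H : Fn n F E}
    (hH : H ∈ FnOfDegree n F E l) : fnSection v * H = sgn l • (H * fnSection v) :=
  Subtype.ext (funext fun x => by
    change _ = sgn l • (H.1 x * exteriorι n E x (ExteriorAlgebra.ι ℝ (v x)))
    rw [fibre_mul_ι, fibreInv_eq (hH x), mul_smul_comm, smul_smul, sgn_mul_self, one_smul]; rfl)

/-- The derivation of functions on `T^*[2]M ⊕ E[1]` along a section of `E`. -/
def fnDSec (g : PseudoMetric n F E) (D : Connection n F E) {ι : Type*} [Fintype ι]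
    (f : ι → SFun n M) (X : ι → VField n M) (v : Cₛ^∞⟮𝓡 n; F, E⟯) : Fn n F E →ₗ[ℂ] Fn n F E :=
  fnC g v + ∑ j, LinearMap.mulRight ℂ (fnSection (D.nabla (X j) v)) ∘ₗ fnD F E (f j)

theorem fnDSec_apply (D : Connection n F E) {ι : Type*} [Fintype ι] (f : ι → SFun n M)
    (X : ι → VField n M) (v : Cₛ^∞⟮𝓡 n; F, E⟯) (G : Fn n F E) : fnDSec g D f X v G =
      fnC g v G + ∑ j, fnD F E (f j) G * fnSection (D.nabla (X j) v) := by
  simp [fnDSec, LinearMap.sum_apply]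

theorem ofReal_inv_sqrt_two_sq : ((1 / Real.sqrt 2 : ℝ) : ℂ) * ((1 / Real.sqrt 2 : ℝ) : ℂ) = 1 / 2 := by
  rw [← Complex.ofReal_mul, div_mul_div_comm, Real.mul_self_sqrt (by norm_num)]
  norm_num

theorem ofReal_inv_sqrt_two_ne : ((1 / Real.sqrt 2 : ℝ) : ℂ) ≠ 0 := by
  intro h
  have := ofReal_inv_sqrt_two_sq
  rw [h] at this
  norm_num at this

variable {FS : Type*} [NormedAddCommGroup FS] [NormedSpace ℝ FS]
  {S : M → Type*} [TopologicalSpace (TotalSpace FS S)] [∀ x, TopologicalSpace (S x)]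
  [∀ x, AddCommGroup (S x)] [∀ x, Module ℝ (S x)]
  [∀ x, IsTopologicalAddGroup (S x)] [∀ x, ContinuousSMul ℝ (S x)]
  [FiberBundle FS S] [VectorBundle ℝ FS S]
  [∀ x, Module ℂ (S x)] [∀ x, IsScalarTower ℝ ℂ (S x)] [IsComplexBundle n FS S]
  [FiniteDimensional ℝ F]
  [T2Space M] [SecondCountableTopology M] [ContMDiffVectorBundle ∞ FS S (𝓡 n)]
  [FiniteDimensional ℝ FS] {ι κ : Type*} [Fintype ι] [Fintype κ] {f : ι → SFun n M}
  {X : ι → VField n M} {ξ η : κ → Cₛ^∞⟮𝓡 n; F, E⟯}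

/-- The symbol calculus of a spinor bundle with a compatible pair of connections. -/
def symbolData (hX : ∀ x (v : TangentSpace (𝓡 n) x), v = ∑ i, mvfderiv (𝓡 n) (f i) x v • X i x)
    (hξ : ∀ (x : M) (v : E x), v = ∑ a, g.form x v (ξ a x) • η a x)
    (hpos : 0 < Module.finrank ℝ F) (c : SpinorStructure FS S g) {DE : Connection n F E}
    {DS : ComplexConnection n FS S} (hD : c.Compatible DE DS) :
    SymbolData (Op n FS S) (Fn n F E) (CFun n M) (SFun n M) (Cₛ^∞⟮𝓡 n; F, E⟯) (VField n M) ι κ where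
  cA := cMul FS S
  cO := fnScalar F E
  re := CFun.ofReal
  sec v := ((1 / Real.sqrt 2 : ℝ) : ℂ) • c.gamma v
  fld := DS.op
  secO := fnSection
  fldO := fnField F E
  metric := g.pair
  app := VField.app
  conn := DE.nabla
  brk := lieBracket
  smulV := fsmul
  fn := f
  vf := X
  ξ := ξ
  η := η
  curvV Y Z a := DE.curvature Y Z (η a)
  curvC Y Z := (c.exists_cMul_curvature hξ hD Y Z).choose
  -- Half the rank, because each of the two factors is divided by `√2`. For the same reason the
  -- coefficient ¼ in the curvature becomes ½.
  ρ := Module.finrank ℝ F / 2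
  cA_inj := by
    have := c.nontrivial_fiber
    exact cMul_injective
  cO_inj := fnScalar_injective
  c_decomp := CFun.exists_ofReal
  c_sec z v := by rw [mul_smul_comm, smul_mul_assoc, c.cMul_comm_gamma]
  sec_sec v w := by
    simp only [mul_smul_comm, smul_mul_assoc, smul_smul, ofReal_inv_sqrt_two_sq]
    rw [← smul_add, c.gamma_rel, smul_smul, cMul_ofReal]
    norm_num
  fld_c Y h := by
    rw [cMul_ofReal, cMul_ofReal, ← DS.op_mulOp]; abel
  fld_sec Y v := by
    rw [mul_smul_comm, smul_mul_assoc, ← smul_add, ← hD.2]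
    congr 1; abel
  fld_fld Y Z := by
    have := (c.exists_cMul_curvature hξ hD Y Z).choose_spec
    refine this.trans (congrArg₂ (· + ·) rfl (congrArg₂ (· + ·) rfl ?_))
    simp only [mul_smul_comm, smul_mul_assoc, smul_smul, ofReal_inv_sqrt_two_sq, ← Finset.smul_sum]
    norm_num
  sec_smul h v := by rw [c.gamma_fsmul, mul_smul_comm, cMul_ofReal]
  fld_expand Y := by
    simp only [cMul_ofReal]
    exact DS.op_expand hX Y
  sec_expand v := by
    conv_lhs => rw [c.gamma_expand hξ v, Finset.smul_sum]
    simp only [cMul_ofReal, mul_smul_comm]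
  conn_expand Y a := by
    conv_lhs => rw [DE.nabla_expand hX Y (ξ a), c.gamma_sum, Finset.smul_sum]
    simp only [cMul_ofReal, mul_smul_comm, c.gamma_fsmul]
  casimir := by
    simp only [mul_smul_comm, smul_mul_assoc, smul_smul, ofReal_inv_sqrt_two_sq, ← Finset.smul_sum]
    rw [c.gamma_casimir hξ, smul_smul]
    congr 1; ring
  ρ_ne := by
    have : (Module.finrank ℝ F : ℂ) ≠ 0 := by exact_mod_cast hpos.ne'
    simpa using this
  deg := FnOfDegree n F E
  deg_neg k hk := eq_bot_iff.2 fun G hG => Subtype.ext (funext fun x => by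
    have := hG x
    rwa [FnDegree_neg hk] at this)
  deg_zero G hG := by
    obtain ⟨z, hz⟩ := exists_cfun_of_degree_zero hG
    exact ⟨z, Subtype.ext (funext hz)⟩
  cO_mem z x := algebraMap_mem_FnDegree _
  secO_mem := fnSection_mem
  fldO_mem Y x := tangentι_mem_FnDegree _
  deg_mul k l G hG H hH := FnOfDegree_mul hG hH
  indep := FnOfDegree_indep hX hξ
  iSup_deg := FnOfDegree_iSup hX hξ
  dfn := fnD F E
  dsec := fnDSec g DE f X
  dfn_mem h k G hG := fnD_mem h hG
  dsec_mem v k G hG := by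
    rw [fnDSec_apply]
    refine add_mem (fun x => fibreC_mem _ (hG x)) (Submodule.sum_mem _ fun j _ => ?_)
    have := FnOfDegree_mul (fnD_mem (f j) hG) (fnSection_mem (DE.nabla (X j) v))
    rwa [show k - 2 + 1 = k - 1 by ring] at this
  dfn_mul := fnD_mul
  dsec_mul v l G H hH := by
    simp only [fnDSec_apply, fnC_mul v G hH, fnD_mul, add_mul, mul_add, Finset.sum_add_distrib,
      Finset.sum_mul, Finset.mul_sum, Finset.smul_sum, smul_add]
    -- The correction term is an even derivative times a section on the right; moving the section
    -- past `H` cancels the sign of the graded Leibniz rule.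
    have : ∀ j, sgn l • (fnD F E (f j) G * fnSection (DE.nabla (X j) v) * H) =
        fnD F E (f j) G * H * fnSection (DE.nabla (X j) v) := fun j => by
      rw [mul_assoc, mul_fnSection _ hH, mul_smul_comm, smul_smul, sgn_mul_self, one_smul, mul_assoc]
    simp only [mul_assoc] at this ⊢
    simp only [this]
    abel
  dfn_c := fnD_fnScalar
  dfn_sec := fnD_fnSection
  dfn_fld := fnD_fnField
  dsec_c v z := by
    rw [fnDSec_apply]
    simp only [fnD_fnScalar, zero_mul, Finset.sum_const_zero, add_zero]
    exact Subtype.ext (funext fun x => fibreC_algebraMap _ _)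
  dsec_sec v w := by
    rw [fnDSec_apply]
    simp only [fnD_fnSection, zero_mul, Finset.sum_const_zero, add_zero]
    refine Subtype.ext (funext fun x => (fibreC_exteriorι _ _).trans ?_)
    rw [g.symm]; rfl
  dsec_fld v Y := by
    rw [fnDSec_apply, fnSection_nabla DE hX Y v]
    simp only [fnD_fnField]
    refine (congrArg (· + _) (Subtype.ext (funext fun x => fibreC_tangentι _ _))).trans (zero_add _)
  euler k G hG := by
    rw [← (fnEuler_eq_iff hX hξ G k).2 hG, fnEuler_apply]
    simp only [fnDSec_apply, add_sub_cancel_right]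

end SpinorSymbolData


set_option linter.unusedSectionVars false

/-! ### Even and odd operators as words of even and odd degree -/

section SpinorParity

variable {n : ℕ} {M : Type*} [TopologicalSpace M] [ChartedSpace (EuclideanSpace ℝ (Fin n)) M]
  [IsManifold (𝓡 n) ∞ M]
  {F : Type*} [NormedAddCommGroup F] [NormedSpace ℝ F]
  {E : M → Type*} [TopologicalSpace (TotalSpace F E)] [∀ x, TopologicalSpace (E x)]
  [∀ x, AddCommGroup (E x)] [∀ x, Module ℝ (E x)]
  [∀ x, IsTopologicalAddGroup (E x)] [∀ x, ContinuousSMul ℝ (E x)]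
  [FiberBundle F E] [VectorBundle ℝ F E]
  {g : PseudoMetric n F E}
  {FS : Type*} [NormedAddCommGroup FS] [NormedSpace ℝ FS]
  {S : M → Type*} [TopologicalSpace (TotalSpace FS S)] [∀ x, TopologicalSpace (S x)]
  [∀ x, AddCommGroup (S x)] [∀ x, Module ℝ (S x)]
  [∀ x, IsTopologicalAddGroup (S x)] [∀ x, ContinuousSMul ℝ (S x)]
  [FiberBundle FS S] [VectorBundle ℝ FS S]
  [∀ x, Module ℂ (S x)] [∀ x, IsScalarTower ℝ ℂ (S x)] [IsComplexBundle n FS S]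
  [FiniteDimensional ℝ F]
  [T2Space M] [SecondCountableTopology M] [ContMDiffVectorBundle ∞ FS S (𝓡 n)]
  [FiniteDimensional ℝ FS] {ι κ : Type*} [Fintype ι] [Fintype κ] {f : ι → SFun n M}
  {X : ι → VField n M} {ξ η : κ → Cₛ^∞⟮𝓡 n; F, E⟯}

variable (FS S) in
theorem finrank_end_le (x : M) : FiniteDimensional ℂ (S x) ∧
    Module.finrank ℂ (Module.End ℂ (S x)) ≤ Module.finrank ℝ FS * Module.finrank ℝ FS := by
  have := finiteDimensional_fiber FS (V := S) x
  have h : FiniteDimensional ℂ (S x) := Module.Finite.of_restrictScalars_finite ℝ ℂ (S x)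
  have h1 : Module.finrank ℂ (S x) ≤ Module.finrank ℝ FS := by
    rw [← finrank_fiber FS (V := S) x, ← Module.finrank_mul_finrank ℝ ℂ (S x),
      Complex.finrank_real_complex]
    omega
  rw [Module.finrank_linearMap]
  exact ⟨h, Nat.mul_le_mul h1 h1⟩

variable (hX : ∀ x (v : TangentSpace (𝓡 n) x), v = ∑ i, mvfderiv (𝓡 n) (f i) x v • X i x)
    (hξ : ∀ (x : M) (v : E x), v = ∑ a, g.form x v (ξ a x) • η a x)
    (hpos : 0 < Module.finrank ℝ F) (c : SpinorStructure FS S g) {DE : Connection n F E}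
    {DS : ComplexConnection n FS S} (hD : c.Compatible DE DS)

namespace SpinorStructure

theorem sym_gamma (v : Cₛ^∞⟮𝓡 n; F, E⟯) : (symbolData hX hξ hpos c hD).Sym 0 1 (c.gamma v)
    (((1 / Real.sqrt 2 : ℝ) : ℂ)⁻¹ • fnSection v) := by
  refine ((SymbolData.Sym.sec (S := symbolData hX hξ hpos c hD) v).smul
    ((1 / Real.sqrt 2 : ℝ) : ℂ)⁻¹).cast rfl rfl ?_ rfl
  exact inv_smul_smul₀ ofReal_inv_sqrt_two_ne _

/-- Smooth families of words of length `k` in the fibres are words of degree `k`. -/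
theorem exists_sym_of_mem_pow (k : ℕ) {T : Op n FS S} {t : ∀ x, Module.End ℂ (S x)}
    (hT : ActsBy T t) (ht : ∀ x, t x ∈ (frameAt hξ hpos c x).gen ^ k) :
    ∃ G, (symbolData hX hξ hpos c hD).Sym 0 k T G := by
  induction k using Nat.strong_induction_on generalizing T t with
  | _ k ih =>
  cases k with
  | zero =>
    have h1 : ∀ x, ∃ z : ℂ, t x = z • 1 := fun x => by
      obtain ⟨z, hz⟩ := Submodule.mem_one.1 (by simpa using ht x)
      exact ⟨z, by rw [← hz, Algebra.algebraMap_eq_smul_one]⟩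
    choose z hz using h1
    obtain rfl : t = fun x => z x • 1 := funext hz
    have := c.nontrivial_fiber
    obtain ⟨z, rfl⟩ := hT.exists_cMul
    exact ⟨_, SymbolData.Sym.const (S := symbolData hX hξ hpos c hD) z⟩
  | succ j =>
    -- The Euler formula of the Clifford algebra recovers `T` from its graded commutators `B a`,
    -- which have length `j`, up to the remainder `R` of length `j - 1`. Thus `T` is built from
    -- global operators known by induction.
    let B : κ → Op n FS S := fun a =>
      c.gamma (ξ a) * T - (-1 : ℂ) ^ (j + 1) • (T * c.gamma (ξ a))
    have hB : ∀ a, ActsBy (B a) fun x => c.gammaAt x (ξ a x) * t x -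
        (-1 : ℂ) ^ (j + 1) • (t x * c.gammaAt x (ξ a x)) := fun a =>
      ((c.gamma_actsBy _).mul hT).sub ((hT.mul (c.gamma_actsBy _)).smul _)
    have h1 : ∀ a, ∃ G, (symbolData hX hξ hpos c hD).Sym 0 j (B a) G := fun a =>
      ih j (Nat.lt_succ_self j) (hB a) fun x =>
        CliffordFrame.comm_mem (f := frameAt hξ hpos c x) (ξ a x) (ht x)
    choose H hH using h1
    let R : Op n FS S := ∑ a, c.gamma (η a) * B a - (2 * (j + 1 : ℕ) : ℂ) • T
    have hR : ActsBy R fun x => ∑ a, c.gammaAt x (η a x) * (c.gammaAt x (ξ a x) * t x -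
        (-1 : ℂ) ^ (j + 1) • (t x * c.gammaAt x (ξ a x))) - (2 * (j + 1 : ℕ) : ℂ) • t x :=
      (ActsBy.sum _ fun a _ => (c.gamma_actsBy _).mul (hB a)).sub (hT.smul _)
    have hR' := fun x => CliffordFrame.euler_mem (f := frameAt hξ hpos c x) (ht x)
    have h2 : ∃ G, (symbolData hX hξ hpos c hD).Sym 0 (j + 1 : ℕ) R G := by
      cases j with
      | zero =>
        have h3 : R = 0 := by
          refine hR.ext ?_
          have h4 := funext fun x => (Submodule.mem_bot ℂ).1 (hR' x)
          exact (congrArg (ActsBy (0 : Op n FS S)) h4).mpr ActsBy.zero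
        exact ⟨0, h3 ▸ SymbolData.Sym.zero _ _⟩
      | succ i =>
        obtain ⟨G, hG⟩ := ih i (by omega) hR hR'
        exact SymbolData.Sym.sub_two (hG.cast rfl (by push_cast; ring) rfl rfl)
    obtain ⟨G, hG⟩ := h2
    have h5 := (((SymbolData.Sym.sum Finset.univ fun a _ =>
      (sym_gamma hX hξ hpos c hD (η a)).mul (hH a)).cast (m' := 0) (k' := ((j + 1 : ℕ) : ℤ))
        (by simp) (by push_cast; ring) rfl rfl).sub hG).smul (2 * (j + 1 : ℕ) : ℂ)⁻¹
    refine ⟨_, h5.cast rfl rfl ?_ rfl⟩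
    rw [sub_sub_cancel, inv_smul_smul₀]
    exact mul_ne_zero two_ne_zero (Nat.cast_ne_zero.2 (Nat.succ_ne_zero j))

/-- A word of order at most 0 contains no effective covariant derivative, so it acts pointwise by
Clifford words of the same length. -/
theorem exists_actsBy_of_sym {m k : ℤ} {T : Op n FS S} {G : Fn n F E}
    (h : (symbolData hX hξ hpos c hD).Sym m k T G) (hm : m ≤ 0) :
    ∃ t, ActsBy T t ∧ ∀ x, ∀ K : ℕ, k = K → t x ∈ (frameAt hξ hpos c x).gen ^ K := by
  induction h with
  | zero m k => exact ⟨_, ActsBy.zero, fun x K _ => zero_mem _⟩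
  | fn f =>
    refine ⟨_, cMul_actsBy (CFun.ofReal f), fun x K hK => ?_⟩
    obtain rfl : K = 0 := by omega
    rw [pow_zero]
    exact Submodule.mem_one.2 ⟨_, Algebra.algebraMap_eq_smul_one _⟩
  | sec v =>
    refine ⟨_, (c.gamma_actsBy v).smul _, fun x K hK => ?_⟩
    obtain rfl : K = 1 := by omega
    rw [pow_one]
    exact Submodule.smul_mem _ _ (CliffordFrame.γ_mem (f := frameAt hξ hpos c x) (v x))
  | fld Y => exact absurd hm (by norm_num)
  | add _ _ ih ih' =>
    obtain ⟨t, h, ht⟩ := ih hm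
    obtain ⟨t', h', ht'⟩ := ih' hm
    exact ⟨_, h.add h', fun x K hK => add_mem (ht x K hK) (ht' x K hK)⟩
  | smul z _ ih =>
    obtain ⟨t, h, ht⟩ := ih hm
    exact ⟨_, h.smul z, fun x K hK => Submodule.smul_mem _ _ (ht x K hK)⟩
  | @mul m k m' k' T T' G G' h1 h2 ih ih' =>
    -- If both factors are nonzero, their orders and degrees are nonnegative. So both orders are 0
    -- and the induction hypotheses apply.
    by_cases hT : T = 0
    · exact ⟨_, by rw [hT, zero_mul]; exact ActsBy.zero, fun x K _ => zero_mem _⟩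
    by_cases hT' : T' = 0
    · exact ⟨_, by rw [hT', mul_zero]; exact ActsBy.zero, fun x K _ => zero_mem _⟩
    have hm0 : 0 ≤ m := not_lt.1 fun h => hT (h1.order_neg h).1
    have hm0' : 0 ≤ m' := not_lt.1 fun h => hT' (h2.order_neg h).1
    have hk0 : 0 ≤ k := not_lt.1 fun h => hT (h1.base.1 h).1
    have hk0' : 0 ≤ k' := not_lt.1 fun h => hT' (h2.base.1 h).1
    obtain ⟨t, h, ht⟩ := ih (by omega)
    obtain ⟨t', h', ht'⟩ := ih' (by omega)
    refine ⟨_, h.mul h', fun x K hK => ?_⟩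
    obtain rfl : K = k.toNat + k'.toNat := by omega
    rw [pow_add]
    exact Submodule.mul_mem_mul (ht x _ (by omega)) (ht' x _ (by omega))
  | mono _ ih => exact ih (by omega)

theorem mem_cliffordSections_of_sym {k : ℤ} {T : Op n FS S} {G : Fn n F E}
    (h : (symbolData hX hξ hpos c hD).Sym 0 k T G) {i : ZMod 2} (hk : (k : ZMod 2) = i) :
    T ∈ c.cliffordSections i := by
  obtain ⟨t, hT, ht⟩ := exists_actsBy_of_sym hX hξ hpos c hD h le_rfl
  rcases lt_or_ge k 0 with h0 | h0
  · rw [(h.base.1 h0).1]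
    exact ⟨fun x => 0, fun x => zero_mem _, fun s x => by rw [map_zero]; rfl⟩
  · lift k to ℕ using h0
    refine ⟨fun x => (c.iso x).symm (t x), fun x => ?_, fun s x => ?_⟩
    · rw [← hk]
      exact_mod_cast iso_symm_mem hξ hpos c (ht x k rfl)
    · rw [hT, AlgEquiv.apply_symm_apply]

theorem exists_sym_of_mem_cliffordSections {i : ZMod 2} {T : Op n FS S}
    (h : T ∈ c.cliffordSections i) : ∃ k : ℤ, (k : ZMod 2) = i ∧
      ∃ G, (symbolData hX hξ hpos c hD).Sym 0 k T G := by
  obtain ⟨t, ht, hT⟩ := h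
  -- The square of the real rank of `S` bounds the complex dimension of the endomorphism algebra in
  -- every fibre, so it gives an exponent where the lengths have stabilized.
  refine ⟨(2 * (Module.finrank ℝ FS * Module.finrank ℝ FS) + i.val : ℕ), ?_,
    exists_sym_of_mem_pow hX hξ hpos c hD _ (t := fun x => c.iso x (t x)) hT fun x => ?_⟩
  · have : (2 : ZMod 2) = 0 := rfl
    push_cast
    rw [ZMod.natCast_val, ZMod.cast_id', this]
    simp
  · have := (finrank_end_le FS S x).1
    exact iso_mem_pow hξ hpos c (finrank_end_le FS S x).2 (ht x)

theorem evenOps_of_sym {k : ℤ} (hk : Even k) {T : Op n FS S} {G : Fn n F E}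
    (h : (symbolData hX hξ hpos c hD).Sym 0 k T G) : T ∈ c.evenOps :=
  Algebra.subset_adjoin (Or.inl (mem_cliffordSections_of_sym hX hξ hpos c hD h
    (ZMod.intCast_eq_zero_iff_even.2 hk)))

theorem oddOps_of_sym {k : ℤ} (hk : Odd k) {T : Op n FS S} {G : Fn n F E}
    (h : (symbolData hX hξ hpos c hD).Sym 0 k T G) : T ∈ c.oddOps :=
  Submodule.subset_span ⟨T, mem_cliffordSections_of_sym hX hξ hpos c hD h
    (ZMod.intCast_eq_one_iff_odd.2 hk), 1, one_mem _, (mul_one T).symm⟩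

theorem exists_sym_of_even {T : Op n FS S} (h : T ∈ c.cliffordSections 0) :
    ∃ k : ℤ, Even k ∧ ∃ G, (symbolData hX hξ hpos c hD).Sym 0 k T G := by
  obtain ⟨k, hk, G, hG⟩ := exists_sym_of_mem_cliffordSections hX hξ hpos c hD h
  exact ⟨k, ZMod.intCast_eq_zero_iff_even.1 hk, G, hG⟩

theorem exists_sym_of_odd {T : Op n FS S} (h : T ∈ c.cliffordSections 1) :
    ∃ k : ℤ, Odd k ∧ ∃ G, (symbolData hX hξ hpos c hD).Sym 0 k T G := by
  obtain ⟨k, hk, G, hG⟩ := exists_sym_of_mem_cliffordSections hX hξ hpos c hD h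
  exact ⟨k, ZMod.intCast_eq_one_iff_odd.1 hk, G, hG⟩

theorem oddOps_mul {U B : Op n FS S} (hU : U ∈ c.oddOps) (hB : B ∈ c.evenOps) :
    U * B ∈ c.oddOps := by
  induction hU using Submodule.span_induction with
  | zero => rw [zero_mul]; exact zero_mem _
  | add U U' _ _ h h' => rw [add_mul]; exact add_mem h h'
  | smul z U _ h => rw [smul_mul_assoc]; exact Submodule.smul_mem _ _ h
  | mem U h =>
    obtain ⟨A, hA, B', hB', rfl⟩ := h
    rw [mul_assoc]
    exact Submodule.subset_span ⟨A, hA, _, mul_mem hB' hB, rfl⟩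

/-- The zeroth order difference of two spinor connections is even. -/
theorem exists_sym_sub {D : ComplexConnection n FS S} (h : c.IsSpinorConnection D)
    (Y : VField n M) :
    ∃ Q G, D.op Y = DS.op Y + Q ∧ (symbolData hX hξ hpos c hD).Sym 0 2 Q G := by
  obtain ⟨DE', hD'⟩ := h
  obtain ⟨z, hz⟩ := c.exists_cMul_sub hξ hD hD' Y
  obtain ⟨G, hG⟩ := SymbolData.Sym.sub_two (S := symbolData hX hξ hpos c hD) (m := 0) (k := 2)
    ((SymbolData.Sym.const (S := symbolData hX hξ hpos c hD) z).cast rfl (by norm_num) rfl rfl)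
  exact ⟨_, _, hz, hG.add ((SymbolData.Sym.sum Finset.univ fun a _ =>
    (sym_gamma hX hξ hpos c hD _).mul (sym_gamma hX hξ hpos c hD _)).smul _)⟩

-- A covariant derivative is moved to the right across an odd Clifford section. The commutator is
-- odd of order zero, also for another spinor connection, since that differs from `DS` by an even
-- operator of order zero.
include hX hξ hpos hD in
theorem evenOps_mul_oddOps {U B : Op n FS S} (hB : B ∈ c.evenOps) (hU : U ∈ c.oddOps) :
    B * U ∈ c.oddOps := by
  induction hB using Algebra.adjoin_induction generalizing U with
  | algebraMap z => rw [← Algebra.smul_def]; exact Submodule.smul_mem _ _ hU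
  | add B B' _ _ h h' => rw [add_mul]; exact add_mem (h hU) (h' hU)
  | mul B B' _ _ h h' => rw [mul_assoc]; exact h (h' hU)
  | mem B hB =>
    induction hU using Submodule.span_induction with
    | zero => rw [mul_zero]; exact zero_mem _
    | add U U' _ _ h h' => rw [mul_add]; exact add_mem h h'
    | smul z U _ h => rw [mul_smul_comm]; exact Submodule.smul_mem _ _ h
    | mem U h =>
      obtain ⟨A, hA, B', hB', rfl⟩ := h
      rw [← mul_assoc]
      refine oddOps_mul c ?_ hB'
      obtain ⟨k, hk, G, hG⟩ := exists_sym_of_odd hX hξ hpos c hD hA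
      rcases hB with hB | ⟨D, Y, hDs, rfl⟩
      · obtain ⟨l, hl, H, hH⟩ := exists_sym_of_even hX hξ hpos c hD hB
        exact oddOps_of_sym hX hξ hpos c hD (hl.add_odd hk) (hH.mul hG)
      · obtain ⟨Q, H, e, hQ⟩ := exists_sym_sub hX hξ hpos c hD hDs Y
        have h1 : D.op Y * A = A * D.op Y - (A * DS.op Y - DS.op Y * A) - (A * Q - Q * A) := by
          rw [e]; noncomm_ring
        rw [h1]
        obtain ⟨G', hG'⟩ := hG.comm_fld Y
        refine sub_mem (sub_mem (Submodule.subset_span ⟨A, hA, _, Algebra.subset_adjoin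
          (Or.inr ⟨D, Y, hDs, rfl⟩), rfl⟩) (oddOps_of_sym hX hξ hpos c hD hk hG')) ?_
        exact oddOps_of_sym hX hξ hpos c hD (k := k + 2) (hk.add_even (by decide))
          ((hG.mul hQ).sub ((hQ.mul hG).cast rfl (by ring) rfl rfl))

include hX hξ hpos hD in
theorem oddOps_mul_oddOps {U U' : Op n FS S} (hU : U ∈ c.oddOps) (hU' : U' ∈ c.oddOps) :
    U * U' ∈ c.evenOps := by
  induction hU using Submodule.span_induction with
  | zero => rw [zero_mul]; exact zero_mem _
  | add U U' _ _ h h' => rw [add_mul]; exact add_mem h h'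
  | smul z U _ h => rw [smul_mul_assoc]; exact Subalgebra.smul_mem _ h _
  | mem U h =>
    obtain ⟨A, hA, B, hB, rfl⟩ := h
    obtain ⟨k, hk, G, hG⟩ := exists_sym_of_odd hX hξ hpos c hD hA
    have h2 := evenOps_mul_oddOps hX hξ hpos c hD hB hU'
    rw [mul_assoc]
    generalize B * U' = V at h2
    induction h2 using Submodule.span_induction with
    | zero => rw [mul_zero]; exact zero_mem _
    | add U U' _ _ h h' => rw [mul_add]; exact add_mem h h'
    | smul z U _ h => rw [mul_smul_comm]; exact Subalgebra.smul_mem _ h _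
    | mem U h =>
      obtain ⟨A', hA', B', hB', rfl⟩ := h
      obtain ⟨l, hl, H, hH⟩ := exists_sym_of_odd hX hξ hpos c hD hA'
      rw [← mul_assoc]
      exact mul_mem (evenOps_of_sym hX hξ hpos c hD (hk.add_odd hl) (hG.mul hH)) hB'

theorem mem_ops_of_sym {m k : ℤ} {T : Op n FS S} {G : Fn n F E}
    (h : (symbolData hX hξ hpos c hD).Sym m k T G) :
    (Even k → T ∈ c.evenOps) ∧ (Odd k → T ∈ c.oddOps) := by
  induction h with
  | zero m k => exact ⟨fun _ => zero_mem _, fun _ => zero_mem _⟩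
  | fn f =>
    exact ⟨fun hk => evenOps_of_sym hX hξ hpos c hD hk (SymbolData.Sym.fn f),
      fun hk => oddOps_of_sym hX hξ hpos c hD hk (SymbolData.Sym.fn f)⟩
  | sec v =>
    exact ⟨fun hk => evenOps_of_sym hX hξ hpos c hD hk (SymbolData.Sym.sec v),
      fun hk => oddOps_of_sym hX hξ hpos c hD hk (SymbolData.Sym.sec v)⟩
  | fld Y =>
    exact ⟨fun _ => Algebra.subset_adjoin (Or.inr ⟨DS, Y, ⟨DE, hD⟩, rfl⟩),
      fun hk => absurd hk (by decide)⟩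
  | add _ _ ih ih' =>
    exact ⟨fun hk => add_mem (ih.1 hk) (ih'.1 hk), fun hk => add_mem (ih.2 hk) (ih'.2 hk)⟩
  | smul z _ ih =>
    exact ⟨fun hk => Subalgebra.smul_mem _ (ih.1 hk) z,
      fun hk => Submodule.smul_mem _ z (ih.2 hk)⟩
  | @mul m k m' k' T T' G G' _ _ ih ih' =>
    rcases Int.even_or_odd k with hk | hk <;> rcases Int.even_or_odd k' with hk' | hk'
    · exact ⟨fun _ => mul_mem (ih.1 hk) (ih'.1 hk'),
        fun h => absurd (hk.add hk') (Int.not_even_iff_odd.2 h)⟩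
    · exact ⟨fun h => absurd h (Int.not_even_iff_odd.2 (hk.add_odd hk')),
        fun _ => evenOps_mul_oddOps hX hξ hpos c hD (ih.1 hk) (ih'.2 hk')⟩
    · exact ⟨fun h => absurd h (Int.not_even_iff_odd.2 (hk.add_even hk')),
        fun _ => oddOps_mul c (ih.2 hk) (ih'.1 hk')⟩
    · exact ⟨fun _ => oddOps_mul_oddOps hX hξ hpos c hD (ih.2 hk) (ih'.2 hk'),
        fun h => absurd (hk.add_odd hk') (Int.not_even_iff_odd.2 h)⟩
  | mono _ ih => exact ih

theorem exists_words_of_mem_evenOps {T : Op n FS S} (h : T ∈ c.evenOps) :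
    ∃ k, Even k ∧ T ∈ (symbolData hX hξ hpos c hD).words k := by
  induction h using Algebra.adjoin_induction with
  | algebraMap z =>
    refine ⟨0, by decide, ?_⟩
    rw [Algebra.algebraMap_eq_smul_one]
    exact Submodule.smul_mem _ _ SymbolData.one_mem_words
  | add T T' _ _ h h' =>
    obtain ⟨k, hk, h⟩ := h
    obtain ⟨l, hl, h'⟩ := h'
    rcases le_total k l with hkl | hkl
    · exact ⟨l, hl, add_mem (SymbolData.words_le hkl (hl.sub hk) h) h'⟩
    · exact ⟨k, hk, add_mem h (SymbolData.words_le hkl (hk.sub hl) h')⟩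
  | mul T T' _ _ h h' =>
    obtain ⟨k, hk, h⟩ := h
    obtain ⟨l, hl, h'⟩ := h'
    exact ⟨k + l, hk.add hl, SymbolData.words_mul h h'⟩
  | mem T h =>
    rcases h with h | ⟨D, Y, hDs, rfl⟩
    · obtain ⟨k, hk, G, hG⟩ := exists_sym_of_even hX hξ hpos c hD h
      exact ⟨k, hk, hG.mem_words⟩
    · obtain ⟨Q, G, e, hQ⟩ := exists_sym_sub hX hξ hpos c hD hDs Y
      exact ⟨2, by decide, e ▸ add_mem (SymbolData.fld_mem (S := symbolData hX hξ hpos c hD) Y)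
        hQ.mem_words⟩

theorem exists_words_of_mem_oddOps {T : Op n FS S} (h : T ∈ c.oddOps) :
    ∃ k, Odd k ∧ T ∈ (symbolData hX hξ hpos c hD).words k := by
  induction h using Submodule.span_induction with
  | zero => exact ⟨1, by decide, zero_mem _⟩
  | add T T' _ _ h h' =>
    obtain ⟨k, hk, h⟩ := h
    obtain ⟨l, hl, h'⟩ := h'
    rcases le_total k l with hkl | hkl
    · exact ⟨l, hl, add_mem (SymbolData.words_le hkl (hl.sub_odd hk) h) h'⟩
    · exact ⟨k, hk, add_mem h (SymbolData.words_le hkl (hk.sub_odd hl) h')⟩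
  | smul z T _ h =>
    obtain ⟨k, hk, h⟩ := h
    exact ⟨k, hk, Submodule.smul_mem _ _ h⟩
  | mem T h =>
    obtain ⟨A, hA, B, hB, rfl⟩ := h
    obtain ⟨k, hk, G, hG⟩ := exists_sym_of_odd hX hξ hpos c hD hA
    obtain ⟨l, hl, hB⟩ := exists_words_of_mem_evenOps hX hξ hpos c hD hB
    exact ⟨k + l, hk.add_even hl, SymbolData.words_mul hG.mem_words hB⟩

end SpinorStructure

end SpinorParity


set_option linter.unusedSectionVars false

/-! ### The direct sum decomposition, and the transfer of the abstract results -/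

section SpinorParity

variable {n : ℕ} {M : Type*} [TopologicalSpace M] [ChartedSpace (EuclideanSpace ℝ (Fin n)) M]
  [IsManifold (𝓡 n) ∞ M]
  {F : Type*} [NormedAddCommGroup F] [NormedSpace ℝ F]
  {E : M → Type*} [TopologicalSpace (TotalSpace F E)] [∀ x, TopologicalSpace (E x)]
  [∀ x, AddCommGroup (E x)] [∀ x, Module ℝ (E x)]
  [∀ x, IsTopologicalAddGroup (E x)] [∀ x, ContinuousSMul ℝ (E x)]
  [FiberBundle F E] [VectorBundle ℝ F E]
  {g : PseudoMetric n F E}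
  {FS : Type*} [NormedAddCommGroup FS] [NormedSpace ℝ FS]
  {S : M → Type*} [TopologicalSpace (TotalSpace FS S)] [∀ x, TopologicalSpace (S x)]
  [∀ x, AddCommGroup (S x)] [∀ x, Module ℝ (S x)]
  [∀ x, IsTopologicalAddGroup (S x)] [∀ x, ContinuousSMul ℝ (S x)]
  [FiberBundle FS S] [VectorBundle ℝ FS S]
  [∀ x, Module ℂ (S x)] [∀ x, IsScalarTower ℝ ℂ (S x)] [IsComplexBundle n FS S]
  [FiniteDimensional ℝ F]
  [T2Space M] [SecondCountableTopology M] [ContMDiffVectorBundle ∞ FS S (𝓡 n)]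
  [FiniteDimensional ℝ FS] {ι κ : Type*} [Fintype ι] [Fintype κ] {f : ι → SFun n M}
  {X : ι → VField n M} {ξ η : κ → Cₛ^∞⟮𝓡 n; F, E⟯}

variable (hX : ∀ x (v : TangentSpace (𝓡 n) x), v = ∑ i, mvfderiv (𝓡 n) (f i) x v • X i x)
    (hξ : ∀ (x : M) (v : E x), v = ∑ a, g.form x v (ξ a x) • η a x)
    (hpos : 0 < Module.finrank ℝ F) (c : SpinorStructure FS S g) {DE : Connection n F E}
    {DS : ComplexConnection n FS S} (hD : c.Compatible DE DS)

namespace SpinorStructure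

/-- Operators of order zero act fibrewise, and in each fibre even and odd Clifford words meet in
zero because the rank is even. -/
theorem sym_eq_zero (heven : Even (Module.finrank ℝ F)) {k l : ℤ} {T : Op n FS S} {G G' : Fn n F E}
    (hk : Even k) (hl : Odd l) (h : (symbolData hX hξ hpos c hD).Sym 0 k T G)
    (h' : (symbolData hX hξ hpos c hD).Sym 0 l T G') : T = 0 := by
  rcases lt_or_ge k 0 with hk0 | hk0
  · exact (h.base.1 hk0).1
  rcases lt_or_ge l 0 with hl0 | hl0
  · exact (h'.base.1 hl0).1
  obtain ⟨t, hT, ht⟩ := exists_actsBy_of_sym hX hξ hpos c hD h le_rfl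
  obtain ⟨t', hT', ht'⟩ := exists_actsBy_of_sym hX hξ hpos c hD h' le_rfl
  obtain rfl := hT.unique hT'
  obtain ⟨m, rfl⟩ := hk
  obtain ⟨m', rfl⟩ := hl
  have : t = fun _ => 0 := funext fun x =>
    CliffordFrame.eq_zero_of_mem_pow (f := frameAt hξ hpos c x) heven rfl
      (ht x (2 * m.toNat) (by omega)) (ht' x (2 * m'.toNat + 1) (by omega))
  exact hT.ext (this ▸ ActsBy.zero)

/-- The operator `T ↦ ∑ γ(η_a) T γ(ξ_a)`. -/
def casOp (ξ η : κ → Cₛ^∞⟮𝓡 n; F, E⟯) : Module.End ℂ (Op n FS S) :=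
  ∑ a, LinearMap.mulLeft ℂ (c.gamma (η a)) ∘ₗ LinearMap.mulRight ℂ (c.gamma (ξ a))

theorem casOp_actsBy {T : Op n FS S} {t : ∀ x, Module.End ℂ (S x)} (hT : ActsBy T t) :
    ActsBy (c.casOp ξ η T) fun x => (frameAt hξ hpos c x).cas (t x) := by
  have h1 : c.casOp ξ η T = ∑ a, c.gamma (η a) * (T * c.gamma (ξ a)) := by
    simp [casOp, LinearMap.sum_apply]
  rw [h1]
  simp only [CliffordFrame.cas_apply]
  exact ActsBy.sum _ fun a _ => (c.gamma_actsBy (η a)).mul (hT.mul (c.gamma_actsBy (ξ a)))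

open Polynomial in
theorem aeval_casOp_actsBy (P : ℂ[X]) {T : Op n FS S} {t : ∀ x, Module.End ℂ (S x)}
    (hT : ActsBy T t) :
    ActsBy (aeval (c.casOp ξ η) P T) fun x => aeval (frameAt hξ hpos c x).cas P (t x) := by
  induction P using Polynomial.induction_on' with
  | add p q hp hq => simp only [map_add]; exact hp.add hq
  | monomial m z =>
    simp only [aeval_monomial, Module.End.mul_apply, Module.algebraMap_end_apply]
    refine ActsBy.smul z ?_
    induction m with
    | zero => simpa using hT
    | succ m ih =>
      simp only [pow_succ', Module.End.mul_apply]
      exact casOp_actsBy hξ hpos c ih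

/-- Both connections obey the same Leibniz rule, so the difference commutes with functions and is
pointwise. -/
theorem comm_sub_op (D D' : ComplexConnection n FS S) (Y : VField n M) :
    D.op Y - D'.op Y ∈ endSections n FS S := by
  refine exists_actsBy_of_comm fun h => ?_
  have h1 := D.op_mulOp Y h
  rw [← D'.op_mulOp Y h] at h1
  rw [sub_mul, mul_sub, ← sub_eq_zero, ← sub_eq_zero.2 h1]; abel

-- The parity components of `T` are taken as polynomials in the global operator `casOp`. They are
-- thus operators on smooth sections, and fibrewise they are the projections of
-- `CliffordFrame.exists_split`.
include hX hξ hpos hD in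
theorem endSections_le (heven : Even (Module.finrank ℝ F)) {T : Op n FS S}
    (h : T ∈ endSections n FS S) : T ∈ Subalgebra.toSubmodule c.evenOps ⊔ c.oddOps := by
  obtain ⟨t, hT⟩ := h
  obtain ⟨P₀, P₁, e, hP⟩ := CliffordFrame.exists_split heven
    (Module.finrank ℝ FS * Module.finrank ℝ FS)
  have h1 : ∀ x, t x ∈ (frameAt hξ hpos c x).gen ^ (2 * (Module.finrank ℝ FS * Module.finrank ℝ FS))
      ⊔ (frameAt hξ hpos c x).gen ^ (2 * (Module.finrank ℝ FS * Module.finrank ℝ FS) + 1) := fun x => by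
    have := (finrank_end_le FS S x).1
    rw [CliffordFrame.pow_sup_pow_eq_top (f := frameAt hξ hpos c x) (c.adjoin_gammaAt x)
      (finrank_end_le FS S x).2]
    trivial
  have h2 := fun x => hP _ _ _ (frameAt hξ hpos c x) rfl (t x) (h1 x)
  obtain ⟨G, hG⟩ := exists_sym_of_mem_pow hX hξ hpos c hD _ (aeval_casOp_actsBy hξ hpos c P₀ hT)
    fun x => (h2 x).1
  obtain ⟨H, hH⟩ := exists_sym_of_mem_pow hX hξ hpos c hD _ (aeval_casOp_actsBy hξ hpos c P₁ hT)
    fun x => (h2 x).2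
  have h3 : T = Polynomial.aeval (c.casOp ξ η) P₀ T + Polynomial.aeval (c.casOp ξ η) P₁ T := by
    rw [← LinearMap.add_apply, ← map_add, e, map_one, Module.End.one_apply]
  rw [h3]
  exact Submodule.add_mem_sup (evenOps_of_sym hX hξ hpos c hD (by simp) hG)
    (oddOps_of_sym hX hξ hpos c hD (by push_cast; exact odd_two_mul_add_one _) hH)

theorem cliffordSections_subset (i : ZMod 2) : c.cliffordSections i ⊆ endSections n FS S :=
  fun _ ⟨t, _, h⟩ => ⟨fun x => c.iso x (t x), h⟩

include hX hξ hpos hD in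
theorem evenOps_sup_oddOps (heven : Even (Module.finrank ℝ F)) :
    Subalgebra.toSubmodule c.evenOps ⊔ c.oddOps = Subalgebra.toSubmodule (diffOps n FS S) := by
  have h0 : c.evenOps ≤ diffOps n FS S := by
    refine Algebra.adjoin_mono (Set.union_subset_union (c.cliffordSections_subset 0) ?_)
    rintro T ⟨D, Y, _, rfl⟩
    exact ⟨D, Y, rfl⟩
  refine le_antisymm (sup_le h0 (Submodule.span_le.2 ?_)) fun T hT => ?_
  · rintro T ⟨A, hA, B, hB, rfl⟩
    exact (diffOps n FS S).mul_mem
      (Algebra.subset_adjoin (Or.inl (c.cliffordSections_subset 1 hA))) (h0 hB)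
  · refine Algebra.adjoin_induction (p := fun T _ => T ∈ Subalgebra.toSubmodule c.evenOps ⊔ c.oddOps)
      ?_ ?_ ?_ ?_ hT
    · rintro T (h | ⟨D, Y, rfl⟩)
      · exact endSections_le hX hξ hpos c hD heven h
      · rw [← add_sub_cancel (DS.op Y) (D.op Y)]
        exact add_mem (Submodule.mem_sup_left (Algebra.subset_adjoin (Or.inr ⟨DS, Y, ⟨DE, hD⟩, rfl⟩)))
          (endSections_le hX hξ hpos c hD heven (comm_sub_op D DS Y))
    · intro z
      exact Submodule.mem_sup_left (Subalgebra.algebraMap_mem _ z)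
    · intro T T' _ _ h h'
      exact add_mem h h'
    · intro T T' _ _ h h'
      obtain ⟨A, hA, B, hB, rfl⟩ := Submodule.mem_sup.1 h
      obtain ⟨A', hA', B', hB', rfl⟩ := Submodule.mem_sup.1 h'
      rw [add_mul, mul_add, mul_add]
      exact add_mem (add_mem (Submodule.mem_sup_left (c.evenOps.mul_mem hA hA'))
        (Submodule.mem_sup_right (evenOps_mul_oddOps hX hξ hpos c hD hA hB')))
        (add_mem (Submodule.mem_sup_right (oddOps_mul c hB hA'))
        (Submodule.mem_sup_left (oddOps_mul_oddOps hX hξ hpos c hD hB hB')))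

theorem isParity (heven : Even (Module.finrank ℝ F)) :
    (symbolData hX hξ hpos c hD).IsParity (diffOps n FS S) c.evenOps c.oddOps where
  mem_even T := by
    refine ⟨exists_words_of_mem_evenOps hX hξ hpos c hD, ?_⟩
    rintro ⟨k, hk, m, G, h⟩
    exact (mem_ops_of_sym hX hξ hpos c hD h).1 hk
  mem_odd T := by
    refine ⟨exists_words_of_mem_oddOps hX hξ hpos c hD, ?_⟩
    rintro ⟨k, hk, m, G, h⟩
    exact (mem_ops_of_sym hX hξ hpos c hD h).2 hk
  sup_eq := evenOps_sup_oddOps hX hξ hpos c hD heven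
  zero_order := sym_eq_zero hX hξ hpos c hD heven

theorem range_gamma : ∃ r : ℂ, r ≠ 0 ∧
    Set.range c.gamma = Set.range fun v => r • (symbolData hX hξ hpos c hD).sec v :=
  ⟨((1 / Real.sqrt 2 : ℝ) : ℂ)⁻¹, inv_ne_zero ofReal_inv_sqrt_two_ne, congrArg Set.range
    (funext fun _ => (inv_smul_smul₀ ofReal_inv_sqrt_two_ne _).symm)⟩

end SpinorStructure

theorem exteriorι_mul (x : M) (a b : ExteriorAlgebra ℝ (E x)) :
    exteriorι n E x (a * b) = exteriorι n E x a * exteriorι n E x b := by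
  rw [exteriorι, exteriorι, exteriorι, ← map_mul, Algebra.TensorProduct.tmul_mul_tmul, one_mul]

include hξ in
theorem IsCurvatureBivector.unique {Y Z : VField n M} {r r' : ∀ x, ExteriorAlgebra ℝ (E x)}
    (h : IsCurvatureBivector g DE Y Z r) (h' : IsCurvatureBivector g DE Y Z r') : r = r' := by
  funext x
  refine sub_eq_zero.1 (bivector_unique (μ := fun a => g.form x (ξ a x)) (w := fun a => η a x)
    (fun u => ?_) (sub_mem (h.1 x) (h'.1 x)) fun a => ?_)
  · simpa only [g.symm x u] using hξ x u
  · rw [map_sub, sub_eq_zero]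
    exact neg_injective ((h.2 (ξ a) x).trans (h'.2 (ξ a) x).symm)

section Bracket

variable {br : Op n FS S →ₗ[ℂ] Op n FS S →ₗ[ℂ] Op n FS S} {𝒟 : ℤ → Submodule ℂ (Op n FS S)}
  (hS : (symbolData hX hξ hpos c hD).IsSymbolic br 𝒟) {D : Subalgebra ℂ (Op n FS S)}
  (hF : IsPoissonFiltration D br 𝒟)

theorem isRothsteinBracket_poisson : IsRothsteinBracket g DE (hS.poisson hF) where
  degree := (hS.isPoisson hF).degree
  skew := (hS.isPoisson hF).skew
  leibniz := (hS.isPoisson hF).leibniz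
  jacobi := (hS.isPoisson hF).jacobi
  field_base Y h x := congrArg (fun G : Fn n F E => G.1 x) (hS.poisson_fld_fn hF Y h)
  base_base f h := hS.poisson_fn_fn hF f h
  field_section Y v := hS.poisson_fld_sec hF Y v
  base_section f v := hS.poisson_fn_sec hF f v
  field_field Y Z := by
    refine ⟨_, isCurvatureBivector_sum hξ hD.1 Y Z, fun x => ?_⟩
    refine (congrArg (fun G : Fn n F E => G.1 x) (hS.poisson_fld_fld hF Y Z)).trans ?_
    refine congrArg ((fnField F E (lieBracket Y Z)).1 x + ·) ?_
    rw [exteriorι_smul, exteriorι_sum]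
    have h1 : ((1 / 2 : ℝ) : ℂ) = 1 / 2 := by norm_num
    rw [h1]
    refine congrArg ((1 / 2 : ℂ) • ·) ((Fn.coe_sum _ _ x).trans (Finset.sum_congr rfl fun a _ => ?_))
    exact (exteriorι_mul x _ _).symm
  section_section v w := hS.poisson_sec_sec hF v w

include hS hF in
theorem IsRothsteinBracket.unique {P P' : Fn n F E →ₗ[ℂ] Fn n F E →ₗ[ℂ] Fn n F E}
    (hP : IsRothsteinBracket g DE P) (hP' : IsRothsteinBracket g DE P') : P = P' := by
  refine SymbolData.isPoisson_unique (S := symbolData hX hξ hpos c hD)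
    ⟨hP.degree, hP.skew, hP.leibniz, hP.jacobi⟩ ⟨hP'.degree, hP'.skew, hP'.leibniz, hP'.jacobi⟩
    (fun f h => (hP.base_base h f).trans (hP'.base_base h f).symm)
    (fun f v => (hP.base_section f v).trans (hP'.base_section f v).symm)
    (fun v w => (hP.section_section v w).trans (hP'.section_section v w).symm)
    (fun Y f => Subtype.ext (funext fun x => (hP.field_base Y f x).trans (hP'.field_base Y f x).symm))
    (fun Y v => (hP.field_section Y v).trans (hP'.field_section Y v).symm)
    (fun Y Z => Subtype.ext (funext fun x => ?_))
  obtain ⟨r, hr, h⟩ := hP.field_field Y Z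
  obtain ⟨r', hr', h'⟩ := hP'.field_field Y Z
  obtain rfl := hr.unique hξ hr'
  exact (h x).trans (h' x).symm

end Bracket

/-- Two spinor connections over the same `∇^E` differ by a scalar function. It has degree 0, so the
operators have the same class in degree 2. -/
theorem HasSymbols.congr {DS' : ComplexConnection n FS S} (hD' : c.Compatible DE DS')
    (hS : (symbolData hX hξ hpos c hD).IsSymbolic c.superComm c.filt)
    {Φ : Gr c.filt ≃ₗ[ℂ] Fn n F E} (h : HasSymbols c DS' Φ) : HasSymbols c DS Φ where
  base := h.base
  fiber := h.fiber
  field Y := by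
    obtain ⟨h1, h2⟩ := h.field Y
    have h3 : DS.op Y ∈ c.filt 2 := hS.mem (SymbolData.Sym.fld Y)
    refine ⟨h3, Eq.trans (congrArg Φ (sub_eq_zero.1 ?_)) h2⟩
    rw [← map_sub]
    refine grClass_eq_zero (m := 1) (by norm_num) _ ?_
    obtain ⟨z, hz⟩ := c.exists_cMul_sub hξ hD' hD Y
    simp only [sub_self, c.gamma_zero, zero_mul, Finset.sum_const_zero, smul_zero, add_zero] at hz
    change DS.op Y - DS'.op Y ∈ c.filt 1
    rw [hz, add_sub_cancel_left]
    exact hS.mono (by norm_num : (0 : ℤ) ≤ 1) (hS.mem (SymbolData.Sym.const z))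

theorem hasSymbols_symbolEquiv
    (hS : (symbolData hX hξ hpos c hD).IsSymbolic c.superComm c.filt) :
    HasSymbols c DS hS.symbolEquiv where
  base h := by
    have := SymbolData.Sym.fn (S := symbolData hX hξ hpos c hD) h
    rw [← cMul_ofReal]
    exact ⟨hS.mem this, hS.symbolEquiv_sym this _⟩
  fiber v := ⟨hS.mem (SymbolData.Sym.sec v), hS.symbolEquiv_sym (SymbolData.Sym.sec v) _⟩
  field Y := ⟨hS.mem (SymbolData.Sym.fld Y), hS.symbolEquiv_sym (SymbolData.Sym.fld Y) _⟩

theorem HasSymbols.eq_symbolEquiv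
    (hS : (symbolData hX hξ hpos c hD).IsSymbolic c.superComm c.filt) (hF : c.IsFiltration)
    {P : Fn n F E →ₗ[ℂ] Fn n F E →ₗ[ℂ] Fn n F E} {Φ : Gr c.filt ≃ₗ[ℂ] Fn n F E}
    (hΦ : IsPoissonIso c hF P Φ) (h : HasSymbols c DS Φ) : Φ = hS.symbolEquiv := by
  refine hS.symbolEquiv_unique hF hΦ.map_mul (fun f hf => ?_) (fun v hv => ?_) (fun Y hY => ?_)
  · obtain ⟨h1, h2⟩ := h.base f
    exact Eq.trans (congrArg Φ (grClass_congr rfl (cMul_ofReal f) _ _)) h2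
  · obtain ⟨h1, h2⟩ := h.fiber v
    exact h2
  · obtain ⟨h1, h2⟩ := h.field Y
    exact h2

end SpinorParity

end

end SpinorSymbol

/-! ### Assembly of the theorem -/

theorem mainTheorem1 {n : ℕ} {M : Type*} [TopologicalSpace M] [T2Space M]
    [SecondCountableTopology M] [ChartedSpace (EuclideanSpace ℝ (Fin n)) M]
    [IsManifold (𝓡 n) ∞ M]
    -- the pseudo-Euclidean vector bundle `(E, g)`, of positive even rank
    {F : Type*} [NormedAddCommGroup F] [NormedSpace ℝ F] [FiniteDimensional ℝ F]
    {E : M → Type*} [TopologicalSpace (TotalSpace F E)] [∀ x, TopologicalSpace (E x)]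
    [∀ x, AddCommGroup (E x)] [∀ x, Module ℝ (E x)]
    [∀ x, IsTopologicalAddGroup (E x)] [∀ x, ContinuousSMul ℝ (E x)]
    [FiberBundle F E] [VectorBundle ℝ F E] [ContMDiffVectorBundle ∞ F E (𝓡 n)]
    (hpos : 0 < Module.finrank ℝ F) (heven : Even (Module.finrank ℝ F))
    (g : PseudoMetric n F E)
    -- the spinor bundle `S`
    {FS : Type*} [NormedAddCommGroup FS] [NormedSpace ℝ FS] [FiniteDimensional ℝ FS]
    {S : M → Type*} [TopologicalSpace (TotalSpace FS S)] [∀ x, TopologicalSpace (S x)]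
    [∀ x, AddCommGroup (S x)] [∀ x, Module ℝ (S x)]
    [∀ x, IsTopologicalAddGroup (S x)] [∀ x, ContinuousSMul ℝ (S x)]
    [FiberBundle FS S] [VectorBundle ℝ FS S] [ContMDiffVectorBundle ∞ FS S (𝓡 n)]
    [∀ x, Module ℂ (S x)] [∀ x, IsScalarTower ℝ ℂ (S x)] [IsComplexBundle n FS S]
    (c : SpinorStructure FS S g)
    -- the compatible pair of connections
    (DE : Connection n F E) (DS : ComplexConnection n FS S) (hD : c.Compatible DE DS) :
    -- `𝒟(M, S)` is the direct sum of its even and odd parts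
    Disjoint (Subalgebra.toSubmodule c.evenOps) c.oddOps ∧
    Subalgebra.toSubmodule c.evenOps ⊔ c.oddOps = Subalgebra.toSubmodule (diffOps n FS S) ∧
    -- `𝒟_k(M, S)` is a filtration with the properties that make `Gr 𝒟(M, S)` a graded algebra
    -- with a bracket of degree `-2`
    ∃ hF : c.IsFiltration,
    -- the Poisson bracket of the target exists and is unique
    ∃ P : Fn n F E →ₗ[ℂ] Fn n F E →ₗ[ℂ] Fn n F E,
      IsRothsteinBracket g DE P ∧ (∀ P', IsRothsteinBracket g DE P' → P' = P) ∧
      -- existence and uniqueness of the isomorphism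
      (∃! Φ : Gr c.filt ≃ₗ[ℂ] Fn n F E, IsPoissonIso c hF P Φ ∧ HasSymbols c DS Φ) ∧
      -- the isomorphism only depends on `∇^E`
      ∀ (DS' : ComplexConnection n FS S) (Φ Φ' : Gr c.filt ≃ₗ[ℂ] Fn n F E),
        c.Compatible DE DS' →
        IsPoissonIso c hF P Φ ∧ HasSymbols c DS Φ →
        IsPoissonIso c hF P Φ' ∧ HasSymbols c DS' Φ' → Φ = Φ' := by
  obtain ⟨ι, _, f, X, hX⟩ := exists_functions n M
  obtain ⟨κ, _, ξ, η, hξ⟩ := g.exists_generators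
  have hP := c.isParity hX hξ hpos hD heven
  have hS : (symbolData hX hξ hpos c hD).IsSymbolic c.superComm c.filt :=
    hP.isSymbolic (c.range_gamma hX hξ hpos hD)
  have hF : c.IsFiltration := hP.isPoissonFiltration (c.range_gamma hX hξ hpos hD)
  have hR := isRothsteinBracket_poisson hX hξ hpos c hD hS hF
  refine ⟨hP.disjoint, hP.sup_eq, hF, hS.poisson hF, hR,
    fun P' h => h.unique hX hξ hpos c hD hS hF hR, ⟨hS.symbolEquiv, ⟨⟨hS.map_symbolEquiv,
      hS.symbolEquiv_mul hF, hS.symbolEquiv_bracket hF⟩,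
      hasSymbols_symbolEquiv hX hξ hpos c hD hS⟩, fun Φ h =>
      h.2.eq_symbolEquiv hX hξ hpos c hD hS hF h.1⟩, fun DS' Φ Φ' hD' h h' => ?_⟩
  -- A map normalized by `DS'` is also normalized by `DS`, so both maps are the same symbol
  -- isomorphism.
  rw [h.2.eq_symbolEquiv hX hξ hpos c hD hS hF h.1,
    (h'.2.congr hX hξ hpos c hD hD' hS).eq_symbolEquiv hX hξ hpos c hD hS hF h'.1]
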